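/- **Setting.** Let $q$ be a prime power, $D\ge 2$, $H$ a hyperplane of $\mathbb F_q^{2D+1}$, and let $X=X'\sqcup X''$, where $X'$ is the set of $(D+1)$-dimensional subspaces of $\mathbb F_q^{2D+1}$ not contained in $H$ and $X''$ is the set of $(D-1)$-dimensional subspaces of $H$. The twisted Grassmann graph has vertex set $X$, with $y,z$ adjacent iff $\dim y+\dim z-2\dim(y\cap z)=2$. Let $A$ be its adjacency matrix, fix $x\in X''$, let $E_i^*$ be the diagonal $0$-$1$ matrix of the set of vertices at distance $i$ from $x$, and let $T=T(x)$ be the subalgebra of $\mathrm{Mat}_X(\mathbb C)$ generated by $A$ and all $E_i^*$. Write $[m]=\frac{1-q^m}{1-q}$ and $(q)_n=\prod_{\ell=1}^n(1-q^\ell)$. For $0\le i\le D$ let $\theta_i=q[D][D+1]-[i][2D-i+2]$ and let $E_i$ be the orthogonal projection onto the eigenspace of $A$ for $\theta_i$. For an irreducible $T$-module $W\subseteq\mathbb CX$ put $\epsilon=\min\{i:E_i^*W\ne0\}$ (endpoint), $\epsilon^*=\min\{i:E_iW\neq 0\}$ (dual endpoint), $d=|\{i:E_i^*W\ne0\}|-1$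 (diameter); $W$ is thin if $\dim E_i^*W\le1$ for all $i$. Let $\tilde P$ be the set of all subspaces of $\mathbb F_q^{2D+1}$ and, for integers $i,j,k$, let $\tilde P_{i,j,k}=\{y\in\tilde P:\dim (x\cap y)=i,\ \dim (H\cap y)=i+j,\ \dim y=i+j+k\}$, which is empty unless $0\le i\le D-1$, $0\le j\le D+1$, $0\le k\le 1$. Let $\tilde{\mathcal E}^*_{i,j,k}\in\mathrm{Mat}_{\tilde P}(\mathbb C)$ be the diagonal $0$-$1$ matrix of $\tilde P_{i,j,k}$. For $y,z\in\tilde P$ with $z\in\tilde P_{i,j,k}$, the $(y,z)$-entry of $\tilde{\mathcal L}_1,\tilde{\mathcal L}_2,\tilde{\mathcal L}_3$ is $1$ if $y\subset z$ and $y$ lies in $\tilde P_{i-1,j,k},\tilde P_{i,j-1,k},\tilde P_{i,j,k-1}$, respectively, and is $0$ otherwise; let $\tilde{\mathcal R}_\ell=\tilde{\mathcal L}_\ell^{\mathsf T}$. Let $\tilde{\mathcal H}$ be the algebra generated by all $\tilde{\mathcal L}_\ell,\tilde{\mathcal R}_\ell,\tilde{\mathcal E}^*_{i,j,k}$. An irreducible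 $\tilde{\mathcal H}$-submodule $\tilde{\mathcal W}$ of $\mathbb C\tilde P$ has lower endpoint $(\nu,\mu,\tau)$ if $\nu$, $\mu$, $\tau$ are, respectively, the least $i$, $j$, $k$ such that $\sum_{j,k}\tilde{\mathcal E}^*_{i,j,k}$, $\sum_{i,k}\tilde{\mathcal E}^*_{i,j,k}$, $\sum_{i,j}\tilde{\mathcal E}^*_{i,j,k}$ does not vanish on $\tilde{\mathcal W}$; its index is $\rho=D-1-\nu-\nu'$, where $\nu'$ is the greatest $i$ such that $\sum_{j,k}\tilde{\mathcal E}^*_{i,j,k}$ does not vanish on $\tilde{\mathcal W}$. If $\tau=0$, a standard basis of $\tilde{\mathcal W}$ is a basis $w_{i,j,k}$ ($\nu\le i\le D-1-\nu-\rho$, $\mu\le j\le D+1-\mu+\rho$, $0\le k\le1$) with $w_{i,j,k}\in\tilde{\mathcal E}^*_{i,j,k}\tilde{\mathcal W}$ and $$\tilde{\mathcal L}_1w_{i,j,k}=q^{\nu+j}[D-\nu-\rho-i][i-\nu]\,w_{i-1,j,k},\qquad \tilde{\mathcal R}_1w_{i,j,k}=q^kw_{i+1,j,k},$$ $$\tilde{\mathcal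 L}_2w_{i,j,k}=q^{D-1-\nu+\mu-\rho}[D+2-\mu+\rho-j][j-\mu]\,w_{i,j-1,k},\qquad \tilde{\mathcal R}_2w_{i,j,k}=q^{\nu-i+k}w_{i,j+1,k},$$ $$\tilde{\mathcal L}_3w_{i,j,k}=q^{2D-i-j}w_{i,j,k-1},\qquad \tilde{\mathcal R}_3w_{i,j,k}=w_{i,j,k+1},$$ where $w_{i,j,k}:=0$ outside the index range. Put $$W_2=\operatorname{span}\bigl\{\,w_{D-i,i,1}-q^D[i-\nu-\rho]\,w_{D-i-1,i,0}\ :\ \max\{\nu+\rho+1,\mu\}\le i\le\min\{D-\nu-1,D-\mu+\rho+1\}\bigr\}\subseteq\mathbb CX .$$ For $h,r,s\neq 0$ with $rq^i\ne 1$, $sq^i/r\neq1$ $(1\le i\le d)$ and $sq^i\ne1$ $(2\le i\le 2d)$, let $\mathsf A(q,d;h,r,s,\lambda_0)$ be the tridiagonal $(d+1)\times(d+1)$ matrix with rows and columns indexed by $0,\dots,d$, with $(i,i+1)$-entries $\mathsf b_i=h(1-q^{i-d})(1-rq^{i+1})$, $(i,i-1)$-entries $\mathsf c_i=hsq(1-q^i)(1-rq^{i-d-1}/s)$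 and diagonal entries $\lambda_0-\mathsf b_i-\mathsf c_i$. Let $$\Omega=\{(\epsilon,\epsilon^*,d)\in\mathbb Z^3:\epsilon,\epsilon^*,d\ge0,\ \epsilon+d\le D,\ \epsilon^*+d\le D,\ 2\epsilon+d\ge D,\ 2\epsilon^*+d\ge D\}.$$ **Theorem.** Every irreducible $\tilde{\mathcal H}$-submodule $\tilde{\mathcal W}$ of $\mathbb C\tilde P$ with $\tau=0$ has a standard basis, and $W_2$ is a $T$-module that does not depend on its choice; if $\rho<D-2\nu-1$, then $W_2$ is a thin irreducible $T$-module. Let $V_2$, $V_{2,0}$, $V_{2,1}$ be the sums of the $W_2$ over, respectively, all $\tilde{\mathcal W}$ with $\tau=0$, those with $\tau=0$ and $\nu+\rho+1\ge\mu$, and those with $\tau=0$ and $\nu+\rho+1<\mu$. These are $T$-modules, $V_2=V_{2,0}\oplus V_{2,1}$, and the following hold. (i) The triples $(\epsilon,\epsilon^*,d)$ of the irreducible $T$-submodules $W$ of $V_{2,0}$ range over exactly $$\Omega_{2,0}=\{(\epsilon,\epsilon^*,d)\in\Omega:\epsilon^*\ge\epsilon,\ \epsilon+d<D\}.$$ Every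 such $W$ is thin and has a basis $v_0,\dots,v_d$ with $v_i\in E^*_{\epsilon+i}W$ with respect to which $A|_W$ is represented by $\mathsf A(q,d;h,r,s,\lambda_0)$ with $$h=\frac{q^{2D+2-\epsilon^*}}{(1-q)^2},\qquad r=q^{\epsilon^*-D-2},\qquad s=q^{2\epsilon^*-2D-3},\qquad \lambda_0=\theta_{\epsilon^*}$$ (these satisfy the above conditions on $h,r,s$). Two such modules are isomorphic if and only if they have the same $(\epsilon,\epsilon^*,d)$, and the multiplicity $m^{2,0}_{\epsilon,\epsilon^*,d}$ of $W$ in $V_{2,0}$ satisfies $$\frac{m^{2,0}_{\epsilon,\epsilon^*,d}}{(q)_{D-1}(q)_{D+1}}=\frac{(-1)^{D-d}(1-q^{2D-2\epsilon^*-d+2})(1-q^{d+2})\,q^{D-2\epsilon+\epsilon^*-d-1+\binom{2\epsilon-D+d}{2}}}{(q)_{D-\epsilon+1}(q)_{2D-\epsilon-\epsilon^*-d+2}(q)_{D-\epsilon-d-1}(q)_{2\epsilon-D+d}(q)_{\epsilon^*-\epsilon}} .$$ (ii) The same statements hold for $V_{2,1}$ with $r=q^{\epsilon^*-D-1}$ (and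 the same $h,s,\lambda_0$), with $\Omega_{2,0}$ replaced by $$\Omega_{2,1}=\{(\epsilon,\epsilon^*,d)\in\Omega:\epsilon^*>\epsilon,\ 2\epsilon+d>D\},$$ and with multiplicity $$\frac{m^{2,1}_{\epsilon,\epsilon^*,d}}{(q)_{D-1}(q)_{D+1}}=\frac{(-1)^{D-d+1}(1-q^{2D-2\epsilon^*-d+3})(1-q^{d+1})\,q^{D-2\epsilon+\epsilon^*-d+\binom{2\epsilon-D+d-1}{2}}}{(q)_{D-\epsilon+2}(q)_{2D-\epsilon-\epsilon^*-d+2}(q)_{D-\epsilon-d+1}(q)_{2\epsilon-D+d-1}(q)_{\epsilon^*-\epsilon-1}} .$$ -/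

import Mathlib

open scoped Matrix Matrix.Module

noncomputable section

namespace TwistedGrassmann

/-! ### Notation: `q`-numbers and `q`-shifted factorials -/

/-- The Gaussian binomial coefficient with lower entry `1`, i.e. `(1 - q ^ m) / (1 - q)`
(in particular it is `0` for `m = 0`). -/
def gauss (q : ℂ) (m : ℤ) : ℂ := (1 - q ^ m) / (1 - q)

/-- The `q`-shifted factorial `(q; q)_n = (1 - q)(1 - q ^ 2) ⋯ (1 - q ^ n)` for `n ≥ 0`. -/
def qFac (q : ℂ) (n : ℤ) : ℂ := ∏ l ∈ Finset.range n.toNat, (1 - q * q ^ l)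

/-- The binomial coefficient `n (n - 1) / 2` for `n ≥ 0`. -/
def binomTwo (n : ℤ) : ℤ := (n.toNat.choose 2 : ℕ)

/-- `M W ≠ 0` for a matrix `M` and a set `W` of column vectors. -/
def ActsNonzero {ι : Type*} [Fintype ι] (M : Matrix ι ι ℂ) (W : Set (ι → ℂ)) : Prop :=
  ∃ w ∈ W, M *ᵥ w ≠ 0

section Subspaces

/-- The subspaces of the vector space of dimension `2 D + 1` over `K`. -/
abbrev Subsp (K : Type*) [Field K] (D : ℕ) : Type _ := Submodule K (Fin (2 * D + 1) → K)

variable {K : Type*} [Field K] {D : ℕ}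

instance fintypeSubsp [Fintype K] : Fintype (Subsp K D) := Fintype.ofFinite _

/-! ### The algebra generated by three kinds of lowering and raising matrices

Here `x ≤ H` are fixed subspaces, `dim x = D - 1` and `dim H = 2 D`. -/

/-- The set of all subspaces `y` with `dim (x ∩ y) = i`, `dim (H ∩ y) = i + j` and
`dim y = i + j + k`; it is empty unless `0 ≤ i ≤ D - 1`, `0 ≤ j ≤ D + 1` and `0 ≤ k ≤ 1`. -/
def cell (x H : Subsp K D) (i j k : ℤ) : Set (Subsp K D) :=
  {y | (Module.finrank K ↥(x ⊓ y) : ℤ) = i ∧ (Module.finrank K ↥(H ⊓ y) : ℤ) = i + j ∧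
    (Module.finrank K ↥y : ℤ) = i + j + k}

/-- The diagonal `0`-`1` matrix of the cell `(i, j, k)`. -/
def cellIdem (x H : Subsp K D) (i j k : ℤ) : Matrix (Subsp K D) (Subsp K D) ℂ :=
  Matrix.diagonal ((cell x H i j k).indicator fun _ => 1)

open Classical in
/-- The lowering matrix taking the cell `(i, j, k)` to the cell `(i - a, j - b, k - c)`. -/
def lowering (x H : Subsp K D) (a b c : ℤ) : Matrix (Subsp K D) (Subsp K D) ℂ :=
  Matrix.of fun y z =>
    if ∃ i j k : ℤ, z ∈ cell x H i j k ∧ y ∈ cell x H (i - a) (j - b) (k - c) ∧ y ≤ z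
    then 1 else 0

open Classical in
/-- The raising matrix taking the cell `(i, j, k)` to the cell `(i + a, j + b, k + c)`. -/
def raising (x H : Subsp K D) (a b c : ℤ) : Matrix (Subsp K D) (Subsp K D) ℂ :=
  Matrix.of fun y z =>
    if ∃ i j k : ℤ, z ∈ cell x H i j k ∧ y ∈ cell x H (i + a) (j + b) (k + c) ∧ z ≤ y
    then 1 else 0

def L₁ (x H : Subsp K D) := lowering x H 1 0 0
def L₂ (x H : Subsp K D) := lowering x H 0 1 0
def L₃ (x H : Subsp K D) := lowering x H 0 0 1
def R₁ (x H : Subsp K D) := raising x H 1 0 0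
def R₂ (x H : Subsp K D) := raising x H 0 1 0
def R₃ (x H : Subsp K D) := raising x H 0 0 1

variable [Fintype K]

/-- The algebra generated by the three lowering matrices, the three raising matrices and the
diagonal matrices of the cells. -/
def algH (x H : Subsp K D) : Subalgebra ℂ (Matrix (Subsp K D) (Subsp K D) ℂ) :=
  Algebra.adjoin ℂ
    ({L₁ x H, L₂ x H, L₃ x H, R₁ x H, R₂ x H, R₃ x H} ∪
      {M | ∃ i j k : ℤ, M = cellIdem x H i j k})

/-- `W` has lower endpoint `(ν, μ, τ)` and index `ρ`, where `ρ = (D - 1) - ν - ν'` and `ν'` is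
the first coordinate of the upper endpoint. -/
def HasEndpoint (x H : Subsp K D) (W : Submodule (algH x H) (Subsp K D → ℂ))
    (ν μ τ ρ : ℤ) : Prop :=
  IsLeast {i : ℤ | ActsNonzero
    (∑ j ∈ Finset.Icc (0 : ℤ) (D + 1), ∑ k ∈ Finset.Icc (0 : ℤ) 1, cellIdem x H i j k) W} ν ∧
  IsLeast {j : ℤ | ActsNonzero
    (∑ i ∈ Finset.Icc (0 : ℤ) (D - 1), ∑ k ∈ Finset.Icc (0 : ℤ) 1, cellIdem x H i j k) W} μ ∧
  IsLeast {k : ℤ | ActsNonzero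
    (∑ i ∈ Finset.Icc (0 : ℤ) (D - 1), ∑ j ∈ Finset.Icc (0 : ℤ) (D + 1), cellIdem x H i j k)
      W} τ ∧
  IsGreatest {i : ℤ | ActsNonzero
    (∑ j ∈ Finset.Icc (0 : ℤ) (D + 1), ∑ k ∈ Finset.Icc (0 : ℤ) 1, cellIdem x H i j k) W}
      (D - 1 - ν - ρ)

/-- The range of the indices `(i, j, k)` of the standard basis (case `τ = 0`). -/
def indexRange (D : ℕ) (ν μ ρ : ℤ) : Set (ℤ × ℤ × ℤ) :=
  {t | ν ≤ t.1 ∧ t.1 ≤ D - 1 - ν - ρ ∧ μ ≤ t.2.1 ∧ t.2.1 ≤ D + 1 - μ + ρ ∧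
    0 ≤ t.2.2 ∧ t.2.2 ≤ 1}

/-- `w` is a standard basis of the module `W` with lower endpoint `(ν, μ, 0)` and index `ρ`,
extended by `w i j k = 0` outside the range of indices. -/
structure IsStandardBasis (x H : Subsp K D) (W : Submodule (algH x H) (Subsp K D → ℂ))
    (ν μ ρ : ℤ) (w : ℤ → ℤ → ℤ → (Subsp K D → ℂ)) : Prop where
  linearIndependent : LinearIndependent ℂ
    fun t : indexRange D ν μ ρ => w t.1.1 t.1.2.1 t.1.2.2
  span_eq : Submodule.span ℂ
    (Set.range fun t : indexRange D ν μ ρ => w t.1.1 t.1.2.1 t.1.2.2) = W.restrictScalars ℂ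
  mem_cell : ∀ i j k, (i, j, k) ∈ indexRange D ν μ ρ →
    ∃ u ∈ W, w i j k = cellIdem x H i j k *ᵥ u
  zero_outside : ∀ i j k, (i, j, k) ∉ indexRange D ν μ ρ → w i j k = 0
  L₁_mul : ∀ i j k, (i, j, k) ∈ indexRange D ν μ ρ →
    L₁ x H *ᵥ w i j k =
      ((Fintype.card K : ℂ) ^ (ν + j) * gauss (Fintype.card K) (D - 1 - ν - ρ - i + 1) *
        gauss (Fintype.card K) (i - ν)) • w (i - 1) j k
  R₁_mul : ∀ i j k, (i, j, k) ∈ indexRange D ν μ ρ →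
    R₁ x H *ᵥ w i j k = ((Fintype.card K : ℂ) ^ k) • w (i + 1) j k
  L₂_mul : ∀ i j k, (i, j, k) ∈ indexRange D ν μ ρ →
    L₂ x H *ᵥ w i j k =
      ((Fintype.card K : ℂ) ^ (D - 1 - ν + μ - ρ) *
        gauss (Fintype.card K) (D + 1 - μ + ρ - j + 1) *
        gauss (Fintype.card K) (j - μ)) • w i (j - 1) k
  R₂_mul : ∀ i j k, (i, j, k) ∈ indexRange D ν μ ρ →
    R₂ x H *ᵥ w i j k = ((Fintype.card K : ℂ) ^ (ν - i + k)) • w i (j + 1) k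
  L₃_mul : ∀ i j k, (i, j, k) ∈ indexRange D ν μ ρ →
    L₃ x H *ᵥ w i j k = ((Fintype.card K : ℂ) ^ (2 * D - i - j)) • w i j (k - 1)
  R₃_mul : ∀ i j k, (i, j, k) ∈ indexRange D ν μ ρ →
    R₃ x H *ᵥ w i j k = w i j (k + 1)

end Subspaces

/-! ### The twisted Grassmann graph and its Terwilliger algebra -/

section Graph

variable {K : Type*} [Field K] {D : ℕ}

/-- The vertices: the `(D + 1)`-dimensional subspaces not contained in `H` and the
`(D - 1)`-dimensional subspaces of `H`. -/
def Vertex (H : Subsp K D) : Type _ :=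
  {y : Subsp K D // (Module.finrank K ↥y = D + 1 ∧ ¬ y ≤ H) ∨
    (Module.finrank K ↥y + 1 = D ∧ y ≤ H)}

instance fintypeVertex [Fintype K] (H : Subsp K D) : Fintype (Vertex H) :=
  haveI : Finite (Vertex H) := Subtype.finite
  Fintype.ofFinite _

instance decidableEqVertex (H : Subsp K D) : DecidableEq (Vertex H) := Classical.decEq _

/-- The twisted Grassmann graph: `y` and `z` are adjacent if and only if
`dim y + dim z - 2 dim (y ∩ z) = 2`. -/
def graph (H : Subsp K D) : SimpleGraph (Vertex H) where
  Adj y z := Module.finrank K ↥y.1 + Module.finrank K ↥z.1 =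
    2 * Module.finrank K ↥(y.1 ⊓ z.1) + 2
  symm := ⟨fun y z h => by rw [inf_comm, ← h, add_comm]⟩
  loopless := ⟨fun y h => by rw [inf_idem] at h; omega⟩

open Classical in
/-- The adjacency matrix. -/
def adj (H : Subsp K D) : Matrix (Vertex H) (Vertex H) ℂ := (graph H).adjMatrix ℂ

/-- The diagonal matrix of the set of vertices at distance `i` from `x`. -/
def distIdem {H : Subsp K D} (x : Vertex H) (i : ℕ) : Matrix (Vertex H) (Vertex H) ℂ :=
  Matrix.diagonal ({y | (graph H).dist x y = i}.indicator fun _ => 1)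

/-- The `i`-th eigenvalue of the graph, `0 ≤ i ≤ D`. -/
def theta (q : ℂ) (D : ℕ) (i : ℤ) : ℂ :=
  q * gauss q D * gauss q (D + 1) - gauss q i * gauss q (2 * D - i + 2)

variable [Fintype K]

/-- The matrix of the orthogonal projection onto the eigenspace of the adjacency matrix with
eigenvalue `theta i`. -/
def primIdem (H : Subsp K D) (i : ℕ) : Matrix (Vertex H) (Vertex H) ℂ :=
  (Matrix.toEuclideanCLM (n := Vertex H) (𝕜 := ℂ)).symm
    (Module.End.eigenspace (Matrix.toEuclideanLin (adj H))
      (theta (Fintype.card K) D i)).starProjection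

/-- The Terwilliger algebra with respect to the base vertex `x`. -/
def terwilliger {H : Subsp K D} (x : Vertex H) :
    Subalgebra ℂ (Matrix (Vertex H) (Vertex H) ℂ) :=
  Algebra.adjoin ℂ ({adj H} ∪ Set.range (distIdem x))

section Modules

variable {H : Subsp K D} {x : Vertex H}

def support (W : Submodule (terwilliger x) (Vertex H → ℂ)) : Set ℕ :=
  {i | ActsNonzero (distIdem x i) W}

def dualSupport (W : Submodule (terwilliger x) (Vertex H → ℂ)) : Set ℕ :=
  {i | i ≤ D ∧ ActsNonzero (primIdem H i) W}

def endpoint (W : Submodule (terwilliger x) (Vertex H → ℂ)) : ℕ := sInf (support W)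

def dualEndpoint (W : Submodule (terwilliger x) (Vertex H → ℂ)) : ℕ := sInf (dualSupport W)

def diameter (W : Submodule (terwilliger x) (Vertex H → ℂ)) : ℕ := (support W).ncard - 1

/-- The triple (endpoint, dual endpoint, diameter). -/
def params (W : Submodule (terwilliger x) (Vertex H → ℂ)) : ℤ × ℤ × ℤ :=
  (endpoint W, dualEndpoint W, diameter W)

/-- The subspace `E_i^* W`. -/
def component (W : Submodule (terwilliger x) (Vertex H → ℂ)) (i : ℕ) :
    Submodule ℂ (Vertex H → ℂ) :=
  (W.restrictScalars ℂ).map (Matrix.toLin' (distIdem x i))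

def IsThin (W : Submodule (terwilliger x) (Vertex H → ℂ)) : Prop :=
  ∀ i, Module.finrank ℂ (component W i) ≤ 1

/-- The irreducible module `W` has multiplicity `m` in `V`: the sum of all submodules of `V`
isomorphic to `W` is isomorphic to the direct sum of `m` copies of `W`. -/
def HasMultiplicity (V W : Submodule (terwilliger x) (Vertex H → ℂ)) (m : ℕ) : Prop :=
  Nonempty (isotypicComponent (terwilliger x) V W ≃ₗ[terwilliger x] (Fin m → W))

end Modules

/-! ### The complementary modules -/

/-- The vector `w_{D-i,i,1} - q^D [i-ν-ρ] w_{D-i-1,i,0}`, viewed as a vector indexed by the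
vertices of the graph (its other coordinates are zero). -/
def wBar (H : Subsp K D) (w : ℤ → ℤ → ℤ → (Subsp K D → ℂ)) (ν ρ i : ℤ) : Vertex H → ℂ :=
  fun y => w (D - i) i 1 y.1 -
    (Fintype.card K : ℂ) ^ D * gauss (Fintype.card K) (i - ν - ρ) * w (D - i - 1) i 0 y.1

/-- The span of the vectors `wBar i`,
`max (ν + ρ + 1) μ ≤ i ≤ min (D - ν - 1) (D - μ + ρ + 1)`. -/
def modW₂ (H : Subsp K D) (w : ℤ → ℤ → ℤ → (Subsp K D → ℂ)) (ν μ ρ : ℤ) :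
    Submodule ℂ (Vertex H → ℂ) :=
  Submodule.span ℂ {v | ∃ i : ℤ, max (ν + ρ + 1) μ ≤ i ∧ i ≤ min (D - ν - 1) (D - μ + ρ + 1) ∧
    v = wBar H w ν ρ i}

/-- The sum of the spaces `modW₂` over all irreducible submodules `W` with `τ = 0` whose lower
endpoint `(ν, μ, 0)` and index `ρ` satisfy the condition `c ν μ ρ`. -/
def sumW₂ {H : Subsp K D} (x : Vertex H) (c : ℤ → ℤ → ℤ → Prop) :
    Submodule ℂ (Vertex H → ℂ) :=
  sSup {U | ∃ (W : Submodule (algH x.1 H) (Subsp K D → ℂ)) (ν μ ρ : ℤ)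
    (w : ℤ → ℤ → ℤ → (Subsp K D → ℂ)),
    IsSimpleModule (algH x.1 H) W ∧ HasEndpoint x.1 H W ν μ 0 ρ ∧
      IsStandardBasis x.1 H W ν μ ρ w ∧ c ν μ ρ ∧ U = modW₂ H w ν μ ρ}

end Graph

/-! ### The dual `q`-Hahn matrix -/

def coeffB (q : ℂ) (d : ℕ) (h r : ℂ) (i : ℕ) : ℂ :=
  h * (1 - q ^ ((i : ℤ) - d)) * (1 - r * q ^ (i + 1))

def coeffC (q : ℂ) (d : ℕ) (h r s : ℂ) (i : ℕ) : ℂ :=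
  h * s * q * (1 - q ^ i) * (1 - r * q ^ ((i : ℤ) - d - 1) / s)

/-- The tridiagonal matrix with rows and columns indexed by `0, …, d`, with diagonal entries
`a_i = lam - b_i - c_i`, superdiagonal entries `b_i` (row `i`), and subdiagonal entries `c_i`
(row `i`). -/
def dualHahn (q : ℂ) (d : ℕ) (h r s lam : ℂ) : Matrix (Fin (d + 1)) (Fin (d + 1)) ℂ :=
  Matrix.of fun i j =>
    if i = j then lam - coeffB q d h r i - coeffC q d h r s i
    else if (j : ℕ) = (i : ℕ) + 1 then coeffB q d h r i
    else if (i : ℕ) = (j : ℕ) + 1 then coeffC q d h r s i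
    else 0

/-- The nondegeneracy conditions on the parameters of the matrix. -/
def Admissible (q : ℂ) (d : ℕ) (h r s : ℂ) : Prop :=
  h ≠ 0 ∧ r ≠ 0 ∧ s ≠ 0 ∧
  (∀ i : ℕ, 1 ≤ i → i ≤ d → r * q ^ i ≠ 1 ∧ s * q ^ i / r ≠ 1) ∧
  (∀ i : ℕ, 2 ≤ i → i ≤ 2 * d → s * q ^ i ≠ 1)

/-! ### The parameter sets and the multiplicities -/

/-- The triples `(ε, ε', d)` satisfying the general constraints. -/
def Omega (D : ℕ) : Set (ℤ × ℤ × ℤ) :=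
  {t | 0 ≤ t.1 ∧ 0 ≤ t.2.1 ∧ 0 ≤ t.2.2 ∧ t.1 + t.2.2 ≤ D ∧ t.2.1 + t.2.2 ≤ D ∧
    D ≤ 2 * t.1 + t.2.2 ∧ D ≤ 2 * t.2.1 + t.2.2}

def Omega₂₀ (D : ℕ) : Set (ℤ × ℤ × ℤ) :=
  {t | t ∈ Omega D ∧ t.1 ≤ t.2.1 ∧ t.1 + t.2.2 < D}

def Omega₂₁ (D : ℕ) : Set (ℤ × ℤ × ℤ) :=
  {t | t ∈ Omega D ∧ t.1 < t.2.1 ∧ D < 2 * t.1 + t.2.2}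

/-- The multiplicity for `(ε, ε', d)` in `Omega₂₀ D`, divided by `(q)_{D-1} (q)_{D+1}`. -/
def ratio₂₀ (q : ℂ) (D : ℕ) : ℤ × ℤ × ℤ → ℂ := fun (ε, ε', d) =>
  ((-1) ^ (D - d) * (1 - q ^ (2 * D - 2 * ε' - d + 2)) * (1 - q ^ (d + 2)) *
      q ^ (D - 2 * ε + ε' - d - 1 + binomTwo (2 * ε - D + d))) /
    (qFac q (D - ε + 1) * qFac q (2 * D - ε - ε' - d + 2) * qFac q (D - ε - d - 1) *
      qFac q (2 * ε - D + d) * qFac q (ε' - ε))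

/-- The multiplicity for `(ε, ε', d)` in `Omega₂₁ D`, divided by `(q)_{D-1} (q)_{D+1}`. -/
def ratio₂₁ (q : ℂ) (D : ℕ) : ℤ × ℤ × ℤ → ℂ := fun (ε, ε', d) =>
  ((-1) ^ (D - d + 1) * (1 - q ^ (2 * D - 2 * ε' - d + 3)) * (1 - q ^ (d + 1)) *
      q ^ (D - 2 * ε + ε' - d + binomTwo (2 * ε - D + d - 1))) /
    (qFac q (D - ε + 2) * qFac q (2 * D - ε - ε' - d + 2) * qFac q (D - ε - d + 1) *
      qFac q (2 * ε - D + d - 1) * qFac q (ε' - ε - 1))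

section Description

variable {K : Type*} [Field K] [Fintype K] {D : ℕ} {H : Subsp K D} {x : Vertex H}

/-- The irreducible module `W` is thin and has a basis `v_0, …, v_d` with `v_i ∈ E_{ε+i}^* W`
with respect to which the adjacency matrix acts by the dual `q`-Hahn matrix with
`h = q^(2D+2-ε') / (1-q)^2`, `s = q^(2ε'-2D-3)`, `lam = theta ε'` and the given `r`, where
`ε, ε', d` are the endpoint, the dual endpoint and the diameter of `W`. -/
def IsDualHahn (W : Submodule (terwilliger x) (Vertex H → ℂ)) (q r : ℂ) : Prop :=
  let ε' : ℤ := dualEndpoint W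
  let h : ℂ := q ^ (2 * D + 2 - ε') / (1 - q) ^ 2
  let s : ℂ := q ^ (2 * ε' - 2 * D - 3)
  IsThin W ∧ Admissible q (diameter W) h r s ∧
  ∃ v : Module.Basis (Fin (diameter W + 1)) ℂ (W.restrictScalars ℂ),
    (∀ i : Fin (diameter W + 1),
      (v i : Vertex H → ℂ) ∈ component W (endpoint W + (i : ℕ))) ∧
    ∀ j, adj H *ᵥ (v j : Vertex H → ℂ) =
      ∑ i, dualHahn q (diameter W) h r s (theta q D ε') i j • (v i : Vertex H → ℂ)

/-- Description of the irreducible submodules of `V`: their parameters range over `Ω`; each of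
them is thin and the adjacency matrix acts on it by the dual `q`-Hahn matrix whose parameter `r`
is given as a function of the dual endpoint; the isomorphism class is determined by the
parameters; the multiplicity in `V`, divided by `(q)_{D-1} (q)_{D+1}`, is `ratio`. -/
def IsDescribedBy (V : Submodule (terwilliger x) (Vertex H → ℂ)) (Ω : Set (ℤ × ℤ × ℤ))
    (r : ℤ → ℂ) (ratio : ℤ × ℤ × ℤ → ℂ) : Prop :=
  let q : ℂ := Fintype.card K
  {t | ∃ W ≤ V, IsSimpleModule (terwilliger x) W ∧ params W = t} = Ω ∧
  (∀ W ≤ V, IsSimpleModule (terwilliger x) W → IsDualHahn W q (r (dualEndpoint W))) ∧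
  (∀ W ≤ V, ∀ W' ≤ V, IsSimpleModule (terwilliger x) W → IsSimpleModule (terwilliger x) W' →
    (Nonempty (W ≃ₗ[terwilliger x] W') ↔ params W = params W')) ∧
  (∀ W ≤ V, IsSimpleModule (terwilliger x) W →
    ∃ m : ℕ, HasMultiplicity V W m ∧
      (m : ℂ) / (qFac q (D - 1) * qFac q (D + 1)) = ratio (params W))

end Description

end TwistedGrassmann

end

open TwistedGrassmann
open scoped Matrix Matrix.Module

set_option linter.unusedSectionVars false
set_option linter.unusedFintypeInType false
set_option linter.unusedDecidableInType false

/-! Split `H = A ⊕ B` with `A = x`, so that `dim A = D - 1` and `dim B = D + 1`. A subspace `y` of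
`H` is given by `a = y ∩ A`, its projection `b` to `B`, and a linear map `B → A` modulo those
carrying `b` into `a`. The abelian group `Hom(B, A)` acts by shears and preserves the relations that
define the lowering and raising matrices inside `H`. Hence the functions on the subspaces of `H`
split according to the characters `φ ↦ e (tr (ψ φ))`, one for each `ψ : A → B`. A function belonging
to `ψ` is determined by its values at the products `a × b`, and these vanish unless `a ≤ ker ψ` and
`range ψ ≤ b` (`shearSpace_ext`). On such functions `L₁, R₁` and `L₂, R₂` are, up to powers of `q`,
lowering and raising in the two independent lattices `[0, ker ψ]` and `[range ψ, B]`. The index `ρ`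
of a module is the rank of `ψ`.

The commutators (`relA_commutator`, `relB_commutator`) are of `sl₂` type, and each raising matrix is
the adjoint of the lowering matrix. Positivity of norms therefore fixes the lengths of strings, and
a vector of a single rank killed by `L₁` and `L₂` generates a module with a standard basis; the
layer `k = 1` is a copy of the layer `k = 0` made by `R₃` (`lowering_R₃`, `raising_R₃`, `L₃_R₃`).
Conversely every simple module with `τ = 0` contains such a lowest vector
(`exists_mem_lowestSpace`). The space of lowest vectors of type `(ν, μ, ρ)` has as dimension the
number of `ψ` of rank `ρ` times two differences of consecutive Gaussian binomial coefficients
(`FlagDecomposition.finrank_lowestSpace`).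

Two vertices are adjacent if one contains the other or if a step down and a step up lead from one to
the other, so the adjacency matrix is expressed by the lowering and raising matrices
(`adj_mulVec_sub`, `adj_mulVec_sup`). The vector `wBar` of index `j` lives at distance `j` from `x`,
and the adjacency matrix acts tridiagonally on these vectors (`adj_mulVec_wBar`). The diagonal
entries and the products of opposite off-diagonal entries are those of a dual `q`-Hahn matrix, so a
rescaling produces that matrix (`isChain_complementary`). Its entries next to the diagonal are
positive, which gives irreducibility. Its row sums are `θ_{ν+μ+1}`, so by Gershgorin's theorem this
is the largest eigenvalue and `ν + μ + 1` is the dual endpoint. The endpoint is `max (ν + ρ + 1) μ`,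
and this maximum is the source of the two cases.

In each case `(ν, μ, ρ)` can be recovered from `(ε, ε*, d)`. So two complementary modules are
isomorphic exactly when they come from the same `(ν, μ, ρ)`, and the multiplicity is the dimension
of the space of lowest vectors. The two sums are independent because, after extension by zero, they
lie in sums of non-isomorphic simple modules of the larger algebra. -/

namespace TwistedGrassmann

/-! ### Covering relations and counting in intervals of a subspace lattice -/

section Intervals

variable {K M : Type*} [Field K] [AddCommGroup M] [Module K M] [FiniteDimensional K M]
  [Fintype (Submodule K M)]

open Classical in
/-- The subspaces of `hi` covering `a`. -/
noncomputable def covers (hi a : Submodule K M) : Finset (Submodule K M) :=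
  {a' | a ≤ a' ∧ a' ≤ hi ∧ Module.finrank K a' = Module.finrank K a + 1}

open Classical in
/-- The subspaces containing `lo` covered by `a`. -/
noncomputable def cocovers (lo a : Submodule K M) : Finset (Submodule K M) :=
  {a' | lo ≤ a' ∧ a' ≤ a ∧ Module.finrank K a' + 1 = Module.finrank K a}

theorem mem_covers {hi a a' : Submodule K M} :
    a' ∈ covers hi a ↔ a ≤ a' ∧ a' ≤ hi ∧ Module.finrank K a' = Module.finrank K a + 1 := by
  simp [covers]

theorem mem_cocovers {lo a a' : Submodule K M} :
    a' ∈ cocovers lo a ↔ lo ≤ a' ∧ a' ≤ a ∧ Module.finrank K a' + 1 = Module.finrank K a := by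
  simp [cocovers]

theorem nat_card_submodule [Fintype K] (a : Submodule K M) :
    Nat.card a = Fintype.card K ^ Module.finrank K a := by
  rw [Module.natCard_eq_pow_finrank (K := K), Nat.card_eq_fintype_card]

theorem finrank_sup_span_singleton_of_notMem {a : Submodule K M} {v : M} (hv : v ∉ a) :
    Module.finrank K ↥(a ⊔ K ∙ v) = Module.finrank K a + 1 := by
  have hv0 : v ≠ 0 := fun h => hv (h ▸ a.zero_mem)
  have h := Submodule.finrank_sup_add_finrank_inf_eq a (K ∙ v)
  have h2 : a ⊓ K ∙ v = ⊥ := by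
    rw [← disjoint_iff]
    exact (Submodule.disjoint_span_singleton' hv0).2 hv
  rw [h2, finrank_bot, finrank_span_singleton hv0] at h
  omega

/-- Each vector of `hi` outside `a` spans, together with `a`, exactly one cover, and the vectors
giving a fixed cover are those of the cover outside `a`. -/
theorem card_covers_nat [Fintype K] {hi a : Submodule K M} (h : a ≤ hi) :
    (covers hi a).card * (Fintype.card K ^ (Module.finrank K a + 1) -
      Fintype.card K ^ Module.finrank K a) =
    Fintype.card K ^ Module.finrank K hi - Fintype.card K ^ Module.finrank K a := by
  classical
  have : Finite M := Module.finite_of_finite K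
  have : Fintype M := Fintype.ofFinite M
  have hcard : ∀ b : Submodule K M, ((Finset.univ : Finset M).filter (· ∈ b)).card =
      Fintype.card K ^ Module.finrank K b := by
    intro b
    rw [← nat_card_submodule b, Nat.card_eq_fintype_card, Fintype.card_subtype]
  have hsd : ∀ b : Submodule K M, a ≤ b →
      ((Finset.univ : Finset M).filter (fun v => v ∈ b ∧ v ∉ a)).card =
      Fintype.card K ^ Module.finrank K b - Fintype.card K ^ Module.finrank K a := by
    intro b hb
    rw [← hcard b, ← hcard a, ← Finset.card_sdiff_of_subset]
    · congr 1
      ext v; simp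
    · intro v; simpa using fun hv => hb hv
  rw [← hsd hi h, Finset.card_eq_sum_card_fiberwise (f := fun v => a ⊔ K ∙ v)
    (t := covers hi a)]
  · rw [Finset.sum_const_nat]
    intro a' ha'
    obtain ⟨h1, h2, h3⟩ := mem_covers.1 ha'
    rw [← h3, ← hsd a' h1]
    congr 1
    ext v
    simp only [Finset.mem_filter, Finset.mem_univ, true_and]
    constructor
    · rintro ⟨⟨-, hv⟩, rfl⟩
      exact ⟨Submodule.mem_sup_right (Submodule.mem_span_singleton_self v), hv⟩
    · rintro ⟨hv, hva⟩
      refine ⟨⟨h2 hv, hva⟩, ?_⟩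
      apply Submodule.eq_of_le_of_finrank_eq
      · exact sup_le h1 (by simpa using hv)
      · rw [h3, finrank_sup_span_singleton_of_notMem hva]
  · intro v hv
    simp only [Finset.coe_filter, Finset.mem_univ, true_and, Set.mem_ofPred_eq] at hv
    exact mem_covers.2 ⟨le_sup_left, sup_le h (by simpa using hv.1),
      finrank_sup_span_singleton_of_notMem hv.2⟩

theorem one_lt_card_field (K : Type*) [Field K] [Fintype K] : (1 : ℝ) < Fintype.card K := by
  exact_mod_cast Fintype.one_lt_card

theorem q_ne_zero (K : Type*) [Field K] [Fintype K] : (Fintype.card K : ℂ) ≠ 0 := by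
  exact_mod_cast Fintype.card_ne_zero

theorem one_sub_q_ne_zero (K : Type*) [Field K] [Fintype K] : (1 - Fintype.card K : ℂ) ≠ 0 := by
  have h : Fintype.card K ≠ 1 := Fintype.one_lt_card.ne'
  rw [sub_ne_zero]
  exact_mod_cast h.symm

theorem q_zpow_eq_one_iff (K : Type*) [Field K] [Fintype K] (m : ℤ) :
    (Fintype.card K : ℂ) ^ m = 1 ↔ m = 0 := by
  have h1 := one_lt_card_field K
  constructor
  · intro h
    have h' : (Fintype.card K : ℝ) ^ m = 1 := Complex.ofReal_injective (by push_cast; exact h)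
    exact (zpow_eq_one_iff_right₀ (by linarith) h1.ne').1 h'
  · rintro rfl; simp

theorem gauss_eq_zero_iff (K : Type*) [Field K] [Fintype K] (m : ℤ) :
    gauss (Fintype.card K) m = 0 ↔ m = 0 := by
  rw [gauss, div_eq_zero_iff, sub_eq_zero, eq_comm, q_zpow_eq_one_iff]
  simp [one_sub_q_ne_zero K]

theorem card_covers [Fintype K] {hi a : Submodule K M} (h : a ≤ hi) :
    ((covers hi a).card : ℂ) =
      gauss (Fintype.card K) (Module.finrank K hi - Module.finrank K a) := by
  have h1 := card_covers_nat h
  have hq := q_ne_zero K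
  have hq1 := one_sub_q_ne_zero K
  have hp : 0 < Fintype.card K := Fintype.card_pos
  have h2 := congrArg (fun n : ℕ => (n : ℂ)) h1
  simp only [Nat.cast_mul] at h2
  rw [Nat.cast_sub (Nat.pow_le_pow_right hp (by omega)),
    Nat.cast_sub (Nat.pow_le_pow_right hp (Submodule.finrank_mono h))] at h2
  push_cast at h2
  rw [gauss, eq_div_iff hq1, zpow_sub₀ hq, zpow_natCast, zpow_natCast]
  have hqa : (Fintype.card K : ℂ) ^ Module.finrank K a ≠ 0 := pow_ne_zero _ hq
  field_simp
  rw [pow_succ] at h2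
  linear_combination -h2

/-- Annihilators in the dual space reverse inclusions, so this is `card_covers` for
`a.dualAnnihilator ≤ lo.dualAnnihilator`. -/
theorem card_cocovers [Fintype K] {lo a : Submodule K M} (h : lo ≤ a) :
    ((cocovers lo a).card : ℂ) =
      gauss (Fintype.card K) (Module.finrank K a - Module.finrank K lo) := by
  classical
  have : Finite M := Module.finite_of_finite K
  have : Finite (Module.Dual K M) := Module.finite_of_finite K
  have : Fintype (Submodule K (Module.Dual K M)) := Fintype.ofFinite _
  have key : (cocovers lo a).card = (covers lo.dualAnnihilator a.dualAnnihilator).card := by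
    have hf : ∀ b : Submodule K M, Module.finrank K b + Module.finrank K b.dualAnnihilator =
      Module.finrank K M := fun b => Subspace.finrank_add_finrank_dualAnnihilator_eq b
    apply Finset.card_nbij' (fun b => b.dualAnnihilator) (fun b => b.dualCoannihilator)
    · intro b hb
      simp only [Finset.mem_coe, mem_cocovers, mem_covers] at hb ⊢
      refine ⟨Submodule.dualAnnihilator_anti hb.2.1, Submodule.dualAnnihilator_anti hb.1, ?_⟩
      have := hf b; have := hf a; omega
    · intro b hb
      simp only [Finset.mem_coe, mem_cocovers, mem_covers] at hb ⊢
      have hb' : b.dualCoannihilator.dualAnnihilator = b :=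
        Subspace.dualCoannihilator_dualAnnihilator_eq
      refine ⟨?_, ?_, ?_⟩
      · rw [← Subspace.dualAnnihilator_dualCoannihilator_eq (W := lo)]
        exact Submodule.dualCoannihilator_anti hb.2.1
      · rw [← Subspace.dualAnnihilator_dualCoannihilator_eq (W := a)]
        exact Submodule.dualCoannihilator_anti hb.1
      · have := hf b.dualCoannihilator; rw [hb'] at this; have := hf a; omega
    · intro b _; exact Subspace.dualAnnihilator_dualCoannihilator_eq
    · intro b _; exact Subspace.dualCoannihilator_dualAnnihilator_eq
  rw [key, card_covers (Submodule.dualAnnihilator_anti h)]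
  congr 1
  have h1 := Subspace.finrank_add_finrank_dualAnnihilator_eq a
  have h2 := Subspace.finrank_add_finrank_dualAnnihilator_eq lo
  omega

/-- The commutator of lowering and raising in an interval of a subspace lattice. -/
theorem sum_covers_cocovers_sub [Fintype K] {lo hi a : Submodule K M} (hlo : lo ≤ a)
    (hhi : a ≤ hi) (h : Submodule K M → ℂ) :
    ∑ a' ∈ covers hi a, ∑ a'' ∈ cocovers lo a', h a'' -
      ∑ a' ∈ cocovers lo a, ∑ a'' ∈ covers hi a', h a'' =
    (gauss (Fintype.card K) (Module.finrank K hi - Module.finrank K a) -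
      gauss (Fintype.card K) (Module.finrank K a - Module.finrank K lo)) * h a := by
  classical
  have e1 : ∑ a' ∈ covers hi a, ∑ a'' ∈ cocovers lo a', h a'' =
      (covers hi a).card * h a +
        ∑ a' ∈ covers hi a, ∑ a'' ∈ (cocovers lo a').erase a, h a'' := by
    rw [← nsmul_eq_mul, ← Finset.sum_const, ← Finset.sum_add_distrib]
    refine Finset.sum_congr rfl fun a' ha' => ?_
    obtain ⟨h1, h2, h3⟩ := mem_covers.1 ha'
    rw [Finset.add_sum_erase]
    exact mem_cocovers.2 ⟨hlo, h1, h3.symm⟩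
  have e2 : ∑ a' ∈ cocovers lo a, ∑ a'' ∈ covers hi a', h a'' =
      (cocovers lo a).card * h a +
        ∑ a' ∈ cocovers lo a, ∑ a'' ∈ (covers hi a').erase a, h a'' := by
    rw [← nsmul_eq_mul, ← Finset.sum_const, ← Finset.sum_add_distrib]
    refine Finset.sum_congr rfl fun a' ha' => ?_
    obtain ⟨h1, h2, h3⟩ := mem_cocovers.1 ha'
    rw [Finset.add_sum_erase]
    exact mem_covers.2 ⟨h2, hhi, h3.symm⟩
  -- The off-diagonal terms cancel by modularity: for `b ≠ a` of the same dimension, `a ⊔ b` covers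
  -- both exactly when both cover `a ⊓ b`, and these are the only possible middle terms.
  have e3 : ∑ a' ∈ covers hi a, ∑ a'' ∈ (cocovers lo a').erase a, h a'' =
      ∑ a' ∈ cocovers lo a, ∑ a'' ∈ (covers hi a').erase a, h a'' := by
    rw [Finset.sum_sigma', Finset.sum_sigma']
    refine Finset.sum_nbij' (fun p => ⟨a ⊓ p.2, p.2⟩) (fun p => ⟨a ⊔ p.2, p.2⟩) ?_ ?_ ?_ ?_ ?_
    · rintro ⟨a', b⟩ hp
      simp only [Finset.mem_sigma, Finset.mem_erase, mem_covers, mem_cocovers] at hp ⊢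
      obtain ⟨⟨h1, h2, h3⟩, hne, h4, h5, h6⟩ := hp
      have hsup : a ⊔ b = a' := by
        apply Submodule.eq_of_le_of_finrank_le (sup_le h1 h5)
        by_contra hlt
        have e : a = a ⊔ b := Submodule.eq_of_le_of_finrank_le le_sup_left (by omega)
        have hba : b ≤ a := by rw [e]; exact le_sup_right
        exact hne (Submodule.eq_of_le_of_finrank_eq hba (by omega))
      have hd := Submodule.finrank_sup_add_finrank_inf_eq a b
      rw [hsup] at hd
      exact ⟨⟨le_inf hlo h4, inf_le_left, by omega⟩, hne, inf_le_right, h5.trans h2, by omega⟩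
    · rintro ⟨a', b⟩ hp
      simp only [Finset.mem_sigma, Finset.mem_erase, mem_covers, mem_cocovers] at hp ⊢
      obtain ⟨⟨h1, h2, h3⟩, hne, h4, h5, h6⟩ := hp
      have hinf : a' = a ⊓ b := by
        apply Submodule.eq_of_le_of_finrank_le (le_inf h2 h4)
        by_contra hlt
        have e : a ⊓ b = a := Submodule.eq_of_le_of_finrank_le inf_le_left (by omega)
        have hba : a ≤ b := by rw [← e]; exact inf_le_right
        exact hne (Submodule.eq_of_le_of_finrank_eq hba (by omega)).symm
      have hd := Submodule.finrank_sup_add_finrank_inf_eq a b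
      rw [← hinf] at hd
      exact ⟨⟨le_sup_left, sup_le hhi h5, by omega⟩, hne, h1.trans h4, le_sup_right, by omega⟩
    · rintro ⟨a', b⟩ hp
      simp only [Finset.mem_sigma, Finset.mem_erase, mem_covers, mem_cocovers] at hp ⊢
      obtain ⟨⟨h1, h2, h3⟩, hne, h4, h5, h6⟩ := hp
      have hsup : a ⊔ b = a' := by
        apply Submodule.eq_of_le_of_finrank_le (sup_le h1 h5)
        by_contra hlt
        have e : a = a ⊔ b := Submodule.eq_of_le_of_finrank_le le_sup_left (by omega)
        have hba : b ≤ a := by rw [e]; exact le_sup_right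
        exact hne (Submodule.eq_of_le_of_finrank_eq hba (by omega))
      rw [hsup]
    · rintro ⟨a', b⟩ hp
      simp only [Finset.mem_sigma, Finset.mem_erase, mem_covers, mem_cocovers] at hp ⊢
      obtain ⟨⟨h1, h2, h3⟩, hne, h4, h5, h6⟩ := hp
      have hinf : a' = a ⊓ b := by
        apply Submodule.eq_of_le_of_finrank_le (le_inf h2 h4)
        by_contra hlt
        have e : a ⊓ b = a := Submodule.eq_of_le_of_finrank_le inf_le_left (by omega)
        have hba : a ≤ b := by rw [← e]; exact inf_le_right
        exact hne (Submodule.eq_of_le_of_finrank_eq hba (by omega)).symm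
      rw [← hinf]
    · rintro ⟨a', b⟩ _
      rfl
  rw [e1, e2, e3, card_covers hhi, card_cocovers hlo]
  ring

open Classical in
/-- The subspaces of relative dimension `i` in an interval. -/
noncomputable def level (lo hi : Submodule K M) (i : ℕ) : Finset (Submodule K M) :=
  {a | lo ≤ a ∧ a ≤ hi ∧ Module.finrank K a = Module.finrank K lo + i}

theorem mem_level {lo hi a : Submodule K M} {i : ℕ} :
    a ∈ level lo hi i ↔ lo ≤ a ∧ a ≤ hi ∧ Module.finrank K a = Module.finrank K lo + i := by
  simp [level]

/-- Double counting of the covering pairs between two consecutive levels; this is the recursion by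
which `gbinom` is defined. -/
theorem card_level_succ [Fintype K] {lo hi : Submodule K M} (i : ℕ) :
    ((level lo hi (i + 1)).card : ℂ) * gauss (Fintype.card K) (i + 1) =
      (level lo hi i).card *
        gauss (Fintype.card K) (Module.finrank K hi - Module.finrank K lo - i) := by
  classical
  have h1 : ((level lo hi (i + 1)).card : ℂ) * gauss (Fintype.card K) (i + 1) =
      ∑ b ∈ level lo hi (i + 1), ∑ a ∈ cocovers lo b, 1 := by
    rw [← nsmul_eq_mul, ← Finset.sum_const]
    refine Finset.sum_congr rfl fun b hb => ?_
    obtain ⟨h1, h2, h3⟩ := mem_level.1 hb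
    rw [Finset.sum_const, nsmul_one, card_cocovers h1, h3]
    congr 1; push_cast; ring
  have h2 : (level lo hi i).card *
        gauss (Fintype.card K) (Module.finrank K hi - Module.finrank K lo - i) =
      ∑ a ∈ level lo hi i, ∑ b ∈ covers hi a, 1 := by
    rw [← nsmul_eq_mul, ← Finset.sum_const]
    refine Finset.sum_congr rfl fun b hb => ?_
    obtain ⟨h1, h2, h3⟩ := mem_level.1 hb
    rw [Finset.sum_const, nsmul_one, card_covers h2, h3]
    congr 1; push_cast; ring
  rw [h1, h2]
  apply Finset.sum_comm'
  intro b a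
  simp only [mem_level, mem_cocovers, mem_covers]
  constructor
  · rintro ⟨⟨h1, h2, h3⟩, h4, h5, h6⟩
    exact ⟨⟨h5, h2, by omega⟩, h4, h5.trans h2, by omega⟩
  · rintro ⟨⟨h1, h2, h3⟩, h4, h5, h6⟩
    exact ⟨⟨h4.trans h1, h2, by omega⟩, h4, h1, by omega⟩

theorem card_level_zero {lo hi : Submodule K M} (h : lo ≤ hi) : (level lo hi 0).card = 1 := by
  classical
  rw [Finset.card_eq_one]
  refine ⟨lo, ?_⟩
  ext a
  simp only [mem_level, Finset.mem_singleton, add_zero]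
  constructor
  · rintro ⟨h1, -, h3⟩
    exact (Submodule.eq_of_le_of_finrank_eq h1 h3.symm).symm
  · rintro rfl
    exact ⟨le_rfl, h, rfl⟩

end Intervals

/-! ### `q`-shifted factorials and Gaussian binomial coefficients -/

theorem qFac_succ (q : ℂ) (n : ℕ) : qFac q ((n : ℤ) + 1) = qFac q n * (1 - q ^ (n + 1)) := by
  have : ((n : ℤ) + 1).toNat = n + 1 := by omega
  rw [qFac, qFac, this, Finset.prod_range_succ, Int.toNat_natCast]
  ring

theorem qFac_zero (q : ℂ) : qFac q 0 = 1 := by simp [qFac]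

theorem qFac_ne_zero (K : Type*) [Field K] [Fintype K] (n : ℤ) :
    qFac (Fintype.card K) n ≠ 0 := by
  rw [qFac, Finset.prod_ne_zero_iff]
  intro l _ h
  rw [sub_eq_zero, eq_comm] at h
  have := (q_zpow_eq_one_iff K (l + 1)).1 (by
    rw [zpow_add₀ (q_ne_zero K)]; simpa [mul_comm] using h)
  omega

/-- The Gaussian binomial coefficients, computed by their recursion in the lower entry. -/
noncomputable def gbinom (q : ℂ) (m : ℕ) : ℕ → ℂ
  | 0 => 1
  | i + 1 => gbinom q m i * gauss q ((m : ℤ) - i) / gauss q (i + 1)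

theorem card_level {K M : Type*} [Field K] [AddCommGroup M] [Module K M] [FiniteDimensional K M]
    [Fintype (Submodule K M)] [Fintype K] {lo hi : Submodule K M} (h : lo ≤ hi) {m : ℕ}
    (hm : Module.finrank K hi = Module.finrank K lo + m) (i : ℕ) :
    ((level lo hi i).card : ℂ) = gbinom (Fintype.card K) m i := by
  induction i with
  | zero => simp [gbinom, card_level_zero h]
  | succ i ih =>
    have h0 : gauss (Fintype.card K) ((i : ℤ) + 1) ≠ 0 := by
      rw [Ne, gauss_eq_zero_iff]; omega
    rw [gbinom, eq_div_iff h0, card_level_succ, ih, hm]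
    congr 2; push_cast; ring

theorem gbinom_eq_div (K : Type*) [Field K] [Fintype K] {m i : ℕ} (h : i ≤ m) :
    gbinom (Fintype.card K) m i =
      qFac (Fintype.card K) m /
        (qFac (Fintype.card K) i * qFac (Fintype.card K) ((m : ℤ) - i)) := by
  have hF := qFac_ne_zero K
  induction i with
  | zero => simp [gbinom, qFac_zero, hF]
  | succ i ih =>
    rw [gbinom, ih (by omega)]
    obtain ⟨k, rfl⟩ : ∃ k, m = i + 1 + k := ⟨m - (i + 1), by omega⟩
    have e1 : ((i + 1 + k : ℕ) : ℤ) - i = (k : ℤ) + 1 := by push_cast; ring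
    have e2 : ((i + 1 + k : ℕ) : ℤ) - (i + 1 : ℕ) = k := by push_cast; ring
    rw [e1, e2]
    push_cast
    rw [qFac_succ, qFac_succ, gauss, gauss]
    have hq1 := one_sub_q_ne_zero K
    have h1 := hF i
    have h2 := hF k
    have h3 : ∀ k : ℕ, (1 - (Fintype.card K : ℂ) ^ (k + 1)) ≠ 0 := fun k h => by
      rw [sub_eq_zero, eq_comm] at h
      have := (q_zpow_eq_one_iff K (k + 1)).1 (by exact_mod_cast h)
      omega
    have h4 := h3 i
    have h5 := h3 k
    have e3 : ∀ k : ℕ, (Fintype.card K : ℂ) ^ ((k : ℤ) + 1) = (Fintype.card K : ℂ) ^ (k + 1) :=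
      fun k => by exact_mod_cast rfl
    rw [e3, e3]
    field_simp

end TwistedGrassmann

namespace TwistedGrassmann

/-! ### Counting linear maps of given rank -/

section Rank

variable {K A B : Type*} [Field K] [Fintype K] [AddCommGroup A] [Module K A]
  [FiniteDimensional K A] [AddCommGroup B] [Module K B] [FiniteDimensional K B]

/-- Linear maps with a given kernel correspond to linearly independent families. -/
noncomputable def kerEquiv (k : Submodule K A) {ρ : ℕ} (b : Module.Basis (Fin ρ) K (A ⧸ k)) :
    {ψ : A →ₗ[K] B // LinearMap.ker ψ = k} ≃ {s : Fin ρ → B // LinearIndependent K s} where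
  toFun ψ := ⟨fun i => k.liftQ ψ.1 ψ.2.ge (b i), by
    have h : LinearMap.ker (k.liftQ ψ.1 ψ.2.ge) = ⊥ :=
      Submodule.ker_liftQ_eq_bot _ _ _ ψ.2.le
    exact b.linearIndependent.map' _ h⟩
  invFun s := ⟨b.constr K s.1 ∘ₗ k.mkQ, by
    have h : LinearMap.ker (b.constr K s.1) = ⊥ := by
      rw [LinearMap.ker_eq_bot']
      intro m hm
      rw [Module.Basis.constr_apply_fintype] at hm
      have := Fintype.linearIndependent_iff.1 s.2 _ hm
      refine b.ext_elem fun i => ?_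
      have h0 : b.repr m i = 0 := this i
      rw [h0, map_zero, Finsupp.zero_apply]
    rw [LinearMap.ker_comp, h, Submodule.comap_bot, Submodule.ker_mkQ]⟩
  left_inv ψ := by
    ext v
    have : b.constr K (fun i => k.liftQ ψ.1 ψ.2.ge (b i)) = k.liftQ ψ.1 ψ.2.ge :=
      b.ext fun i => by simp
    simp [this]
  right_inv s := by
    ext i
    obtain ⟨v, hv⟩ := k.mkQ_surjective (b i)
    change k.liftQ _ _ (b i) = s.1 i
    rw [← hv, Submodule.mkQ_apply, Submodule.liftQ_apply, LinearMap.comp_apply, hv,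
      Module.Basis.constr_basis]
  
/-- The maps are sorted by their kernels, the subspaces of dimension `n - ρ`. A map with a given
kernel is an injection of the `ρ`-dimensional quotient, that is, a linearly independent `ρ`-tuple in
`B`. The symmetry of the Gaussian binomial coefficient replaces `n - ρ` by `ρ`. -/
theorem card_rank_eq {n N ρ : ℕ} (hn : Module.finrank K A = n) (hN : Module.finrank K B = N)
    (h1 : ρ ≤ n) (h2 : ρ ≤ N) :
    (Nat.card {ψ : A →ₗ[K] B // Module.finrank K (LinearMap.range ψ) = ρ} : ℂ) =
      gbinom (Fintype.card K) n ρ *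
        ∏ l ∈ Finset.range ρ, ((Fintype.card K : ℂ) ^ N - (Fintype.card K : ℂ) ^ l) := by
  classical
  have : Finite A := Module.finite_of_finite K
  have : Finite B := Module.finite_of_finite K
  have : Fintype A := Fintype.ofFinite A
  have : Fintype (Submodule K A) := Fintype.ofFinite _
  have : Finite (A →ₗ[K] B) := Module.finite_of_finite K
  have : Fintype (A →ₗ[K] B) := Fintype.ofFinite _
  have hfib : ∀ k : Submodule K A, Module.finrank K k = n - ρ →
      (Finset.univ.filter fun ψ : A →ₗ[K] B => LinearMap.ker ψ = k).card =
        ∏ l : Fin ρ, (Fintype.card K ^ N - Fintype.card K ^ (l : ℕ)) := by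
    intro k hk
    have hq : Module.finrank K (A ⧸ k) = ρ := by
      have := k.finrank_quotient_add_finrank; omega
    rw [← Fintype.card_subtype, ← Nat.card_eq_fintype_card,
      Nat.card_congr (kerEquiv k (Module.finBasisOfFinrankEq K _ hq))]
    rw [card_linearIndependent (by omega), hN]
  have key : (Finset.univ.filter fun ψ : A →ₗ[K] B =>
      Module.finrank K (LinearMap.range ψ) = ρ).card =
      (level (⊥ : Submodule K A) ⊤ (n - ρ)).card *
        ∏ l : Fin ρ, (Fintype.card K ^ N - Fintype.card K ^ (l : ℕ)) := by
    rw [Finset.card_eq_sum_card_fiberwise (f := fun ψ => LinearMap.ker ψ)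
      (t := level (⊥ : Submodule K A) ⊤ (n - ρ))]
    · rw [Finset.sum_const_nat]
      intro k hk
      obtain ⟨-, -, h3⟩ := mem_level.1 hk
      rw [finrank_bot, zero_add] at h3
      rw [← hfib k h3]
      congr 1
      ext ψ
      simp only [Finset.mem_filter, Finset.mem_univ, true_and, and_iff_right_iff_imp]
      rintro rfl
      have := ψ.finrank_range_add_finrank_ker
      omega
    · intro ψ hψ
      simp only [Finset.coe_filter, Finset.mem_univ, true_and, Set.mem_ofPred_eq] at hψ
      refine mem_level.2 ⟨bot_le, le_top, ?_⟩
      have := ψ.finrank_range_add_finrank_ker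
      rw [finrank_bot]
      simp only
      omega
  rw [Nat.card_eq_fintype_card, Fintype.card_subtype, key]
  push_cast
  rw [card_level bot_le (m := n) (by simp [hn]), gbinom_eq_div K (by omega), gbinom_eq_div K h1]
  congr 1
  · have e : ((n - ρ : ℕ) : ℤ) = (n : ℤ) - ρ := by omega
    rw [e, mul_comm]
    congr 3; ring
  · rw [Finset.prod_range]
    refine Finset.prod_congr rfl fun l _ => ?_
    rw [Nat.cast_sub (Nat.pow_le_pow_right Fintype.card_pos (by omega))]
    push_cast; rfl

end Rank

/-- Each factor is `-q ^ l (1 - q ^ (N - l))`. This is where the sign and the binomial exponent in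
the multiplicities come from. -/
theorem prod_pow_sub_pow (K : Type*) [Field K] [Fintype K] {N ρ : ℕ} (h : ρ ≤ N) :
    ∏ l ∈ Finset.range ρ, ((Fintype.card K : ℂ) ^ N - (Fintype.card K : ℂ) ^ l) =
      (-1) ^ ρ * (Fintype.card K : ℂ) ^ (ρ.choose 2) * qFac (Fintype.card K) N /
        qFac (Fintype.card K) ((N : ℤ) - ρ) := by
  have hF := qFac_ne_zero K
  induction ρ with
  | zero => simp [hF]
  | succ ρ ih =>
    obtain ⟨k, rfl⟩ : ∃ k, N = ρ + 1 + k := ⟨N - (ρ + 1), by omega⟩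
    rw [Finset.prod_range_succ, ih (by omega)]
    have e1 : ((ρ + 1 + k : ℕ) : ℤ) - ρ = (k : ℤ) + 1 := by push_cast; ring
    have e2 : ((ρ + 1 + k : ℕ) : ℤ) - (ρ + 1 : ℕ) = k := by push_cast; ring
    rw [e1, e2, qFac_succ, Nat.choose_succ_succ' ρ 1, Nat.choose_one_right]
    have h2 := hF k
    have h3 : (1 - (Fintype.card K : ℂ) ^ (k + 1)) ≠ 0 := fun h => by
      rw [sub_eq_zero, eq_comm] at h
      have := (q_zpow_eq_one_iff K (k + 1)).1 (by exact_mod_cast h)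
      omega
    field_simp
    ring

/-- Such a difference is the dimension of the kernel of a surjective lowering map between
consecutive levels, and it contributes one factor `1 - q ^ _` to the numerator of the multiplicity.
-/
theorem gbinom_succ_sub (K : Type*) [Field K] [Fintype K] {m i : ℕ} (h : i + 1 ≤ m) :
    gbinom (Fintype.card K) m (i + 1) - gbinom (Fintype.card K) m i =
      (Fintype.card K : ℂ) ^ (i + 1) * (1 - (Fintype.card K : ℂ) ^ ((m : ℤ) - 2 * i - 1)) *
        qFac (Fintype.card K) m /
        (qFac (Fintype.card K) (i + 1) * qFac (Fintype.card K) ((m : ℤ) - i)) := by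
  have hF := qFac_ne_zero K
  have hq := q_ne_zero K
  obtain ⟨k, rfl⟩ : ∃ k, m = i + 1 + k := ⟨m - (i + 1), by omega⟩
  rw [gbinom_eq_div K h, gbinom_eq_div K (by omega)]
  have e1 : ((i + 1 + k : ℕ) : ℤ) - i = (k : ℤ) + 1 := by push_cast; ring
  have e2 : ((i + 1 + k : ℕ) : ℤ) - (i + 1 : ℕ) = k := by push_cast; ring
  have e3 : ((i + 1 + k : ℕ) : ℤ) - 2 * i - 1 = (k : ℤ) - i := by push_cast; ring
  have e4 : ((i + 1 : ℕ) : ℤ) = (i : ℤ) + 1 := by push_cast; ring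
  rw [e1, e2, e3, e4, qFac_succ, qFac_succ, zpow_sub₀ hq, zpow_natCast, zpow_natCast]
  have h1 := hF i
  have h2 := hF k
  have h3 : ∀ k : ℕ, (1 - (Fintype.card K : ℂ) ^ (k + 1)) ≠ 0 := fun k h => by
    rw [sub_eq_zero, eq_comm] at h
    have := (q_zpow_eq_one_iff K (k + 1)).1 (by exact_mod_cast h)
    omega
  have h4 := h3 i
  have h5 := h3 k
  field_simp
  ring

end TwistedGrassmann

namespace TwistedGrassmann

/-! ### Subspaces of a product as shears of product subspaces -/

section Shear

variable {K A B : Type*} [Field K] [AddCommGroup A] [Module K A] [AddCommGroup B] [Module K B]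

/-- Rank-one shears suffice to detect where a character of the shear group is nontrivial. -/
theorem trace_comp_smulRight {A B : Type*} [AddCommGroup A] [Module K A] [FiniteDimensional K A]
    [AddCommGroup B] [Module K B] [FiniteDimensional K B]
    (ψ : A →ₗ[K] B) (c : Module.Dual K B) (u : A) :
    LinearMap.trace K B (ψ ∘ₗ c.smulRight u) = c (ψ u) := by
  have h : ψ ∘ₗ c.smulRight u = dualTensorHom K B B (c ⊗ₜ ψ u) := by
    ext v; simp [dualTensorHom_apply]
  rw [h, LinearMap.trace_eq_contract_apply, contractLeft_apply]

theorem trace_comp_eq_zero [FiniteDimensional K B] {ψ : A →ₗ[K] B} {φ : B →ₗ[K] A}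
    (h : ∀ u, ψ (φ (ψ u)) = 0) : LinearMap.trace K B (ψ ∘ₗ φ) = 0 := by
  apply IsNilpotent.eq_zero
  apply LinearMap.isNilpotent_trace_of_isNilpotent
  refine ⟨2, ?_⟩
  ext v
  simp [pow_two, h]

/-- The image of `y` under the unipotent map `(u, v) ↦ (u + σ v, v)`. -/
def shear (σ : B →ₗ[K] A) (y : Submodule K (A × B)) : Submodule K (A × B) :=
  y.comap ((LinearMap.fst K A B - σ ∘ₗ LinearMap.snd K A B).prod (LinearMap.snd K A B))

theorem mem_shear {σ : B →ₗ[K] A} {y : Submodule K (A × B)} {p : A × B} :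
    p ∈ shear σ y ↔ (p.1 - σ p.2, p.2) ∈ y := Iff.rfl

/-- The intersection with the first factor. -/
def fstPart (y : Submodule K (A × B)) : Submodule K A := y.comap (LinearMap.inl K A B)

/-- The projection to the second factor. -/
def sndPart (y : Submodule K (A × B)) : Submodule K B := y.map (LinearMap.snd K A B)

theorem mem_fstPart {y : Submodule K (A × B)} {u : A} : u ∈ fstPart y ↔ (u, 0) ∈ y := Iff.rfl

theorem mem_sndPart {y : Submodule K (A × B)} {v : B} : v ∈ sndPart y ↔ ∃ u, (u, v) ∈ y := by
  simp [sndPart]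

theorem fstPart_mono {y z : Submodule K (A × B)} (h : y ≤ z) : fstPart y ≤ fstPart z :=
  Submodule.comap_mono h

theorem sndPart_mono {y z : Submodule K (A × B)} (h : y ≤ z) : sndPart y ≤ sndPart z :=
  Submodule.map_mono h

theorem shear_shear (σ τ : B →ₗ[K] A) (y : Submodule K (A × B)) :
    shear σ (shear τ y) = shear (τ + σ) y := by
  ext p
  simp only [mem_shear, LinearMap.add_apply]
  rw [show p.1 - σ p.2 - τ p.2 = p.1 - (τ p.2 + σ p.2) by abel]

theorem shear_zero (y : Submodule K (A × B)) : shear 0 y = y := by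
  ext p; simp [mem_shear]

theorem shear_le_shear_iff {σ : B →ₗ[K] A} {y z : Submodule K (A × B)} :
    shear σ y ≤ shear σ z ↔ y ≤ z := by
  have h : ∀ (σ : B →ₗ[K] A) {y z : Submodule K (A × B)}, y ≤ z → shear σ y ≤ shear σ z :=
    fun σ y z h => Submodule.comap_mono h
  refine ⟨fun h1 => ?_, h σ⟩
  have := h (-σ) h1
  rwa [shear_shear, shear_shear, add_neg_cancel, shear_zero, shear_zero] at this

theorem fstPart_shear (σ : B →ₗ[K] A) (y : Submodule K (A × B)) :
    fstPart (shear σ y) = fstPart y := by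
  ext u; simp [mem_fstPart, mem_shear]

theorem sndPart_shear (σ : B →ₗ[K] A) (y : Submodule K (A × B)) :
    sndPart (shear σ y) = sndPart y := by
  ext v
  simp only [mem_sndPart, mem_shear]
  constructor
  · rintro ⟨u, hu⟩; exact ⟨_, hu⟩
  · rintro ⟨u, hu⟩; exact ⟨u + σ v, by simpa using hu⟩

theorem fstPart_prod (a : Submodule K A) (b : Submodule K B) : fstPart (a.prod b) = a := by
  ext u; simp [mem_fstPart]

theorem sndPart_prod (a : Submodule K A) (b : Submodule K B) : sndPart (a.prod b) = b := by
  ext v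
  simp only [mem_sndPart, Submodule.mem_prod, exists_and_right, and_iff_right_iff_imp]
  exact fun _ => ⟨0, a.zero_mem⟩

/-- Take a linear section of the projection of `y` onto `sndPart y`, keep its first coordinate, and
extend that map from `sndPart y` to all of `B`. The result is unique only modulo maps carrying
`sndPart y` into `fstPart y`. -/
theorem exists_eq_shear (y : Submodule K (A × B)) :
    ∃ φ : B →ₗ[K] A, y = shear φ ((fstPart y).prod (sndPart y)) := by
  let f : y →ₗ[K] sndPart y := (LinearMap.snd K A B).submoduleMap y
  obtain ⟨s, hs⟩ := LinearMap.exists_rightInverse_of_surjective f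
    (LinearMap.range_eq_top.2 ((LinearMap.snd K A B).submoduleMap_surjective y))
  obtain ⟨φ, hφ⟩ := LinearMap.exists_extend (LinearMap.fst K A B ∘ₗ y.subtype ∘ₗ s)
  have key : ∀ v : sndPart y, (φ v, (v : B)) ∈ y := by
    intro v
    have h1 : φ v = (s v : A × B).1 := by simpa using LinearMap.congr_fun hφ v
    have h2 : (s v : A × B).2 = v := congrArg Subtype.val (LinearMap.congr_fun hs v)
    have h3 : (φ v, (v : B)) = (s v : A × B) := by rw [h1, ← h2]
    rw [h3]; exact (s v).2
  refine ⟨φ, ?_⟩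
  ext ⟨u, v⟩
  simp only [mem_shear, Submodule.mem_prod, mem_fstPart]
  constructor
  · intro h
    have hv : v ∈ sndPart y := mem_sndPart.2 ⟨u, h⟩
    exact ⟨by simpa using y.sub_mem h (key ⟨v, hv⟩), hv⟩
  · rintro ⟨h1, hv⟩
    simpa using y.add_mem h1 (key ⟨v, hv⟩)

theorem finrank_eq_add [FiniteDimensional K A] [FiniteDimensional K B]
    (y : Submodule K (A × B)) :
    Module.finrank K y = Module.finrank K (fstPart y) + Module.finrank K (sndPart y) := by
  have h := ((LinearMap.snd K A B).submoduleMap y).finrank_range_add_finrank_ker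
  rw [LinearMap.range_eq_top.2 ((LinearMap.snd K A B).submoduleMap_surjective y),
    finrank_top] at h
  have e : (LinearMap.ker ((LinearMap.snd K A B).submoduleMap y)).map y.subtype =
      (fstPart y).map (LinearMap.inl K A B) := by
    ext ⟨u, v⟩
    simp only [Submodule.mem_map, LinearMap.mem_ker, Submodule.subtype_apply, Subtype.exists,
      mem_fstPart, LinearMap.inl_apply, Prod.mk.injEq]
    constructor
    · rintro ⟨p, hp, h1, rfl⟩
      have h2 : v = 0 := congrArg Subtype.val h1
      subst h2
      exact ⟨u, hp, rfl, rfl⟩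
    · rintro ⟨w, hw, rfl, rfl⟩
      exact ⟨_, hw, Subtype.ext rfl, rfl⟩
  have e1 := (Submodule.equivMapOfInjective y.subtype y.subtype_injective
    (LinearMap.ker ((LinearMap.snd K A B).submoduleMap y))).finrank_eq
  have e2 := (Submodule.equivMapOfInjective (LinearMap.inl K A B) LinearMap.inl_injective
    (fstPart y)).finrank_eq
  rw [e] at e1
  change Module.finrank K (sndPart y) + _ = _ at h
  omega

theorem finrank_submodule_prod [FiniteDimensional K A] [FiniteDimensional K B]
    (a : Submodule K A) (b : Submodule K B) :
    Module.finrank K (a.prod b) = Module.finrank K a + Module.finrank K b := by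
  rw [finrank_eq_add, fstPart_prod, sndPart_prod]

theorem prod_eq_of_le [FiniteDimensional K A] [FiniteDimensional K B]
    {y : Submodule K (A × B)} {a : Submodule K A} {b : Submodule K B} (h : a.prod b ≤ y)
    (h1 : Module.finrank K (fstPart y) = Module.finrank K a)
    (h2 : Module.finrank K (sndPart y) = Module.finrank K b) : y = a.prod b := by
  refine (Submodule.eq_of_le_of_finrank_eq h ?_).symm
  rw [finrank_submodule_prod, finrank_eq_add, h1, h2]

theorem eq_prod_of_le [FiniteDimensional K A] [FiniteDimensional K B]
    {y : Submodule K (A × B)} {a : Submodule K A} {b : Submodule K B} (h : y ≤ a.prod b)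
    (h1 : Module.finrank K (fstPart y) = Module.finrank K a)
    (h2 : Module.finrank K (sndPart y) = Module.finrank K b) : y = a.prod b := by
  refine Submodule.eq_of_le_of_finrank_eq h ?_
  rw [finrank_submodule_prod, finrank_eq_add, h1, h2]

end Shear

section RelSum

open Classical in
/-- The operator with `0`-`1` matrix given by a relation. -/
noncomputable def relSum {G : Type*} [Fintype G] (r : G → G → Prop) : (G → ℂ) →ₗ[ℂ] (G → ℂ) where
  toFun g y := ∑ z with r y z, g z
  map_add' g h := by ext y; simp [Finset.sum_add_distrib]
  map_smul' c g := by ext y; simp [Finset.mul_sum]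

open Classical in
theorem relSum_apply {G : Type*} [Fintype G] (r : G → G → Prop) (g : G → ℂ) (y : G) :
    relSum r g y = ∑ z with r y z, g z := rfl

end RelSum

/-! ### Fourier analysis over the group of shears -/

section Fourier

variable {K A B : Type*} [Field K] [Fintype K] [AddCommGroup A] [Module K A]
  [FiniteDimensional K A] [AddCommGroup B] [Module K B] [FiniteDimensional K B]
  [Fintype (Submodule K (A × B))] (e : AddChar K ℂ)

/-- The functions on which the group of shears acts by the character attached to `ψ`. -/
def shearSpace (ψ : A →ₗ[K] B) : Submodule ℂ (Submodule K (A × B) → ℂ) where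
  carrier := {g | ∀ (σ : B →ₗ[K] A) y,
    g (shear σ y) = e (-LinearMap.trace K B (ψ ∘ₗ σ)) * g y}
  add_mem' h1 h2 σ y := by simp [h1 σ y, h2 σ y, mul_add]
  zero_mem' σ y := by simp
  smul_mem' c g h σ y := by simp [h σ y, mul_left_comm]

variable {e} {ψ : A →ₗ[K] B} {g : Submodule K (A × B) → ℂ}

/-- An operator given by an invariant relation commutes with the shears, so it preserves each
character space. -/
theorem relSum_mem_shearSpace {r : Submodule K (A × B) → Submodule K (A × B) → Prop}
    (hr : ∀ σ y z, r (shear σ y) (shear σ z) ↔ r y z) (hg : g ∈ shearSpace e ψ) :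
    relSum r g ∈ shearSpace e ψ := by
  classical
  intro σ y
  rw [relSum_apply, relSum_apply, Finset.mul_sum]
  refine Finset.sum_nbij' (shear (-σ)) (shear σ) ?_ ?_ ?_ ?_ ?_
  · intro z hz
    simp only [Finset.mem_filter, Finset.mem_univ, true_and] at hz ⊢
    rw [← hr σ, shear_shear]
    simpa [shear_zero] using hz
  · intro z hz
    simp only [Finset.mem_filter, Finset.mem_univ, true_and] at hz ⊢
    rwa [hr]
  · intro z _; rw [shear_shear]; simp [shear_zero]
  · intro z _; rw [shear_shear]; simp [shear_zero]
  · intro z _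
    rw [← hg, shear_shear]; simp [shear_zero]

/-- A shear in the stabilizer of `y` on which the character is nontrivial kills the value at `y`.
The two vanishing lemmas below exhibit rank-one elements of the stabilizer. -/
theorem eq_zero_of_shear_eq {σ : B →ₗ[K] A} {y : Submodule K (A × B)} (hg : g ∈ shearSpace e ψ)
    (h : shear σ y = y) (hσ : e (-LinearMap.trace K B (ψ ∘ₗ σ)) ≠ 1) : g y = 0 := by
  have := hg σ y
  rw [h] at this
  by_contra h0
  exact hσ (mul_right_cancel₀ h0 (by rw [one_mul]; exact this.symm))

theorem exists_scale (he : e ≠ 1) {t : K} (ht : t ≠ 0) : ∃ s : K, e (-(s * t)) ≠ 1 := by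
  obtain ⟨s, hs⟩ := AddChar.ne_one_iff.1 he
  exact ⟨-s / t, by rwa [div_mul_cancel₀ _ ht, neg_neg]⟩

/-- Choose `u` in the first part of `y` with `ψ u ≠ 0` and a functional `c` with `c (ψ u) ≠ 0`. The
shear `v ↦ s c(v) u` changes vectors only by multiples of `(u, 0) ∈ y`, so it fixes `y`, while its
trace against `ψ` is `s c(ψ u)`. -/
theorem vanish_of_not_le_ker (he : e ≠ 1) {y : Submodule K (A × B)} (hg : g ∈ shearSpace e ψ)
    (h : ¬ fstPart y ≤ LinearMap.ker ψ) : g y = 0 := by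
  obtain ⟨u, hu, hψ⟩ := SetLike.not_le_iff_exists.1 h
  rw [LinearMap.mem_ker] at hψ
  obtain ⟨c, hc, -⟩ := (⊥ : Submodule K B).exists_le_ker_of_notMem (v := ψ u) (by simpa using hψ)
  obtain ⟨s, hs⟩ := exists_scale he hc
  refine eq_zero_of_shear_eq (σ := (s • c).smulRight u) hg ?_ ?_
  · ext p
    have h1 : ((s * c p.2) • u, (0 : B)) ∈ y := by
      simpa using y.smul_mem (s * c p.2) (mem_fstPart.1 hu)
    rw [mem_shear]
    have h2 : p = (p.1 - (s * c p.2) • u, p.2) + ((s * c p.2) • u, (0 : B)) := by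
      ext <;> simp
    constructor
    · intro h; rw [h2]; exact y.add_mem (by simpa using h) h1
    · intro h
      have := y.sub_mem h h1
      rw [show p - ((s * c p.2) • u, (0 : B)) = (p.1 - (s * c p.2) • u, p.2) by ext <;> simp]
        at this
      simpa using this
  · rw [trace_comp_smulRight]; simpa using hs

/-- The dual argument: the functional now vanishes on `sndPart y` but not at a value `ψ u` outside
it, so the rank-one shear fixes every vector of `y`. -/
theorem vanish_of_not_range_le (he : e ≠ 1) {y : Submodule K (A × B)} (hg : g ∈ shearSpace e ψ)
    (h : ¬ LinearMap.range ψ ≤ sndPart y) : g y = 0 := by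
  obtain ⟨w, ⟨u, rfl⟩, hu⟩ := SetLike.not_le_iff_exists.1 h
  obtain ⟨c, hc, hy⟩ := (sndPart y).exists_le_ker_of_notMem hu
  obtain ⟨s, hs⟩ := exists_scale he hc
  have hz : ∀ p ∈ y, c p.2 = 0 := fun p hp => hy (mem_sndPart.2 ⟨p.1, hp⟩)
  refine eq_zero_of_shear_eq (σ := (s • c).smulRight u) hg ?_ ?_
  · ext p
    rw [mem_shear]
    constructor
    · intro h
      have := hz _ h
      simpa [this] using h
    · intro h
      have := hz _ h
      simpa [this] using h
  · rw [trace_comp_smulRight]; simpa using hs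

/-- Every subspace is a shear of the product of its two parts, so only the values at products
matter, and the two vanishing lemmas leave only the pairs `(a, b)` listed here. All operator
identities below are thereby reduced to two independent subspace lattices. -/
theorem shearSpace_ext (he : e ≠ 1) {g g' : Submodule K (A × B) → ℂ} (hg : g ∈ shearSpace e ψ)
    (hg' : g' ∈ shearSpace e ψ)
    (h : ∀ (a : Submodule K A) (b : Submodule K B), a ≤ LinearMap.ker ψ →
      LinearMap.range ψ ≤ b → g (a.prod b) = g' (a.prod b)) : g = g' := by
  ext y
  by_cases h1 : fstPart y ≤ LinearMap.ker ψ
  · by_cases h2 : LinearMap.range ψ ≤ sndPart y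
    · obtain ⟨φ, hφ⟩ := exists_eq_shear y
      rw [hφ, hg, hg', h _ _ h1 h2]
    · rw [vanish_of_not_range_le he hg h2, vanish_of_not_range_le he hg' h2]
  · rw [vanish_of_not_le_ker he hg h1, vanish_of_not_le_ker he hg' h1]

/-- Under the hypothesis the character is trivial at `φ`. If `(a, b)` is not one of the pairs on
which `g` can be nonzero, both sides vanish. -/
theorem apply_shear_prod (he : e ≠ 1) (hg : g ∈ shearSpace e ψ) {φ : B →ₗ[K] A}
    {a : Submodule K A} {b : Submodule K B}
    (h : a ≤ LinearMap.ker ψ → LinearMap.range ψ ≤ b → ∀ u, ψ (φ (ψ u)) = 0) :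
    g (shear φ (a.prod b)) = g (a.prod b) := by
  by_cases h1 : a ≤ LinearMap.ker ψ
  · by_cases h2 : LinearMap.range ψ ≤ b
    · rw [hg, trace_comp_eq_zero (h h1 h2)]; simp
    · rw [vanish_of_not_range_le he hg (by rwa [sndPart_shear, sndPart_prod]),
        vanish_of_not_range_le he hg (by rwa [sndPart_prod])]
  · rw [vanish_of_not_le_ker he hg (by rwa [fstPart_shear, fstPart_prod]),
      vanish_of_not_le_ker he hg (by rwa [fstPart_prod])]

/-- The relations defining the four lowering and raising operators. -/
def relA (y z : Submodule K (A × B)) : Prop :=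
  y ≤ z ∧ Module.finrank K (fstPart z) = Module.finrank K (fstPart y) + 1 ∧
    Module.finrank K (sndPart z) = Module.finrank K (sndPart y)

def relB (y z : Submodule K (A × B)) : Prop :=
  y ≤ z ∧ Module.finrank K (fstPart z) = Module.finrank K (fstPart y) ∧
    Module.finrank K (sndPart z) = Module.finrank K (sndPart y) + 1

theorem relA_shear (σ : B →ₗ[K] A) (y z : Submodule K (A × B)) :
    relA (shear σ y) (shear σ z) ↔ relA y z := by
  rw [relA, relA, shear_le_shear_iff, fstPart_shear, fstPart_shear, sndPart_shear, sndPart_shear]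

theorem relB_shear (σ : B →ₗ[K] A) (y z : Submodule K (A × B)) :
    relB (shear σ y) (shear σ z) ↔ relB y z := by
  rw [relB, relB, shear_le_shear_iff, fstPart_shear, fstPart_shear, sndPart_shear, sndPart_shear]

variable [Fintype (Submodule K A)] [Fintype (Submodule K B)]

/-- A subspace above `a.prod b` with the same second part is itself a product. Hence no shears occur
and no power of `q` appears; the same is true of going below a product with the first part fixed, as
in `relSum_swap_relB_prod`. -/
theorem relSum_relA_prod (g : Submodule K (A × B) → ℂ) (a : Submodule K A) (b : Submodule K B) :
    relSum relA g (a.prod b) = ∑ a' ∈ covers ⊤ a, g (a'.prod b) := by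
  classical
  rw [relSum_apply]
  symm
  refine Finset.sum_nbij' (fun a' => a'.prod b) fstPart ?_ ?_ ?_ ?_ ?_
  · intro a' ha
    obtain ⟨h1, -, h3⟩ := mem_covers.1 ha
    rw [Finset.mem_filter, relA, fstPart_prod, fstPart_prod, sndPart_prod,
      sndPart_prod]
    exact ⟨Finset.mem_univ _, Submodule.prod_mono h1 le_rfl, h3, rfl⟩
  · intro z hz
    rw [Finset.mem_filter, relA, fstPart_prod, sndPart_prod] at hz
    replace hz := hz.2
    refine mem_covers.2 ⟨?_, le_top, hz.2.1⟩
    simpa [fstPart_prod] using fstPart_mono hz.1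
  · intro a' _; exact fstPart_prod _ _
  · intro z hz
    rw [Finset.mem_filter, relA, fstPart_prod, sndPart_prod] at hz
    replace hz := hz.2
    refine (prod_eq_of_le ?_ rfl hz.2.2).symm
    rintro ⟨u, v⟩ ⟨hu, hv⟩
    have h1 := hz.1 (show ((0 : A), v) ∈ a.prod b from ⟨a.zero_mem, hv⟩)
    simpa using z.add_mem (mem_fstPart.1 hu) h1
  · intro a' _; rfl

theorem relSum_swap_relB_prod (g : Submodule K (A × B) → ℂ) (a : Submodule K A)
    (b : Submodule K B) :
    relSum (fun y z => relB z y) g (a.prod b) = ∑ b' ∈ cocovers ⊥ b, g (a.prod b') := by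
  classical
  rw [relSum_apply]
  symm
  refine Finset.sum_nbij' (fun b' => a.prod b') sndPart ?_ ?_ ?_ ?_ ?_
  · intro b' ha
    obtain ⟨-, h1, h3⟩ := mem_cocovers.1 ha
    rw [Finset.mem_filter, relB, fstPart_prod, fstPart_prod, sndPart_prod,
      sndPart_prod]
    exact ⟨Finset.mem_univ _, Submodule.prod_mono le_rfl h1, rfl, h3.symm⟩
  · intro z hz
    rw [Finset.mem_filter, relB, fstPart_prod, sndPart_prod] at hz
    replace hz := hz.2
    refine mem_cocovers.2 ⟨bot_le, ?_, hz.2.2.symm⟩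
    simpa [sndPart_prod] using sndPart_mono hz.1
  · intro a' _; exact sndPart_prod _ _
  · intro z hz
    rw [Finset.mem_filter, relB, fstPart_prod, sndPart_prod] at hz
    replace hz := hz.2
    refine (eq_prod_of_le ?_ hz.2.1.symm rfl).symm
    rintro ⟨u, v⟩ huv
    exact ⟨(hz.1 huv).1, mem_sndPart.2 ⟨u, huv⟩⟩
  · intro a' _; rfl

/-- These are the hyperplanes of `a.prod b` that contain `a'.prod ⊥` but not `a.prod ⊥`. Their
number is a difference of two consecutive Gaussian numbers, hence a power of `q`. -/
theorem card_filter_relA_fiber {a a' : Submodule K A} {b : Submodule K B} (h : a' ≤ a)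
    (h' : Module.finrank K a' + 1 = Module.finrank K a)
    (s : Finset (Submodule K (A × B)))
    (hs : ∀ z, z ∈ s ↔ relA z (a.prod b) ∧ fstPart z = a') :
    (s.card : ℂ) = (Fintype.card K : ℂ) ^ Module.finrank K b := by
  classical
  have key : s = cocovers (a'.prod ⊥) (a.prod b) \ cocovers (a.prod ⊥) (a.prod b) := by
    ext z
    rw [hs, Finset.mem_sdiff, mem_cocovers, mem_cocovers, relA, finrank_submodule_prod,
      fstPart_prod, sndPart_prod]
    constructor
    · rintro ⟨⟨h1, h2, h3⟩, rfl⟩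
      refine ⟨⟨?_, h1, by rw [finrank_eq_add]; omega⟩, ?_⟩
      · rintro ⟨u, v⟩ ⟨hu, hv⟩
        obtain rfl : v = 0 := by simpa using hv
        exact hu
      · rintro ⟨h4, -⟩
        have := fstPart_mono h4
        rw [fstPart_prod] at this
        have := Submodule.finrank_mono this
        omega
    · rintro ⟨⟨h1, h2, h3⟩, h4⟩
      have h5 := fstPart_mono h1
      rw [fstPart_prod] at h5
      have h6 := fstPart_mono h2
      rw [fstPart_prod] at h6
      have h7 : ¬ a ≤ fstPart z := by
        intro h8
        refine h4 ⟨?_, h2, h3⟩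
        rintro ⟨u, v⟩ ⟨hu, hv⟩
        obtain rfl : v = 0 := by simpa using hv
        exact h8 hu
      have h9 : Module.finrank K (fstPart z) < Module.finrank K a :=
        Submodule.finrank_lt_finrank_of_lt (lt_of_le_not_ge h6 h7)
      have h10 : a' = fstPart z := Submodule.eq_of_le_of_finrank_le h5 (by omega)
      have h11 := finrank_eq_add z
      rw [← h10] at h11
      exact ⟨⟨h2, by rw [← h10]; omega, by omega⟩, h10.symm⟩
  have hsub : cocovers (a.prod ⊥) (a.prod b) ⊆ cocovers (a'.prod ⊥) (a.prod b) := by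
    intro z hz
    obtain ⟨h1, h2, h3⟩ := mem_cocovers.1 hz
    exact mem_cocovers.2 ⟨(Submodule.prod_mono h le_rfl).trans h1, h2, h3⟩
  rw [key, Finset.card_sdiff_of_subset hsub, Nat.cast_sub (Finset.card_le_card hsub),
    card_cocovers (Submodule.prod_mono h bot_le), card_cocovers (Submodule.prod_mono le_rfl bot_le)]
  simp only [finrank_submodule_prod, finrank_bot]
  rw [← h', gauss, gauss, ← sub_div, div_eq_iff (one_sub_q_ne_zero K)]
  have e1 : (((Module.finrank K a' + 1 + Module.finrank K b : ℕ) : ℤ) -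
    ((Module.finrank K a' + 0 : ℕ) : ℤ)) = ((Module.finrank K b + 1 : ℕ) : ℤ) := by
    push_cast; ring
  have e2 : (((Module.finrank K a' + 1 + Module.finrank K b : ℕ) : ℤ) -
    ((Module.finrank K a' + 1 + 0 : ℕ) : ℤ)) = ((Module.finrank K b : ℕ) : ℤ) := by
    push_cast; ring
  rw [e1, e2, zpow_natCast, zpow_natCast]
  ring

/-- Dually, these are the covers of `a.prod b` inside `⊤.prod b'` but not inside `⊤.prod b`. -/
theorem card_filter_relB_fiber {a : Submodule K A} {b b' : Submodule K B} (h : b ≤ b')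
    (h' : Module.finrank K b' = Module.finrank K b + 1)
    (s : Finset (Submodule K (A × B)))
    (hs : ∀ z, z ∈ s ↔ relB (a.prod b) z ∧ sndPart z = b') :
    (s.card : ℂ) = (Fintype.card K : ℂ) ^ ((Module.finrank K A : ℤ) - Module.finrank K a) := by
  classical
  have key : s = covers ((⊤ : Submodule K A).prod b') (a.prod b) \
      covers ((⊤ : Submodule K A).prod b) (a.prod b) := by
    ext z
    rw [hs, Finset.mem_sdiff, mem_covers, mem_covers, relB, finrank_submodule_prod,
      fstPart_prod, sndPart_prod]
    have hle : ∀ c : Submodule K B, z ≤ (⊤ : Submodule K A).prod c ↔ sndPart z ≤ c := by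
      intro c
      constructor
      · intro h; simpa [sndPart_prod] using sndPart_mono h
      · rintro h ⟨u, v⟩ huv
        exact ⟨trivial, h (mem_sndPart.2 ⟨u, huv⟩)⟩
    rw [hle, hle]
    constructor
    · rintro ⟨⟨h1, h2, h3⟩, rfl⟩
      refine ⟨⟨h1, le_rfl, by rw [finrank_eq_add]; omega⟩, ?_⟩
      rintro ⟨-, h4, -⟩
      have := Submodule.finrank_mono h4
      omega
    · rintro ⟨⟨h1, h2, h3⟩, h4⟩
      have h5 := sndPart_mono h1
      rw [sndPart_prod] at h5
      have h7 : ¬ sndPart z ≤ b := fun h8 => h4 ⟨h1, h8, h3⟩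
      have h9 : Module.finrank K b < Module.finrank K (sndPart z) :=
        Submodule.finrank_lt_finrank_of_lt (lt_of_le_not_ge h5 h7)
      have h10 : sndPart z = b' := Submodule.eq_of_le_of_finrank_le h2 (by omega)
      have h11 := finrank_eq_add z
      rw [h10] at h11
      exact ⟨⟨h1, by omega, by rw [h10]; omega⟩, h10⟩
  have hsub : covers ((⊤ : Submodule K A).prod b) (a.prod b) ⊆
      covers ((⊤ : Submodule K A).prod b') (a.prod b) := by
    intro z hz
    obtain ⟨h1, h2, h3⟩ := mem_covers.1 hz
    exact mem_covers.2 ⟨h1, h2.trans (Submodule.prod_mono le_rfl h), h3⟩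
  rw [key, Finset.card_sdiff_of_subset hsub, Nat.cast_sub (Finset.card_le_card hsub),
    card_covers (Submodule.prod_mono le_top h), card_covers (Submodule.prod_mono le_top le_rfl)]
  simp only [finrank_submodule_prod, finrank_top, h']
  rw [gauss, gauss, ← sub_div, div_eq_iff (one_sub_q_ne_zero K)]
  have e1 : (((Module.finrank K A + (Module.finrank K b + 1) : ℕ) : ℤ) -
    ((Module.finrank K a + Module.finrank K b : ℕ) : ℤ)) =
      ((Module.finrank K A : ℤ) - Module.finrank K a) + 1 := by
    push_cast; ring
  have e2 : (((Module.finrank K A + Module.finrank K b : ℕ) : ℤ) -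
    ((Module.finrank K a + Module.finrank K b : ℕ) : ℤ)) =
      ((Module.finrank K A : ℤ) - Module.finrank K a) := by
    push_cast; ring
  rw [e1, e2, zpow_add_one₀ (q_ne_zero K)]
  ring

/-- The sum is sorted by the first part. The members of one fibre are shears `φ` of the same
product, and `g` agrees on them: `(φ (ψ u), ψ u)` lies in `z ≤ a.prod b`, so `φ (ψ u) ∈ a ≤ ker ψ`
and the trace vanishes. -/
theorem relSum_swap_relA_prod (he : e ≠ 1) (hg : g ∈ shearSpace e ψ) {a : Submodule K A}
    (b : Submodule K B) (ha : a ≤ LinearMap.ker ψ) :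
    relSum (fun y z => relA z y) g (a.prod b) =
      (Fintype.card K : ℂ) ^ Module.finrank K b * ∑ a' ∈ cocovers ⊥ a, g (a'.prod b) := by
  classical
  rw [relSum_apply, ← Finset.sum_fiberwise_of_maps_to (g := fstPart) (t := cocovers ⊥ a)]
  · rw [Finset.mul_sum]
    refine Finset.sum_congr rfl fun a' ha' => ?_
    obtain ⟨-, h1, h2⟩ := mem_cocovers.1 ha'
    rw [← card_filter_relA_fiber (b := b) h1 h2 {z ∈ {z | relA z (a.prod b)} | fstPart z = a'}
      (fun z => by
        rw [Finset.mem_filter, Finset.mem_filter]; simp only [Finset.mem_univ, true_and])]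
    rw [← nsmul_eq_mul, ← Finset.sum_const]
    refine Finset.sum_congr rfl fun z hz => ?_
    rw [Finset.mem_filter, Finset.mem_filter] at hz
    obtain ⟨⟨-, h3, h4, h5⟩, rfl⟩ := hz
    rw [sndPart_prod] at h5
    have h6 : sndPart z = b := by
      have := sndPart_mono h3
      rw [sndPart_prod] at this
      exact Submodule.eq_of_le_of_finrank_eq this h5.symm
    obtain ⟨φ, hφ⟩ := exists_eq_shear z
    rw [h6] at hφ
    conv_lhs => rw [hφ]
    apply apply_shear_prod he hg
    intro h7 h8 u
    have h9 : (φ (ψ u), ψ u) ∈ z := by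
      rw [hφ, mem_shear]
      exact ⟨by simp, h8 ⟨u, rfl⟩⟩
    exact ha (h3 h9).1
  · intro z hz
    rw [Finset.mem_filter] at hz
    obtain ⟨-, h3, h4, h5⟩ := hz
    rw [fstPart_prod] at h4
    refine mem_cocovers.2 ⟨bot_le, ?_, h4.symm⟩
    simpa [fstPart_prod] using fstPart_mono h3

/-- The same argument, sorted by the second part. Now `(0, ψ u)` lies in `a.prod b ≤ z`, which puts
`φ (ψ u)` into `a`, hence into `ker ψ`. -/
theorem relSum_relB_prod (he : e ≠ 1) (hg : g ∈ shearSpace e ψ) {a : Submodule K A}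
    {b : Submodule K B} (ha : a ≤ LinearMap.ker ψ) (hb : LinearMap.range ψ ≤ b) :
    relSum relB g (a.prod b) =
      (Fintype.card K : ℂ) ^ ((Module.finrank K A : ℤ) - Module.finrank K a) *
        ∑ b' ∈ covers ⊤ b, g (a.prod b') := by
  classical
  rw [relSum_apply, ← Finset.sum_fiberwise_of_maps_to (g := sndPart) (t := covers ⊤ b)]
  · rw [Finset.mul_sum]
    refine Finset.sum_congr rfl fun b' hb' => ?_
    obtain ⟨h1, -, h2⟩ := mem_covers.1 hb'
    rw [← card_filter_relB_fiber (a := a) h1 h2 {z ∈ {z | relB (a.prod b) z} | sndPart z = b'}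
      (fun z => by
        rw [Finset.mem_filter, Finset.mem_filter]; simp only [Finset.mem_univ, true_and])]
    rw [← nsmul_eq_mul, ← Finset.sum_const]
    refine Finset.sum_congr rfl fun z hz => ?_
    rw [Finset.mem_filter, Finset.mem_filter] at hz
    obtain ⟨⟨-, h3, h4, h5⟩, rfl⟩ := hz
    rw [fstPart_prod] at h4
    have h6 : fstPart z = a := by
      have := fstPart_mono h3
      rw [fstPart_prod] at this
      exact (Submodule.eq_of_le_of_finrank_eq this h4.symm).symm
    obtain ⟨φ, hφ⟩ := exists_eq_shear z
    rw [h6] at hφ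
    conv_lhs => rw [hφ]
    apply apply_shear_prod he hg
    intro h7 h8 u
    have h9 : ((0 : A), ψ u) ∈ z := h3 ⟨a.zero_mem, hb ⟨u, rfl⟩⟩
    rw [hφ, mem_shear] at h9
    have h10 := ha h9.1
    simpa using h10
  · intro z hz
    rw [Finset.mem_filter] at hz
    obtain ⟨-, h3, h4, h5⟩ := hz
    rw [sndPart_prod] at h5
    refine mem_covers.2 ⟨?_, le_top, h5⟩
    simpa [sndPart_prod] using sndPart_mono h3

end Fourier
end TwistedGrassmann

namespace TwistedGrassmann

/-! ### Commutation relations and dimensions on a character space -/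

section Fourier

variable {K A B : Type*} [Field K] [Fintype K] [AddCommGroup A] [Module K A]
  [FiniteDimensional K A] [AddCommGroup B] [Module K B] [FiniteDimensional K B]
  [Fintype (Submodule K (A × B))] {e : AddChar K ℂ}
  {ψ : A →ₗ[K] B} {g : Submodule K (A × B) → ℂ}

/-- The scalars in the commutators depend on the cell. Since the two parts are invariant under
shears, multiplying by such scalars stays in the space, so `shearSpace_ext` applies to the
right-hand sides too. -/
theorem mul_mem_shearSpace (hg : g ∈ shearSpace e ψ) (c : Submodule K A → Submodule K B → ℂ) :
    (fun y => c (fstPart y) (sndPart y) * g y) ∈ shearSpace e ψ := by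
  intro σ y
  simp only
  rw [fstPart_shear, sndPart_shear, hg, mul_left_comm]

theorem relA_mem (hg : g ∈ shearSpace e ψ) : relSum relA g ∈ shearSpace e ψ :=
  relSum_mem_shearSpace relA_shear hg

theorem relB_mem (hg : g ∈ shearSpace e ψ) : relSum relB g ∈ shearSpace e ψ :=
  relSum_mem_shearSpace relB_shear hg

theorem swap_relA_mem (hg : g ∈ shearSpace e ψ) :
    relSum (fun y z => relA z y) g ∈ shearSpace e ψ :=
  relSum_mem_shearSpace (fun σ y z => relA_shear σ z y) hg

theorem swap_relB_mem (hg : g ∈ shearSpace e ψ) :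
    relSum (fun y z => relB z y) g ∈ shearSpace e ψ :=
  relSum_mem_shearSpace (fun σ y z => relB_shear σ z y) hg

theorem apply_prod_eq_zero (he : e ≠ 1) (hg : g ∈ shearSpace e ψ) {a : Submodule K A}
    (b : Submodule K B) (h : ¬ a ≤ LinearMap.ker ψ) : g (a.prod b) = 0 :=
  vanish_of_not_le_ker he hg (by rwa [fstPart_prod])

theorem apply_prod_eq_zero' (he : e ≠ 1) (hg : g ∈ shearSpace e ψ) (a : Submodule K A)
    {b : Submodule K B} (h : ¬ LinearMap.range ψ ≤ b) : g (a.prod b) = 0 :=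
  vanish_of_not_range_le he hg (by rwa [sndPart_prod])

variable [Fintype (Submodule K A)] [Fintype (Submodule K B)]

/-- The additional summands vanish, so the relevant lattice is `[⊥, ker ψ]`; in
`sum_cocovers_bot_eq` it is `[range ψ, ⊤]`. -/
theorem sum_covers_top_eq (he : e ≠ 1) (hg : g ∈ shearSpace e ψ) (a : Submodule K A)
    (b : Submodule K B) :
    ∑ a' ∈ covers ⊤ a, g (a'.prod b) = ∑ a' ∈ covers (LinearMap.ker ψ) a, g (a'.prod b) := by
  symm
  refine Finset.sum_subset (fun a' h => ?_) (fun a' h1 h2 => ?_)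
  · obtain ⟨h1, h2, h3⟩ := mem_covers.1 h
    exact mem_covers.2 ⟨h1, le_top, h3⟩
  · apply apply_prod_eq_zero he hg
    intro h3
    obtain ⟨h4, -, h5⟩ := mem_covers.1 h1
    exact h2 (mem_covers.2 ⟨h4, h3, h5⟩)

theorem sum_cocovers_bot_eq (he : e ≠ 1) (hg : g ∈ shearSpace e ψ) (a : Submodule K A)
    (b : Submodule K B) :
    ∑ b' ∈ cocovers ⊥ b, g (a.prod b') = ∑ b' ∈ cocovers (LinearMap.range ψ) b, g (a.prod b') := by
  symm
  refine Finset.sum_subset (fun a' h => ?_) (fun a' h1 h2 => ?_)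
  · obtain ⟨h1, h2, h3⟩ := mem_cocovers.1 h
    exact mem_cocovers.2 ⟨bot_le, h2, h3⟩
  · apply apply_prod_eq_zero' he hg
    intro h3
    obtain ⟨-, h4, h5⟩ := mem_cocovers.1 h1
    exact h2 (mem_cocovers.2 ⟨h3, h4, h5⟩)

theorem gauss_sub_gauss {q : ℂ} (hq : q ≠ 0) (m i : ℤ) :
    gauss q m - gauss q i = q ^ i * gauss q (m - i) := by
  rw [gauss, gauss, gauss, zpow_sub₀ hq]
  have := zpow_ne_zero i hq
  field_simp
  ring

/-- The commutator of the operators changing the intersection with the first factor. -/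
theorem relA_commutator (he : e ≠ 1) (hg : g ∈ shearSpace e ψ) (y : Submodule K (A × B)) :
    relSum relA (relSum (fun y z => relA z y) g) y -
      relSum (fun y z => relA z y) (relSum relA g) y =
    (Fintype.card K : ℂ) ^ ((Module.finrank K (fstPart y) : ℤ) + Module.finrank K (sndPart y)) *
      gauss (Fintype.card K) (Module.finrank K (LinearMap.ker ψ) -
        2 * Module.finrank K (fstPart y)) * g y := by
  have hq := q_ne_zero K
  have h1 := (shearSpace e ψ).sub_mem (relA_mem (swap_relA_mem hg)) (swap_relA_mem (relA_mem hg))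
  have h2 := mul_mem_shearSpace hg (fun a b =>
    (Fintype.card K : ℂ) ^ ((Module.finrank K a : ℤ) + Module.finrank K b) *
      gauss (Fintype.card K) (Module.finrank K (LinearMap.ker ψ) - 2 * Module.finrank K a))
  refine congrFun (shearSpace_ext he h1 h2 fun a b ha hb => ?_) y
  simp only [Pi.sub_apply]
  rw [fstPart_prod, sndPart_prod, relSum_relA_prod, sum_covers_top_eq he (swap_relA_mem hg),
    relSum_swap_relA_prod he (relA_mem hg) b ha]
  have e1 : ∑ a' ∈ covers (LinearMap.ker ψ) a, relSum (fun y z => relA z y) g (a'.prod b) =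
      (Fintype.card K : ℂ) ^ Module.finrank K b * ∑ a' ∈ covers (LinearMap.ker ψ) a,
        ∑ a'' ∈ cocovers ⊥ a', g (a''.prod b) := by
    rw [Finset.mul_sum]
    exact Finset.sum_congr rfl fun a' h =>
      relSum_swap_relA_prod he hg b (mem_covers.1 h).2.1
  have e2 : ∑ a' ∈ cocovers ⊥ a, relSum relA g (a'.prod b) =
      ∑ a' ∈ cocovers ⊥ a, ∑ a'' ∈ covers (LinearMap.ker ψ) a', g (a''.prod b) :=
    Finset.sum_congr rfl fun a' h => by rw [relSum_relA_prod, sum_covers_top_eq he hg]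
  -- This is the commutator in the interval from `⊥` to `ker ψ`, multiplied by the weight `q ^ dim
  -- b` of the downward step.
  rw [e1, e2, ← mul_sub, sum_covers_cocovers_sub bot_le ha (fun a => g (a.prod b)),
    gauss_sub_gauss hq, finrank_bot, zpow_add₀ hq, zpow_natCast, zpow_natCast]
  have e3 : (Module.finrank K (LinearMap.ker ψ) : ℤ) - Module.finrank K a -
    (Module.finrank K a - (0 : ℕ)) = Module.finrank K (LinearMap.ker ψ) -
      2 * Module.finrank K a := by push_cast; ring
  rw [e3, Nat.cast_zero, sub_zero, zpow_natCast]
  ring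

/-- The commutator of the operators changing the projection to the second factor. -/
theorem relB_commutator (he : e ≠ 1) (hg : g ∈ shearSpace e ψ) (y : Submodule K (A × B)) :
    relSum relB (relSum (fun y z => relB z y) g) y -
      relSum (fun y z => relB z y) (relSum relB g) y =
    (Fintype.card K : ℂ) ^ ((Module.finrank K A : ℤ) - Module.finrank K (fstPart y) +
        Module.finrank K (sndPart y) - Module.finrank K (LinearMap.range ψ)) *
      gauss (Fintype.card K) (Module.finrank K B + Module.finrank K (LinearMap.range ψ) -
        2 * Module.finrank K (sndPart y)) * g y := by
  have hq := q_ne_zero K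
  have h1 := (shearSpace e ψ).sub_mem (relB_mem (swap_relB_mem hg)) (swap_relB_mem (relB_mem hg))
  have h2 := mul_mem_shearSpace hg (fun a b =>
    (Fintype.card K : ℂ) ^ ((Module.finrank K A : ℤ) - Module.finrank K a +
        Module.finrank K b - Module.finrank K (LinearMap.range ψ)) *
      gauss (Fintype.card K) (Module.finrank K B + Module.finrank K (LinearMap.range ψ) -
        2 * Module.finrank K b))
  refine congrFun (shearSpace_ext he h1 h2 fun a b ha hb => ?_) y
  simp only [Pi.sub_apply]
  rw [fstPart_prod, sndPart_prod, relSum_relB_prod he (swap_relB_mem hg) ha hb,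
    relSum_swap_relB_prod, sum_cocovers_bot_eq he (relB_mem hg)]
  have e1 : ∑ b' ∈ covers ⊤ b, relSum (fun y z => relB z y) g (a.prod b') =
      ∑ b' ∈ covers ⊤ b, ∑ b'' ∈ cocovers (LinearMap.range ψ) b', g (a.prod b'') :=
    Finset.sum_congr rfl fun b' h => by rw [relSum_swap_relB_prod, sum_cocovers_bot_eq he hg]
  have e2 : ∑ b' ∈ cocovers (LinearMap.range ψ) b, relSum relB g (a.prod b') =
      (Fintype.card K : ℂ) ^ ((Module.finrank K A : ℤ) - Module.finrank K a) *
      ∑ b' ∈ cocovers (LinearMap.range ψ) b, ∑ b'' ∈ covers ⊤ b', g (a.prod b'') := by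
    rw [Finset.mul_sum]
    exact Finset.sum_congr rfl fun b' h => relSum_relB_prod he hg ha (mem_cocovers.1 h).1
  rw [e1, e2, ← mul_sub, sum_covers_cocovers_sub hb le_top (fun b => g (a.prod b)),
    gauss_sub_gauss hq, finrank_top, ← mul_assoc, ← mul_assoc, ← zpow_add₀ hq]
  have e3 : (Module.finrank K A : ℤ) - Module.finrank K a +
      (Module.finrank K b - Module.finrank K (LinearMap.range ψ)) =
      (Module.finrank K A : ℤ) - Module.finrank K a + Module.finrank K b -
        Module.finrank K (LinearMap.range ψ) := by ring
  have e4 : (Module.finrank K B : ℤ) - Module.finrank K b -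
      (Module.finrank K b - Module.finrank K (LinearMap.range ψ)) =
      Module.finrank K B + Module.finrank K (LinearMap.range ψ) - 2 * Module.finrank K b := by ring
  rw [e3, e4]

/-- The two operators act on different factors and interact only through weights: `relB` carries `q
^ (dim A - dim a)` and the transpose of `relA` carries `q ^ dim b`, while the other two carry none.
A factor `q` appears in this and the next three relations exactly when such a weight changes without
compensation. -/
theorem relB_relA (he : e ≠ 1) (hg : g ∈ shearSpace e ψ) :
    relSum relB (relSum relA g) = (Fintype.card K : ℂ) • relSum relA (relSum relB g) := by
  have hq := q_ne_zero K
  refine shearSpace_ext he (relB_mem (relA_mem hg))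
    ((shearSpace e ψ).smul_mem _ (relA_mem (relB_mem hg))) fun a b ha hb => ?_
  rw [Pi.smul_apply, relSum_relB_prod he (relA_mem hg) ha hb, relSum_relA_prod,
    sum_covers_top_eq he (relB_mem hg), Finset.smul_sum, Finset.mul_sum]
  simp only [relSum_relA_prod]
  simp only [sum_covers_top_eq he hg a, Finset.mul_sum]
  rw [Finset.sum_comm]
  refine Finset.sum_congr rfl fun a' ha' => ?_
  obtain ⟨h1, h2, h3⟩ := mem_covers.1 ha'
  rw [relSum_relB_prod he hg h2 hb, Finset.mul_sum, Finset.smul_sum]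
  refine Finset.sum_congr rfl fun b' hb' => ?_
  have e1 : (Module.finrank K A : ℤ) - Module.finrank K a =
    (Module.finrank K A : ℤ) - Module.finrank K a' + 1 := by rw [h3]; push_cast; ring
  rw [e1, zpow_add_one₀ hq, smul_eq_mul]
  ring

theorem relA_swap_relB (he : e ≠ 1) (hg : g ∈ shearSpace e ψ) :
    relSum relA (relSum (fun y z => relB z y) g) =
      relSum (fun y z => relB z y) (relSum relA g) := by
  refine shearSpace_ext he (relA_mem (swap_relB_mem hg)) (swap_relB_mem (relA_mem hg))
    fun a b ha hb => ?_
  simp only [relSum_relA_prod, relSum_swap_relB_prod]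
  rw [Finset.sum_comm]

theorem swap_relA_swap_relB (he : e ≠ 1) (hg : g ∈ shearSpace e ψ) :
    relSum (fun y z => relA z y) (relSum (fun y z => relB z y) g) =
      (Fintype.card K : ℂ) • relSum (fun y z => relB z y) (relSum (fun y z => relA z y) g) := by
  refine shearSpace_ext he (swap_relA_mem (swap_relB_mem hg))
    ((shearSpace e ψ).smul_mem _ (swap_relB_mem (swap_relA_mem hg))) fun a b ha hb => ?_
  rw [Pi.smul_apply, relSum_swap_relA_prod he (swap_relB_mem hg) b ha, relSum_swap_relB_prod]
  simp only [relSum_swap_relB_prod, relSum_swap_relA_prod he hg _ ha, Finset.mul_sum,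
    Finset.smul_sum]
  rw [Finset.sum_comm]
  refine Finset.sum_congr rfl fun b' hb' => ?_
  obtain ⟨h1, h2, h3⟩ := mem_cocovers.1 hb'
  refine Finset.sum_congr rfl fun a' ha' => ?_
  rw [← h3, pow_succ, smul_eq_mul]
  ring

/-- Here both weights change, and the two changes cancel. -/
theorem swap_relA_relB (he : e ≠ 1) (hg : g ∈ shearSpace e ψ) :
    relSum (fun y z => relA z y) (relSum relB g) =
      relSum relB (relSum (fun y z => relA z y) g) := by
  have hq := q_ne_zero K
  refine shearSpace_ext he (swap_relA_mem (relB_mem hg)) (relB_mem (swap_relA_mem hg))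
    fun a b ha hb => ?_
  rw [relSum_swap_relA_prod he (relB_mem hg) b ha, relSum_relB_prod he (swap_relA_mem hg) ha hb]
  simp only [relSum_swap_relA_prod he hg _ ha, Finset.mul_sum]
  rw [Finset.sum_comm]
  refine Finset.sum_congr rfl fun a' ha' => ?_
  obtain ⟨h1, h2, h3⟩ := mem_cocovers.1 ha'
  rw [relSum_relB_prod he hg (h2.trans ha) hb, Finset.mul_sum, Finset.mul_sum]
  refine Finset.sum_congr rfl fun b' hb' => ?_
  obtain ⟨h4, h5, h6⟩ := mem_covers.1 hb'
  have e1 : (Module.finrank K A : ℤ) - Module.finrank K a' =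
    (Module.finrank K A : ℤ) - Module.finrank K a + 1 := by rw [← h3]; push_cast; ring
  rw [e1, zpow_add_one₀ hq, h6, pow_succ]
  ring

/-- Functions supported on the subspaces with given dimensions of the two parts. -/
def dimSpace (K A B : Type*) [Field K] [AddCommGroup A] [Module K A] [AddCommGroup B] [Module K B]
    (i j : ℕ) : Submodule ℂ (Submodule K (A × B) → ℂ) where
  carrier := {g | ∀ y, ¬ (Module.finrank K (fstPart y) = i ∧ Module.finrank K (sndPart y) = j) →
    g y = 0}
  add_mem' h1 h2 y hy := by simp [h1 y hy, h2 y hy]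
  zero_mem' y _ := rfl
  smul_mem' c g h y hy := by simp [h y hy]

/-- The shear straightening a subspace is a choice; this makes the extension `shearExtend`
independent of it. -/
theorem char_trace_eq_of_shear_eq {a : Submodule K A} {b : Submodule K B} {φ φ' : B →ₗ[K] A}
    (ha : a ≤ LinearMap.ker ψ) (hb : LinearMap.range ψ ≤ b)
    (h : shear φ (a.prod b) = shear φ' (a.prod b)) :
    LinearMap.trace K B (ψ ∘ₗ φ) = LinearMap.trace K B (ψ ∘ₗ φ') := by
  rw [← sub_eq_zero, ← map_sub, ← LinearMap.comp_sub]
  refine trace_comp_eq_zero fun u => ?_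
  have h1 : (φ (ψ u), ψ u) ∈ shear φ (a.prod b) := by
    rw [mem_shear]
    exact ⟨by simp, hb ⟨u, rfl⟩⟩
  rw [h, mem_shear] at h1
  exact ha h1.1

open Classical in
/-- The extension of a function of the two parts to an element of `shearSpace`. -/
noncomputable def shearExtend (e : AddChar K ℂ) (ψ : A →ₗ[K] B)
    (h : Submodule K A → Submodule K B → ℂ) (y : Submodule K (A × B)) : ℂ :=
  if fstPart y ≤ LinearMap.ker ψ ∧ LinearMap.range ψ ≤ sndPart y then
    e (-LinearMap.trace K B (ψ ∘ₗ (exists_eq_shear y).choose)) * h (fstPart y) (sndPart y)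
  else 0

theorem shearExtend_shear_prod {a : Submodule K A} {b : Submodule K B}
    (h : Submodule K A → Submodule K B → ℂ) (φ : B →ₗ[K] A)
    (ha : a ≤ LinearMap.ker ψ) (hb : LinearMap.range ψ ≤ b) :
    shearExtend e ψ h (shear φ (a.prod b)) = e (-LinearMap.trace K B (ψ ∘ₗ φ)) * h a b := by
  have h1 := (exists_eq_shear (shear φ (a.prod b))).choose_spec
  rw [shearExtend]
  generalize (exists_eq_shear (shear φ (a.prod b))).choose = φ' at h1
  rw [fstPart_shear, sndPart_shear, fstPart_prod, sndPart_prod] at h1 ⊢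
  rw [if_pos ⟨ha, hb⟩, char_trace_eq_of_shear_eq ha hb h1]

theorem shearExtend_mem (h : Submodule K A → Submodule K B → ℂ) :
    shearExtend e ψ h ∈ shearSpace e ψ := by
  intro σ y
  by_cases hy : fstPart y ≤ LinearMap.ker ψ ∧ LinearMap.range ψ ≤ sndPart y
  · obtain ⟨φ, hφ⟩ := exists_eq_shear y
    rw [hφ, shear_shear, shearExtend_shear_prod h _ hy.1 hy.2,
      shearExtend_shear_prod h _ hy.1 hy.2, LinearMap.comp_add, map_add, neg_add_rev,
      AddChar.map_add_eq_mul, mul_assoc]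
  · rw [shearExtend, shearExtend, if_neg hy, if_neg (by rwa [fstPart_shear, sndPart_shear])]
    simp

/-- Evaluation at products identifies the space with the functions on pairs formed from a level of
`[⊥, ker ψ]` and a level of `[range ψ, ⊤]`. Injectivity is `shearSpace_ext`, surjectivity is
`shearExtend`. -/
theorem finrank_shearSpace_inf_dimSpace (he : e ≠ 1) (i j : ℕ) {n ρ N : ℕ}
    (hn : Module.finrank K A = n) (hρ : Module.finrank K (LinearMap.range ψ) = ρ)
    (hN : Module.finrank K B = N) :
    (Module.finrank ℂ ↥(shearSpace e ψ ⊓ dimSpace K A B i (ρ + j)) : ℂ) =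
      gbinom (Fintype.card K) (n - ρ) i * gbinom (Fintype.card K) (N - ρ) j := by
  classical
  have hk := ψ.finrank_range_add_finrank_ker
  have hr := Submodule.finrank_le (LinearMap.range ψ)
  let I := {a // a ∈ level ⊥ (LinearMap.ker ψ) i}
  let J := {b // b ∈ level (LinearMap.range ψ) ⊤ j}
  let E : ↥(shearSpace e ψ ⊓ dimSpace K A B i (ρ + j)) →ₗ[ℂ] (I × J → ℂ) :=
    { toFun := fun g p => g.1 (p.1.1.prod p.2.1)
      map_add' := fun _ _ => rfl
      map_smul' := fun _ _ => rfl }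
  have hinj : Function.Injective E := by
    rw [← LinearMap.ker_eq_bot, LinearMap.ker_eq_bot']
    rintro ⟨g, hg, hd⟩ hE
    refine Subtype.ext (shearSpace_ext he hg (shearSpace e ψ).zero_mem fun a b ha hb => ?_)
    by_cases hab : Module.finrank K a = i ∧ Module.finrank K b = ρ + j
    · exact congrFun hE (⟨a, mem_level.2 ⟨bot_le, ha, by simp [hab.1]⟩⟩,
        ⟨b, mem_level.2 ⟨hb, le_top, by rw [hρ]; exact hab.2⟩⟩)
    · exact hd _ (by rwa [fstPart_prod, sndPart_prod])
  have hsurj : Function.Surjective E := by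
    intro h
    let h' : Submodule K A → Submodule K B → ℂ := fun a b =>
      if H : a ∈ level ⊥ (LinearMap.ker ψ) i ∧ b ∈ level (LinearMap.range ψ) ⊤ j
      then h (⟨a, H.1⟩, ⟨b, H.2⟩) else 0
    refine ⟨⟨shearExtend e ψ h', shearExtend_mem h', fun y hy => ?_⟩, ?_⟩
    · rw [shearExtend]
      split_ifs with h1
      · have : h' (fstPart y) (sndPart y) = 0 := by
          apply dif_neg
          rw [mem_level, mem_level, finrank_bot, zero_add, hρ]
          rintro ⟨⟨-, -, h2⟩, -, -, h3⟩
          exact hy ⟨h2, h3⟩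
        rw [this, mul_zero]
      · rfl
    · ext ⟨⟨a, ha⟩, ⟨b, hb⟩⟩
      change shearExtend e ψ h' (a.prod b) = _
      have h1 := shearExtend_shear_prod (e := e) h' 0 (mem_level.1 ha).2.1 (mem_level.1 hb).1
      rw [shear_zero] at h1
      rw [h1]
      simp [h', ha, hb]
  rw [(LinearEquiv.ofBijective E ⟨hinj, hsurj⟩).finrank_eq, Module.finrank_fintype_fun_eq_card,
    Fintype.card_prod, Fintype.card_coe, Fintype.card_coe, Nat.cast_mul,
    card_level bot_le (m := n - ρ) (by rw [finrank_bot]; omega),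
    card_level le_top (m := N - ρ) (by rw [finrank_top]; omega)]

end Fourier
end TwistedGrassmann

namespace TwistedGrassmann

/-! ### Projections onto the character spaces -/

section Projection

variable {K A B : Type*} [Field K] [Fintype K] [AddCommGroup A] [Module K A]
  [FiniteDimensional K A] [AddCommGroup B] [Module K B] [FiniteDimensional K B]
  {e : AddChar K ℂ}

theorem trace_comp_comm' (ψ : A →ₗ[K] B) (φ : B →ₗ[K] A) :
    LinearMap.trace K B (ψ ∘ₗ φ) = LinearMap.trace K A (φ ∘ₗ ψ) :=
  LinearMap.trace_comp_comm' φ ψ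

/-- The sum of the character `φ ↦ e (tr (ψ φ))`. -/
theorem sum_char_trace [Fintype (B →ₗ[K] A)] (he : e ≠ 1) {ψ : A →ₗ[K] B} (hψ : ψ ≠ 0) :
    ∑ φ : B →ₗ[K] A, e (LinearMap.trace K B (ψ ∘ₗ φ)) = 0 := by
  let χ : AddChar (B →ₗ[K] A) ℂ := e.compAddMonoidHom
    { toFun := fun φ => LinearMap.trace K B (ψ ∘ₗ φ)
      map_zero' := by simp
      map_add' := fun a b => by rw [LinearMap.comp_add, map_add] }
  have h : χ ≠ 0 := by
    obtain ⟨u, hu⟩ : ∃ u, ψ u ≠ 0 := by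
      by_contra! h; exact hψ (LinearMap.ext h)
    obtain ⟨c, hc, -⟩ := (⊥ : Submodule K B).exists_le_ker_of_notMem (v := ψ u) (by simpa using hu)
    obtain ⟨s, hs⟩ := exists_scale he hc
    intro h
    have h1 : χ ((-(s • c)).smulRight u) = 1 := by rw [h]; rfl
    have h2 : χ ((-(s • c)).smulRight u) = e (-(s * c (ψ u))) := by
      change e (LinearMap.trace K B (ψ ∘ₗ _)) = _
      rw [trace_comp_smulRight]; simp
    exact hs (h2.symm.trans h1)
  classical
  exact (AddChar.sum_eq_ite χ).trans (if_neg h)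

theorem sum_char_trace' [Fintype (A →ₗ[K] B)] (he : e ≠ 1) {φ : B →ₗ[K] A} (hφ : φ ≠ 0) :
    ∑ ψ : A →ₗ[K] B, e (LinearMap.trace K B (ψ ∘ₗ φ)) = 0 := by
  rw [Finset.sum_congr rfl fun ψ _ => congrArg e (trace_comp_comm' ψ φ)]
  exact sum_char_trace he hφ

variable [Fintype (B →ₗ[K] A)]

/-- The projection to `shearSpace e ψ`. -/
noncomputable def shearProj (e : AddChar K ℂ) (ψ : A →ₗ[K] B) :
    (Submodule K (A × B) → ℂ) →ₗ[ℂ] (Submodule K (A × B) → ℂ) where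
  toFun g y := (Fintype.card (B →ₗ[K] A) : ℂ)⁻¹ *
    ∑ φ : B →ₗ[K] A, e (LinearMap.trace K B (ψ ∘ₗ φ)) * g (shear φ y)
  map_add' g h := by
    ext y; simp only [Pi.add_apply, mul_add, Finset.sum_add_distrib]
  map_smul' c g := by
    ext y
    simp only [Pi.smul_apply, smul_eq_mul, RingHom.id_apply, mul_left_comm _ c, Finset.mul_sum]

theorem shearProj_apply (ψ : A →ₗ[K] B) (g : Submodule K (A × B) → ℂ) (y) :
    shearProj e ψ g y = (Fintype.card (B →ₗ[K] A) : ℂ)⁻¹ *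
      ∑ φ : B →ₗ[K] A, e (LinearMap.trace K B (ψ ∘ₗ φ)) * g (shear φ y) := rfl

variable [Fintype (Submodule K (A × B))]

theorem shearProj_mem (ψ : A →ₗ[K] B) (g : Submodule K (A × B) → ℂ) :
    shearProj e ψ g ∈ shearSpace e ψ := by
  intro σ y
  rw [shearProj_apply, shearProj_apply, mul_left_comm]
  congr 1
  rw [Finset.mul_sum]
  refine Fintype.sum_equiv (Equiv.addRight σ) _ _ fun φ => ?_
  rw [Equiv.coe_addRight, shear_shear, add_comm σ φ, LinearMap.comp_add, map_add, ← mul_assoc,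
    ← AddChar.map_add_eq_mul, neg_add_cancel_comm_assoc]

theorem shearProj_of_mem {ψ : A →ₗ[K] B} {g : Submodule K (A × B) → ℂ}
    (hg : g ∈ shearSpace e ψ) : shearProj e ψ g = g := by
  ext y
  have h : ∀ φ : B →ₗ[K] A, e (LinearMap.trace K B (ψ ∘ₗ φ)) * g (shear φ y) = g y := fun φ => by
    rw [hg, ← mul_assoc, ← AddChar.map_add_eq_mul, add_neg_cancel, AddChar.map_zero_eq_one,
      one_mul]
  rw [shearProj_apply, Finset.sum_congr rfl fun φ _ => h φ, Finset.sum_const, Finset.card_univ,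
    nsmul_eq_mul, ← mul_assoc, inv_mul_cancel₀ (by exact_mod_cast Fintype.card_ne_zero), one_mul]

/-- Averaging against the wrong character leaves the sum of the nontrivial character attached to `ψ
- ψ'`, which is zero. -/
theorem shearProj_of_ne (he : e ≠ 1) {ψ ψ' : A →ₗ[K] B} (hne : ψ ≠ ψ')
    {g : Submodule K (A × B) → ℂ} (hg : g ∈ shearSpace e ψ') : shearProj e ψ g = 0 := by
  ext y
  have h : ∀ φ : B →ₗ[K] A, e (LinearMap.trace K B (ψ ∘ₗ φ)) * g (shear φ y) =
      e (LinearMap.trace K B ((ψ - ψ') ∘ₗ φ)) * g y := fun φ => by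
    rw [hg, ← mul_assoc, ← AddChar.map_add_eq_mul, LinearMap.sub_comp, map_sub, sub_eq_add_neg]
  rw [shearProj_apply, Finset.sum_congr rfl fun φ _ => h φ, ← Finset.sum_mul,
    sum_char_trace he (sub_ne_zero.2 hne), zero_mul, mul_zero]
  rfl

/-- Summing the characters over all `ψ` kills every shear except the trivial one. The number of `ψ`
equals the number of shears, which cancels the normalization. -/
theorem sum_shearProj [Fintype (A →ₗ[K] B)] (he : e ≠ 1) (g : Submodule K (A × B) → ℂ) :
    ∑ ψ : A →ₗ[K] B, shearProj e ψ g = g := by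
  ext y
  have hcard : Fintype.card (A →ₗ[K] B) = Fintype.card (B →ₗ[K] A) := by
    rw [Module.card_eq_pow_finrank (K := K) (V := A →ₗ[K] B),
      Module.card_eq_pow_finrank (K := K) (V := B →ₗ[K] A), Module.finrank_linearMap,
      Module.finrank_linearMap, mul_comm]
  rw [Finset.sum_apply]
  simp only [shearProj_apply]
  rw [← Finset.mul_sum, Finset.sum_comm]
  simp only [← Finset.sum_mul]
  rw [Finset.sum_eq_single 0]
  · simp only [LinearMap.comp_zero, map_zero, AddChar.map_zero_eq_one, Finset.sum_const,
      Finset.card_univ, nsmul_one, shear_zero, hcard]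
    rw [← mul_assoc, inv_mul_cancel₀ (by exact_mod_cast Fintype.card_ne_zero), one_mul]
  · intro φ _ hφ
    rw [sum_char_trace' he hφ, zero_mul]
  · simp

end Projection

/-! ### Transfer from `A × B` to the subspaces of `H` -/

section Transfer

variable {K : Type*} [Field K] {D : ℕ}

/-- `y` is obtained from `z` by lowering the three coordinates by `a`, `b`, `c`. -/
def lowRel (x H : Subsp K D) (a b c : ℕ) (y z : Subsp K D) : Prop :=
  y ≤ z ∧ Module.finrank K ↥(x ⊓ z) = Module.finrank K ↥(x ⊓ y) + a ∧
    Module.finrank K ↥(H ⊓ z) = Module.finrank K ↥(H ⊓ y) + a + b ∧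
    Module.finrank K ↥z = Module.finrank K ↥y + a + b + c

theorem mem_cell {x H : Subsp K D} {i j k : ℤ} {y : Subsp K D} :
    y ∈ cell x H i j k ↔ (Module.finrank K ↥(x ⊓ y) : ℤ) = i ∧
      (Module.finrank K ↥(H ⊓ y) : ℤ) = i + j ∧ (Module.finrank K ↥y : ℤ) = i + j + k := Iff.rfl

theorem lowRel_iff {x H : Subsp K D} (a b c : ℕ) (y z : Subsp K D) :
    lowRel x H a b c y z ↔
      ∃ i j k : ℤ, z ∈ cell x H i j k ∧ y ∈ cell x H (i - a) (j - b) (k - c) ∧ y ≤ z := by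
  simp only [mem_cell, lowRel]
  constructor
  · rintro ⟨h1, h2, h3, h4⟩
    refine ⟨_, Module.finrank K ↥(H ⊓ z) - Module.finrank K ↥(x ⊓ z),
      Module.finrank K ↥z - Module.finrank K ↥(H ⊓ z), ⟨rfl, ?_, ?_⟩, ⟨?_, ?_, ?_⟩, h1⟩ <;> omega
  · rintro ⟨i, j, k, ⟨h1, h2, h3⟩, ⟨h4, h5, h6⟩, h7⟩
    refine ⟨h7, ?_, ?_, ?_⟩ <;> omega

theorem lowRel_iff' {x H : Subsp K D} (a b c : ℕ) (y z : Subsp K D) :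
    lowRel x H a b c z y ↔
      ∃ i j k : ℤ, z ∈ cell x H i j k ∧ y ∈ cell x H (i + a) (j + b) (k + c) ∧ z ≤ y := by
  rw [lowRel_iff]
  constructor
  · rintro ⟨i, j, k, h1, h2, h3⟩
    exact ⟨_, _, _, h2, by simpa using h1, h3⟩
  · rintro ⟨i, j, k, h1, h2, h3⟩
    exact ⟨_, _, _, h2, by simpa using h1, h3⟩

variable [Fintype K]

theorem lowering_mulVec (x H : Subsp K D) (a b c : ℕ) (f : Subsp K D → ℂ) :
    lowering x H a b c *ᵥ f = relSum (lowRel x H a b c) f := by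
  classical
  ext y
  rw [relSum_apply, Finset.sum_filter, Matrix.mulVec, dotProduct]
  refine Finset.sum_congr rfl fun z _ => ?_
  rw [lowering, Matrix.of_apply, ite_mul, one_mul, zero_mul]
  exact if_congr (lowRel_iff a b c y z).symm rfl rfl

theorem raising_mulVec (x H : Subsp K D) (a b c : ℕ) (f : Subsp K D → ℂ) :
    raising x H a b c *ᵥ f = relSum (fun y z => lowRel x H a b c z y) f := by
  classical
  ext y
  rw [relSum_apply, Finset.sum_filter, Matrix.mulVec, dotProduct]
  refine Finset.sum_congr rfl fun z _ => ?_
  rw [raising, Matrix.of_apply, ite_mul, one_mul, zero_mul]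
  exact if_congr (lowRel_iff' a b c y z).symm rfl rfl

theorem L₁_mulVec (x H : Subsp K D) (f : Subsp K D → ℂ) :
    L₁ x H *ᵥ f = relSum (lowRel x H 1 0 0) f := by
  simpa [L₁] using lowering_mulVec x H 1 0 0 f

theorem L₂_mulVec (x H : Subsp K D) (f : Subsp K D → ℂ) :
    L₂ x H *ᵥ f = relSum (lowRel x H 0 1 0) f := by
  simpa [L₂] using lowering_mulVec x H 0 1 0 f

theorem L₃_mulVec (x H : Subsp K D) (f : Subsp K D → ℂ) :
    L₃ x H *ᵥ f = relSum (lowRel x H 0 0 1) f := by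
  simpa [L₃] using lowering_mulVec x H 0 0 1 f

theorem R₁_mulVec (x H : Subsp K D) (f : Subsp K D → ℂ) :
    R₁ x H *ᵥ f = relSum (fun y z => lowRel x H 1 0 0 z y) f := by
  simpa [R₁] using raising_mulVec x H 1 0 0 f

theorem R₂_mulVec (x H : Subsp K D) (f : Subsp K D → ℂ) :
    R₂ x H *ᵥ f = relSum (fun y z => lowRel x H 0 1 0 z y) f := by
  simpa [R₂] using raising_mulVec x H 0 1 0 f

theorem R₃_mulVec (x H : Subsp K D) (f : Subsp K D → ℂ) :
    R₃ x H *ᵥ f = relSum (fun y z => lowRel x H 0 0 1 z y) f := by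
  simpa [R₃] using raising_mulVec x H 0 0 1 f

variable {A B : Type*} [AddCommGroup A] [Module K A]
  [FiniteDimensional K A] [AddCommGroup B] [Module K B] [FiniteDimensional K B]
  (ι : (A × B) →ₗ[K] (Fin (2 * D + 1) → K)) {x H : Subsp K D}

open Classical in
/-- The extension by zero of a function on the subspaces of `H`, identified with `A × B`. -/
noncomputable def extendH (H : Subsp K D) :
    (Submodule K (A × B) → ℂ) →ₗ[ℂ] (Subsp K D → ℂ) where
  toFun g z := if z ≤ H then g (z.comap ι) else 0
  map_add' g h := by ext z; simp only [Pi.add_apply]; split_ifs <;> simp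
  map_smul' c g := by ext z; simp only [Pi.smul_apply, RingHom.id_apply]; split_ifs <;> simp

/-- The restriction of a function to the subspaces of `H`, identified with `A × B`. -/
noncomputable def restrictH :
    (Subsp K D → ℂ) →ₗ[ℂ] (Submodule K (A × B) → ℂ) where
  toFun f y := f (y.map ι)
  map_add' _ _ := rfl
  map_smul' _ _ := rfl

variable {ι}

theorem extendH_of_not_le (g : Submodule K (A × B) → ℂ) {z : Subsp K D} (hz : ¬ z ≤ H) :
    extendH ι H g z = 0 := if_neg hz

theorem extendH_map (hι : Function.Injective ι) (hH : LinearMap.range ι = H)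
    (g : Submodule K (A × B) → ℂ) (y : Submodule K (A × B)) :
    extendH ι H g (y.map ι) = g y := by
  have h : y.map ι ≤ H := hH ▸ LinearMap.map_le_range
  rw [extendH, LinearMap.coe_mk, AddHom.coe_mk, if_pos h, Submodule.comap_map_eq_of_injective hι]

theorem map_comap_of_le (hH : LinearMap.range ι = H) {z : Subsp K D} (hz : z ≤ H) :
    (z.comap ι).map ι = z := by
  rw [Submodule.map_comap_eq, hH, inf_eq_right.2 hz]

theorem restrictH_extendH (hι : Function.Injective ι) (hH : LinearMap.range ι = H)
    (g : Submodule K (A × B) → ℂ) : restrictH ι (extendH ι H g) = g :=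
  funext fun y => extendH_map hι hH g y

theorem extendH_restrictH (hH : LinearMap.range ι = H) {f : Subsp K D → ℂ}
    (hf : ∀ z, ¬ z ≤ H → f z = 0) : extendH ι H (restrictH ι f) = f := by
  ext z
  by_cases hz : z ≤ H
  · rw [extendH, LinearMap.coe_mk, AddHom.coe_mk, if_pos hz]
    change f _ = _
    rw [map_comap_of_le hH hz]
  · rw [extendH_of_not_le _ hz, hf z hz]

/-- Condition `h2` prevents the operator from producing values at subspaces outside `H`, so it
commutes with extension by zero. -/
theorem relSum_extendH [Fintype (Submodule K (A × B))]
    (hι : Function.Injective ι) (hH : LinearMap.range ι = H)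
    {R : Subsp K D → Subsp K D → Prop} {r : Submodule K (A × B) → Submodule K (A × B) → Prop}
    (h1 : ∀ y z, R (y.map ι) (z.map ι) ↔ r y z) (h2 : ∀ y z, z ≤ H → R y z → y ≤ H)
    (g : Submodule K (A × B) → ℂ) :
    relSum R (extendH ι H g) = extendH ι H (relSum r g) := by
  classical
  ext y
  by_cases hy : y ≤ H
  · rw [← map_comap_of_le hH hy, extendH_map hι hH, relSum_apply, relSum_apply]
    symm
    refine Finset.sum_of_injOn (fun z => z.map ι) ?_ ?_ ?_ ?_
    · intro z _ z' _ h
      exact Submodule.map_injective_of_injective hι h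
    · intro z hz
      simp only [Finset.coe_filter, Finset.mem_univ, true_and, Set.mem_ofPred_eq] at hz ⊢
      exact (h1 _ _).2 hz
    · intro z hz hz'
      apply extendH_of_not_le
      intro hzH
      apply hz'
      refine ⟨z.comap ι, ?_, map_comap_of_le hH hzH⟩
      simp only [Finset.coe_filter, Finset.mem_filter, Finset.mem_univ, true_and,
        Set.mem_ofPred_eq] at hz ⊢
      rwa [← h1, map_comap_of_le hH hzH]
    · intro z _
      exact (extendH_map hι hH g z).symm
  · rw [extendH_of_not_le _ hy, relSum_apply]
    refine Finset.sum_eq_zero fun z hz => extendH_of_not_le _ fun hzH => hy ?_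
    exact h2 y z hzH (Finset.mem_filter.1 hz).2

theorem finrank_inf_map_fst (hι : Function.Injective ι)
    (hx : LinearMap.range (ι ∘ₗ LinearMap.inl K A B) = x) (y : Submodule K (A × B)) :
    Module.finrank K ↥(x ⊓ y.map ι) = Module.finrank K (fstPart y) := by
  have h : x ⊓ y.map ι = (fstPart y).map (ι ∘ₗ LinearMap.inl K A B) := by
    ext v
    simp only [Submodule.mem_inf, ← hx, LinearMap.mem_range, Submodule.mem_map, mem_fstPart,
      LinearMap.comp_apply, LinearMap.inl_apply]
    constructor
    · rintro ⟨⟨u, rfl⟩, p, hp, hpu⟩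
      exact ⟨u, by rwa [← hι hpu], rfl⟩
    · rintro ⟨u, hu, rfl⟩
      exact ⟨⟨u, rfl⟩, _, hu, rfl⟩
  rw [h]
  have hinj : Function.Injective (ι ∘ₗ LinearMap.inl K A B) := by
    rw [LinearMap.coe_comp]; exact hι.comp LinearMap.inl_injective
  exact (Submodule.equivMapOfInjective _ hinj _).finrank_eq.symm

theorem finrank_map_of_injective (hι : Function.Injective ι) (y : Submodule K (A × B)) :
    Module.finrank K ↥(y.map ι) = Module.finrank K (fstPart y) + Module.finrank K (sndPart y) := by
  rw [← finrank_eq_add]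
  exact (Submodule.equivMapOfInjective _ hι _).finrank_eq.symm

theorem map_mem_cell (hι : Function.Injective ι) (hH : LinearMap.range ι = H)
    (hx : LinearMap.range (ι ∘ₗ LinearMap.inl K A B) = x) (y : Submodule K (A × B)) (i j : ℤ) :
    y.map ι ∈ cell x H i j 0 ↔ (Module.finrank K (fstPart y) : ℤ) = i ∧
      (Module.finrank K (sndPart y) : ℤ) = j := by
  have h : y.map ι ≤ H := hH ▸ LinearMap.map_le_range
  rw [mem_cell, inf_eq_right.2 h, finrank_inf_map_fst hι hx, finrank_map_of_injective hι]
  push_cast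
  constructor
  · rintro ⟨h1, h2, -⟩; exact ⟨h1, by omega⟩
  · rintro ⟨h1, h2⟩; refine ⟨h1, ?_, ?_⟩ <;> omega

theorem lowRel_map_iff (hι : Function.Injective ι) (hH : LinearMap.range ι = H)
    (hx : LinearMap.range (ι ∘ₗ LinearMap.inl K A B) = x) (a b : ℕ) (y z : Submodule K (A × B)) :
    lowRel x H a b 0 (y.map ι) (z.map ι) ↔ y ≤ z ∧
      Module.finrank K (fstPart z) = Module.finrank K (fstPart y) + a ∧
      Module.finrank K (sndPart z) = Module.finrank K (sndPart y) + b := by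
  have h : ∀ y : Submodule K (A × B), y.map ι ≤ H := fun y => hH ▸ LinearMap.map_le_range
  rw [lowRel, inf_eq_right.2 (h y), inf_eq_right.2 (h z), finrank_inf_map_fst hι hx,
    finrank_inf_map_fst hι hx, finrank_map_of_injective hι, finrank_map_of_injective hι,
    Submodule.map_le_map_iff_of_injective hι]
  constructor
  · rintro ⟨h1, h2, h3, -⟩; exact ⟨h1, h2, by omega⟩
  · rintro ⟨h1, h2, h3⟩; exact ⟨h1, h2, by omega, by omega⟩

/-- When the third coordinate does not change, neither does the codimension of `H ⊓ z` in `z`, so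
lying in `H` is inherited upwards. -/
theorem le_of_lowRel {a b : ℕ} {y z : Subsp K D} (hz : z ≤ H) (h : lowRel x H a b 0 z y) :
    y ≤ H := by
  obtain ⟨-, -, h1, h2⟩ := h
  rw [inf_eq_right.2 hz] at h1
  have h3 : H ⊓ y = y := Submodule.eq_of_le_of_finrank_eq inf_le_right (by omega)
  rw [← h3]; exact inf_le_left

end Transfer
end TwistedGrassmann

/-! ### The decomposition of the functions on the subspaces of `H` -/

namespace TwistedGrassmann

universe u

variable {K : Type u} [Field K] [Fintype K] {D : ℕ}

/-- The functions supported on a cell. -/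
def cellSpace (x H : Subsp K D) (i j k : ℤ) : Submodule ℂ (Subsp K D → ℂ) where
  carrier := {f | ∀ y, y ∉ cell x H i j k → f y = 0}
  add_mem' h1 h2 y hy := by simp [h1 y hy, h2 y hy]
  zero_mem' y _ := rfl
  smul_mem' c g h y hy := by simp [h y hy]

theorem cellIdem_mulVec (x H : Subsp K D) (i j k : ℤ) (f : Subsp K D → ℂ) :
    cellIdem x H i j k *ᵥ f = (cell x H i j k).indicator f := by
  classical
  ext y
  rw [cellIdem, Matrix.mulVec_diagonal, Set.indicator_apply, Set.indicator_apply]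
  split_ifs <;> simp

/-- The decomposition of the functions on the subspaces of `H` under the lowering and raising
matrices. -/
structure FlagDecomposition (x H : Subsp K D) where
  /-- the index set of the summands -/
  idx : Type u
  [fintypeIdx : Fintype idx]
  /-- the index (rank) of a summand -/
  rk : idx → ℕ
  /-- the summands -/
  I : idx → Submodule ℂ (Subsp K D → ℂ)
  /-- the projections to the summands -/
  proj : idx → (Subsp K D → ℂ) →ₗ[ℂ] (Subsp K D → ℂ)
  cut : ∀ s, ∀ f ∈ I s, ∀ i j : ℤ, (cell x H i j 0).indicator f ∈ I s
  L₁_mem : ∀ s, ∀ f ∈ I s, L₁ x H *ᵥ f ∈ I s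
  L₂_mem : ∀ s, ∀ f ∈ I s, L₂ x H *ᵥ f ∈ I s
  R₁_mem : ∀ s, ∀ f ∈ I s, R₁ x H *ᵥ f ∈ I s
  R₂_mem : ∀ s, ∀ f ∈ I s, R₂ x H *ᵥ f ∈ I s
  -- The constants of the two commutators are governed by the lengths `D - 1 - rk s` and `D + 1 - rk
  -- s` of the lattices `[0, ker ψ]` and `[range ψ, B]`; the second coordinate starts at `rk s`
  -- rather than at `0`.
  comm₁ : ∀ s, ∀ f ∈ I s, ∀ i j : ℤ, f ∈ cellSpace x H i j 0 →
    L₁ x H *ᵥ (R₁ x H *ᵥ f) - R₁ x H *ᵥ (L₁ x H *ᵥ f) =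
      ((Fintype.card K : ℂ) ^ (i + j) * gauss (Fintype.card K) (D - 1 - rk s - 2 * i)) • f
  comm₂ : ∀ s, ∀ f ∈ I s, ∀ i j : ℤ, f ∈ cellSpace x H i j 0 →
    L₂ x H *ᵥ (R₂ x H *ᵥ f) - R₂ x H *ᵥ (L₂ x H *ᵥ f) =
      ((Fintype.card K : ℂ) ^ (D - 1 - i + j - rk s) *
        gauss (Fintype.card K) (D + 1 + rk s - 2 * j)) • f
  L₂_L₁ : ∀ s, ∀ f ∈ I s, L₂ x H *ᵥ (L₁ x H *ᵥ f) =
    (Fintype.card K : ℂ) • (L₁ x H *ᵥ (L₂ x H *ᵥ f))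
  L₁_R₂ : ∀ s, ∀ f ∈ I s, L₁ x H *ᵥ (R₂ x H *ᵥ f) = R₂ x H *ᵥ (L₁ x H *ᵥ f)
  R₁_R₂ : ∀ s, ∀ f ∈ I s, R₁ x H *ᵥ (R₂ x H *ᵥ f) =
    (Fintype.card K : ℂ) • (R₂ x H *ᵥ (R₁ x H *ᵥ f))
  R₁_L₂ : ∀ s, ∀ f ∈ I s, R₁ x H *ᵥ (L₂ x H *ᵥ f) = L₂ x H *ᵥ (R₁ x H *ᵥ f)
  proj_mem : ∀ s f, proj s f ∈ I s
  sum_proj : ∀ f : Subsp K D → ℂ, (∀ y, ¬ y ≤ H → f y = 0) → ∑ s, proj s f = f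
  proj_of_mem : ∀ s, ∀ f ∈ I s, proj s f = f
  proj_of_ne : ∀ s t, s ≠ t → ∀ f ∈ I t, proj s f = 0
  eq_zero_of_lt : ∀ s, ∀ f ∈ I s, ∀ i j : ℤ, f ∈ cellSpace x H i j 0 → j < rk s → f = 0
  finrank : ∀ s, ∀ i j : ℕ, (Module.finrank ℂ ↥(I s ⊓ cellSpace x H i (rk s + j) 0) : ℂ) =
    gbinom (Fintype.card K) (D - 1 - rk s) i * gbinom (Fintype.card K) (D + 1 - rk s) j
  card : ∀ ρ : ℕ, ρ + 1 ≤ D → (Nat.card {s // rk s = ρ} : ℂ) =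
    gbinom (Fintype.card K) (D - 1) ρ *
      ∏ l ∈ Finset.range ρ, ((Fintype.card K : ℂ) ^ (D + 1) - (Fintype.card K : ℂ) ^ l)

theorem exists_addChar_ne_one (K : Type u) [Field K] [Fintype K] : ∃ e : AddChar K ℂ, e ≠ 1 := by
  have : ∃ e : AddChar K ℂ, e 1 ≠ 1 := AddChar.exists_apply_ne_zero.2 one_ne_zero
  obtain ⟨e, he⟩ := this
  exact ⟨e, fun h => he (by rw [h]; rfl)⟩

/-- The summands are indexed by the maps `ψ : A → B`: the summand of `ψ` is its character space,
extended by zero, and its rank is the rank of `ψ`. -/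
theorem nonempty_flagDecomposition_of_prod {A B : Type u} [AddCommGroup A] [Module K A]
    [FiniteDimensional K A] [AddCommGroup B] [Module K B] [FiniteDimensional K B] {x H : Subsp K D}
    (hD : 1 ≤ D) (ι : (A × B) →ₗ[K] (Fin (2 * D + 1) → K)) (hι : Function.Injective ι)
    (hιH : LinearMap.range ι = H) (hιx : LinearMap.range (ι ∘ₗ LinearMap.inl K A B) = x)
    (hA : Module.finrank K A = D - 1) (hB : Module.finrank K B = D + 1) :
    Nonempty (FlagDecomposition x H) := by
  classical
  have : Finite A := Module.finite_of_finite K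
  have : Finite B := Module.finite_of_finite K
  have : Fintype (Submodule K A) := Fintype.ofFinite _
  have : Fintype (Submodule K B) := Fintype.ofFinite _
  have : Fintype (Submodule K (A × B)) := Fintype.ofFinite _
  have : Finite (A →ₗ[K] B) := Module.finite_of_finite K
  have : Finite (B →ₗ[K] A) := Module.finite_of_finite K
  have : Fintype (A →ₗ[K] B) := Fintype.ofFinite _
  have : Fintype (B →ₗ[K] A) := Fintype.ofFinite _
  obtain ⟨e, he⟩ := exists_addChar_ne_one K
  have rl₁ : ∀ g : Submodule K (A × B) → ℂ, L₁ x H *ᵥ extendH ι H g =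
      extendH ι H (relSum relA g) := fun g => by
    rw [L₁_mulVec]
    refine relSum_extendH hι hιH (fun y z => ?_) (fun y z hz h => h.1.trans hz) g
    rw [lowRel_map_iff hι hιH hιx, relA, add_zero]
  have rl₂ : ∀ g : Submodule K (A × B) → ℂ, L₂ x H *ᵥ extendH ι H g =
      extendH ι H (relSum relB g) := fun g => by
    rw [L₂_mulVec]
    refine relSum_extendH hι hιH (fun y z => ?_) (fun y z hz h => h.1.trans hz) g
    rw [lowRel_map_iff hι hιH hιx, relB, add_zero]
  have rr₁ : ∀ g : Submodule K (A × B) → ℂ, R₁ x H *ᵥ extendH ι H g =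
      extendH ι H (relSum (fun y z => relA z y) g) := fun g => by
    rw [R₁_mulVec]
    refine relSum_extendH hι hιH (fun y z => ?_) (fun y z hz h => le_of_lowRel hz h) g
    rw [lowRel_map_iff hι hιH hιx, relA, add_zero]
  have rr₂ : ∀ g : Submodule K (A × B) → ℂ, R₂ x H *ᵥ extendH ι H g =
      extendH ι H (relSum (fun y z => relB z y) g) := fun g => by
    rw [R₂_mulVec]
    refine relSum_extendH hι hιH (fun y z => ?_) (fun y z hz h => le_of_lowRel hz h) g
    rw [lowRel_map_iff hι hιH hιx, relB, add_zero]
  have hcell : ∀ (g : Submodule K (A × B) → ℂ) (i j : ℤ),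
      extendH ι H g ∈ cellSpace x H i j 0 → ∀ y,
        ¬ ((Module.finrank K (fstPart y) : ℤ) = i ∧ (Module.finrank K (sndPart y) : ℤ) = j) →
        g y = 0 := fun g i j hg y hy => by
    have := hg (y.map ι) (by rwa [map_mem_cell hι hιH hιx])
    rwa [extendH_map hι hιH] at this
  have hinj : Function.Injective (extendH ι H) :=
    Function.LeftInverse.injective (restrictH_extendH hι hιH)
  have hrk : ∀ ψ : A →ₗ[K] B, Module.finrank K (LinearMap.range ψ) + 1 ≤ D := fun ψ => by
    have := ψ.finrank_range_add_finrank_ker; omega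
  have hker : ∀ ψ : A →ₗ[K] B, (Module.finrank K (LinearMap.ker ψ) : ℤ) =
      D - 1 - Module.finrank K (LinearMap.range ψ) := fun ψ => by
    have := ψ.finrank_range_add_finrank_ker; have := hrk ψ; omega
  have hAz : (Module.finrank K A : ℤ) = D - 1 := by omega
  have hBz : (Module.finrank K B : ℤ) = D + 1 := by omega
  refine ⟨{
    idx := A →ₗ[K] B
    rk := fun ψ => Module.finrank K (LinearMap.range ψ)
    I := fun ψ => (shearSpace e ψ).map (extendH ι H)
    proj := fun ψ => extendH ι H ∘ₗ shearProj e ψ ∘ₗ restrictH ι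
    cut := ?_, L₁_mem := ?_, L₂_mem := ?_, R₁_mem := ?_, R₂_mem := ?_,
    comm₁ := ?_, comm₂ := ?_, L₂_L₁ := ?_, L₁_R₂ := ?_, R₁_R₂ := ?_, R₁_L₂ := ?_,
    proj_mem := ?_, sum_proj := ?_, proj_of_mem := ?_, proj_of_ne := ?_, eq_zero_of_lt := ?_,
    finrank := ?_, card := ?_ }⟩
  · rintro ψ _ ⟨g, hg, rfl⟩ i j
    refine ⟨_, mul_mem_shearSpace hg (fun a b => if (Module.finrank K a : ℤ) = i ∧
      (Module.finrank K b : ℤ) = j then 1 else 0), ?_⟩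
    ext z
    by_cases hz : z ≤ H
    · rw [← map_comap_of_le hιH hz, extendH_map hι hιH, Set.indicator_apply, extendH_map hι hιH,
        ite_mul, one_mul, zero_mul]
      exact if_congr (map_mem_cell hι hιH hιx _ _ _).symm rfl rfl
    · rw [extendH_of_not_le _ hz, Set.indicator_apply, extendH_of_not_le _ hz, ite_self]
  · rintro ψ _ ⟨g, hg, rfl⟩
    rw [rl₁]; exact ⟨_, relA_mem hg, rfl⟩
  · rintro ψ _ ⟨g, hg, rfl⟩
    rw [rl₂]; exact ⟨_, relB_mem hg, rfl⟩
  · rintro ψ _ ⟨g, hg, rfl⟩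
    rw [rr₁]; exact ⟨_, swap_relA_mem hg, rfl⟩
  · rintro ψ _ ⟨g, hg, rfl⟩
    rw [rr₂]; exact ⟨_, swap_relB_mem hg, rfl⟩
  · rintro ψ _ ⟨g, hg, rfl⟩ i j hij
    rw [rl₁, rr₁, rr₁, rl₁, ← map_sub, ← map_smul]
    congr 1
    ext y
    rw [Pi.sub_apply, relA_commutator he hg, Pi.smul_apply, smul_eq_mul]
    by_cases hy : (Module.finrank K (fstPart y) : ℤ) = i ∧ (Module.finrank K (sndPart y) : ℤ) = j
    · rw [hy.1, hy.2, hker]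
    · rw [hcell g i j hij y hy]; simp
  · rintro ψ _ ⟨g, hg, rfl⟩ i j hij
    rw [rl₂, rr₂, rr₂, rl₂, ← map_sub, ← map_smul]
    congr 1
    ext y
    rw [Pi.sub_apply, relB_commutator he hg, Pi.smul_apply, smul_eq_mul]
    by_cases hy : (Module.finrank K (fstPart y) : ℤ) = i ∧ (Module.finrank K (sndPart y) : ℤ) = j
    · rw [hy.1, hy.2, hAz, hBz]
    · rw [hcell g i j hij y hy]; simp
  · rintro ψ _ ⟨g, hg, rfl⟩
    rw [rl₁, rl₂, rl₂, rl₁, relB_relA he hg, map_smul]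
  · rintro ψ _ ⟨g, hg, rfl⟩
    rw [rr₂, rl₁, rl₁, rr₂, relA_swap_relB he hg]
  · rintro ψ _ ⟨g, hg, rfl⟩
    rw [rr₂, rr₁, rr₁, rr₂, swap_relA_swap_relB he hg, map_smul]
  · rintro ψ _ ⟨g, hg, rfl⟩
    rw [rl₂, rr₁, rr₁, rl₂, swap_relA_relB he hg]
  · intro ψ f
    exact ⟨_, shearProj_mem ψ _, rfl⟩
  · intro f hf
    simp only [LinearMap.comp_apply]
    rw [← map_sum, sum_shearProj he, extendH_restrictH hιH hf]
  · rintro ψ _ ⟨g, hg, rfl⟩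
    rw [LinearMap.comp_apply, LinearMap.comp_apply, restrictH_extendH hι hιH, shearProj_of_mem hg]
  · rintro ψ ψ' hne _ ⟨g, hg, rfl⟩
    rw [LinearMap.comp_apply, LinearMap.comp_apply, restrictH_extendH hι hιH,
      shearProj_of_ne he hne hg, map_zero]
  · rintro ψ _ ⟨g, hg, rfl⟩ i j hij hlt
    have : g = 0 := by
      ext y
      by_cases hy : (Module.finrank K (fstPart y) : ℤ) = i ∧ (Module.finrank K (sndPart y) : ℤ) = j
      · refine vanish_of_not_range_le he hg fun hle => ?_
        have := Submodule.finrank_mono hle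
        omega
      · exact hcell g i j hij y hy
    rw [this, map_zero]
  · intro ψ i j
    have h := finrank_shearSpace_inf_dimSpace (ψ := ψ) he i j hA rfl hB
    rw [← h]
    have hmap : (shearSpace e ψ).map (extendH ι H) ⊓
        cellSpace x H i ((Module.finrank K (LinearMap.range ψ) : ℤ) + j) 0 =
        (shearSpace e ψ ⊓ dimSpace K A B i (Module.finrank K (LinearMap.range ψ) + j)).map
          (extendH ι H) := by
      ext f
      constructor
      · rintro ⟨⟨g, hg, rfl⟩, h2⟩
        refine ⟨g, ⟨hg, fun y hy => hcell g _ _ h2 y fun h3 => hy ?_⟩, rfl⟩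
        omega
      · rintro ⟨g, ⟨hg, hd⟩, rfl⟩
        refine ⟨⟨g, hg, rfl⟩, fun z hz => ?_⟩
        by_cases hzH : z ≤ H
        · rw [← map_comap_of_le hιH hzH, extendH_map hι hιH]
          apply hd
          rw [← map_comap_of_le hιH hzH, map_mem_cell hι hιH hιx] at hz
          omega
        · exact extendH_of_not_le g hzH
    rw [hmap]
    exact_mod_cast (Submodule.equivMapOfInjective _ hinj _).finrank_eq.symm
  · intro ρ hρ
    have h := card_rank_eq (ρ := ρ) hA hB (by omega) (by omega)
    exact h

/-- The existence of the decomposition. -/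
theorem nonempty_flagDecomposition {x H : Subsp K D} (hxH : x ≤ H)
    (hx : Module.finrank K x + 1 = D) (hH : Module.finrank K H = 2 * D) :
    Nonempty (FlagDecomposition x H) := by
  obtain ⟨C, hC⟩ := Submodule.exists_isCompl (x.submoduleOf H)
  have hA : Module.finrank K (x.submoduleOf H) = Module.finrank K x :=
    (Submodule.submoduleOfEquivOfLe hxH).finrank_eq
  have hB := Submodule.finrank_add_eq_of_isCompl hC
  rw [hA, hH] at hB
  have hA' : Module.finrank K (x.submoduleOf H) = D - 1 := by rw [hA]; omega
  have hB' : Module.finrank K C = D + 1 := by omega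
  have hD : 1 ≤ D := by omega
  refine nonempty_flagDecomposition_of_prod (A := ↥(x.submoduleOf H)) (B := ↥C) hD
    (H.subtype ∘ₗ (Submodule.prodEquivOfIsCompl _ C hC).toLinearMap) ?_ ?_ ?_
    hA' hB'
  · rw [LinearMap.coe_comp]
    exact H.subtype_injective.comp (Submodule.prodEquivOfIsCompl _ C hC).injective
  · rw [LinearMap.range_comp, LinearEquiv.range, Submodule.map_top, Submodule.range_subtype]
  · have h : (H.subtype ∘ₗ (Submodule.prodEquivOfIsCompl _ C hC).toLinearMap) ∘ₗ
        LinearMap.inl K _ _ = H.subtype ∘ₗ (x.submoduleOf H).subtype := by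
      ext v : 1
      simp [Submodule.coe_prodEquivOfIsCompl]
    rw [h, LinearMap.range_comp, Submodule.range_subtype, Submodule.submoduleOf,
      Submodule.map_comap_subtype, inf_eq_right.2 hxH]

end TwistedGrassmann

namespace TwistedGrassmann

/-! ### Crossing the hyperplane: the matrices `L₃` and `R₃` -/

section Hyperplane

universe u
variable {K : Type u} [Field K] [Fintype K] {D : ℕ} {x H : Subsp K D}

/-- `f` is supported on the subspaces of `H`. -/
def SuppIn (H : Subsp K D) (f : Subsp K D → ℂ) : Prop := ∀ y, ¬ y ≤ H → f y = 0

theorem finrank_inf_hyperplane (hH : Module.finrank K H = 2 * D) {z : Subsp K D} (hz : ¬ z ≤ H) :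
    Module.finrank K ↥(H ⊓ z) + 1 = Module.finrank K z := by
  have h1 := Submodule.finrank_sup_add_finrank_inf_eq H z
  have h2 : Module.finrank K ↥(H ⊔ z) ≤ 2 * D + 1 := by
    have := Submodule.finrank_le (H ⊔ z); rwa [Module.finrank_fin_fun] at this
  have h3 : Module.finrank K H < Module.finrank K ↥(H ⊔ z) := by
    apply Submodule.finrank_lt_finrank_of_lt
    exact lt_of_le_of_ne le_sup_left fun h => hz (h ▸ le_sup_right)
  omega

/-- A subspace outside `H` covers exactly one subspace of `H`, its trace on `H`. So `R₃` pulls a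
function on the subspaces of `H` back along `z ↦ H ⊓ z`. -/
theorem lowRel_zero_zero_one_iff (hxH : x ≤ H) (hH : Module.finrank K H = 2 * D)
    {y z : Subsp K D} (hy : y ≤ H) : lowRel x H 0 0 1 y z ↔ ¬ z ≤ H ∧ y = H ⊓ z := by
  constructor
  · rintro ⟨h1, h2, h3, h4⟩
    rw [inf_eq_right.2 hy] at h3
    have hz : ¬ z ≤ H := fun hz => by rw [inf_eq_right.2 hz] at h3; omega
    exact ⟨hz, Submodule.eq_of_le_of_finrank_eq (le_inf hy h1) (by omega)⟩
  · rintro ⟨hz, rfl⟩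
    have h := finrank_inf_hyperplane hH hz
    refine ⟨inf_le_right, ?_, ?_, by omega⟩
    · rw [← inf_assoc, inf_eq_left.2 hxH, add_zero]
    · rw [← inf_assoc, inf_idem]; omega

open Classical in
theorem R₃_mulVec_apply (hxH : x ≤ H) (hH : Module.finrank K H = 2 * D) {f : Subsp K D → ℂ}
    (hf : SuppIn H f) (z : Subsp K D) :
    (R₃ x H *ᵥ f) z = if z ≤ H then 0 else f (H ⊓ z) := by
  rw [R₃_mulVec, relSum_apply]
  split_ifs with hz
  · refine Finset.sum_eq_zero fun y hy => hf y fun hyH => ?_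
    exact ((lowRel_zero_zero_one_iff hxH hH hyH).1 (Finset.mem_filter.1 hy).2).1 hz
  · rw [Finset.sum_eq_single_of_mem (H ⊓ z)]
    · rw [Finset.mem_filter]
      exact ⟨Finset.mem_univ _, (lowRel_zero_zero_one_iff hxH hH inf_le_left).2 ⟨hz, rfl⟩⟩
    · intro y hy hne
      refine hf y fun hyH => hne ?_
      exact ((lowRel_zero_zero_one_iff hxH hH hyH).1 (Finset.mem_filter.1 hy).2).2

theorem le_of_lowRel_of_le {a b : ℕ} {y z : Subsp K D} (h : lowRel x H a b 0 y z) :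
    y ≤ H ↔ z ≤ H :=
  ⟨fun hy => le_of_lowRel hy h, fun hz => h.1.trans hz⟩

/-- Lowering within a layer commutes with raising out of `H`. -/
theorem lowering_R₃ (hxH : x ≤ H) (hH : Module.finrank K H = 2 * D) {f : Subsp K D → ℂ}
    (hf : SuppIn H f) (a b : ℕ) :
    relSum (lowRel x H a b 0) (R₃ x H *ᵥ f) = R₃ x H *ᵥ relSum (lowRel x H a b 0) f := by
  classical
  have hf' : SuppIn H (relSum (lowRel x H a b 0) f) := fun y hy => by
    rw [relSum_apply]
    refine Finset.sum_eq_zero fun z hz => hf z fun hzH => hy ?_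
    exact (le_of_lowRel_of_le (Finset.mem_filter.1 hz).2).2 hzH
  ext z'
  rw [R₃_mulVec_apply hxH hH hf', relSum_apply]
  split_ifs with hz'
  · refine Finset.sum_eq_zero fun z hz => ?_
    rw [R₃_mulVec_apply hxH hH hf, if_pos]
    exact (le_of_lowRel_of_le (Finset.mem_filter.1 hz).2).1 hz'
  · have hdim' := finrank_inf_hyperplane hH hz'
    rw [relSum_apply]
    -- The two maps are inverse to each other by the modular law: `H ⊓ (y ⊔ z') = y ⊔ (H ⊓ z') = y`
    -- for `H ⊓ z' ≤ y ≤ H`.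
    refine Finset.sum_nbij' (fun z => H ⊓ z) (fun y => y ⊔ z') ?_ ?_ ?_ ?_ ?_
    · intro z hz
      rw [Finset.mem_filter] at hz ⊢
      obtain ⟨-, h1, h2, h3, h4⟩ := hz
      have hzH : ¬ z ≤ H := fun h => hz' (h1.trans h)
      have hdim := finrank_inf_hyperplane hH hzH
      refine ⟨Finset.mem_univ _, inf_le_inf_left H h1, ?_, ?_, by omega⟩
      · rw [← inf_assoc, ← inf_assoc, inf_eq_left.2 hxH, h2]
      · rw [← inf_assoc, ← inf_assoc, inf_idem, h3]
    · intro y hy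
      rw [Finset.mem_filter] at hy ⊢
      have hyH : y ≤ H := (le_of_lowRel_of_le hy.2).1 inf_le_left
      obtain ⟨-, h1, h2, h3, h4⟩ := hy
      have hzH : ¬ y ⊔ z' ≤ H := fun h => hz' (le_sup_right.trans h)
      have hdim := finrank_inf_hyperplane hH hzH
      have hinf : H ⊓ (y ⊔ z') = y := by
        rw [inf_comm, sup_inf_assoc_of_le z' hyH, inf_comm, sup_eq_left.2 h1]
      refine ⟨Finset.mem_univ _, le_sup_right, ?_, ?_, ?_⟩
      · rw [← inf_eq_left.2 hxH, inf_assoc, inf_assoc, hinf, h2, ← inf_assoc, inf_eq_left.2 hxH]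
      · rw [hinf, ← inf_eq_right.2 hyH, h3, ← inf_assoc, inf_idem]
      · rw [hinf] at hdim; omega
    · intro z hz
      rw [Finset.mem_filter] at hz
      obtain ⟨-, h1, h2, h3, h4⟩ := hz
      have hzH : ¬ z ≤ H := fun h => hz' (h1.trans h)
      have hdim := finrank_inf_hyperplane hH hzH
      apply Submodule.eq_of_le_of_finrank_le (sup_le inf_le_right h1)
      have : H ⊓ z < H ⊓ z ⊔ z' := lt_of_le_of_ne le_sup_left fun h => hz' (by
        have : z' ≤ H ⊓ z := h ▸ le_sup_right
        exact this.trans inf_le_left)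
      have := Submodule.finrank_lt_finrank_of_lt this
      omega
    · intro y hy
      rw [Finset.mem_filter] at hy
      have hyH : y ≤ H := (le_of_lowRel_of_le hy.2).1 inf_le_left
      have h1 := hy.2.1
      change H ⊓ (y ⊔ z') = y
      rw [inf_comm, sup_inf_assoc_of_le z' hyH, inf_comm, sup_eq_left.2 h1]
    · intro z hz
      rw [Finset.mem_filter] at hz
      rw [R₃_mulVec_apply hxH hH hf, if_neg fun h => hz' (hz.2.1.trans h)]

theorem gauss_succ_sub {q : ℂ} (hq : q ≠ 0) (hq1 : 1 - q ≠ 0) (m : ℤ) :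
    gauss q (m + 1) - gauss q m = q ^ m := by
  rw [gauss, gauss, ← sub_div, div_eq_iff hq1, zpow_add_one₀ hq]; ring

/-- Raising within a layer `q`-commutes with raising out of `H`. -/
theorem raising_R₃ (hxH : x ≤ H) (hH : Module.finrank K H = 2 * D) {f : Subsp K D → ℂ}
    (hf : SuppIn H f) {a b : ℕ} (hab : a + b = 1) :
    relSum (fun y z => lowRel x H a b 0 z y) (R₃ x H *ᵥ f) =
      (Fintype.card K : ℂ) • (R₃ x H *ᵥ relSum (fun y z => lowRel x H a b 0 z y) f) := by
  classical
  have hf' : SuppIn H (relSum (fun y z => lowRel x H a b 0 z y) f) := fun y hy => by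
    rw [relSum_apply]
    refine Finset.sum_eq_zero fun z hz => hf z fun hzH => hy ?_
    exact (le_of_lowRel_of_le (Finset.mem_filter.1 hz).2).1 hzH
  ext z
  rw [Pi.smul_apply, R₃_mulVec_apply hxH hH hf', relSum_apply]
  split_ifs with hz
  · rw [smul_zero]
    refine Finset.sum_eq_zero fun z' hz' => ?_
    rw [R₃_mulVec_apply hxH hH hf, if_pos]
    exact (le_of_lowRel_of_le (Finset.mem_filter.1 hz').2).2 hz
  · have hdim := finrank_inf_hyperplane hH hz
    rw [relSum_apply, ← Finset.sum_fiberwise_of_maps_to (g := fun z' => H ⊓ z')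
      (t := Finset.univ.filter fun y => lowRel x H a b 0 y (H ⊓ z)), Finset.smul_sum]
    · refine Finset.sum_congr rfl fun y hy => ?_
      have hyH : y ≤ H := (le_of_lowRel_of_le (Finset.mem_filter.1 hy).2).2 inf_le_left
      obtain ⟨-, h1, h2, h3, h4⟩ := Finset.mem_filter.1 hy
      have hyz : y ≤ z := h1.trans inf_le_right
      -- For a fixed trace `y` the interval from `y` to `z` has length two, hence `q + 1` middle
      -- members. One of them is `H ⊓ z`; the other `q` lie outside `H` and give the factor.
      have hset : (Finset.univ.filter fun z' => lowRel x H a b 0 z' z).filter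
          (fun z' => H ⊓ z' = y) = (covers z y).erase (H ⊓ z) := by
        ext z'
        rw [Finset.mem_filter, Finset.mem_filter, Finset.mem_erase, mem_covers]
        constructor
        · rintro ⟨⟨-, hl⟩, rfl⟩
          have hz' : ¬ z' ≤ H := fun h => hz ((le_of_lowRel_of_le hl).1 h)
          have := finrank_inf_hyperplane hH hz'
          exact ⟨fun h => hz' (h ▸ inf_le_left), inf_le_right, hl.1, this.symm⟩
        · rintro ⟨hne, h5, h6, h7⟩
          have hz' : ¬ z' ≤ H := fun h => hne <|
            Submodule.eq_of_le_of_finrank_eq (le_inf h h6) (by omega)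
          have := finrank_inf_hyperplane hH hz'
          have e1 : H ⊓ z' = y :=
            (Submodule.eq_of_le_of_finrank_eq (le_inf hyH h5) (by omega)).symm
          refine ⟨⟨Finset.mem_univ _, h6, ?_, ?_, by omega⟩, e1⟩
          · have e2 : x ⊓ z = x ⊓ (H ⊓ z) := by rw [← inf_assoc, inf_eq_left.2 hxH]
            have e3 : x ⊓ z' = x ⊓ y := by rw [← e1, ← inf_assoc, inf_eq_left.2 hxH]
            rw [e2, e3, h2]
          · rw [e1, ← inf_eq_right.2 hyH, ← h3, ← inf_assoc, inf_idem]
      rw [hset, Finset.sum_congr rfl (g := fun _ => f y), Finset.sum_const,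
        Finset.card_erase_of_mem, nsmul_eq_mul, smul_eq_mul, Nat.cast_sub, card_covers hyz]
      · congr 1
        have e1 : (Module.finrank K z : ℤ) - Module.finrank K y = 1 + 1 := by omega
        have e2 : gauss (Fintype.card K : ℂ) 1 = 1 := by
          rw [gauss, zpow_one, div_self (one_sub_q_ne_zero K)]
        have := gauss_succ_sub (q_ne_zero K) (one_sub_q_ne_zero K) 1
        rw [e2, zpow_one] at this
        rw [e1, Nat.cast_one, this]
      · exact Finset.card_pos.2 ⟨H ⊓ z, mem_covers.2 ⟨h1, inf_le_right, by omega⟩⟩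
      · exact mem_covers.2 ⟨h1, inf_le_right, by omega⟩
      · intro z' hz'
        rw [← hset, Finset.mem_filter, Finset.mem_filter] at hz'
        rw [R₃_mulVec_apply hxH hH hf, hz'.2,
          if_neg fun h => hz ((le_of_lowRel_of_le hz'.1.2).1 h)]
    · intro z' hz'
      rw [Finset.mem_filter] at hz' ⊢
      have hl := hz'.2
      have hz'H : ¬ z' ≤ H := fun h => hz ((le_of_lowRel_of_le hl).1 h)
      have hdim' := finrank_inf_hyperplane hH hz'H
      obtain ⟨h1, h2, h3, h4⟩ := hl
      refine ⟨Finset.mem_univ _, inf_le_inf_left H h1, ?_, ?_, by omega⟩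
      · rw [← inf_assoc, ← inf_assoc, inf_eq_left.2 hxH, h2]
      · rw [← inf_assoc, ← inf_assoc, inf_idem, h3]

/-- The covers of `y` outside `H` number `[2D + 1 - dim y] - [2D - dim y] = q ^ (2D - dim y)`, and
`R₃ f` takes the value `f y` at each of them. -/
theorem L₃_R₃_apply (hxH : x ≤ H) (hH : Module.finrank K H = 2 * D) {f : Subsp K D → ℂ}
    (hf : SuppIn H f) (y : Subsp K D) :
    (L₃ x H *ᵥ (R₃ x H *ᵥ f)) y =
      (Fintype.card K : ℂ) ^ (2 * D - Module.finrank K y : ℤ) * f y := by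
  classical
  rw [L₃_mulVec, relSum_apply]
  by_cases hy : y ≤ H
  · have hset : (Finset.univ.filter fun z => lowRel x H 0 0 1 y z) = covers ⊤ y \ covers H y := by
      ext z
      rw [Finset.mem_filter, Finset.mem_sdiff, mem_covers, mem_covers,
        lowRel_zero_zero_one_iff hxH hH hy]
      constructor
      · rintro ⟨-, hz, rfl⟩
        have := finrank_inf_hyperplane hH hz
        exact ⟨⟨inf_le_right, le_top, this.symm⟩, fun h => hz h.2.1⟩
      · rintro ⟨⟨h1, -, h3⟩, h4⟩
        have hz : ¬ z ≤ H := fun h => h4 ⟨h1, h, h3⟩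
        have := finrank_inf_hyperplane hH hz
        exact ⟨Finset.mem_univ _, hz, Submodule.eq_of_le_of_finrank_eq (le_inf hy h1) (by omega)⟩
    have hsub : covers H y ⊆ covers ⊤ y := fun z hz => by
      obtain ⟨h1, -, h3⟩ := mem_covers.1 hz
      exact mem_covers.2 ⟨h1, le_top, h3⟩
    rw [Finset.sum_congr rfl (g := fun _ => f y), Finset.sum_const, hset,
      Finset.card_sdiff_of_subset hsub, nsmul_eq_mul, Nat.cast_sub (Finset.card_le_card hsub),
      card_covers le_top, card_covers hy]
    · congr 1
      rw [finrank_top, Module.finrank_fin_fun, hH]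
      have e1 : ((2 * D + 1 : ℕ) : ℤ) - Module.finrank K y =
        (2 * D - Module.finrank K y) + 1 := by push_cast; ring
      rw [e1, Nat.cast_mul, Nat.cast_ofNat, gauss_succ_sub (q_ne_zero K) (one_sub_q_ne_zero K)]
    · intro z hz
      obtain ⟨hz1, hz2⟩ := (lowRel_zero_zero_one_iff hxH hH hy).1 (Finset.mem_filter.1 hz).2
      rw [R₃_mulVec_apply hxH hH hf, if_neg hz1, ← hz2]
  · rw [hf y hy, mul_zero]
    refine Finset.sum_eq_zero fun z hz => ?_
    obtain ⟨h1, h2, h3, h4⟩ := (Finset.mem_filter.1 hz).2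
    have hz' : ¬ z ≤ H := fun h => hy (h1.trans h)
    have e1 := finrank_inf_hyperplane hH hz'
    have e2 := finrank_inf_hyperplane hH hy
    omega

theorem L₃_mulVec_eq_zero {f : Subsp K D → ℂ} (hf : SuppIn H f) : L₃ x H *ᵥ f = 0 := by
  classical
  ext y
  rw [L₃_mulVec, relSum_apply]
  refine Finset.sum_eq_zero fun z hz => hf z fun hzH => ?_
  obtain ⟨h1, h2, h3, h4⟩ := (Finset.mem_filter.1 hz).2
  rw [inf_eq_right.2 hzH, inf_eq_right.2 (h1.trans hzH)] at h3
  omega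

theorem R₃_R₃_mulVec_eq_zero (hxH : x ≤ H) (hH : Module.finrank K H = 2 * D)
    {f : Subsp K D → ℂ} (hf : SuppIn H f) : R₃ x H *ᵥ (R₃ x H *ᵥ f) = 0 := by
  classical
  ext y
  rw [R₃_mulVec, relSum_apply]
  refine Finset.sum_eq_zero fun z hz => ?_
  obtain ⟨h1, h2, h3, h4⟩ := (Finset.mem_filter.1 hz).2
  rw [R₃_mulVec_apply hxH hH hf]
  split_ifs with hzH
  · rfl
  · have hy : ¬ y ≤ H := fun h => hzH (h1.trans h)
    have e1 := finrank_inf_hyperplane hH hzH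
    have e2 := finrank_inf_hyperplane hH hy
    omega

end Hyperplane
end TwistedGrassmann

namespace TwistedGrassmann

/-! ### Strings of vectors for operators with an `sl₂`-type commutator -/

section Strings

variable (K : Type*) [Field K] [Fintype K]

theorem gauss_card_eq_ofReal (m : ℤ) : gauss (Fintype.card K) m =
    (((1 - (Fintype.card K : ℝ) ^ m) / (1 - (Fintype.card K : ℝ)) : ℝ) : ℂ) := by
  rw [gauss]; push_cast; rfl

theorem gaussReal_pos {m : ℤ} (hm : 0 < m) :
    0 < (1 - (Fintype.card K : ℝ) ^ m) / (1 - (Fintype.card K : ℝ)) := by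
  have h1 := one_lt_card_field K
  exact div_pos_of_neg_of_neg (by linarith [one_lt_zpow₀ h1 hm]) (by linarith)

theorem gaussReal_neg {m : ℤ} (hm : m < 0) :
    (1 - (Fintype.card K : ℝ) ^ m) / (1 - (Fintype.card K : ℝ)) < 0 := by
  have h1 := one_lt_card_field K
  exact div_neg_of_pos_of_neg (by linarith [zpow_lt_one_of_neg₀ h1 hm]) (by linarith)

/-- This allows the rank of a vector to be read off from an eigenvalue of `L₁ R₁`. -/
theorem gauss_injective : Function.Injective (gauss (Fintype.card K : ℂ)) := by
  intro m n h
  have := gauss_sub_gauss (q_ne_zero K) m n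
  rw [h, sub_self, eq_comm, mul_eq_zero, gauss_eq_zero_iff] at this
  rcases this with h | h
  · exact absurd h (zpow_ne_zero _ (q_ne_zero K))
  · omega

variable {ι : Type*} [Fintype ι]

theorem star_dotProduct_self (u : ι → ℂ) : star u ⬝ᵥ u = ((∑ i, ‖u i‖ ^ 2 : ℝ) : ℂ) := by
  rw [dotProduct]; push_cast
  exact Finset.sum_congr rfl fun i _ => Complex.conj_mul' (u i)

theorem sum_norm_sq_pos {u : ι → ℂ} (hu : u ≠ 0) : 0 < ∑ i, ‖u i‖ ^ 2 := by
  obtain ⟨i, hi⟩ := Function.ne_iff.1 hu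
  exact Finset.sum_pos' (fun _ _ => sq_nonneg _) ⟨i, Finset.mem_univ _, by
    have := norm_pos_iff.2 (show u i ≠ 0 from hi); positivity⟩

theorem sum_norm_sq_conjTranspose (M : Matrix ι ι ℂ) (u : ι → ℂ) :
    ((∑ i, ‖(Mᴴ *ᵥ u) i‖ ^ 2 : ℝ) : ℂ) = star u ⬝ᵥ (M *ᵥ (Mᴴ *ᵥ u)) := by
  rw [← star_dotProduct_self, Matrix.star_mulVec, Matrix.conjTranspose_conjTranspose,
    ← Matrix.dotProduct_mulVec]

theorem sum_norm_sq_of_eigen {M : Matrix ι ι ℂ} {u : ι → ℂ} {c : ℝ}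
    (h : M *ᵥ (Mᴴ *ᵥ u) = (c : ℂ) • u) : ∑ i, ‖(Mᴴ *ᵥ u) i‖ ^ 2 = c * ∑ i, ‖u i‖ ^ 2 := by
  have := sum_norm_sq_conjTranspose M u
  rw [h, dotProduct_smul, star_dotProduct_self, smul_eq_mul] at this
  exact_mod_cast this

/-- `Mᴴ` is injective where `M Mᴴ - Mᴴ M` is a positive scalar. -/
theorem eq_zero_of_conjTranspose_mulVec {M : Matrix ι ι ℂ} {u : ι → ℂ} {c : ℝ} (hc : 0 < c)
    (h : M *ᵥ (Mᴴ *ᵥ u) - Mᴴ *ᵥ (M *ᵥ u) = (c : ℂ) • u) (h0 : Mᴴ *ᵥ u = 0) : u = 0 := by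
  by_contra hu
  -- If `Mᴴ u = 0`, then `Mᴴ M u = -c u`, so the squared norm of `M u` would be `-c` times that of
  -- `u`, which is negative.
  have h1 : Mᴴ *ᵥ (M *ᵥ u) = -(c : ℂ) • u := by
    rw [h0, Matrix.mulVec_zero, zero_sub] at h
    rw [neg_smul, ← h, neg_neg]
  have h2 := sum_norm_sq_conjTranspose Mᴴ u
  rw [Matrix.conjTranspose_conjTranspose, h1, dotProduct_smul, star_dotProduct_self,
    smul_eq_mul] at h2
  have h3 : ∑ i, ‖(M *ᵥ u) i‖ ^ 2 = -c * ∑ i, ‖u i‖ ^ 2 := by exact_mod_cast h2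
  have h4 : 0 ≤ ∑ i, ‖(M *ᵥ u) i‖ ^ 2 := Finset.sum_nonneg fun _ _ => sq_nonneg _
  nlinarith [sum_norm_sq_pos hu]

/-- The induction step of `string_lower`, with the common power of `q` removed. -/
theorem gauss_string_identity {q : ℂ} (hq : q ≠ 0) (hq1 : 1 - q ≠ 0) (t m : ℤ) :
    q ^ (t + 1) * gauss q (m - 2 * (t + 1)) + gauss q (t + 1) * gauss q (m - t) =
      gauss q (t + 2) * gauss q (m - (t + 1)) := by
  simp only [gauss]
  field_simp
  have e1 : q ^ (m - 2 * (t + 1)) = q ^ m / (q ^ t) ^ 2 / q ^ 2 := by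
    rw [zpow_sub₀ hq, mul_comm (2 : ℤ), zpow_mul, zpow_add₀ hq]
    simp; ring
  have e2 : q ^ (m - t) = q ^ m / q ^ t := zpow_sub₀ hq _ _
  have e3 : q ^ (m - (t + 1)) = q ^ m / q ^ t / q := by
    rw [zpow_sub₀ hq, zpow_add₀ hq, zpow_one, div_div]
  have e4 : q ^ (t + 1) = q ^ t * q := zpow_add_one₀ hq t
  have e5 : q ^ (t + 2) = q ^ t * q ^ 2 := by rw [zpow_add₀ hq]; rfl
  rw [e1, e2, e3, e4, e5]
  have := zpow_ne_zero t hq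
  field_simp
  ring

variable {K} {M : Matrix ι ι ℂ} {v : ℕ → ι → ℂ} {e m : ℤ}

/-- The action of the lowering operator on a string. -/
theorem string_lower (hv : ∀ t, v (t + 1) = Mᴴ *ᵥ v t) (h0 : M *ᵥ v 0 = 0)
    (hc : ∀ t : ℕ, M *ᵥ (Mᴴ *ᵥ v t) - Mᴴ *ᵥ (M *ᵥ v t) =
      ((Fintype.card K : ℂ) ^ (e + t) * gauss (Fintype.card K) (m - 2 * t)) • v t) (t : ℕ) :
    M *ᵥ v (t + 1) = ((Fintype.card K : ℂ) ^ e * gauss (Fintype.card K) (t + 1) *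
      gauss (Fintype.card K) (m - t)) • v t := by
  induction t with
  | zero =>
    have := hc 0
    rw [h0, Matrix.mulVec_zero, sub_zero, ← hv] at this
    rw [this]
    have e2 : gauss (Fintype.card K : ℂ) 1 = 1 := by
      rw [gauss, zpow_one, div_self (one_sub_q_ne_zero K)]
    simp [e2]
  | succ t ih =>
    have h1 := hc (t + 1)
    rw [ih, Matrix.mulVec_smul, ← hv, ← hv, sub_eq_iff_eq_add] at h1
    rw [h1, ← add_smul]
    congr 1
    have := gauss_string_identity (q_ne_zero K) (one_sub_q_ne_zero K) t m
    push_cast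
    rw [show (t : ℤ) + 1 + 1 = t + 2 by ring, mul_assoc, mul_assoc, ← this,
      zpow_add₀ (q_ne_zero K)]
    ring

/-- The squared norm of `v (t + 1) = Mᴴ v t` is the inner product of `v t` with `M v (t + 1)`, which
`string_lower` computes. The sign of the ratio is that of `[m - t]`, and this decides where the
string ends. -/
theorem string_norm (hv : ∀ t, v (t + 1) = Mᴴ *ᵥ v t) (h0 : M *ᵥ v 0 = 0)
    (hc : ∀ t : ℕ, M *ᵥ (Mᴴ *ᵥ v t) - Mᴴ *ᵥ (M *ᵥ v t) =
      ((Fintype.card K : ℂ) ^ (e + t) * gauss (Fintype.card K) (m - 2 * t)) • v t) (t : ℕ) :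
    ∃ c : ℝ, 0 < c ∧ ∑ i, ‖v (t + 1) i‖ ^ 2 =
      c * ((1 - (Fintype.card K : ℝ) ^ (m - t)) / (1 - (Fintype.card K : ℝ))) *
        ∑ i, ‖v t i‖ ^ 2 := by
  have h := string_lower hv h0 hc t
  rw [hv t, gauss_card_eq_ofReal, gauss_card_eq_ofReal] at h
  refine ⟨(Fintype.card K : ℝ) ^ e *
    ((1 - (Fintype.card K : ℝ) ^ ((t : ℤ) + 1)) / (1 - (Fintype.card K : ℝ))), ?_, ?_⟩
  · have := one_lt_card_field K
    have := gaussReal_pos K (m := (t : ℤ) + 1) (by omega)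
    positivity
  · rw [hv t]
    apply sum_norm_sq_of_eigen
    rw [h]; push_cast; rfl

/-- Beyond `m` the factor `[m - t]` is negative, and a nonzero `v t` would be followed by a vector
of negative squared norm. -/
theorem string_nonneg (hv : ∀ t, v (t + 1) = Mᴴ *ᵥ v t) (h0 : M *ᵥ v 0 = 0)
    (hc : ∀ t : ℕ, M *ᵥ (Mᴴ *ᵥ v t) - Mᴴ *ᵥ (M *ᵥ v t) =
      ((Fintype.card K : ℂ) ^ (e + t) * gauss (Fintype.card K) (m - 2 * t)) • v t) {t : ℕ}
    (ht : v t ≠ 0) : (t : ℤ) ≤ m := by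
  by_contra hlt
  obtain ⟨c, hc0, hn⟩ := string_norm hv h0 hc t
  have h1 := gaussReal_neg K (m := m - t) (by omega)
  have h2 : 0 ≤ ∑ i, ‖v (t + 1) i‖ ^ 2 := Finset.sum_nonneg fun _ _ => sq_nonneg _
  have h3 := mul_neg_of_pos_of_neg hc0 h1
  nlinarith [sum_norm_sq_pos ht]

theorem string_ne_zero (hv : ∀ t, v (t + 1) = Mᴴ *ᵥ v t) (h0 : M *ᵥ v 0 = 0)
    (hc : ∀ t : ℕ, M *ᵥ (Mᴴ *ᵥ v t) - Mᴴ *ᵥ (M *ᵥ v t) =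
      ((Fintype.card K : ℂ) ^ (e + t) * gauss (Fintype.card K) (m - 2 * t)) • v t)
    (h : v 0 ≠ 0) {t : ℕ} (ht : (t : ℤ) ≤ m) : v t ≠ 0 := by
  induction t with
  | zero => exact h
  | succ t ih =>
    intro hz
    push_cast at ht
    obtain ⟨c, hc0, hn⟩ := string_norm hv h0 hc t
    have h1 := gaussReal_pos K (m := m - t) (by omega)
    have h2 := sum_norm_sq_pos (ih (by omega))
    rw [hz] at hn
    simp only [Pi.zero_apply, norm_zero, ne_eq, OfNat.ofNat_ne_zero, not_false_eq_true, zero_pow,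
      Finset.sum_const_zero] at hn
    have := mul_pos (mul_pos hc0 h1) h2
    linarith

/-- If `Mᴴ` is injective on `W`, then `M` maps `U` onto `W`. -/
theorem finrank_inf_ker_add (M : Matrix ι ι ℂ) (U W : Submodule ℂ (ι → ℂ))
    (hU : ∀ u ∈ U, M *ᵥ u ∈ W) (hW : ∀ w ∈ W, Mᴴ *ᵥ w ∈ U)
    (hinj : ∀ w ∈ W, Mᴴ *ᵥ w = 0 → w = 0) :
    Module.finrank ℂ ↥(U ⊓ LinearMap.ker M.mulVecLin) + Module.finrank ℂ W =
      Module.finrank ℂ U := by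
  let f : U →ₗ[ℂ] W := M.mulVecLin.restrict hU
  let g : W →ₗ[ℂ] U := Mᴴ.mulVecLin.restrict hW
  -- If `M Mᴴ w = 0`, then the norm of `Mᴴ w` is zero, so `w = 0`. In finite dimension `M Mᴴ` is
  -- then onto `W`, and so is `M`.
  have h1 : Function.Injective (f ∘ₗ g) := by
    rw [← LinearMap.ker_eq_bot, LinearMap.ker_eq_bot']
    rintro ⟨w, hw⟩ h
    have h2 : M *ᵥ (Mᴴ *ᵥ w) = ((0 : ℝ) : ℂ) • w := by
      rw [Complex.ofReal_zero, zero_smul]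
      exact congrArg Subtype.val h
    have h3 := sum_norm_sq_of_eigen h2
    rw [zero_mul] at h3
    have h4 : Mᴴ *ᵥ w = 0 := by
      by_contra hne
      exact (sum_norm_sq_pos hne).ne' h3
    exact Subtype.ext (hinj w hw h4)
  have h2 : LinearMap.range f = ⊤ := by
    have := LinearMap.range_eq_top.2 (LinearMap.surjective_of_injective h1)
    exact top_le_iff.1 (this ▸ LinearMap.range_comp_le_range g f)
  have h3 := f.finrank_range_add_finrank_ker
  have h4 : Module.finrank ℂ (LinearMap.ker f) =
      Module.finrank ℂ ↥(U ⊓ LinearMap.ker M.mulVecLin) := by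
    have : LinearMap.ker f = (U ⊓ LinearMap.ker M.mulVecLin).comap U.subtype := by
      ext u
      rw [LinearMap.mem_ker, Submodule.mem_comap, Submodule.mem_inf, LinearMap.mem_ker,
        ← Subtype.coe_inj]
      exact ⟨fun h => ⟨u.2, h⟩, fun h => h.2⟩
    rw [this]
    exact (Submodule.comapSubtypeEquivOfLe inf_le_left).finrank_eq
  rw [h2, finrank_top, h4] at h3
  omega

end Strings

section Adjoint

variable {K : Type*} [Field K] {D : ℕ}

theorem conjTranspose_lowering (x H : Subsp K D) (a b c : ℤ) :
    (lowering x H a b c)ᴴ = raising x H a b c := by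
  classical
  ext y z
  rw [Matrix.conjTranspose_apply, lowering, raising, Matrix.of_apply, Matrix.of_apply]
  have : (∃ i j k : ℤ, y ∈ cell x H i j k ∧ z ∈ cell x H (i - a) (j - b) (k - c) ∧ z ≤ y) ↔
      ∃ i j k : ℤ, z ∈ cell x H i j k ∧ y ∈ cell x H (i + a) (j + b) (k + c) ∧ z ≤ y := by
    constructor
    · rintro ⟨i, j, k, h1, h2, h3⟩
      exact ⟨_, _, _, h2, by simpa using h1, h3⟩
    · rintro ⟨i, j, k, h1, h2, h3⟩
      exact ⟨_, _, _, h2, by simpa using h1, h3⟩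
  simp only [this]
  split_ifs <;> simp

theorem conjTranspose_L₁ (x H : Subsp K D) : (L₁ x H)ᴴ = R₁ x H := conjTranspose_lowering ..
theorem conjTranspose_L₂ (x H : Subsp K D) : (L₂ x H)ᴴ = R₂ x H := conjTranspose_lowering ..

end Adjoint
end TwistedGrassmann

/-! ### Cells, ranks and lowest vectors -/

namespace TwistedGrassmann

attribute [instance] FlagDecomposition.fintypeIdx

universe u

variable {K : Type u} [Field K] [Fintype K] {D : ℕ} {x H : Subsp K D}

theorem cell_unique {i j k i' j' k' : ℤ} {y : Subsp K D} (h : y ∈ cell x H i j k)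
    (h' : y ∈ cell x H i' j' k') : i = i' ∧ j = j' ∧ k = k' := by
  obtain ⟨h1, h2, h3⟩ := h
  obtain ⟨h1', h2', h3'⟩ := h'
  omega

theorem lowering_mem_cellSpace {i j k : ℤ} {f : Subsp K D → ℂ} (hf : f ∈ cellSpace x H i j k)
    (a b c : ℤ) : lowering x H a b c *ᵥ f ∈ cellSpace x H (i - a) (j - b) (k - c) := by
  intro y hy
  rw [Matrix.mulVec, dotProduct]
  refine Finset.sum_eq_zero fun z _ => ?_
  by_cases hz : z ∈ cell x H i j k
  · rw [lowering, Matrix.of_apply, if_neg, zero_mul]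
    rintro ⟨i', j', k', h1, h2, -⟩
    obtain ⟨rfl, rfl, rfl⟩ := cell_unique hz h1
    exact hy h2
  · rw [hf z hz, mul_zero]

theorem raising_mem_cellSpace {i j k : ℤ} {f : Subsp K D → ℂ} (hf : f ∈ cellSpace x H i j k)
    (a b c : ℤ) : raising x H a b c *ᵥ f ∈ cellSpace x H (i + a) (j + b) (k + c) := by
  intro y hy
  rw [Matrix.mulVec, dotProduct]
  refine Finset.sum_eq_zero fun z _ => ?_
  by_cases hz : z ∈ cell x H i j k
  · rw [raising, Matrix.of_apply, if_neg, zero_mul]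
    rintro ⟨i', j', k', h1, h2, -⟩
    obtain ⟨rfl, rfl, rfl⟩ := cell_unique hz h1
    exact hy h2
  · rw [hf z hz, mul_zero]

section Steps
variable {i j k : ℤ} {f : Subsp K D → ℂ}

theorem L₁_mem_cellSpace (hf : f ∈ cellSpace x H i j k) :
    L₁ x H *ᵥ f ∈ cellSpace x H (i - 1) j k := by
  simpa [L₁] using lowering_mem_cellSpace hf 1 0 0

theorem L₂_mem_cellSpace (hf : f ∈ cellSpace x H i j k) :
    L₂ x H *ᵥ f ∈ cellSpace x H i (j - 1) k := by
  simpa [L₂] using lowering_mem_cellSpace hf 0 1 0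

theorem L₃_mem_cellSpace (hf : f ∈ cellSpace x H i j k) :
    L₃ x H *ᵥ f ∈ cellSpace x H i j (k - 1) := by
  simpa [L₃] using lowering_mem_cellSpace hf 0 0 1

theorem R₁_mem_cellSpace (hf : f ∈ cellSpace x H i j k) :
    R₁ x H *ᵥ f ∈ cellSpace x H (i + 1) j k := by
  simpa [R₁] using raising_mem_cellSpace hf 1 0 0

theorem R₂_mem_cellSpace (hf : f ∈ cellSpace x H i j k) :
    R₂ x H *ᵥ f ∈ cellSpace x H i (j + 1) k := by
  simpa [R₂] using raising_mem_cellSpace hf 0 1 0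

theorem R₃_mem_cellSpace (hf : f ∈ cellSpace x H i j k) :
    R₃ x H *ᵥ f ∈ cellSpace x H i j (k + 1) := by
  simpa [R₃] using raising_mem_cellSpace hf 0 0 1

theorem cellIdem_mulVec_of_mem (hf : f ∈ cellSpace x H i j k) : cellIdem x H i j k *ᵥ f = f := by
  classical
  rw [cellIdem_mulVec]
  ext y
  rw [Set.indicator_apply]
  split_ifs with h
  · rfl
  · exact (hf y h).symm

theorem cellIdem_mulVec_of_ne {i' j' k' : ℤ} (hf : f ∈ cellSpace x H i j k)
    (hne : (i', j', k') ≠ (i, j, k)) : cellIdem x H i' j' k' *ᵥ f = 0 := by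
  classical
  rw [cellIdem_mulVec]
  ext y
  rw [Set.indicator_apply]
  split_ifs with h
  · refine hf y fun h' => hne ?_
    obtain ⟨rfl, rfl, rfl⟩ := cell_unique h h'
    rfl
  · rfl

theorem cellIdem_mem_cellSpace (f : Subsp K D → ℂ) (i j k : ℤ) :
    cellIdem x H i j k *ᵥ f ∈ cellSpace x H i j k := by
  classical
  intro y hy
  rw [cellIdem_mulVec, Set.indicator_of_notMem hy]

theorem suppIn_of_mem_cellSpace (hf : f ∈ cellSpace x H i j 0) : SuppIn H f := by
  intro y hy
  refine hf y fun ⟨h1, h2, h3⟩ => hy ?_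
  have : H ⊓ y = y := Submodule.eq_of_le_of_finrank_eq inf_le_right (by omega)
  exact inf_eq_right.1 this

theorem cellSpace_eq_zero_of_neg (hf : f ∈ cellSpace x H i j k) (h : i < 0) : f = 0 := by
  ext y
  refine hf y fun ⟨h1, _, _⟩ => ?_
  omega

end Steps

namespace FlagDecomposition

variable (F : FlagDecomposition x H)

/-- On functions supported in `H` the projections sum to the identity, so an operator that preserves
every summand commutes with each of them. -/
theorem proj_comm {M : (Subsp K D → ℂ) →ₗ[ℂ] (Subsp K D → ℂ)}
    (hM : ∀ s, ∀ f ∈ F.I s, M f ∈ F.I s) {f : Subsp K D → ℂ} (hf : SuppIn H f) (s : F.idx) :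
    F.proj s (M f) = M (F.proj s f) := by
  conv_lhs => rw [← F.sum_proj f hf, map_sum, map_sum]
  rw [Finset.sum_eq_single s]
  · exact F.proj_of_mem s _ (hM s _ (F.proj_mem s f))
  · intro t _ hne
    exact F.proj_of_ne s t hne.symm _ (hM t _ (F.proj_mem t f))
  · exact fun h => absurd (Finset.mem_univ s) h

theorem proj_L₁ {f : Subsp K D → ℂ} (hf : SuppIn H f) (s : F.idx) :
    F.proj s (L₁ x H *ᵥ f) = L₁ x H *ᵥ F.proj s f :=
  F.proj_comm (M := (L₁ x H).mulVecLin) F.L₁_mem hf s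
theorem proj_L₂ {f : Subsp K D → ℂ} (hf : SuppIn H f) (s : F.idx) :
    F.proj s (L₂ x H *ᵥ f) = L₂ x H *ᵥ F.proj s f :=
  F.proj_comm (M := (L₂ x H).mulVecLin) F.L₂_mem hf s
theorem proj_R₁ {f : Subsp K D → ℂ} (hf : SuppIn H f) (s : F.idx) :
    F.proj s (R₁ x H *ᵥ f) = R₁ x H *ᵥ F.proj s f :=
  F.proj_comm (M := (R₁ x H).mulVecLin) F.R₁_mem hf s
theorem proj_R₂ {f : Subsp K D → ℂ} (hf : SuppIn H f) (s : F.idx) :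
    F.proj s (R₂ x H *ᵥ f) = R₂ x H *ᵥ F.proj s f :=
  F.proj_comm (M := (R₂ x H).mulVecLin) F.R₂_mem hf s

theorem proj_mem_cellSpace {i j : ℤ} {f : Subsp K D → ℂ} (hf : f ∈ cellSpace x H i j 0)
    (s : F.idx) : F.proj s f ∈ cellSpace x H i j 0 := by
  have := F.proj_comm (M := (cellIdem x H i j 0).mulVecLin) (fun s f hf => by
    rw [Matrix.mulVecLin_apply, cellIdem_mulVec]; exact F.cut s f hf i j)
    (suppIn_of_mem_cellSpace hf) s
  rw [Matrix.mulVecLin_apply, Matrix.mulVecLin_apply, cellIdem_mulVec_of_mem hf] at this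
  rw [this]
  exact cellIdem_mem_cellSpace _ _ _ _

theorem ext_proj {f g : Subsp K D → ℂ} (hf : SuppIn H f) (hg : SuppIn H g)
    (h : ∀ s, F.proj s f = F.proj s g) : f = g := by
  rw [← F.sum_proj f hf, ← F.sum_proj g hg]
  exact Finset.sum_congr rfl fun s _ => h s

variable {i j : ℤ} {f : Subsp K D → ℂ}

/-- The constants in this relation and the next two are the same in every summand, so the relations
hold on all of the cell by comparing components. -/
theorem cell_L₁_R₂ (F : FlagDecomposition x H) (hf : f ∈ cellSpace x H i j 0) : L₁ x H *ᵥ (R₂ x H *ᵥ f) =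
    R₂ x H *ᵥ (L₁ x H *ᵥ f) := by
  have h1 := L₁_mem_cellSpace hf
  have h2 := R₂_mem_cellSpace hf
  refine F.ext_proj (suppIn_of_mem_cellSpace (L₁_mem_cellSpace h2))
    (suppIn_of_mem_cellSpace (R₂_mem_cellSpace h1)) fun s => ?_
  rw [F.proj_L₁ (suppIn_of_mem_cellSpace h2), F.proj_R₂ (suppIn_of_mem_cellSpace hf),
    F.proj_R₂ (suppIn_of_mem_cellSpace h1), F.proj_L₁ (suppIn_of_mem_cellSpace hf),
    F.L₁_R₂ s _ (F.proj_mem s f)]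

theorem cell_R₁_R₂ (F : FlagDecomposition x H) (hf : f ∈ cellSpace x H i j 0) : R₁ x H *ᵥ (R₂ x H *ᵥ f) =
    (Fintype.card K : ℂ) • (R₂ x H *ᵥ (R₁ x H *ᵥ f)) := by
  have h1 := R₁_mem_cellSpace hf
  have h2 := R₂_mem_cellSpace hf
  have h3 := (cellSpace x H (i + 1) (j + 1) 0).smul_mem (Fintype.card K : ℂ) (R₂_mem_cellSpace h1)
  refine F.ext_proj (suppIn_of_mem_cellSpace (R₁_mem_cellSpace h2)) (suppIn_of_mem_cellSpace h3)
    fun s => ?_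
  rw [F.proj_R₁ (suppIn_of_mem_cellSpace h2), F.proj_R₂ (suppIn_of_mem_cellSpace hf), map_smul,
    F.proj_R₂ (suppIn_of_mem_cellSpace h1), F.proj_R₁ (suppIn_of_mem_cellSpace hf),
    F.R₁_R₂ s _ (F.proj_mem s f)]

theorem cell_R₁_L₂ (F : FlagDecomposition x H) (hf : f ∈ cellSpace x H i j 0) : R₁ x H *ᵥ (L₂ x H *ᵥ f) =
    L₂ x H *ᵥ (R₁ x H *ᵥ f) := by
  have h1 := R₁_mem_cellSpace hf
  have h2 := L₂_mem_cellSpace hf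
  refine F.ext_proj (suppIn_of_mem_cellSpace (R₁_mem_cellSpace h2))
    (suppIn_of_mem_cellSpace (L₂_mem_cellSpace h1)) fun s => ?_
  rw [F.proj_R₁ (suppIn_of_mem_cellSpace h2), F.proj_L₂ (suppIn_of_mem_cellSpace hf),
    F.proj_L₂ (suppIn_of_mem_cellSpace h1), F.proj_R₁ (suppIn_of_mem_cellSpace hf),
    F.R₁_L₂ s _ (F.proj_mem s f)]

/-- The functions on the cell `(i, j, 0)` whose components of rank other than `ρ` vanish. -/
def rankSpace (i j ρ : ℤ) : Submodule ℂ (Subsp K D → ℂ) :=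
  cellSpace x H i j 0 ⊓ ⨅ (s : F.idx) (_ : (F.rk s : ℤ) ≠ ρ), LinearMap.ker (F.proj s)

theorem mem_rankSpace {i j ρ : ℤ} {f : Subsp K D → ℂ} : f ∈ F.rankSpace i j ρ ↔
    f ∈ cellSpace x H i j 0 ∧ ∀ s, (F.rk s : ℤ) ≠ ρ → F.proj s f = 0 := by
  simp [rankSpace, Submodule.mem_iInf]

variable {F} {ρ : ℤ}

theorem R₁_mem_rankSpace (hf : f ∈ F.rankSpace i j ρ) :
    R₁ x H *ᵥ f ∈ F.rankSpace (i + 1) j ρ := by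
  rw [mem_rankSpace] at *
  refine ⟨R₁_mem_cellSpace hf.1, fun s hs => ?_⟩
  rw [F.proj_R₁ (suppIn_of_mem_cellSpace hf.1), hf.2 s hs, Matrix.mulVec_zero]

theorem R₂_mem_rankSpace (hf : f ∈ F.rankSpace i j ρ) :
    R₂ x H *ᵥ f ∈ F.rankSpace i (j + 1) ρ := by
  rw [mem_rankSpace] at *
  refine ⟨R₂_mem_cellSpace hf.1, fun s hs => ?_⟩
  rw [F.proj_R₂ (suppIn_of_mem_cellSpace hf.1), hf.2 s hs, Matrix.mulVec_zero]

theorem proj_comm₁ (F : FlagDecomposition x H) (hf : f ∈ cellSpace x H i j 0) (s : F.idx) :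
    F.proj s (L₁ x H *ᵥ (R₁ x H *ᵥ f) - R₁ x H *ᵥ (L₁ x H *ᵥ f)) =
      ((Fintype.card K : ℂ) ^ (i + j) * gauss (Fintype.card K) (D - 1 - F.rk s - 2 * i)) •
        F.proj s f := by
  rw [map_sub, F.proj_L₁ (suppIn_of_mem_cellSpace (R₁_mem_cellSpace hf)),
    F.proj_R₁ (suppIn_of_mem_cellSpace (L₁_mem_cellSpace hf)),
    F.proj_L₁ (suppIn_of_mem_cellSpace hf), F.proj_R₁ (suppIn_of_mem_cellSpace hf),
    F.comm₁ s _ (F.proj_mem s f) i j (F.proj_mem_cellSpace hf s)]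

/-- The commutators depend on the summand only through its rank, so they are still scalar on the sum
of the summands of one rank. -/
theorem rank_comm₁ (hf : f ∈ F.rankSpace i j ρ) :
    L₁ x H *ᵥ (R₁ x H *ᵥ f) - R₁ x H *ᵥ (L₁ x H *ᵥ f) =
      ((Fintype.card K : ℂ) ^ (i + j) * gauss (Fintype.card K) (D - 1 - ρ - 2 * i)) • f := by
  have h := F.mem_rankSpace.1 hf
  have h1 : L₁ x H *ᵥ (R₁ x H *ᵥ f) ∈ cellSpace x H i j 0 := by
    simpa using L₁_mem_cellSpace (R₁_mem_cellSpace h.1)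
  have h2 : R₁ x H *ᵥ (L₁ x H *ᵥ f) ∈ cellSpace x H i j 0 := by
    simpa using R₁_mem_cellSpace (L₁_mem_cellSpace h.1)
  refine F.ext_proj (suppIn_of_mem_cellSpace (Submodule.sub_mem _ h1 h2))
    (suppIn_of_mem_cellSpace (Submodule.smul_mem _ _ h.1)) fun s => ?_
  rw [proj_comm₁ F h.1, map_smul]
  by_cases hs : (F.rk s : ℤ) = ρ
  · rw [hs]
  · rw [h.2 s hs, smul_zero, smul_zero]

theorem rank_comm₂ (hf : f ∈ F.rankSpace i j ρ) :
    L₂ x H *ᵥ (R₂ x H *ᵥ f) - R₂ x H *ᵥ (L₂ x H *ᵥ f) =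
      ((Fintype.card K : ℂ) ^ (D - 1 - i + j - ρ) *
        gauss (Fintype.card K) (D + 1 + ρ - 2 * j)) • f := by
  have h := F.mem_rankSpace.1 hf
  have h1 : L₂ x H *ᵥ (R₂ x H *ᵥ f) ∈ cellSpace x H i j 0 := by
    simpa using L₂_mem_cellSpace (R₂_mem_cellSpace h.1)
  have h2 : R₂ x H *ᵥ (L₂ x H *ᵥ f) ∈ cellSpace x H i j 0 := by
    simpa using R₂_mem_cellSpace (L₂_mem_cellSpace h.1)
  refine F.ext_proj (suppIn_of_mem_cellSpace (Submodule.sub_mem _ h1 h2))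
    (suppIn_of_mem_cellSpace (Submodule.smul_mem _ _ h.1)) fun s => ?_
  rw [map_sub, F.proj_L₂ (suppIn_of_mem_cellSpace (R₂_mem_cellSpace h.1)),
    F.proj_R₂ (suppIn_of_mem_cellSpace (L₂_mem_cellSpace h.1)),
    F.proj_L₂ (suppIn_of_mem_cellSpace h.1), F.proj_R₂ (suppIn_of_mem_cellSpace h.1),
    F.comm₂ s _ (F.proj_mem s f) i j (F.proj_mem_cellSpace h.1 s), map_smul]
  by_cases hs : (F.rk s : ℤ) = ρ
  · rw [hs]
  · rw [h.2 s hs, smul_zero, smul_zero]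

variable (F) in
/-- The vectors of rank `ρ` on the cell `(ν, μ, 0)` that are killed by the lowering matrices. -/
noncomputable def lowestSpace (ν μ ρ : ℤ) : Submodule ℂ (Subsp K D → ℂ) :=
  F.rankSpace ν μ ρ ⊓ LinearMap.ker (L₁ x H).mulVecLin ⊓ LinearMap.ker (L₂ x H).mulVecLin

theorem mem_lowestSpace {ν μ : ℤ} : f ∈ F.lowestSpace ν μ ρ ↔
    f ∈ F.rankSpace ν μ ρ ∧ L₁ x H *ᵥ f = 0 ∧ L₂ x H *ᵥ f = 0 := by
  simp [lowestSpace, and_assoc]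

end FlagDecomposition

/-- The operator `R₁ ^ a R₂ ^ b`. -/
noncomputable def ladder (x H : Subsp K D) (a b : ℕ) : (Subsp K D → ℂ) →ₗ[ℂ] (Subsp K D → ℂ) :=
  (R₁ x H).mulVecLin ^ a * (R₂ x H).mulVecLin ^ b

theorem ladder_succ_left (a b : ℕ) (f : Subsp K D → ℂ) :
    ladder x H (a + 1) b f = R₁ x H *ᵥ ladder x H a b f := by
  rw [ladder, pow_succ', mul_assoc]; rfl

theorem ladder_zero_succ (b : ℕ) (f : Subsp K D → ℂ) :
    ladder x H 0 (b + 1) f = R₂ x H *ᵥ ladder x H 0 b f := by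
  rw [ladder, pow_succ', pow_zero, one_mul]; rfl

theorem ladder_zero_zero (f : Subsp K D → ℂ) : ladder x H 0 0 f = f := by
  rw [ladder, pow_zero, pow_zero]; rfl

/-! ### Ladders above a lowest vector -/

section Ladder

variable {F : FlagDecomposition x H} {ν μ ρ : ℤ} {f : Subsp K D → ℂ}

theorem ladder_mem_rankSpace (hf : f ∈ F.rankSpace ν μ ρ) (a b : ℕ) :
    ladder x H a b f ∈ F.rankSpace (ν + a) (μ + b) ρ := by
  induction a with
  | zero =>
    induction b with
    | zero => simpa [ladder_zero_zero] using hf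
    | succ b ih =>
      rw [ladder_zero_succ]
      simpa [add_assoc] using FlagDecomposition.R₂_mem_rankSpace ih
  | succ a ih =>
    rw [ladder_succ_left]
    simpa [add_assoc] using FlagDecomposition.R₁_mem_rankSpace ih

theorem ladder_mem_cellSpace (hf : f ∈ F.rankSpace ν μ ρ) (a b : ℕ) :
    ladder x H a b f ∈ cellSpace x H (ν + a) (μ + b) 0 :=
  (F.mem_rankSpace.1 (ladder_mem_rankSpace hf a b)).1

/-- Moving `R₂` past one `R₁` costs a factor `q⁻¹`. -/
theorem R₂_ladder (hf : f ∈ F.rankSpace ν μ ρ) (a b : ℕ) :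
    R₂ x H *ᵥ ladder x H a b f =
      ((Fintype.card K : ℂ) ^ (-(a : ℤ))) • ladder x H a (b + 1) f := by
  induction a with
  | zero => rw [ladder_zero_succ]; simp
  | succ a ih =>
    have h := F.cell_R₁_R₂ (ladder_mem_cellSpace hf a b)
    rw [ih, Matrix.mulVec_smul, ← ladder_succ_left, ← ladder_succ_left] at h
    have hq := q_ne_zero K
    rw [← inv_smul_eq_iff₀ hq] at h
    rw [← h, smul_smul]
    congr 1
    push_cast
    rw [neg_add, zpow_add₀ hq, zpow_neg_one, mul_comm]

theorem L₁_ladder_zero (hf : f ∈ F.lowestSpace ν μ ρ) (b : ℕ) :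
    L₁ x H *ᵥ ladder x H 0 b f = 0 := by
  have h := FlagDecomposition.mem_lowestSpace.1 hf
  induction b with
  | zero => rw [ladder_zero_zero]; exact h.2.1
  | succ b ih =>
    rw [ladder_zero_succ, F.cell_L₁_R₂ (ladder_mem_cellSpace h.1 0 b), ih, Matrix.mulVec_zero]

/-- For a lowest vector the ladder is a string in each direction separately, of length `m = D - 1 -
ρ - 2ν` for `L₁` and `m = D + 1 + ρ - 2μ` for `L₂`. -/
theorem ladder_string₁ (hf : f ∈ F.rankSpace ν μ ρ) (b t : ℕ) :
    L₁ x H *ᵥ ((L₁ x H)ᴴ *ᵥ ladder x H t b f) - (L₁ x H)ᴴ *ᵥ (L₁ x H *ᵥ ladder x H t b f) =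
      ((Fintype.card K : ℂ) ^ ((ν + μ + b) + t : ℤ) *
        gauss (Fintype.card K) ((D - 1 - ρ - 2 * ν) - 2 * t)) • ladder x H t b f := by
  rw [conjTranspose_L₁, FlagDecomposition.rank_comm₁ (ladder_mem_rankSpace hf t b)]
  congr 3 <;> ring

theorem ladder_string₂ (hf : f ∈ F.rankSpace ν μ ρ) (t : ℕ) :
    L₂ x H *ᵥ ((L₂ x H)ᴴ *ᵥ ladder x H 0 t f) - (L₂ x H)ᴴ *ᵥ (L₂ x H *ᵥ ladder x H 0 t f) =
      ((Fintype.card K : ℂ) ^ ((D - 1 - ν + μ - ρ) + t : ℤ) *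
        gauss (Fintype.card K) ((D + 1 + ρ - 2 * μ) - 2 * t)) • ladder x H 0 t f := by
  rw [conjTranspose_L₂, FlagDecomposition.rank_comm₂ (ladder_mem_rankSpace hf 0 t)]
  congr 3 <;> push_cast <;> ring

theorem L₁_ladder_succ (hf : f ∈ F.lowestSpace ν μ ρ) (a b : ℕ) :
    L₁ x H *ᵥ ladder x H (a + 1) b f = ((Fintype.card K : ℂ) ^ (ν + μ + b) *
      gauss (Fintype.card K) (a + 1) * gauss (Fintype.card K) (D - 1 - ρ - 2 * ν - a)) •
        ladder x H a b f := by
  have h := FlagDecomposition.mem_lowestSpace.1 hf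
  exact string_lower (M := L₁ x H) (v := fun a => ladder x H a b f)
    (fun t => by rw [conjTranspose_L₁, ladder_succ_left]) (L₁_ladder_zero hf b)
    (ladder_string₁ h.1 b) a

/-- `R₁` commutes with `L₂`, so the property of being killed by `L₂` climbs the first direction of
the ladder. -/
theorem L₂_ladder_zero (hf : f ∈ F.lowestSpace ν μ ρ) (a : ℕ) :
    L₂ x H *ᵥ ladder x H a 0 f = 0 := by
  have h := FlagDecomposition.mem_lowestSpace.1 hf
  induction a with
  | zero => rw [ladder_zero_zero]; exact h.2.2
  | succ a ih =>
    rw [ladder_succ_left, ← F.cell_R₁_L₂ (ladder_mem_cellSpace h.1 a 0), ih, Matrix.mulVec_zero]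

theorem L₂_ladder_succ (hf : f ∈ F.lowestSpace ν μ ρ) (a b : ℕ) :
    L₂ x H *ᵥ ladder x H a (b + 1) f = ((Fintype.card K : ℂ) ^ (D - 1 - ν + μ - ρ) *
      gauss (Fintype.card K) (b + 1) * gauss (Fintype.card K) (D + 1 + ρ - 2 * μ - b)) •
        ladder x H a b f := by
  have h := FlagDecomposition.mem_lowestSpace.1 hf
  induction a with
  | zero =>
    exact string_lower (M := L₂ x H) (v := fun b => ladder x H 0 b f)
      (fun t => by rw [conjTranspose_L₂, ladder_zero_succ]) (L₂_ladder_zero hf 0)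
      (ladder_string₂ h.1) b
  | succ a ih =>
    rw [ladder_succ_left, ← F.cell_R₁_L₂ (ladder_mem_cellSpace h.1 a (b + 1)), ih,
      Matrix.mulVec_smul, ← ladder_succ_left]

/-- Positivity of norms in both directions. Applied to the lowest vector itself, it bounds `ν` and
`μ`. -/
theorem le_of_ladder_ne_zero (hf : f ∈ F.lowestSpace ν μ ρ) {a b : ℕ}
    (h0 : ladder x H a b f ≠ 0) : (a : ℤ) ≤ D - 1 - ρ - 2 * ν ∧ (b : ℤ) ≤ D + 1 + ρ - 2 * μ := by
  have h := FlagDecomposition.mem_lowestSpace.1 hf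
  constructor
  · exact string_nonneg (M := L₁ x H) (v := fun a => ladder x H a b f)
      (fun t => by rw [conjTranspose_L₁, ladder_succ_left]) (L₁_ladder_zero hf b)
      (ladder_string₁ h.1 b) h0
  · have h1 : ladder x H 0 b f ≠ 0 := fun h1 => h0 <| by
      have : ∀ a, ladder x H a b f = 0 := fun a => by
        induction a with
        | zero => exact h1
        | succ a ih => rw [ladder_succ_left, ih, Matrix.mulVec_zero]
      exact this a
    exact string_nonneg (M := L₂ x H) (v := fun b => ladder x H 0 b f)
      (fun t => by rw [conjTranspose_L₂, ladder_zero_succ]) (L₂_ladder_zero hf 0)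
      (ladder_string₂ h.1) h1

theorem ladder_ne_zero (hf : f ∈ F.lowestSpace ν μ ρ) (hf0 : f ≠ 0) {a b : ℕ}
    (ha : (a : ℤ) ≤ D - 1 - ρ - 2 * ν) (hb : (b : ℤ) ≤ D + 1 + ρ - 2 * μ) :
    ladder x H a b f ≠ 0 := by
  have h := FlagDecomposition.mem_lowestSpace.1 hf
  have h1 : ladder x H 0 b f ≠ 0 :=
    string_ne_zero (M := L₂ x H) (v := fun b => ladder x H 0 b f)
      (fun t => by rw [conjTranspose_L₂, ladder_zero_succ]) (L₂_ladder_zero hf 0)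
      (ladder_string₂ h.1) (by rwa [ladder_zero_zero]) hb
  exact string_ne_zero (M := L₁ x H) (v := fun a => ladder x H a b f)
      (fun t => by rw [conjTranspose_L₁, ladder_succ_left]) (L₁_ladder_zero hf b)
      (ladder_string₁ h.1 b) h1 ha

end Ladder
end TwistedGrassmann

namespace TwistedGrassmann

/-! ### Modules over an algebra given by generators -/

section Adjoin

variable {ι : Type*} [Fintype ι] [DecidableEq ι] {A : Subalgebra ℂ (Matrix ι ι ℂ)}
  {S : Set (Matrix ι ι ℂ)}

/-- A subspace that is stable under the generators of a matrix algebra, as a submodule. -/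
def submoduleOfStable (hA : A = Algebra.adjoin ℂ S) (U : Submodule ℂ (ι → ℂ))
    (hU : ∀ M ∈ S, ∀ u ∈ U, M *ᵥ u ∈ U) : Submodule A (ι → ℂ) where
  carrier := U
  add_mem' := U.add_mem
  zero_mem' := U.zero_mem
  smul_mem' := by
    rintro ⟨M, hM⟩ u hu
    change M *ᵥ u ∈ U
    rw [hA] at hM
    induction hM using Algebra.adjoin_induction generalizing u with
    | mem M hM => exact hU M hM u hu
    | algebraMap c =>
      rw [Algebra.algebraMap_eq_smul_one, Matrix.smul_mulVec, Matrix.one_mulVec]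
      exact U.smul_mem c hu
    | add M N _ _ h1 h2 => rw [Matrix.add_mulVec]; exact U.add_mem (h1 hu) (h2 hu)
    | mul M N _ _ h1 h2 => rw [← Matrix.mulVec_mulVec]; exact h1 (h2 hu)

theorem restrictScalars_submoduleOfStable {hA : A = Algebra.adjoin ℂ S}
    {U : Submodule ℂ (ι → ℂ)} {hU : ∀ M ∈ S, ∀ u ∈ U, M *ᵥ u ∈ U} :
    (submoduleOfStable hA U hU).restrictScalars ℂ = U := by
  ext u; rfl

theorem mulVec_mem_of_mem {U : Submodule A (ι → ℂ)} {M : Matrix ι ι ℂ} (hM : M ∈ A) {u : ι → ℂ}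
    (hu : u ∈ U) : M *ᵥ u ∈ U :=
  U.smul_mem (⟨M, hM⟩ : A) hu

theorem complex_smul_mem {U : Submodule A (ι → ℂ)} (c : ℂ) {u : ι → ℂ} (hu : u ∈ U) : c • u ∈ U :=
  (U.restrictScalars ℂ).smul_mem c hu

theorem map_mulVec {U W : Submodule A (ι → ℂ)} (φ : U ≃ₗ[A] W) {M : Matrix ι ι ℂ} (hM : M ∈ A)
    (u : U) : (φ ⟨M *ᵥ u.1, mulVec_mem_of_mem hM u.2⟩ : ι → ℂ) = M *ᵥ (φ u : ι → ℂ) :=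
  congrArg Subtype.val (φ.map_smul (⟨M, hM⟩ : A) u)

/-- Whether an element of the algebra acts as zero is an invariant of the isomorphism class;
endpoints are invariants for this reason. -/
theorem ActsNonzero.of_linearEquiv {U W : Submodule A (ι → ℂ)} (φ : U ≃ₗ[A] W)
    {M : Matrix ι ι ℂ} (hM : M ∈ A) (h : ActsNonzero M (U : Set (ι → ℂ))) :
    ActsNonzero M (W : Set (ι → ℂ)) := by
  obtain ⟨u, hu, h⟩ := h
  refine ⟨φ ⟨u, hu⟩, (φ ⟨u, hu⟩).2, fun h0 => h ?_⟩
  rw [← map_mulVec φ hM ⟨u, hu⟩] at h0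
  have h1 : φ ⟨M *ᵥ u, mulVec_mem_of_mem hM hu⟩ = 0 := Subtype.ext h0
  exact congrArg Subtype.val (φ.map_eq_zero_iff.1 h1)

end Adjoin

universe u

variable {K : Type u} [Field K] [Fintype K] {D : ℕ} {x H : Subsp K D}

theorem cell_bounds (hxH : x ≤ H) (hx : Module.finrank K x + 1 = D)
    (hH : Module.finrank K H = 2 * D) {i j k : ℤ} {y : Subsp K D} (hy : y ∈ cell x H i j k) :
    (0 ≤ i ∧ i ≤ D - 1) ∧ (0 ≤ j ∧ j ≤ D + 1) ∧ (0 ≤ k ∧ k ≤ 1) := by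
  obtain ⟨h1, h2, h3⟩ := hy
  have e1 := Submodule.finrank_mono (inf_le_left : x ⊓ y ≤ x)
  have e2 := Submodule.finrank_mono (inf_le_inf_right y hxH)
  have e3 := Submodule.finrank_sup_add_finrank_inf_eq x (H ⊓ y)
  rw [← inf_assoc, inf_eq_left.2 hxH] at e3
  have e4 := Submodule.finrank_mono (sup_le hxH (inf_le_left : H ⊓ y ≤ H))
  have e5 := Submodule.finrank_mono (inf_le_right : H ⊓ y ≤ y)
  have e6 : Module.finrank K y ≤ Module.finrank K ↥(H ⊓ y) + 1 := by
    by_cases hyH : y ≤ H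
    · rw [inf_eq_right.2 hyH]; omega
    · exact (finrank_inf_hyperplane hH hyH).ge
  omega

theorem cell_bounds_of_ne_zero (hxH : x ≤ H) (hx : Module.finrank K x + 1 = D)
    (hH : Module.finrank K H = 2 * D) {i j k : ℤ} {f : Subsp K D → ℂ}
    (hf : f ∈ cellSpace x H i j k) (h0 : f ≠ 0) :
    (0 ≤ i ∧ i ≤ D - 1) ∧ (0 ≤ j ∧ j ≤ D + 1) ∧ (0 ≤ k ∧ k ≤ 1) := by
  obtain ⟨y, hy⟩ := Function.ne_iff.1 h0
  exact cell_bounds hxH hx hH (by_contra fun h => hy (hf y h))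

/-! ### The standard basis generated by a lowest vector -/

section OutOfH
variable (hxH : x ≤ H) (hH : Module.finrank K H = 2 * D) {i j : ℤ} {f : Subsp K D → ℂ}

theorem L₁_R₃ (hf : f ∈ cellSpace x H i j 0) (hxH : x ≤ H) (hH : Module.finrank K H = 2 * D) :
    L₁ x H *ᵥ (R₃ x H *ᵥ f) = R₃ x H *ᵥ (L₁ x H *ᵥ f) := by
  rw [L₁_mulVec, L₁_mulVec, lowering_R₃ hxH hH (suppIn_of_mem_cellSpace hf)]

theorem L₂_R₃ (hf : f ∈ cellSpace x H i j 0) (hxH : x ≤ H) (hH : Module.finrank K H = 2 * D) :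
    L₂ x H *ᵥ (R₃ x H *ᵥ f) = R₃ x H *ᵥ (L₂ x H *ᵥ f) := by
  rw [L₂_mulVec, L₂_mulVec, lowering_R₃ hxH hH (suppIn_of_mem_cellSpace hf)]

theorem R₁_R₃ (hf : f ∈ cellSpace x H i j 0) (hxH : x ≤ H) (hH : Module.finrank K H = 2 * D) :
    R₁ x H *ᵥ (R₃ x H *ᵥ f) = (Fintype.card K : ℂ) • (R₃ x H *ᵥ (R₁ x H *ᵥ f)) := by
  rw [R₁_mulVec, R₁_mulVec, raising_R₃ hxH hH (suppIn_of_mem_cellSpace hf) rfl]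

theorem R₂_R₃ (hf : f ∈ cellSpace x H i j 0) (hxH : x ≤ H) (hH : Module.finrank K H = 2 * D) :
    R₂ x H *ᵥ (R₃ x H *ᵥ f) = (Fintype.card K : ℂ) • (R₃ x H *ᵥ (R₂ x H *ᵥ f)) := by
  rw [R₂_mulVec, R₂_mulVec, raising_R₃ hxH hH (suppIn_of_mem_cellSpace hf) rfl]

theorem L₃_R₃ (hf : f ∈ cellSpace x H i j 0) (hxH : x ≤ H) (hH : Module.finrank K H = 2 * D) :
    L₃ x H *ᵥ (R₃ x H *ᵥ f) = ((Fintype.card K : ℂ) ^ (2 * D - i - j)) • f := by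
  ext y
  rw [L₃_R₃_apply hxH hH (suppIn_of_mem_cellSpace hf), Pi.smul_apply, smul_eq_mul]
  by_cases hy : y ∈ cell x H i j 0
  · rw [hy.2.2]; congr 2; ring
  · rw [hf y hy, mul_zero, mul_zero]

end OutOfH

/-- The vectors of the standard basis generated by a vector in the cell `(ν, μ, 0)`. -/
noncomputable def stdVec (x H : Subsp K D) (ν μ i j k : ℤ) :
    (Subsp K D → ℂ) →ₗ[ℂ] (Subsp K D → ℂ) :=
  if ν ≤ i ∧ μ ≤ j then
    if k = 0 then ladder x H (i - ν).toNat (j - μ).toNat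
    else if k = 1 then (R₃ x H).mulVecLin ∘ₗ ladder x H (i - ν).toNat (j - μ).toNat
    else 0
  else 0

theorem stdVec_zero (ν μ : ℤ) (a b : ℕ) (f : Subsp K D → ℂ) :
    stdVec x H ν μ (ν + a) (μ + b) 0 f = ladder x H a b f := by
  rw [stdVec, if_pos ⟨by omega, by omega⟩, if_pos rfl]
  simp

theorem stdVec_one (ν μ : ℤ) (a b : ℕ) (f : Subsp K D → ℂ) :
    stdVec x H ν μ (ν + a) (μ + b) 1 f = R₃ x H *ᵥ ladder x H a b f := by
  rw [stdVec, if_pos ⟨by omega, by omega⟩, if_neg one_ne_zero, if_pos rfl]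
  simp

theorem stdVec_eq_zero_left {ν μ i j k : ℤ} (h : i < ν) (f : Subsp K D → ℂ) :
    stdVec x H ν μ i j k f = 0 := by
  rw [stdVec, if_neg (by omega)]; rfl

theorem stdVec_eq_zero_right {ν μ i j k : ℤ} (h : j < μ) (f : Subsp K D → ℂ) :
    stdVec x H ν μ i j k f = 0 := by
  rw [stdVec, if_neg (by omega)]; rfl

theorem stdVec_eq_zero_layer {ν μ i j k : ℤ} (h0 : k ≠ 0) (h1 : k ≠ 1) (f : Subsp K D → ℂ) :
    stdVec x H ν μ i j k f = 0 := by
  rw [stdVec, if_neg h0, if_neg h1, ite_self]; rfl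

section Std

variable {F : FlagDecomposition x H} {ν μ ρ : ℤ} {f : Subsp K D → ℂ}

theorem stdVec_mem_cellSpace (hf : f ∈ F.rankSpace ν μ ρ) (i j k : ℤ) :
    stdVec x H ν μ i j k f ∈ cellSpace x H i j k := by
  by_cases hi : i < ν
  · rw [stdVec_eq_zero_left hi]; exact Submodule.zero_mem _
  by_cases hj : j < μ
  · rw [stdVec_eq_zero_right hj]; exact Submodule.zero_mem _
  obtain ⟨a, rfl⟩ : ∃ a : ℕ, i = ν + a := ⟨(i - ν).toNat, by omega⟩
  obtain ⟨b, rfl⟩ : ∃ b : ℕ, j = μ + b := ⟨(j - μ).toNat, by omega⟩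
  by_cases h0 : k = 0
  · rw [h0, stdVec_zero]; exact ladder_mem_cellSpace hf a b
  by_cases h1 : k = 1
  · rw [h1, stdVec_one]
    simpa using R₃_mem_cellSpace (ladder_mem_cellSpace hf a b)
  · rw [stdVec_eq_zero_layer h0 h1]; exact Submodule.zero_mem _

/-- `L₃ R₃` is a nonzero scalar on the cell. -/
theorem R₃_ne_zero {i j : ℤ} (hxH : x ≤ H) (hH : Module.finrank K H = 2 * D)
    (hf : f ∈ cellSpace x H i j 0) (h : f ≠ 0) : R₃ x H *ᵥ f ≠ 0 := by
  intro h0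
  have := L₃_R₃ hf hxH hH
  rw [h0, Matrix.mulVec_zero, eq_comm, smul_eq_zero] at this
  exact this.elim (zpow_ne_zero _ (q_ne_zero K)) h

theorem mem_indexRange_iff {i j k : ℤ} : (i, j, k) ∈ indexRange D ν μ ρ ↔
    ∃ a b : ℕ, i = ν + a ∧ j = μ + b ∧ (a : ℤ) ≤ D - 1 - ρ - 2 * ν ∧
      (b : ℤ) ≤ D + 1 + ρ - 2 * μ ∧ (k = 0 ∨ k = 1) := by
  constructor
  · rintro ⟨h1, h2, h3, h4, h5, h6⟩
    simp only at h1 h2 h3 h4 h5 h6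
    exact ⟨(i - ν).toNat, (j - μ).toNat, by omega, by omega, by omega, by omega, by omega⟩
  · rintro ⟨a, b, rfl, rfl, h1, h2, h3⟩
    refine ⟨?_, ?_, ?_, ?_, ?_, ?_⟩ <;> simp only <;> omega

theorem stdVec_ne_zero (hxH : x ≤ H) (hH : Module.finrank K H = 2 * D)
    (hf : f ∈ F.lowestSpace ν μ ρ) (h0 : f ≠ 0) {i j k : ℤ}
    (h : (i, j, k) ∈ indexRange D ν μ ρ) : stdVec x H ν μ i j k f ≠ 0 := by
  obtain ⟨a, b, rfl, rfl, ha, hb, rfl | rfl⟩ := mem_indexRange_iff.1 h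
  · rw [stdVec_zero]; exact ladder_ne_zero hf h0 ha hb
  · rw [stdVec_one]
    exact R₃_ne_zero hxH hH
      (ladder_mem_cellSpace (FlagDecomposition.mem_lowestSpace.1 hf).1 a b)
      (ladder_ne_zero hf h0 ha hb)

theorem stdVec_outside (hf : f ∈ F.lowestSpace ν μ ρ) {i j k : ℤ}
    (h : (i, j, k) ∉ indexRange D ν μ ρ) : stdVec x H ν μ i j k f = 0 := by
  by_contra hne
  have hi : ν ≤ i := not_lt.1 fun hi => hne (stdVec_eq_zero_left hi f)
  have hj : μ ≤ j := not_lt.1 fun hj => hne (stdVec_eq_zero_right hj f)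
  have hk : k = 0 ∨ k = 1 := by
    by_contra! hk; exact hne (stdVec_eq_zero_layer hk.1 hk.2 f)
  obtain ⟨a, rfl⟩ : ∃ a : ℕ, i = ν + a := ⟨(i - ν).toNat, by omega⟩
  obtain ⟨b, rfl⟩ : ∃ b : ℕ, j = μ + b := ⟨(j - μ).toNat, by omega⟩
  have hl : ladder x H a b f ≠ 0 := by
    rcases hk with rfl | rfl
    · rwa [stdVec_zero] at hne
    · rw [stdVec_one] at hne
      exact fun h => hne (by rw [h, Matrix.mulVec_zero])
  obtain ⟨ha, hb⟩ := le_of_ladder_ne_zero hf hl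
  exact h (mem_indexRange_iff.2 ⟨a, b, rfl, rfl, ha, hb, hk⟩)

/-- On the layer `k = 0` this is the string formula for the ladder; it passes to `k = 1` because
`L₁` commutes with `R₃`. At the bottom of the string the coefficient `[0]` agrees with the
convention that vectors outside the range are zero. -/
theorem stdVec_L₁ (hxH : x ≤ H) (hH : Module.finrank K H = 2 * D)
    (hf : f ∈ F.lowestSpace ν μ ρ) {i j k : ℤ} (h : (i, j, k) ∈ indexRange D ν μ ρ) :
    L₁ x H *ᵥ stdVec x H ν μ i j k f =
      ((Fintype.card K : ℂ) ^ (ν + j) * gauss (Fintype.card K) (D - 1 - ν - ρ - i + 1) *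
        gauss (Fintype.card K) (i - ν)) • stdVec x H ν μ (i - 1) j k f := by
  have hr := (FlagDecomposition.mem_lowestSpace.1 hf).1
  have h0 : ∀ a b : ℕ, L₁ x H *ᵥ stdVec x H ν μ (ν + a) (μ + b) 0 f =
      ((Fintype.card K : ℂ) ^ (ν + (μ + b)) * gauss (Fintype.card K) (D - 1 - ν - ρ - (ν + a) + 1) *
        gauss (Fintype.card K) (ν + a - ν)) • stdVec x H ν μ (ν + a - 1) (μ + b) 0 f := fun a b => by
    rw [stdVec_zero]
    rcases a with - | a
    · rw [stdVec_eq_zero_left (by omega), L₁_ladder_zero hf, smul_zero]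
    · rw [L₁_ladder_succ hf, show ν + ((a + 1 : ℕ) : ℤ) - 1 = ν + a by push_cast; ring, stdVec_zero]
      have e1 : D - 1 - ρ - 2 * ν - (a : ℤ) = D - 1 - ν - ρ - (ν + (a + 1 : ℕ)) + 1 := by
        push_cast; ring
      have e2 : (a : ℤ) + 1 = ν + (a + 1 : ℕ) - ν := by push_cast; ring
      rw [e1, e2, add_assoc ν, mul_right_comm]
  obtain ⟨a, b, rfl, rfl, ha, hb, rfl | rfl⟩ := mem_indexRange_iff.1 h
  · exact h0 a b
  · rw [stdVec_one, L₁_R₃ (ladder_mem_cellSpace hr a b) hxH hH, ← stdVec_zero ν μ, h0,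
      Matrix.mulVec_smul]
    rcases a with - | a
    · rw [stdVec_eq_zero_left (by omega), stdVec_eq_zero_left (by omega), Matrix.mulVec_zero]
    · rw [show ν + ((a + 1 : ℕ) : ℤ) - 1 = ν + a by push_cast; ring, stdVec_zero, stdVec_one]

theorem stdVec_L₂ (hxH : x ≤ H) (hH : Module.finrank K H = 2 * D)
    (hf : f ∈ F.lowestSpace ν μ ρ) {i j k : ℤ} (h : (i, j, k) ∈ indexRange D ν μ ρ) :
    L₂ x H *ᵥ stdVec x H ν μ i j k f =
      ((Fintype.card K : ℂ) ^ (D - 1 - ν + μ - ρ) *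
        gauss (Fintype.card K) (D + 1 - μ + ρ - j + 1) *
        gauss (Fintype.card K) (j - μ)) • stdVec x H ν μ i (j - 1) k f := by
  have hr := (FlagDecomposition.mem_lowestSpace.1 hf).1
  have h0 : ∀ a b : ℕ, L₂ x H *ᵥ stdVec x H ν μ (ν + a) (μ + b) 0 f =
      ((Fintype.card K : ℂ) ^ (D - 1 - ν + μ - ρ) *
        gauss (Fintype.card K) (D + 1 - μ + ρ - (μ + b) + 1) *
        gauss (Fintype.card K) (μ + b - μ)) • stdVec x H ν μ (ν + a) (μ + b - 1) 0 f := fun a b => by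
    rw [stdVec_zero]
    rcases b with - | b
    · rw [stdVec_eq_zero_right (by omega), L₂_ladder_zero hf, smul_zero]
    · rw [L₂_ladder_succ hf, show μ + ((b + 1 : ℕ) : ℤ) - 1 = μ + b by push_cast; ring, stdVec_zero]
      have e1 : D + 1 + ρ - 2 * μ - (b : ℤ) = D + 1 - μ + ρ - (μ + (b + 1 : ℕ)) + 1 := by
        push_cast; ring
      have e2 : (b : ℤ) + 1 = μ + (b + 1 : ℕ) - μ := by push_cast; ring
      rw [e1, e2, mul_right_comm]
  obtain ⟨a, b, rfl, rfl, ha, hb, rfl | rfl⟩ := mem_indexRange_iff.1 h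
  · exact h0 a b
  · rw [stdVec_one, L₂_R₃ (ladder_mem_cellSpace hr a b) hxH hH, ← stdVec_zero ν μ, h0,
      Matrix.mulVec_smul]
    rcases b with - | b
    · rw [stdVec_eq_zero_right (by omega), stdVec_eq_zero_right (by omega), Matrix.mulVec_zero]
    · rw [show μ + ((b + 1 : ℕ) : ℤ) - 1 = μ + b by push_cast; ring, stdVec_zero, stdVec_one]

/-- The factor `q ^ k` comes from `R₁ R₃ = q R₃ R₁`. -/
theorem stdVec_R₁ (hxH : x ≤ H) (hH : Module.finrank K H = 2 * D)
    (hf : f ∈ F.lowestSpace ν μ ρ) {i j k : ℤ} (h : (i, j, k) ∈ indexRange D ν μ ρ) :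
    R₁ x H *ᵥ stdVec x H ν μ i j k f =
      ((Fintype.card K : ℂ) ^ k) • stdVec x H ν μ (i + 1) j k f := by
  have hr := (FlagDecomposition.mem_lowestSpace.1 hf).1
  obtain ⟨a, b, rfl, rfl, ha, hb, rfl | rfl⟩ := mem_indexRange_iff.1 h
  · rw [stdVec_zero, show ν + (a : ℤ) + 1 = ν + (a + 1 : ℕ) by push_cast; ring, stdVec_zero,
      ladder_succ_left, zpow_zero, one_smul]
  · rw [stdVec_one, show ν + (a : ℤ) + 1 = ν + (a + 1 : ℕ) by push_cast; ring, stdVec_one,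
      ladder_succ_left, zpow_one, R₁_R₃ (ladder_mem_cellSpace hr a b) hxH hH]

theorem stdVec_R₂ (hxH : x ≤ H) (hH : Module.finrank K H = 2 * D)
    (hf : f ∈ F.lowestSpace ν μ ρ) {i j k : ℤ} (h : (i, j, k) ∈ indexRange D ν μ ρ) :
    R₂ x H *ᵥ stdVec x H ν μ i j k f =
      ((Fintype.card K : ℂ) ^ (ν - i + k)) • stdVec x H ν μ i (j + 1) k f := by
  have hr := (FlagDecomposition.mem_lowestSpace.1 hf).1
  obtain ⟨a, b, rfl, rfl, ha, hb, rfl | rfl⟩ := mem_indexRange_iff.1 h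
  · rw [stdVec_zero, show μ + (b : ℤ) + 1 = μ + (b + 1 : ℕ) by push_cast; ring, stdVec_zero,
      R₂_ladder hr]
    congr 2; ring
  · rw [stdVec_one, show μ + (b : ℤ) + 1 = μ + (b + 1 : ℕ) by push_cast; ring, stdVec_one,
      R₂_R₃ (ladder_mem_cellSpace hr a b) hxH hH, R₂_ladder hr, Matrix.mulVec_smul, smul_smul]
    congr 1
    rw [← zpow_one_add₀ (q_ne_zero K)]
    congr 1; ring

theorem stdVec_L₃ (hxH : x ≤ H) (hH : Module.finrank K H = 2 * D)
    (hf : f ∈ F.lowestSpace ν μ ρ) {i j k : ℤ} (h : (i, j, k) ∈ indexRange D ν μ ρ) :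
    L₃ x H *ᵥ stdVec x H ν μ i j k f =
      ((Fintype.card K : ℂ) ^ (2 * D - i - j)) • stdVec x H ν μ i j (k - 1) f := by
  have hr := (FlagDecomposition.mem_lowestSpace.1 hf).1
  obtain ⟨a, b, rfl, rfl, ha, hb, rfl | rfl⟩ := mem_indexRange_iff.1 h
  · rw [stdVec_eq_zero_layer (k := 0 - 1) (by omega) (by omega), smul_zero,
      L₃_mulVec_eq_zero (suppIn_of_mem_cellSpace (stdVec_mem_cellSpace hr _ _ _))]
  · rw [stdVec_one, sub_self, stdVec_zero, L₃_R₃ (ladder_mem_cellSpace hr a b) hxH hH]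

theorem stdVec_R₃ (hxH : x ≤ H) (hH : Module.finrank K H = 2 * D)
    (hf : f ∈ F.lowestSpace ν μ ρ) {i j k : ℤ} (h : (i, j, k) ∈ indexRange D ν μ ρ) :
    R₃ x H *ᵥ stdVec x H ν μ i j k f = stdVec x H ν μ i j (k + 1) f := by
  have hr := (FlagDecomposition.mem_lowestSpace.1 hf).1
  obtain ⟨a, b, rfl, rfl, ha, hb, rfl | rfl⟩ := mem_indexRange_iff.1 h
  · rw [stdVec_zero, zero_add, stdVec_one]
  · rw [stdVec_one, stdVec_eq_zero_layer (k := 1 + 1) (by omega) (by omega),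
      R₃_R₃_mulVec_eq_zero hxH hH (suppIn_of_mem_cellSpace (ladder_mem_cellSpace hr a b))]

/-- Nonzero vectors in distinct cells are linearly independent. -/
theorem linearIndependent_of_cells {s : Set (ℤ × ℤ × ℤ)} {w : ℤ → ℤ → ℤ → (Subsp K D → ℂ)}
    (hw : ∀ i j k, w i j k ∈ cellSpace x H i j k) (h0 : ∀ i j k, (i, j, k) ∈ s → w i j k ≠ 0) :
    LinearIndependent ℂ fun t : s => w t.1.1 t.1.2.1 t.1.2.2 := by
  rw [linearIndependent_iff']
  rintro S g hg ⟨⟨i, j, k⟩, ht⟩ hS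
  have := congrArg (fun u => cellIdem x H i j k *ᵥ u) hg
  simp only [Matrix.mulVec_zero] at this
  rw [Matrix.mulVec_sum, Finset.sum_eq_single ⟨(i, j, k), ht⟩, Matrix.mulVec_smul,
    cellIdem_mulVec_of_mem (hw i j k), smul_eq_zero] at this
  · exact this.resolve_right (h0 i j k ht)
  · rintro ⟨⟨i', j', k'⟩, ht'⟩ _ hne
    rw [Matrix.mulVec_smul, cellIdem_mulVec_of_ne (hw i' j' k'), smul_zero]
    exact fun h => hne (Subtype.ext h.symm)
  · exact fun h => absurd hS h

/-- The linear span of the standard basis generated by `f`. -/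
def stdSpan (x H : Subsp K D) (ν μ ρ : ℤ) (f : Subsp K D → ℂ) : Submodule ℂ (Subsp K D → ℂ) :=
  Submodule.span ℂ (Set.range fun t : indexRange D ν μ ρ =>
    stdVec x H ν μ t.1.1 t.1.2.1 t.1.2.2 f)

theorem stdVec_mem_stdSpan (hf : f ∈ F.lowestSpace ν μ ρ) (i j k : ℤ) :
    stdVec x H ν μ i j k f ∈ stdSpan x H ν μ ρ f := by
  by_cases h : (i, j, k) ∈ indexRange D ν μ ρ
  · exact Submodule.subset_span ⟨⟨(i, j, k), h⟩, rfl⟩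
  · rw [stdVec_outside hf h]; exact Submodule.zero_mem _

/-- The index range is exactly the part of the ladder that survives, so every formula for a
generator ends either at a basis vector or at zero. -/
theorem stdSpan_stable (hxH : x ≤ H) (hH : Module.finrank K H = 2 * D)
    (hf : f ∈ F.lowestSpace ν μ ρ) : ∀ M ∈ ({L₁ x H, L₂ x H, L₃ x H, R₁ x H, R₂ x H, R₃ x H} ∪
      {M | ∃ i j k : ℤ, M = cellIdem x H i j k} : Set (Matrix (Subsp K D) (Subsp K D) ℂ)),
      ∀ u ∈ stdSpan x H ν μ ρ f, M *ᵥ u ∈ stdSpan x H ν μ ρ f := by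
  intro M hM
  suffices h : ∀ i j k, (i, j, k) ∈ indexRange D ν μ ρ →
      M *ᵥ stdVec x H ν μ i j k f ∈ stdSpan x H ν μ ρ f by
    have : stdSpan x H ν μ ρ f ≤ (stdSpan x H ν μ ρ f).comap M.mulVecLin := by
      refine Submodule.span_le.2 ?_
      rintro _ ⟨⟨⟨i, j, k⟩, ht⟩, rfl⟩
      exact h i j k ht
    exact this
  intro i j k h
  have hm := stdVec_mem_stdSpan hf
  rcases hM with hM | ⟨i', j', k', rfl⟩
  · simp only [Set.mem_insert_iff, Set.mem_singleton_iff] at hM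
    rcases hM with rfl | rfl | rfl | rfl | rfl | rfl
    · rw [stdVec_L₁ hxH hH hf h]; exact Submodule.smul_mem _ _ (hm _ _ _)
    · rw [stdVec_L₂ hxH hH hf h]; exact Submodule.smul_mem _ _ (hm _ _ _)
    · rw [stdVec_L₃ hxH hH hf h]; exact Submodule.smul_mem _ _ (hm _ _ _)
    · rw [stdVec_R₁ hxH hH hf h]; exact Submodule.smul_mem _ _ (hm _ _ _)
    · rw [stdVec_R₂ hxH hH hf h]; exact Submodule.smul_mem _ _ (hm _ _ _)
    · rw [stdVec_R₃ hxH hH hf h]; exact hm _ _ _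
  · have hc := stdVec_mem_cellSpace (FlagDecomposition.mem_lowestSpace.1 hf).1 i j k
    by_cases he : (i', j', k') = (i, j, k)
    · obtain ⟨rfl, rfl, rfl⟩ : i' = i ∧ j' = j ∧ k' = k := by simpa using he
      rw [cellIdem_mulVec_of_mem hc]; exact hm _ _ _
    · rw [cellIdem_mulVec_of_ne hc he]; exact Submodule.zero_mem _

theorem algH_eq (x H : Subsp K D) : algH x H = Algebra.adjoin ℂ
    ({L₁ x H, L₂ x H, L₃ x H, R₁ x H, R₂ x H, R₃ x H} ∪
      {M | ∃ i j k : ℤ, M = cellIdem x H i j k}) := by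
  rw [algH]

/-- The module generated by `f`. -/
noncomputable def stdModule (hxH : x ≤ H) (hH : Module.finrank K H = 2 * D)
    (hf : f ∈ F.lowestSpace ν μ ρ) : Submodule (algH x H) (Subsp K D → ℂ) :=
  submoduleOfStable (algH_eq x H) (stdSpan x H ν μ ρ f) (stdSpan_stable hxH hH hf)

theorem mem_stdModule {hxH : x ≤ H} {hH : Module.finrank K H = 2 * D}
    {hf : f ∈ F.lowestSpace ν μ ρ} {u : Subsp K D → ℂ} :
    u ∈ stdModule hxH hH hf ↔ u ∈ stdSpan x H ν μ ρ f := Iff.rfl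

theorem restrictScalars_stdModule {hxH : x ≤ H} {hH : Module.finrank K H = 2 * D}
    {hf : f ∈ F.lowestSpace ν μ ρ} :
    (stdModule hxH hH hf).restrictScalars ℂ = stdSpan x H ν μ ρ f := by
  rw [stdModule, restrictScalars_submoduleOfStable]

theorem isStandardBasis_stdVec (hxH : x ≤ H) (hH : Module.finrank K H = 2 * D)
    (hf : f ∈ F.lowestSpace ν μ ρ) (h0 : f ≠ 0) :
    IsStandardBasis x H (stdModule hxH hH hf) ν μ ρ fun i j k => stdVec x H ν μ i j k f := by
  have hc := stdVec_mem_cellSpace (FlagDecomposition.mem_lowestSpace.1 hf).1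
  constructor
  · exact linearIndependent_of_cells (w := fun i j k => stdVec x H ν μ i j k f) hc
      fun _ _ _ h => stdVec_ne_zero hxH hH hf h0 h
  · rw [restrictScalars_stdModule, stdSpan]
  · exact fun i j k _ => ⟨_, mem_stdModule.2 (stdVec_mem_stdSpan hf i j k),
      (cellIdem_mulVec_of_mem (hc i j k)).symm⟩
  · exact fun _ _ _ h => stdVec_outside hf h
  · exact fun _ _ _ h => stdVec_L₁ hxH hH hf h
  · exact fun _ _ _ h => stdVec_R₁ hxH hH hf h
  · exact fun _ _ _ h => stdVec_L₂ hxH hH hf h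
  · exact fun _ _ _ h => stdVec_R₂ hxH hH hf h
  · exact fun _ _ _ h => stdVec_L₃ hxH hH hf h
  · exact fun _ _ _ h => stdVec_R₃ hxH hH hf h

end Std
end TwistedGrassmann

/-! ### Standard bases: simplicity, endpoints and uniqueness -/

namespace TwistedGrassmann

universe u

variable {K : Type u} [Field K] [Fintype K] {D : ℕ} {x H : Subsp K D}

theorem mem_algH_of_mem {M : Matrix (Subsp K D) (Subsp K D) ℂ}
    (hM : M ∈ ({L₁ x H, L₂ x H, L₃ x H, R₁ x H, R₂ x H, R₃ x H} ∪
      {M | ∃ i j k : ℤ, M = cellIdem x H i j k} : Set (Matrix (Subsp K D) (Subsp K D) ℂ))) :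
    M ∈ algH x H := by
  rw [algH_eq]; exact Algebra.subset_adjoin hM

theorem L₁_mem_algH (x H : Subsp K D) : L₁ x H ∈ algH x H := mem_algH_of_mem (by simp)
theorem L₂_mem_algH (x H : Subsp K D) : L₂ x H ∈ algH x H := mem_algH_of_mem (by simp)
theorem L₃_mem_algH (x H : Subsp K D) : L₃ x H ∈ algH x H := mem_algH_of_mem (by simp)
theorem R₁_mem_algH (x H : Subsp K D) : R₁ x H ∈ algH x H := mem_algH_of_mem (by simp)
theorem R₂_mem_algH (x H : Subsp K D) : R₂ x H ∈ algH x H := mem_algH_of_mem (by simp)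
theorem R₃_mem_algH (x H : Subsp K D) : R₃ x H ∈ algH x H := mem_algH_of_mem (by simp)
theorem cellIdem_mem_algH (x H : Subsp K D) (i j k : ℤ) : cellIdem x H i j k ∈ algH x H :=
  mem_algH_of_mem (Or.inr ⟨i, j, k, rfl⟩)

/-- A nonzero function has a nonzero component in some cell. -/
theorem exists_cellIdem_ne_zero {f : Subsp K D → ℂ} (hf : f ≠ 0) :
    ∃ i j k : ℤ, cellIdem x H i j k *ᵥ f ≠ 0 := by
  classical
  obtain ⟨y, hy⟩ := Function.ne_iff.1 hf
  refine ⟨Module.finrank K ↥(x ⊓ y), Module.finrank K ↥(H ⊓ y) - Module.finrank K ↥(x ⊓ y),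
    Module.finrank K y - Module.finrank K ↥(H ⊓ y), fun h => hy ?_⟩
  have := congrFun h y
  rwa [cellIdem_mulVec, Set.indicator_of_mem] at this
  exact ⟨rfl, by ring, by ring⟩

section Sums

variable {i j k : ℤ} {f : Subsp K D → ℂ} (hxH : x ≤ H) (hx : Module.finrank K x + 1 = D)
  (hH : Module.finrank K H = 2 * D)

theorem sum_cellIdem_mulVec {s t : Finset ℤ} {g : ℤ → ℤ → ℤ × ℤ × ℤ} (hg : ∀ a b c d,
    g a b = g c d → a = c ∧ b = d)
    (hf : f ∈ cellSpace x H i j k) :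
    (∑ a ∈ s, ∑ b ∈ t, cellIdem x H (g a b).1 (g a b).2.1 (g a b).2.2) *ᵥ f =
      if ∃ a ∈ s, ∃ b ∈ t, g a b = (i, j, k) then f else 0 := by
  classical
  simp_rw [Matrix.sum_mulVec]
  split_ifs with h
  · obtain ⟨a, ha, b, hb, hab⟩ := h
    rw [Finset.sum_eq_single_of_mem a ha, Finset.sum_eq_single_of_mem b hb, hab,
      cellIdem_mulVec_of_mem hf]
    · intro b' _ hne
      refine cellIdem_mulVec_of_ne hf fun h => hne ?_
      exact (hg _ _ _ _ ((show g a b' = _ from h).trans hab.symm)).2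
    · intro a' _ hne
      refine Finset.sum_eq_zero fun b' _ => cellIdem_mulVec_of_ne hf fun h => hne ?_
      exact (hg _ _ _ _ ((show g a' b' = _ from h).trans hab.symm)).1
  · refine Finset.sum_eq_zero fun a ha => Finset.sum_eq_zero fun b hb =>
      cellIdem_mulVec_of_ne hf fun h' => h ⟨a, ha, b, hb, h'⟩

/-- The summation ranges exhaust the nonempty cells, so on a function supported on one cell the sum
tests a single coordinate. -/
theorem sum_cellIdem₁ (hxH : x ≤ H) (hx : Module.finrank K x + 1 = D)
    (hH : Module.finrank K H = 2 * D) (hf : f ∈ cellSpace x H i j k) (i' : ℤ) :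
    (∑ j ∈ Finset.Icc (0 : ℤ) (D + 1), ∑ k ∈ Finset.Icc (0 : ℤ) 1, cellIdem x H i' j k) *ᵥ f =
      if i' = i then f else 0 := by
  classical
  rw [sum_cellIdem_mulVec (g := fun a b => (i', a, b)) (by simp) hf]
  by_cases h0 : f = 0
  · simp [h0]
  obtain ⟨-, ⟨h1, h2⟩, h3, h4⟩ := cell_bounds_of_ne_zero hxH hx hH hf h0
  congr 1
  simp only [Finset.mem_Icc, Prod.mk.injEq, eq_iff_iff]
  constructor
  · rintro ⟨_, -, _, -, h⟩; tauto
  · exact fun h => ⟨_, ⟨h1, h2⟩, _, ⟨h3, h4⟩, by tauto⟩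

theorem sum_cellIdem₂ (hxH : x ≤ H) (hx : Module.finrank K x + 1 = D)
    (hH : Module.finrank K H = 2 * D) (hf : f ∈ cellSpace x H i j k) (j' : ℤ) :
    (∑ i ∈ Finset.Icc (0 : ℤ) (D - 1), ∑ k ∈ Finset.Icc (0 : ℤ) 1, cellIdem x H i j' k) *ᵥ f =
      if j' = j then f else 0 := by
  classical
  rw [sum_cellIdem_mulVec (g := fun a b => (a, j', b)) (by simp) hf]
  by_cases h0 : f = 0
  · simp [h0]
  obtain ⟨⟨h1, h2⟩, -, h3, h4⟩ := cell_bounds_of_ne_zero hxH hx hH hf h0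
  congr 1
  simp only [Finset.mem_Icc, Prod.mk.injEq, eq_iff_iff]
  constructor
  · rintro ⟨_, -, _, -, h⟩; tauto
  · exact fun h => ⟨_, ⟨h1, h2⟩, _, ⟨h3, h4⟩, by tauto⟩

theorem sum_cellIdem₃ (hxH : x ≤ H) (hx : Module.finrank K x + 1 = D)
    (hH : Module.finrank K H = 2 * D) (hf : f ∈ cellSpace x H i j k) (k' : ℤ) :
    (∑ i ∈ Finset.Icc (0 : ℤ) (D - 1), ∑ j ∈ Finset.Icc (0 : ℤ) (D + 1), cellIdem x H i j k') *ᵥ f =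
      if k' = k then f else 0 := by
  classical
  rw [sum_cellIdem_mulVec (g := fun a b => (a, b, k')) (by simp) hf]
  by_cases h0 : f = 0
  · simp [h0]
  obtain ⟨⟨h1, h2⟩, ⟨h3, h4⟩, -⟩ := cell_bounds_of_ne_zero hxH hx hH hf h0
  congr 1
  simp only [Finset.mem_Icc, Prod.mk.injEq, eq_iff_iff]
  constructor
  · rintro ⟨_, -, _, -, h⟩; tauto
  · exact fun h => ⟨_, ⟨h1, h2⟩, _, ⟨h3, h4⟩, by tauto⟩

end Sums

namespace IsStandardBasis

variable {W : Submodule (algH x H) (Subsp K D → ℂ)} {ν μ ρ : ℤ}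
  {w : ℤ → ℤ → ℤ → (Subsp K D → ℂ)} (hB : IsStandardBasis x H W ν μ ρ w) {i j k : ℤ}

theorem cell (hB : IsStandardBasis x H W ν μ ρ w) (i j k : ℤ) :
    w i j k ∈ cellSpace x H i j k := by
  by_cases h : (i, j, k) ∈ indexRange D ν μ ρ
  · obtain ⟨u, -, hu⟩ := hB.mem_cell i j k h
    rw [hu]; exact cellIdem_mem_cellSpace _ _ _ _
  · rw [hB.zero_outside i j k h]; exact Submodule.zero_mem _

theorem ne_zero (hB : IsStandardBasis x H W ν μ ρ w) (h : (i, j, k) ∈ indexRange D ν μ ρ) :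
    w i j k ≠ 0 :=
  hB.linearIndependent.ne_zero ⟨(i, j, k), h⟩

theorem mem (hB : IsStandardBasis x H W ν μ ρ w) (i j k : ℤ) : w i j k ∈ W := by
  by_cases h : (i, j, k) ∈ indexRange D ν μ ρ
  · have : w i j k ∈ W.restrictScalars ℂ := by
      rw [← hB.span_eq]; exact Submodule.subset_span ⟨⟨(i, j, k), h⟩, rfl⟩
    exact this
  · rw [hB.zero_outside i j k h]; exact Submodule.zero_mem _

theorem le_of_forall_mem (hB : IsStandardBasis x H W ν μ ρ w) {U : Submodule ℂ (Subsp K D → ℂ)}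
    (h : ∀ i j k, (i, j, k) ∈ indexRange D ν μ ρ → w i j k ∈ U) {u : Subsp K D → ℂ} (hu : u ∈ W) :
    u ∈ U := by
  have h1 : u ∈ W.restrictScalars ℂ := hu
  rw [← hB.span_eq] at h1
  refine Submodule.span_le.2 ?_ h1
  rintro _ ⟨⟨⟨i, j, k⟩, ht⟩, rfl⟩
  exact h i j k ht

/-- A matrix that acts on a standard basis module acts nontrivially on some basis vector. -/
theorem exists_of_actsNonzero (hB : IsStandardBasis x H W ν μ ρ w)
    {M : Matrix (Subsp K D) (Subsp K D) ℂ} (h : ActsNonzero M (W : Set (Subsp K D → ℂ))) :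
    ∃ i j k, (i, j, k) ∈ indexRange D ν μ ρ ∧ M *ᵥ w i j k ≠ 0 := by
  by_contra! hM
  obtain ⟨u, hu, hne⟩ := h
  exact hne (hB.le_of_forall_mem (U := LinearMap.ker M.mulVecLin) hM hu)

theorem cellIdem_mem_span (hB : IsStandardBasis x H W ν μ ρ w) {u : Subsp K D → ℂ} (hu : u ∈ W)
    (i j k : ℤ) : ∃ c : ℂ, cellIdem x H i j k *ᵥ u = c • w i j k := by
  have : u ∈ (Submodule.span ℂ {w i j k}).comap (cellIdem x H i j k).mulVecLin := by
    refine hB.le_of_forall_mem (fun i' j' k' _ => ?_) hu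
    rw [Submodule.mem_comap, Matrix.mulVecLin_apply]
    by_cases he : (i, j, k) = (i', j', k')
    · obtain ⟨rfl, rfl, rfl⟩ : i = i' ∧ j = j' ∧ k = k' := by simpa using he
      rw [cellIdem_mulVec_of_mem (hB.cell i j k)]
      exact Submodule.mem_span_singleton_self _
    · rw [cellIdem_mulVec_of_ne (hB.cell i' j' k') he]; exact Submodule.zero_mem _
  obtain ⟨c, hc⟩ := Submodule.mem_span_singleton.1 this
  exact ⟨c, hc.symm⟩

/-- A nonzero vector has a nonzero cell component, and that component is a multiple of one basis
vector because each cell meets the module in at most a line. The lowering matrices bring it down to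
`w ν μ 0` with nonzero coefficients, and the raising matrices then produce the whole basis. -/
theorem le_of_ne_bot (hB : IsStandardBasis x H W ν μ ρ w)
    {U : Submodule (algH x H) (Subsp K D → ℂ)} (hU : U ≤ W) (h0 : U ≠ ⊥) : W ≤ U := by
  have hq := q_ne_zero K
  obtain ⟨u, huU, hu0⟩ := U.ne_bot_iff.1 h0
  obtain ⟨i, j, k, hne⟩ := exists_cellIdem_ne_zero (x := x) (H := H) hu0
  obtain ⟨c, hc⟩ := hB.cellIdem_mem_span (hU huU) i j k
  have hwU : w i j k ∈ U := by
    have h1 := mulVec_mem_of_mem (cellIdem_mem_algH x H i j k) huU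
    rw [hc] at h1 hne
    have h2 := complex_smul_mem c⁻¹ h1
    rwa [inv_smul_smul₀ (left_ne_zero_of_smul hne)] at h2
  have hr : (i, j, k) ∈ indexRange D ν μ ρ := by
    by_contra h
    rw [hc, hB.zero_outside i j k h, smul_zero] at hne
    exact hne rfl
  have cancel : ∀ (c : ℂ) (v : Subsp K D → ℂ), c ≠ 0 → c • v ∈ U → v ∈ U := fun c v hc h => by
    have := complex_smul_mem c⁻¹ h
    rwa [inv_smul_smul₀ hc] at this
  obtain ⟨a, b, rfl, rfl, ha, hb, hk⟩ := mem_indexRange_iff.1 hr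
  have rng : ∀ a' b' : ℕ, (a' : ℤ) ≤ D - 1 - ρ - 2 * ν → (b' : ℤ) ≤ D + 1 + ρ - 2 * μ →
      ∀ k', k' = 0 ∨ k' = 1 → (ν + a', μ + b', k') ∈ indexRange D ν μ ρ :=
    fun a' b' h1 h2 k' h3 => mem_indexRange_iff.2 ⟨a', b', rfl, rfl, h1, h2, h3⟩
  have h0 : w (ν + a) (μ + b) 0 ∈ U := by
    rcases hk with rfl | rfl
    · exact hwU
    · have := mulVec_mem_of_mem (L₃_mem_algH x H) hwU
      rw [hB.L₃_mul _ _ _ hr, sub_self] at this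
      exact cancel _ _ (zpow_ne_zero _ hq) this
  have h1 : ∀ a' : ℕ, (a' : ℤ) ≤ D - 1 - ρ - 2 * ν → w (ν + a') (μ + b) 0 ∈ U →
      w ν (μ + b) 0 ∈ U := fun a' => by
    induction a' with
    | zero => intro _ h; simpa using h
    | succ a' ih =>
      intro h2 h3
      refine ih (by omega) ?_
      have := mulVec_mem_of_mem (L₁_mem_algH x H) h3
      rw [hB.L₁_mul _ _ _ (rng _ _ h2 hb _ (Or.inl rfl))] at this
      have e : ν + ((a' + 1 : ℕ) : ℤ) - 1 = ν + a' := by push_cast; ring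
      rw [e] at this
      refine cancel _ _ (mul_ne_zero (mul_ne_zero (zpow_ne_zero _ hq) ?_) ?_) this <;>
        rw [ne_eq, gauss_eq_zero_iff] <;> omega
  have h2 : ∀ b' : ℕ, (b' : ℤ) ≤ D + 1 + ρ - 2 * μ → w ν (μ + b') 0 ∈ U →
      w ν μ 0 ∈ U := fun b' => by
    induction b' with
    | zero => intro _ h; simpa using h
    | succ b' ih =>
      intro h2 h3
      refine ih (by omega) ?_
      have := mulVec_mem_of_mem (L₂_mem_algH x H) h3
      rw [hB.L₂_mul _ _ _ (by simpa using rng 0 (b' + 1) (by omega) h2 0 (Or.inl rfl))] at this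
      have e : μ + ((b' + 1 : ℕ) : ℤ) - 1 = μ + b' := by push_cast; ring
      rw [e] at this
      refine cancel _ _ (mul_ne_zero (mul_ne_zero (zpow_ne_zero _ hq) ?_) ?_) this <;>
        rw [ne_eq, gauss_eq_zero_iff] <;> omega
  have h3 := h2 b hb (h1 a ha h0)
  have h4 : ∀ b' : ℕ, (b' : ℤ) ≤ D + 1 + ρ - 2 * μ → w ν (μ + b') 0 ∈ U := fun b' => by
    induction b' with
    | zero => intro _; simpa using h3
    | succ b' ih =>
      intro h
      have := mulVec_mem_of_mem (R₂_mem_algH x H) (ih (by omega))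
      rw [hB.R₂_mul _ _ _ (by simpa using rng 0 b' (by omega) (by omega) 0 (Or.inl rfl))] at this
      rw [show μ + ((b' + 1 : ℕ) : ℤ) = μ + b' + 1 by push_cast; ring]
      exact cancel _ _ (zpow_ne_zero _ hq) this
  have h5 : ∀ a' b' : ℕ, (a' : ℤ) ≤ D - 1 - ρ - 2 * ν → (b' : ℤ) ≤ D + 1 + ρ - 2 * μ →
      w (ν + a') (μ + b') 0 ∈ U := fun a' b' => by
    induction a' with
    | zero => intro _ h; simpa using h4 b' h
    | succ a' ih =>
      intro h h'
      have := mulVec_mem_of_mem (R₁_mem_algH x H) (ih (by omega) h')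
      rw [hB.R₁_mul _ _ _ (rng a' b' (by omega) h' 0 (Or.inl rfl))] at this
      rw [show ν + ((a' + 1 : ℕ) : ℤ) = ν + a' + 1 by push_cast; ring]
      exact cancel _ _ (zpow_ne_zero _ hq) this
  intro v hv
  refine hB.le_of_forall_mem (U := U.restrictScalars ℂ) (fun i j k h => ?_) hv
  obtain ⟨a', b', rfl, rfl, ha', hb', rfl | rfl⟩ := mem_indexRange_iff.1 h
  · exact h5 a' b' ha' hb'
  · have := mulVec_mem_of_mem (R₃_mem_algH x H) (h5 a' b' ha' hb')
    rwa [hB.R₃_mul _ _ _ (rng a' b' ha' hb' 0 (Or.inl rfl)), zero_add] at this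

theorem isSimpleModule (hB : IsStandardBasis x H W ν μ ρ w)
    (h0 : (ν, μ, 0) ∈ indexRange D ν μ ρ) : IsSimpleModule (algH x H) W := by
  rw [isSimpleModule_iff_isAtom]
  refine ⟨fun h => hB.ne_zero h0 ?_, fun U hU => ?_⟩
  · have := hB.mem ν μ 0; rwa [h, Submodule.mem_bot] at this
  · by_contra hne
    exact hU.not_ge (hB.le_of_ne_bot hU.le hne)

theorem hasEndpoint (hxH : x ≤ H) (hx : Module.finrank K x + 1 = D)
    (hH : Module.finrank K H = 2 * D) (hB : IsStandardBasis x H W ν μ ρ w)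
    (h0 : (ν, μ, 0) ∈ indexRange D ν μ ρ) : HasEndpoint x H W ν μ 0 ρ := by
  have htop : (D - 1 - ν - ρ, μ, 0) ∈ indexRange D ν μ ρ := by
    obtain ⟨h1, h2, h3, h4, h5, h6⟩ := h0
    exact ⟨h2, le_rfl, h3, h4, h5, h6⟩
  refine ⟨⟨⟨_, hB.mem ν μ 0, ?_⟩, ?_⟩, ⟨⟨_, hB.mem ν μ 0, ?_⟩, ?_⟩, ⟨⟨_, hB.mem ν μ 0, ?_⟩, ?_⟩,
    ⟨⟨_, hB.mem (D - 1 - ν - ρ) μ 0, ?_⟩, ?_⟩⟩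
  · rw [sum_cellIdem₁ hxH hx hH (hB.cell _ _ _), if_pos rfl]; exact hB.ne_zero h0
  · intro i' h
    obtain ⟨i, j, k, hr, hne⟩ := hB.exists_of_actsNonzero h
    rw [sum_cellIdem₁ hxH hx hH (hB.cell _ _ _)] at hne
    obtain rfl : i' = i := by by_contra h; exact hne (if_neg h)
    exact hr.1
  · rw [sum_cellIdem₂ hxH hx hH (hB.cell _ _ _), if_pos rfl]; exact hB.ne_zero h0
  · intro i' h
    obtain ⟨i, j, k, hr, hne⟩ := hB.exists_of_actsNonzero h
    rw [sum_cellIdem₂ hxH hx hH (hB.cell _ _ _)] at hne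
    obtain rfl : i' = j := by by_contra h; exact hne (if_neg h)
    exact hr.2.2.1
  · rw [sum_cellIdem₃ hxH hx hH (hB.cell _ _ _), if_pos rfl]; exact hB.ne_zero h0
  · intro i' h
    obtain ⟨i, j, k, hr, hne⟩ := hB.exists_of_actsNonzero h
    rw [sum_cellIdem₃ hxH hx hH (hB.cell _ _ _)] at hne
    obtain rfl : i' = k := by by_contra h; exact hne (if_neg h)
    exact hr.2.2.2.2.1
  · rw [sum_cellIdem₁ hxH hx hH (hB.cell _ _ _), if_pos rfl]; exact hB.ne_zero htop
  · intro i' h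
    obtain ⟨i, j, k, hr, hne⟩ := hB.exists_of_actsNonzero h
    rw [sum_cellIdem₁ hxH hx hH (hB.cell _ _ _)] at hne
    obtain rfl : i' = i := by by_contra h; exact hne (if_neg h)
    exact hr.2.1

/-- If the lowest index is missing, the whole index range is empty, and then the module is zero. -/
theorem eq_zero_or_range (hB : IsStandardBasis x H W ν μ ρ w) (hW : W ≠ ⊥) :
    (ν, μ, 0) ∈ indexRange D ν μ ρ := by
  by_contra h
  have hemp : ∀ i j k, (i, j, k) ∉ indexRange D ν μ ρ := by
    rintro i j k ⟨h1, h2, h3, h4, h5, h6⟩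
    exact h ⟨le_rfl, h1.trans h2, le_rfl, h3.trans h4, le_rfl, h5.trans h6⟩
  refine hW (W.eq_bot_iff.2 fun u hu => ?_)
  exact hB.le_of_forall_mem (U := ⊥) (fun i j k h => absurd h (hemp i j k)) hu

end IsStandardBasis

theorem HasEndpoint.unique {W : Submodule (algH x H) (Subsp K D → ℂ)} {ν μ ρ ν' μ' ρ' : ℤ}
    (h : HasEndpoint x H W ν μ 0 ρ) (h' : HasEndpoint x H W ν' μ' 0 ρ') :
    ν = ν' ∧ μ = μ' ∧ ρ = ρ' := by
  have h1 := h.1.unique h'.1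
  have h2 := h.2.1.unique h'.2.1
  have h3 := h.2.2.2.unique h'.2.2.2
  omega

theorem HasEndpoint.of_linearEquiv {W W' : Submodule (algH x H) (Subsp K D → ℂ)} {ν μ τ ρ : ℤ}
    (h : HasEndpoint x H W ν μ τ ρ) (φ : W ≃ₗ[algH x H] W') : HasEndpoint x H W' ν μ τ ρ := by
  have key : ∀ M ∈ algH x H, ActsNonzero M (W : Set (Subsp K D → ℂ)) ↔
      ActsNonzero M (W' : Set (Subsp K D → ℂ)) := fun M hM =>
    ⟨fun h => h.of_linearEquiv φ hM, fun h => h.of_linearEquiv φ.symm hM⟩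
  have hs : ∀ (s t : Finset ℤ) (g : ℤ → ℤ → Matrix (Subsp K D) (Subsp K D) ℂ),
      (∀ a b, g a b ∈ algH x H) → ∑ a ∈ s, ∑ b ∈ t, g a b ∈ algH x H := fun s t g hg =>
    Subalgebra.sum_mem _ fun a _ => Subalgebra.sum_mem _ fun b _ => hg a b
  have hc := cellIdem_mem_algH x H
  have e1 := fun i => key _ (hs (Finset.Icc (0 : ℤ) (D + 1)) (Finset.Icc (0 : ℤ) 1)
    (fun j k => cellIdem x H i j k) fun j k => hc i j k)
  have e2 := fun j => key _ (hs (Finset.Icc (0 : ℤ) (D - 1)) (Finset.Icc (0 : ℤ) 1)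
    (fun i k => cellIdem x H i j k) fun i k => hc i j k)
  have e3 := fun k => key _ (hs (Finset.Icc (0 : ℤ) (D - 1)) (Finset.Icc (0 : ℤ) (D + 1))
    (fun i j => cellIdem x H i j k) fun i j => hc i j k)
  unfold HasEndpoint at h ⊢
  simp only [e1, e2, e3] at h
  exact h

section Classification

variable {W : Submodule (algH x H) (Subsp K D → ℂ)} {ν μ ρ : ℤ}
  {w : ℤ → ℤ → ℤ → (Subsp K D → ℂ)}

/-- The vector `w ν μ 0` is killed by `L₁` and `L₂` and is an eigenvector of `L₁ R₁`. A component of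
rank `r` has the eigenvalue `q ^ (ν + μ) [D - 1 - r - 2ν]`, so the components of rank other than `ρ`
vanish. The remaining basis vectors are then forced by the raising matrices. -/
theorem IsStandardBasis.eq_stdVec (hB : IsStandardBasis x H W ν μ ρ w)
    (F : FlagDecomposition x H) (h0 : (ν, μ, 0) ∈ indexRange D ν μ ρ) :
    w ν μ 0 ∈ F.lowestSpace ν μ ρ ∧ ∀ i j k, w i j k = stdVec x H ν μ i j k (w ν μ 0) := by
  have hq := q_ne_zero K
  have hL₁ : L₁ x H *ᵥ w ν μ 0 = 0 := by
    rw [hB.L₁_mul _ _ _ h0, sub_self, (gauss_eq_zero_iff K 0).2 rfl, mul_zero, zero_smul]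
  have hL₂ : L₂ x H *ᵥ w ν μ 0 = 0 := by
    rw [hB.L₂_mul _ _ _ h0, sub_self, (gauss_eq_zero_iff K 0).2 rfl, mul_zero, zero_smul]
  have hLR : L₁ x H *ᵥ (R₁ x H *ᵥ w ν μ 0) = ((Fintype.card K : ℂ) ^ (ν + μ) *
      gauss (Fintype.card K) (D - 1 - ρ - 2 * ν)) • w ν μ 0 := by
    rw [hB.R₁_mul _ _ _ h0, zpow_zero, one_smul]
    by_cases h1 : (ν + 1, μ, 0) ∈ indexRange D ν μ ρ
    · rw [hB.L₁_mul _ _ _ h1, add_sub_cancel_left, add_sub_cancel_right, show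
        gauss (Fintype.card K : ℂ) 1 = 1 by rw [gauss, zpow_one, div_self (one_sub_q_ne_zero K)],
        mul_one]
      congr 3; ring
    -- When the first coordinate has only one value, `R₁` gives zero and the claimed eigenvalue
    -- contains the factor `[0]`.
    · rw [hB.zero_outside _ _ _ h1, Matrix.mulVec_zero]
      obtain ⟨h2, h3, h4, h5, h6, h7⟩ := h0
      have : D - 1 - ρ - 2 * ν = 0 := by
        by_contra hne
        exact h1 ⟨by simp, by simp only at h3 ⊢; omega, h4, h5, h6, h7⟩
      rw [this, (gauss_eq_zero_iff K 0).2 rfl, mul_zero, zero_smul]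
  have hlow : w ν μ 0 ∈ F.lowestSpace ν μ ρ := by
    refine FlagDecomposition.mem_lowestSpace.2 ⟨F.mem_rankSpace.2 ⟨hB.cell _ _ _, fun s hs => ?_⟩,
      hL₁, hL₂⟩
    have h1 := FlagDecomposition.proj_comm₁ F (hB.cell ν μ 0) s
    rw [hL₁, Matrix.mulVec_zero, sub_zero, hLR, map_smul, ← sub_eq_zero, ← sub_smul,
      ← mul_sub, smul_eq_zero] at h1
    refine h1.resolve_left (mul_ne_zero (zpow_ne_zero _ hq) fun h => hs ?_)
    have := gauss_injective K (sub_eq_zero.1 h)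
    omega
  refine ⟨hlow, ?_⟩
  have rng : ∀ a' b' : ℕ, (a' : ℤ) ≤ D - 1 - ρ - 2 * ν → (b' : ℤ) ≤ D + 1 + ρ - 2 * μ →
      ∀ k', k' = 0 ∨ k' = 1 → (ν + a', μ + b', k') ∈ indexRange D ν μ ρ :=
    fun a' b' h1 h2 k' h3 => mem_indexRange_iff.2 ⟨a', b', rfl, rfl, h1, h2, h3⟩
  have hz : ∀ a b : ℕ, (a : ℤ) ≤ D - 1 - ρ - 2 * ν → (b : ℤ) ≤ D + 1 + ρ - 2 * μ →
      w (ν + a) (μ + b) 0 = ladder x H a b (w ν μ 0) := fun a b => by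
    induction a with
    | zero =>
      induction b with
      | zero => intros; simp [ladder_zero_zero]
      | succ b ih =>
        intro ha hb
        have h := hB.R₂_mul _ _ _ (rng 0 b ha (by omega) 0 (Or.inl rfl))
        rw [ih ha (by omega), ← ladder_zero_succ] at h
        rw [h]; simp [add_assoc]
    | succ a ih =>
      intro ha hb
      have h := hB.R₁_mul _ _ _ (rng a b (by omega) hb 0 (Or.inl rfl))
      rw [ih (by omega) hb, ← ladder_succ_left] at h
      rw [h]; simp [add_assoc]
  intro i j k
  by_cases h : (i, j, k) ∈ indexRange D ν μ ρ
  · obtain ⟨a, b, rfl, rfl, ha, hb, rfl | rfl⟩ := mem_indexRange_iff.1 h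
    · rw [stdVec_zero, hz a b ha hb]
    · have h := hB.R₃_mul _ _ _ (rng a b ha hb 0 (Or.inl rfl))
      rw [stdVec_one, ← hz a b ha hb, h, zero_add]
  · rw [hB.zero_outside _ _ _ h, stdVec_outside hlow h]

end Classification
end TwistedGrassmann

/-! ### Simple modules meeting the layer `k = 0` -/

namespace TwistedGrassmann

universe u

variable {K : Type u} [Field K] [Fintype K] {D : ℕ} {x H : Subsp K D} {ν μ ρ : ℤ}

theorem mem_indexRange_of_lowestSpace {F : FlagDecomposition x H} {f : Subsp K D → ℂ}
    (hf : f ∈ F.lowestSpace ν μ ρ) (h0 : f ≠ 0) : (ν, μ, 0) ∈ indexRange D ν μ ρ := by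
  obtain ⟨h1, h2⟩ := le_of_ladder_ne_zero hf (a := 0) (b := 0) (by rwa [ladder_zero_zero])
  exact mem_indexRange_iff.2 ⟨0, 0, by simp, by simp, h1, h2, Or.inl rfl⟩

theorem stdModule_isSimpleModule {F : FlagDecomposition x H} (hxH : x ≤ H)
    (hH : Module.finrank K H = 2 * D) {f : Subsp K D → ℂ}
    (hf : f ∈ F.lowestSpace ν μ ρ) (h0 : f ≠ 0) :
    IsSimpleModule (algH x H) (stdModule hxH hH hf) :=
  (isStandardBasis_stdVec hxH hH hf h0).isSimpleModule (mem_indexRange_of_lowestSpace hf h0)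

theorem stdModule_hasEndpoint {F : FlagDecomposition x H} (hxH : x ≤ H)
    (hx : Module.finrank K x + 1 = D) (hH : Module.finrank K H = 2 * D) {f : Subsp K D → ℂ}
    (hf : f ∈ F.lowestSpace ν μ ρ) (h0 : f ≠ 0) :
    HasEndpoint x H (stdModule hxH hH hf) ν μ 0 ρ :=
  (isStandardBasis_stdVec hxH hH hf h0).hasEndpoint hxH hx hH (mem_indexRange_of_lowestSpace hf h0)

theorem mem_stdModule_self {F : FlagDecomposition x H} {hxH : x ≤ H}
    {hH : Module.finrank K H = 2 * D} {f : Subsp K D → ℂ} (hf : f ∈ F.lowestSpace ν μ ρ) :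
    f ∈ stdModule hxH hH hf := by
  have := stdVec_mem_stdSpan hf (ν + (0 : ℕ)) (μ + (0 : ℕ)) 0
  rw [stdVec_zero, ladder_zero_zero] at this
  exact this

/-- A nonzero algebra submodule that meets the layer `k = 0` contains a lowest vector. -/
theorem exists_mem_lowestSpace (F : FlagDecomposition x H) (hxH : x ≤ H)
    (hx : Module.finrank K x + 1 = D) (hH : Module.finrank K H = 2 * D)
    {W : Submodule (algH x H) (Subsp K D → ℂ)} {i j : ℤ} {u : Subsp K D → ℂ} (hu : u ∈ W)
    (hne : cellIdem x H i j 0 *ᵥ u ≠ 0) :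
    ∃ (ν μ ρ : ℤ) (f : Subsp K D → ℂ), f ∈ F.lowestSpace ν μ ρ ∧ f ≠ 0 ∧ f ∈ W := by
  classical
  -- Among the cells of the layer met by `W`, take one with `i + j` least. Both lowering matrices
  -- then kill the part of `W` in this cell.
  have hex : ∃ n : ℕ, ∃ i j : ℤ, i + j = n ∧ ∃ f ∈ W, f ∈ cellSpace x H i j 0 ∧ f ≠ 0 := by
    have h1 := cellIdem_mem_cellSpace (x := x) (H := H) u i j 0
    obtain ⟨⟨h2, -⟩, ⟨h3, -⟩, -⟩ := cell_bounds_of_ne_zero hxH hx hH h1 hne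
    exact ⟨(i + j).toNat, i, j, by omega, _, mulVec_mem_of_mem (cellIdem_mem_algH x H i j 0) hu,
      h1, hne⟩
  obtain ⟨ν, μ, hn, f₀, hf₀W, hf₀, hf₀0⟩ := Nat.find_spec hex
  have hmin : ∀ i j : ℤ, i + j < ν + μ → ∀ f ∈ W, f ∈ cellSpace x H i j 0 → f = 0 := by
    intro i j hij f hfW hf
    by_contra h0
    obtain ⟨⟨h2, -⟩, ⟨h3, -⟩, -⟩ := cell_bounds_of_ne_zero hxH hx hH hf h0
    refine Nat.find_min hex (m := (i + j).toNat) (by omega) ⟨i, j, by omega, f, hfW, hf, h0⟩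
  have hL₁ : ∀ f ∈ W, f ∈ cellSpace x H ν μ 0 → L₁ x H *ᵥ f = 0 := fun f hfW hf =>
    hmin (ν - 1) μ (by omega) _ (mulVec_mem_of_mem (L₁_mem_algH x H) hfW) (L₁_mem_cellSpace hf)
  have hL₂ : ∀ f ∈ W, f ∈ cellSpace x H ν μ 0 → L₂ x H *ᵥ f = 0 := fun f hfW hf =>
    hmin ν (μ - 1) (by omega) _ (mulVec_mem_of_mem (L₂_mem_algH x H) hfW) (L₂_mem_cellSpace hf)
  let U : Submodule ℂ (Subsp K D → ℂ) := W.restrictScalars ℂ ⊓ cellSpace x H ν μ 0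
  have hT : ∀ f ∈ U, ((L₁ x H).mulVecLin ∘ₗ (R₁ x H).mulVecLin) f ∈ U := fun f hf => by
    refine ⟨mulVec_mem_of_mem (L₁_mem_algH x H) (mulVec_mem_of_mem (R₁_mem_algH x H) hf.1), ?_⟩
    have := L₁_mem_cellSpace (R₁_mem_cellSpace hf.2)
    rwa [add_sub_cancel_right] at this
  have : Nontrivial U := ⟨⟨⟨f₀, hf₀W, hf₀⟩, 0, fun h => hf₀0 (congrArg Subtype.val h)⟩⟩
  -- On this part of `W` the operator `L₁ R₁` acts by scalars that determine the rank, so an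
  -- eigenvector has components of a single rank and is a lowest vector.
  obtain ⟨c, hc⟩ := Module.End.exists_eigenvalue
    (((L₁ x H).mulVecLin ∘ₗ (R₁ x H).mulVecLin).restrict hT)
  obtain ⟨⟨f, hfW, hf⟩, hfe⟩ := hc.exists_hasEigenvector
  have hf0 : f ≠ 0 := fun h => hfe.2 (Subtype.ext h)
  have hLR : L₁ x H *ᵥ (R₁ x H *ᵥ f) = c • f := congrArg Subtype.val hfe.apply_eq_smul
  have hproj : ∀ s, F.proj s f ≠ 0 → c = (Fintype.card K : ℂ) ^ (ν + μ) *
      gauss (Fintype.card K) (D - 1 - F.rk s - 2 * ν) := fun s hs => by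
    have h1 := FlagDecomposition.proj_comm₁ F hf s
    rw [hL₁ f hfW hf, Matrix.mulVec_zero, sub_zero, hLR, map_smul, ← sub_eq_zero,
      ← sub_smul, smul_eq_zero] at h1
    exact sub_eq_zero.1 (h1.resolve_right hs)
  obtain ⟨s, hs⟩ : ∃ s, F.proj s f ≠ 0 := by
    by_contra! h
    refine hf0 ?_
    rw [← F.sum_proj f (suppIn_of_mem_cellSpace hf)]
    exact Finset.sum_eq_zero fun s _ => h s
  refine ⟨ν, μ, F.rk s, f, FlagDecomposition.mem_lowestSpace.2 ⟨F.mem_rankSpace.2 ⟨hf,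
    fun t ht => ?_⟩, hL₁ f hfW hf, hL₂ f hfW hf⟩, hf0, hfW⟩
  by_contra hpt
  have h1 := (hproj s hs).symm.trans (hproj t hpt)
  have := gauss_injective K (mul_left_cancel₀ (zpow_ne_zero _ (q_ne_zero K)) h1)
  omega

/-- The simple modules meeting the layer `k = 0` are generated by lowest vectors. -/
theorem exists_eq_stdModule (F : FlagDecomposition x H) (hxH : x ≤ H)
    (hx : Module.finrank K x + 1 = D) (hH : Module.finrank K H = 2 * D)
    {W : Submodule (algH x H) (Subsp K D → ℂ)} (hW : IsSimpleModule (algH x H) W)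
    (he : HasEndpoint x H W ν μ 0 ρ) :
    ∃ (f : Subsp K D → ℂ) (hf : f ∈ F.lowestSpace ν μ ρ), f ≠ 0 ∧ W = stdModule hxH hH hf := by
  obtain ⟨u, hu, hne⟩ := he.2.2.1.1
  rw [Matrix.sum_mulVec] at hne
  obtain ⟨i, -, hi⟩ := Finset.exists_ne_zero_of_sum_ne_zero hne
  rw [Matrix.sum_mulVec] at hi
  obtain ⟨j, -, hj⟩ := Finset.exists_ne_zero_of_sum_ne_zero hi
  obtain ⟨ν', μ', ρ', f, hf, hf0, hfW⟩ := exists_mem_lowestSpace F hxH hx hH hu hj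
  have hle : stdModule hxH hH hf ≤ W := by
    have hbot : stdModule hxH hH hf ⊓ W ≠ ⊥ := by
      rw [Submodule.ne_bot_iff]
      exact ⟨f, ⟨mem_stdModule_self hf, hfW⟩, hf0⟩
    have := (isStandardBasis_stdVec hxH hH hf hf0).le_of_ne_bot inf_le_left hbot
    exact this.trans inf_le_right
  have heq : W = stdModule hxH hH hf := by
    have hat := isSimpleModule_iff_isAtom.1 hW
    refine ((hat.le_iff.1 hle).resolve_left fun h => hf0 ?_).symm
    have := mem_stdModule_self (hxH := hxH) (hH := hH) hf
    rwa [h, Submodule.mem_bot] at this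
  subst heq
  obtain ⟨rfl, rfl, rfl⟩ := he.unique (stdModule_hasEndpoint hxH hx hH hf hf0)
  exact ⟨f, hf, hf0, rfl⟩

end TwistedGrassmann

/-! ### The dimension of the space of lowest vectors -/

namespace TwistedGrassmann

universe u

variable {K : Type u} [Field K] [Fintype K] {D : ℕ} {x H : Subsp K D}

/-- The difference of two consecutive Gaussian binomial coefficients. -/
noncomputable def gbinomStep (q : ℂ) (m i : ℕ) : ℂ :=
  q ^ i * (1 - q ^ ((m : ℤ) - 2 * i + 1)) * qFac q m / (qFac q i * qFac q ((m : ℤ) - i + 1))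

variable (K) in
theorem gbinomStep_zero (m : ℕ) : gbinomStep (Fintype.card K) m 0 = 1 := by
  have h := qFac_succ (Fintype.card K : ℂ) m
  have h1 := qFac_ne_zero K m
  have h2 := qFac_ne_zero K (m + 1)
  have e : (1 : ℂ) - (Fintype.card K : ℂ) ^ ((m : ℤ) + 1) = 1 - (Fintype.card K : ℂ) ^ (m + 1) := by
    rw [← zpow_natCast]; push_cast; rfl
  rw [gbinomStep]
  simp only [pow_zero, one_mul, Nat.cast_zero, mul_zero, sub_zero, qFac_zero]
  rw [h] at h2
  rw [e, h, mul_comm, div_self h2]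

variable (K) in
theorem gbinomStep_succ {m i : ℕ} (h : i + 1 ≤ m) : gbinomStep (Fintype.card K) m (i + 1) =
    gbinom (Fintype.card K) m (i + 1) - gbinom (Fintype.card K) m i := by
  rw [gbinom_succ_sub K h, gbinomStep]
  push_cast
  have e1 : (m : ℤ) - 2 * (i + 1) + 1 = m - 2 * i - 1 := by ring
  have e2 : (m : ℤ) - (i + 1) + 1 = m - i := by ring
  rw [e1, e2]

namespace FlagDecomposition

variable (F : FlagDecomposition x H)

/-- Below the middle of the lattice the commutator is a positive scalar, so `R₁` is injective on the
cell below and its adjoint `L₁` maps onto it. The kernel has the difference of the two dimensions.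
For `ν = 0` there is no cell below. -/
theorem finrank_inf_ker_L₁ {s : F.idx} {ν b : ℕ} (hν : 2 * ν + F.rk s + 1 ≤ D) :
    (Module.finrank ℂ ↥(F.I s ⊓ cellSpace x H ν (F.rk s + b) 0 ⊓
      LinearMap.ker (L₁ x H).mulVecLin) : ℂ) =
      gbinomStep (Fintype.card K) (D - 1 - F.rk s) ν *
        gbinom (Fintype.card K) (D + 1 - F.rk s) b := by
  rcases ν with - | ν
  · have : F.I s ⊓ cellSpace x H (0 : ℕ) (F.rk s + b) 0 ⊓ LinearMap.ker (L₁ x H).mulVecLin =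
        F.I s ⊓ cellSpace x H (0 : ℕ) (F.rk s + b) 0 := by
      refine inf_eq_left.2 fun f hf => ?_
      exact cellSpace_eq_zero_of_neg (L₁_mem_cellSpace hf.2) (by norm_num)
    rw [this, F.finrank s 0 b, gbinomStep_zero]
    simp [gbinom]
  · have h := finrank_inf_ker_add (L₁ x H) (F.I s ⊓ cellSpace x H (ν + 1 : ℕ) (F.rk s + b) 0)
      (F.I s ⊓ cellSpace x H ν (F.rk s + b) 0)
      (fun f hf => ⟨F.L₁_mem s f hf.1, by simpa using L₁_mem_cellSpace hf.2⟩)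
      (fun f hf => by
        rw [conjTranspose_L₁]
        exact ⟨F.R₁_mem s f hf.1, by simpa using R₁_mem_cellSpace hf.2⟩)
      (fun f hf h0 => by
        have h1 := F.comm₁ s f hf.1 _ _ hf.2
        rw [gauss_card_eq_ofReal, ← conjTranspose_L₁] at h1
        refine eq_zero_of_conjTranspose_mulVec (c := (Fintype.card K : ℝ) ^
          ((ν : ℤ) + (F.rk s + b)) * ((1 - (Fintype.card K : ℝ) ^ ((D : ℤ) - 1 - F.rk s - 2 * ν)) /
          (1 - (Fintype.card K : ℝ)))) ?_ ?_ h0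
        · have := one_lt_card_field K
          exact mul_pos (by positivity) (gaussReal_pos K (by omega))
        · rw [h1]; push_cast; rfl)
    have h' := congrArg (Nat.cast : ℕ → ℂ) h
    rw [Nat.cast_add, F.finrank, F.finrank] at h'
    rw [gbinomStep_succ K (by omega), sub_mul]
    linear_combination h'

/-- The same argument for `L₂` inside the kernel of `L₁`; this kernel is stable under `L₂` and `R₂`
because `L₂ L₁ = q L₁ L₂` and `L₁ R₂ = R₂ L₁`. -/
theorem finrank_inf_ker_L₁_ker_L₂ {s : F.idx} {ν b : ℕ} (hν : 2 * ν + F.rk s + 1 ≤ D)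
    (hb : 2 * b + F.rk s ≤ D + 1) :
    (Module.finrank ℂ ↥(F.I s ⊓ cellSpace x H ν (F.rk s + b) 0 ⊓
      LinearMap.ker (L₁ x H).mulVecLin ⊓ LinearMap.ker (L₂ x H).mulVecLin) : ℂ) =
      gbinomStep (Fintype.card K) (D - 1 - F.rk s) ν *
        gbinomStep (Fintype.card K) (D + 1 - F.rk s) b := by
  rcases b with - | b
  · have : F.I s ⊓ cellSpace x H ν (F.rk s + (0 : ℕ)) 0 ⊓ LinearMap.ker (L₁ x H).mulVecLin ⊓
        LinearMap.ker (L₂ x H).mulVecLin = F.I s ⊓ cellSpace x H ν (F.rk s + (0 : ℕ)) 0 ⊓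
        LinearMap.ker (L₁ x H).mulVecLin := by
      refine inf_eq_left.2 fun f hf => ?_
      exact F.eq_zero_of_lt s _ (F.L₂_mem s f hf.1.1) _ _ (L₂_mem_cellSpace hf.1.2)
        (by push_cast; omega)
    rw [this, F.finrank_inf_ker_L₁ hν, gbinomStep_zero]
    simp [gbinom]
  · have h := finrank_inf_ker_add (L₂ x H)
      (F.I s ⊓ cellSpace x H ν (F.rk s + (b + 1 : ℕ)) 0 ⊓ LinearMap.ker (L₁ x H).mulVecLin)
      (F.I s ⊓ cellSpace x H ν (F.rk s + b) 0 ⊓ LinearMap.ker (L₁ x H).mulVecLin)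
      (fun f hf => ⟨⟨F.L₂_mem s f hf.1.1, by
          have := L₂_mem_cellSpace hf.1.2
          rwa [Nat.cast_add, Nat.cast_one, ← add_assoc, add_sub_cancel_right] at this⟩, by
        have h1 := F.L₂_L₁ s f hf.1.1
        rw [show L₁ x H *ᵥ f = 0 from hf.2, Matrix.mulVec_zero, eq_comm, smul_eq_zero] at h1
        exact h1.resolve_left (q_ne_zero K)⟩)
      (fun f hf => by
        rw [conjTranspose_L₂]
        refine ⟨⟨F.R₂_mem s f hf.1.1, ?_⟩, ?_⟩
        · rw [Nat.cast_add, Nat.cast_one, ← add_assoc]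
          exact R₂_mem_cellSpace hf.1.2
        · have h1 := F.L₁_R₂ s f hf.1.1
          rwa [show L₁ x H *ᵥ f = 0 from hf.2, Matrix.mulVec_zero] at h1)
      (fun f hf h0 => by
        have h1 := F.comm₂ s f hf.1.1 _ _ hf.1.2
        rw [gauss_card_eq_ofReal, ← conjTranspose_L₂] at h1
        refine eq_zero_of_conjTranspose_mulVec (c := (Fintype.card K : ℝ) ^
          ((D : ℤ) - 1 - ν + (F.rk s + b) - F.rk s) *
          ((1 - (Fintype.card K : ℝ) ^ ((D : ℤ) + 1 + F.rk s - 2 * (F.rk s + b))) /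
          (1 - (Fintype.card K : ℝ)))) ?_ ?_ h0
        · have := one_lt_card_field K
          exact mul_pos (by positivity) (gaussReal_pos K (by omega))
        · rw [h1]; push_cast; rfl)
    have h' := congrArg (Nat.cast : ℕ → ℂ) h
    rw [Nat.cast_add, F.finrank_inf_ker_L₁ hν, F.finrank_inf_ker_L₁ hν] at h'
    rw [gbinomStep_succ K (by omega), mul_sub]
    linear_combination h'

/-- The projections to the summands of rank `ρ` identify the space with the product of its parts in
these summands. -/
theorem finrank_lowestSpace_eq_sum (ν μ ρ : ℤ) : Module.finrank ℂ (F.lowestSpace ν μ ρ) =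
    ∑ s : {s : F.idx // (F.rk s : ℤ) = ρ}, Module.finrank ℂ ↥(F.I s ⊓ cellSpace x H ν μ 0 ⊓
      LinearMap.ker (L₁ x H).mulVecLin ⊓ LinearMap.ker (L₂ x H).mulVecLin) := by
  classical
  have hmem : ∀ f ∈ F.lowestSpace ν μ ρ, ∀ s : {s : F.idx // (F.rk s : ℤ) = ρ},
      F.proj s f ∈ F.I s ⊓ cellSpace x H ν μ 0 ⊓
      LinearMap.ker (L₁ x H).mulVecLin ⊓ LinearMap.ker (L₂ x H).mulVecLin := fun f hf s => by
    obtain ⟨h1, h2, h3⟩ := mem_lowestSpace.1 hf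
    have h4 := (F.mem_rankSpace.1 h1).1
    refine ⟨⟨⟨F.proj_mem s f, F.proj_mem_cellSpace h4 s⟩, ?_⟩, ?_⟩
    · change L₁ x H *ᵥ F.proj s f = 0
      rw [← F.proj_L₁ (suppIn_of_mem_cellSpace h4), h2, map_zero]
    · change L₂ x H *ᵥ F.proj s f = 0
      rw [← F.proj_L₂ (suppIn_of_mem_cellSpace h4), h3, map_zero]
  let φ : F.lowestSpace ν μ ρ →ₗ[ℂ] Π s : {s : F.idx // (F.rk s : ℤ) = ρ},
      ↥(F.I s ⊓ cellSpace x H ν μ 0 ⊓ LinearMap.ker (L₁ x H).mulVecLin ⊓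
        LinearMap.ker (L₂ x H).mulVecLin) :=
    LinearMap.pi fun s => (F.proj s ∘ₗ (F.lowestSpace ν μ ρ).subtype).codRestrict _
      fun f => hmem f f.2 s
  have hφ : ∀ f s, (φ f s : Subsp K D → ℂ) = F.proj s f := fun _ _ => rfl
  have hinj : Function.Injective φ := by
    rw [← LinearMap.ker_eq_bot, LinearMap.ker_eq_bot']
    intro f hf
    obtain ⟨h1, h2, h3⟩ := mem_lowestSpace.1 f.2
    have h4 := F.mem_rankSpace.1 h1
    refine Subtype.ext ?_
    rw [← F.sum_proj f.1 (suppIn_of_mem_cellSpace h4.1)]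
    refine Finset.sum_eq_zero fun s _ => ?_
    by_cases hs : (F.rk s : ℤ) = ρ
    · rw [← hφ f ⟨s, hs⟩, hf]; rfl
    · exact h4.2 s hs
  have hsurj : Function.Surjective φ := by
    intro g
    have hp : ∀ t, F.proj t (∑ s, (g s : Subsp K D → ℂ)) =
        if h : (F.rk t : ℤ) = ρ then (g ⟨t, h⟩ : Subsp K D → ℂ) else 0 := fun t => by
      rw [map_sum]
      split_ifs with h
      · rw [Finset.sum_eq_single_of_mem ⟨t, h⟩ (Finset.mem_univ _)]
        · exact F.proj_of_mem t _ (g ⟨t, h⟩).2.1.1.1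
        · intro s _ hne
          exact F.proj_of_ne t s (fun e => hne (Subtype.ext e.symm)) _ (g s).2.1.1.1
      · refine Finset.sum_eq_zero fun s _ => F.proj_of_ne t s (fun e => h ?_) _ (g s).2.1.1.1
        rw [e]; exact s.2
    refine ⟨⟨∑ s, (g s : Subsp K D → ℂ), mem_lowestSpace.2 ⟨F.mem_rankSpace.2 ⟨?_, ?_⟩, ?_, ?_⟩⟩, ?_⟩
    · exact Submodule.sum_mem _ fun s _ => (g s).2.1.1.2
    · intro t ht; rw [hp, dif_neg ht]
    · rw [Matrix.mulVec_sum]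
      exact Finset.sum_eq_zero fun s _ => (g s).2.1.2
    · rw [Matrix.mulVec_sum]
      exact Finset.sum_eq_zero fun s _ => (g s).2.2
    · ext1 s
      refine Subtype.ext ?_
      rw [hφ, hp, dif_pos s.2]
  rw [(LinearEquiv.ofBijective φ ⟨hinj, hsurj⟩).finrank_eq, Module.finrank_pi_fintype]

/-- Every summand of rank `ρ` contributes the same product of two steps, and there are as many
summands as maps of rank `ρ`. The factorials `(q)_{D-1-ρ}` and `(q)_{D+1-ρ}` cancel. -/
theorem finrank_lowestSpace {ν b ρ : ℕ} (hν : 2 * ν + ρ + 1 ≤ D) (hb : 2 * b + ρ ≤ D + 1) :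
    (Module.finrank ℂ (F.lowestSpace ν (ρ + b) ρ) : ℂ) =
      (qFac (Fintype.card K) (D - 1) * qFac (Fintype.card K) (D + 1)) *
      ((-1) ^ ρ * (Fintype.card K : ℂ) ^ (ρ.choose 2 + ν + b) *
        (1 - (Fintype.card K : ℂ) ^ ((D : ℤ) - ρ - 2 * ν)) *
        (1 - (Fintype.card K : ℂ) ^ ((D : ℤ) + 2 - ρ - 2 * b)) /
      (qFac (Fintype.card K) ρ * qFac (Fintype.card K) ν * qFac (Fintype.card K) (D - ρ - ν) *
        qFac (Fintype.card K) b * qFac (Fintype.card K) (D + 2 - ρ - b))) := by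
  have hF := qFac_ne_zero K
  rw [finrank_lowestSpace_eq_sum, Nat.cast_sum]
  have h1 : ∀ s : {s : F.idx // (F.rk s : ℤ) = ρ},
      (Module.finrank ℂ ↥(F.I s ⊓ cellSpace x H ν (ρ + b) 0 ⊓
      LinearMap.ker (L₁ x H).mulVecLin ⊓ LinearMap.ker (L₂ x H).mulVecLin) : ℂ) =
      gbinomStep (Fintype.card K) (D - 1 - ρ) ν *
        gbinomStep (Fintype.card K) (D + 1 - ρ) b := fun s => by
    have hs : F.rk s.1 = ρ := by exact_mod_cast s.2
    have := F.finrank_inf_ker_L₁_ker_L₂ (s := s.1) (ν := ν) (b := b) (by omega) (by omega)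
    rwa [hs] at this
  rw [Finset.sum_congr rfl fun s _ => h1 s, Finset.sum_const, Finset.card_univ, nsmul_eq_mul]
  have h2 : (Fintype.card {s : F.idx // (F.rk s : ℤ) = ρ} : ℂ) =
      gbinom (Fintype.card K) (D - 1) ρ *
      ∏ l ∈ Finset.range ρ, ((Fintype.card K : ℂ) ^ (D + 1) - (Fintype.card K : ℂ) ^ l) := by
    rw [← F.card ρ (by omega), Nat.card_eq_fintype_card]
    norm_cast
  rw [h2, gbinom_eq_div K (by omega), prod_pow_sub_pow K (by omega), gbinomStep, gbinomStep]
  have e1 : ((D - 1 : ℕ) : ℤ) = D - 1 := by omega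
  have e2 : ((D - 1 - ρ : ℕ) : ℤ) = D - 1 - ρ := by omega
  have e3 : ((D + 1 - ρ : ℕ) : ℤ) = D + 1 - ρ := by omega
  have e4 : (D : ℤ) - 1 - ρ - 2 * ν + 1 = D - ρ - 2 * ν := by ring
  have e5 : (D : ℤ) - 1 - ρ - ν + 1 = D - ρ - ν := by ring
  have e6 : (D : ℤ) + 1 - ρ - 2 * b + 1 = D + 2 - ρ - 2 * b := by ring
  have e7 : (D : ℤ) + 1 - ρ - b + 1 = D + 2 - ρ - b := by ring
  rw [e1, e2, e3, e4, e5, e6, e7, Nat.cast_add, Nat.cast_one, pow_add, pow_add]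
  have a1 := hF ρ
  have a2 := hF ν
  have a3 := hF b
  have a4 := hF (D - 1 - ρ)
  have a5 := hF (D + 1 - ρ)
  have a6 := hF (D - ρ - ν)
  have a7 := hF (D + 2 - ρ - b)
  field_simp

end FlagDecomposition
end TwistedGrassmann

/-! ### The adjacency matrix in terms of lowering and raising -/

namespace TwistedGrassmann

universe u

variable {K : Type u} [Field K] [Fintype K] {D : ℕ} {x H : Subsp K D}

/-- `z` covers `y`, and both or none of the two are contained in `H`. -/
def layerRel (H y z : Subsp K D) : Prop :=
  y ≤ z ∧ Module.finrank K ↥(H ⊓ z) = Module.finrank K ↥(H ⊓ y) + 1 ∧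
    Module.finrank K z = Module.finrank K y + 1

/-- A cover enlarges the intersection with `x` by at most one dimension. Hence `L₁ + L₂` and `R₁ +
R₂` depend on `H` only, just as adjacency does not involve `x`. -/
theorem layerRel_iff {y z : Subsp K D} :
    layerRel H y z ↔ lowRel x H 1 0 0 y z ∨ lowRel x H 0 1 0 y z := by
  constructor
  · rintro ⟨h1, h2, h3⟩
    have e1 := Submodule.finrank_mono (inf_le_inf_left x h1)
    have e2 := Submodule.finrank_sup_add_finrank_inf_eq (x ⊓ z) y
    have e3 : x ⊓ z ⊓ y = x ⊓ y := by rw [inf_assoc, inf_eq_right.2 h1]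
    have e4 := Submodule.finrank_mono (sup_le (inf_le_right : x ⊓ z ≤ z) h1)
    rw [e3] at e2
    by_cases h : Module.finrank K ↥(x ⊓ z) = Module.finrank K ↥(x ⊓ y)
    · exact Or.inr ⟨h1, by omega, by omega, by omega⟩
    · exact Or.inl ⟨h1, by omega, by omega, by omega⟩
  · rintro (⟨h1, h2, h3, h4⟩ | ⟨h1, h2, h3, h4⟩) <;> exact ⟨h1, by omega, by omega⟩

theorem L₁_add_L₂_mulVec (f : Subsp K D → ℂ) :
    L₁ x H *ᵥ f + L₂ x H *ᵥ f = relSum (layerRel H) f := by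
  classical
  ext y
  rw [Pi.add_apply, L₁_mulVec, L₂_mulVec, relSum_apply, relSum_apply, relSum_apply,
    ← Finset.sum_union]
  · refine Finset.sum_congr ?_ fun _ _ => rfl
    ext z
    simp only [Finset.mem_union, Finset.mem_filter, Finset.mem_univ, true_and]
    exact layerRel_iff.symm
  · rw [Finset.disjoint_left]
    intro z h1 h2
    have := (Finset.mem_filter.1 h1).2.2.1
    have := (Finset.mem_filter.1 h2).2.2.1
    omega

theorem R₁_add_R₂_mulVec (f : Subsp K D → ℂ) :
    R₁ x H *ᵥ f + R₂ x H *ᵥ f = relSum (fun y z => layerRel H z y) f := by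
  classical
  ext y
  rw [Pi.add_apply, R₁_mulVec, R₂_mulVec, relSum_apply, relSum_apply, relSum_apply,
    ← Finset.sum_union]
  · refine Finset.sum_congr ?_ fun _ _ => rfl
    ext z
    simp only [Finset.mem_union, Finset.mem_filter, Finset.mem_univ, true_and]
    exact layerRel_iff.symm
  · rw [Finset.disjoint_left]
    intro z h1 h2
    have := (Finset.mem_filter.1 h1).2.2.1
    have := (Finset.mem_filter.1 h2).2.2.1
    omega

/-- The adjacency relation of the graph. -/
def adjRel (y z : Subsp K D) : Prop :=
  Module.finrank K y + Module.finrank K z = 2 * Module.finrank K ↥(y ⊓ z) + 2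

open Classical in
theorem adj_mulVec_apply {f : Subsp K D → ℂ}
    (hf : ∀ z, f z ≠ 0 → (Module.finrank K z = D + 1 ∧ ¬ z ≤ H) ∨
      (Module.finrank K z + 1 = D ∧ z ≤ H)) (y : Vertex H) :
    (adj H *ᵥ fun v => f v.1) y = ∑ z with adjRel y.1 z, f z := by
  rw [Matrix.mulVec, dotProduct, Finset.sum_filter]
  refine Finset.sum_of_injOn (fun v : Vertex H => v.1) ?_ ?_ ?_ ?_
  · exact Subtype.val_injective.injOn
  · intro v _; exact Finset.mem_coe.2 (Finset.mem_univ _)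
  · intro z _ hz
    have : f z = 0 := by
      by_contra h
      exact hz ⟨⟨z, hf z h⟩, Finset.mem_coe.2 (Finset.mem_univ _), rfl⟩
    rw [this, ite_self]
  · intro v _
    rw [adj, SimpleGraph.adjMatrix_apply, ite_mul, one_mul, zero_mul]
    rfl

open Classical in
/-- Going down and up again in the lattice of all subspaces. -/
theorem sum_cocovers_covers {f : Subsp K D → ℂ} {y : Subsp K D}
    (hf : ∀ z, f z ≠ 0 → Module.finrank K z = Module.finrank K y) :
    ∑ t ∈ cocovers ⊥ y, ∑ z ∈ covers ⊤ t, f z =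
      gauss (Fintype.card K) (Module.finrank K y) * f y + ∑ z with adjRel y z, f z := by
  have h1 : ∑ t ∈ cocovers ⊥ y, ∑ z ∈ covers ⊤ t, f z =
      ∑ z : Subsp K D, ∑ t ∈ cocovers ⊥ y ∩ cocovers ⊥ z, f z := by
    refine Finset.sum_comm' fun t z => ?_
    simp only [Finset.mem_inter, mem_cocovers, mem_covers, Finset.mem_univ, and_true, le_top,
      bot_le, true_and]
    constructor
    · rintro ⟨h1, h2, h3⟩; exact ⟨h1, h2, h3.symm⟩
    · rintro ⟨h1, h2, h3⟩; exact ⟨h1, h2, h3.symm⟩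
  rw [h1, Finset.sum_filter]
  rw [show gauss (Fintype.card K : ℂ) (Module.finrank K y) * f y = ∑ z : Subsp K D,
    if z = y then gauss (Fintype.card K : ℂ) (Module.finrank K z) * f z else 0 by
      rw [Finset.sum_ite_eq' Finset.univ y, if_pos (Finset.mem_univ y)],
    ← Finset.sum_add_distrib]
  refine Finset.sum_congr rfl fun z _ => ?_
  rw [Finset.sum_const, nsmul_eq_mul]
  by_cases hz0 : f z = 0
  · simp [hz0]
  have hz := hf z hz0
  by_cases hzy : z = y
  · subst hzy
    rw [if_pos rfl, if_neg, add_zero, Finset.inter_self, card_cocovers bot_le, finrank_bot,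
      Nat.cast_zero, sub_zero]
    rw [adjRel, inf_idem]; omega
  · rw [if_neg hzy, zero_add]
    have hlt : Module.finrank K ↥(y ⊓ z) < Module.finrank K y := by
      refine Submodule.finrank_lt_finrank_of_lt (lt_of_le_of_ne inf_le_left fun h => hzy ?_)
      exact (Submodule.eq_of_le_of_finrank_eq (inf_eq_left.1 h) hz.symm).symm
    split_ifs with ha
    · rw [adjRel] at ha
      have : cocovers ⊥ y ∩ cocovers ⊥ z = {y ⊓ z} := by
        ext t
        rw [Finset.mem_inter, mem_cocovers, mem_cocovers, Finset.mem_singleton]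
        constructor
        · rintro ⟨⟨-, h2, h3⟩, -, h5, h6⟩
          exact Submodule.eq_of_le_of_finrank_eq (le_inf h2 h5) (by omega)
        · rintro rfl
          exact ⟨⟨bot_le, inf_le_left, by omega⟩, bot_le, inf_le_right, by omega⟩
      rw [this]; simp
    · have : cocovers ⊥ y ∩ cocovers ⊥ z = ∅ := by
        rw [Finset.eq_empty_iff_forall_notMem]
        intro t ht
        rw [Finset.mem_inter, mem_cocovers, mem_cocovers] at ht
        obtain ⟨⟨-, h2, h3⟩, -, h5, h6⟩ := ht
        have := Submodule.finrank_mono (le_inf h2 h5)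
        exact ha (by rw [adjRel]; omega)
      rw [this]; simp

theorem vertex_of_sub {i j : ℤ} (hij : i + j = D - 1) {z : Subsp K D}
    (hz : z ∈ cell x H i j 0) : Module.finrank K z + 1 = D ∧ z ≤ H := by
  obtain ⟨h1, h2, h3⟩ := hz
  refine ⟨by omega, inf_eq_right.1 (Submodule.eq_of_le_of_finrank_eq inf_le_right ?_)⟩
  omega

theorem vertex_of_sup {i j : ℤ} (hij : i + j = D) {z : Subsp K D}
    (hz : z ∈ cell x H i j 1) : Module.finrank K z = D + 1 ∧ ¬ z ≤ H := by
  obtain ⟨h1, h2, h3⟩ := hz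
  refine ⟨by omega, fun h => ?_⟩
  rw [inf_eq_right.2 h] at h2
  omega

variable {i j : ℤ} {f : Subsp K D → ℂ}

/-- The adjacency matrix on the functions supported on the vertices in `H`. -/
theorem adj_mulVec_sub (hxH : x ≤ H) (hH : Module.finrank K H = 2 * D)
    (hf : f ∈ cellSpace x H i j 0) (hij : i + j = D - 1) (y : Vertex H) :
    (adj H *ᵥ fun v => f v.1) y =
      (R₁ x H *ᵥ (L₁ x H *ᵥ f + L₂ x H *ᵥ f) + R₂ x H *ᵥ (L₁ x H *ᵥ f + L₂ x H *ᵥ f)) y.1 -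
        gauss (Fintype.card K) (D - 1) * f y.1 + (R₃ x H *ᵥ (R₁ x H *ᵥ f + R₂ x H *ᵥ f)) y.1 := by
  classical
  have hsupp : ∀ z, f z ≠ 0 → Module.finrank K z + 1 = D ∧ z ≤ H := fun z hz =>
    vertex_of_sub hij (by_contra fun h => hz (hf z h))
  have hR : SuppIn H (R₁ x H *ᵥ f + R₂ x H *ᵥ f) := fun z hz => by
    rw [Pi.add_apply, suppIn_of_mem_cellSpace (R₁_mem_cellSpace hf) z hz,
      suppIn_of_mem_cellSpace (R₂_mem_cellSpace hf) z hz, add_zero]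
  rw [adj_mulVec_apply (fun z hz => Or.inr (hsupp z hz)), R₃_mulVec_apply hxH hH hR,
    R₁_add_R₂_mulVec, R₁_add_R₂_mulVec, L₁_add_L₂_mulVec]
  obtain ⟨y, ⟨hy1, hy2⟩ | ⟨hy1, hy2⟩⟩ := y
  · have hdim := finrank_inf_hyperplane hH hy2
    have h0 : f y = 0 := by by_contra h; exact hy2 (hsupp y h).2
    have h1 : relSum (fun y z => layerRel H z y) (relSum (layerRel H) f) y = 0 := by
      rw [relSum_apply]
      refine Finset.sum_eq_zero fun t ht => ?_
      rw [relSum_apply]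
      refine Finset.sum_eq_zero fun z hz => ?_
      by_contra h
      obtain ⟨a1, a2, a3⟩ := (Finset.mem_filter.1 ht).2
      have htH : t ≤ H := (Finset.mem_filter.1 hz).2.1.trans (hsupp z h).2
      rw [inf_eq_right.2 htH] at a2
      omega
    simp only [h0, h1, if_neg hy2, mul_zero, sub_zero, zero_add]
    rw [relSum_apply, Finset.sum_filter, Finset.sum_filter]
    refine Finset.sum_congr rfl fun z _ => ?_
    by_cases hz : f z = 0
    · rw [hz, ite_self, ite_self]
    obtain ⟨hz1, hz2⟩ := hsupp z hz
    -- The dimensions are `D + 1` for `y` and `D - 1` for `z`, so adjacency means `z ≤ y`, that is,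
    -- `z` is a hyperplane of `H ⊓ y`.
    refine if_congr ⟨fun h => ?_, fun h => ?_⟩ rfl rfl
    · rw [adjRel] at h
      change _ + _ = 2 * Module.finrank K ↥(y ⊓ z) + 2 at h
      have hzy : y ⊓ z = z := Submodule.eq_of_le_of_finrank_eq inf_le_right (by omega)
      refine ⟨le_inf hz2 (inf_eq_right.1 hzy), ?_, by omega⟩
      rw [← inf_assoc, inf_idem, inf_eq_right.2 hz2]; omega
    · rw [adjRel]
      rw [inf_eq_right.2 (h.1.trans inf_le_right)]; omega
  · simp only [if_pos hy2, add_zero]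
    -- Two vertices in `H` of equal dimension: adjacency is a step down and up, from which the `[D -
    -- 1]` paths returning to `y` are removed.
    have h1 := sum_cocovers_covers (f := f) (y := y) fun z hz => by
      have := (hsupp z hz).1; omega
    have h2 : (Module.finrank K y : ℤ) = D - 1 := by omega
    rw [h2, ← sub_eq_iff_eq_add'] at h1
    rw [← h1]
    congr 1
    rw [relSum_apply]
    refine Finset.sum_congr ?_ fun t ht => ?_
    · ext t
      rw [mem_cocovers, Finset.mem_filter]
      constructor
      · rintro ⟨-, a1, a2⟩
        refine ⟨Finset.mem_univ _, a1, ?_, a2.symm⟩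
        rw [inf_eq_right.2 hy2, inf_eq_right.2 (a1.trans hy2)]; exact a2.symm
      · rintro ⟨-, a1, a2, a3⟩
        exact ⟨bot_le, a1, a3.symm⟩
    · rw [relSum_apply]
      have htH : t ≤ H := (Finset.mem_filter.1 ht).2.1.trans hy2
      rw [covers, Finset.sum_filter, Finset.sum_filter]
      refine Finset.sum_congr rfl fun z _ => ?_
      by_cases hz : f z = 0
      · rw [hz, ite_self, ite_self]
      obtain ⟨hz1, hz2⟩ := hsupp z hz
      refine if_congr ⟨fun ⟨a1, _, a3⟩ => ⟨a1, ?_, a3⟩, fun ⟨a1, _, a3⟩ => ⟨a1, le_top, a3⟩⟩ rfl rfl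
      rw [inf_eq_right.2 hz2, inf_eq_right.2 htH, a3]

/-- The adjacency matrix on the functions supported on the vertices not in `H`. -/
theorem adj_mulVec_sup (hxH : x ≤ H) (hH : Module.finrank K H = 2 * D)
    (hf : f ∈ cellSpace x H i j 1) (hij : i + j = D) (y : Vertex H) :
    (adj H *ᵥ fun v => f v.1) y =
      (L₁ x H *ᵥ (L₃ x H *ᵥ f) + L₂ x H *ᵥ (L₃ x H *ᵥ f)) y.1 + (R₃ x H *ᵥ (L₃ x H *ᵥ f)) y.1 -
        gauss (Fintype.card K) (D + 1) * f y.1 +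
      (R₁ x H *ᵥ (L₁ x H *ᵥ f + L₂ x H *ᵥ f) + R₂ x H *ᵥ (L₁ x H *ᵥ f + L₂ x H *ᵥ f)) y.1 := by
  classical
  have hsupp : ∀ z, f z ≠ 0 → Module.finrank K z = D + 1 ∧ ¬ z ≤ H := fun z hz =>
    vertex_of_sup hij (by_contra fun h => hz (hf z h))
  have hL₃ : SuppIn H (L₃ x H *ᵥ f) := suppIn_of_mem_cellSpace
    (by simpa using L₃_mem_cellSpace hf)
  have hL₃a : ∀ t ≤ H, (L₃ x H *ᵥ f) t = ∑ z with ¬ z ≤ H ∧ t = H ⊓ z, f z := fun t ht => by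
    rw [L₃_mulVec, relSum_apply]
    refine Finset.sum_congr (Finset.filter_congr fun z _ => ?_) fun _ _ => rfl
    exact lowRel_zero_zero_one_iff hxH hH ht
  rw [adj_mulVec_apply (fun z hz => Or.inl (hsupp z hz)), R₃_mulVec_apply hxH hH hL₃,
    L₁_add_L₂_mulVec, R₁_add_R₂_mulVec, L₁_add_L₂_mulVec]
  obtain ⟨y, ⟨hy1, hy2⟩ | ⟨hy1, hy2⟩⟩ := y
  · have hdim := finrank_inf_hyperplane hH hy2
    have h0 : relSum (layerRel H) (L₃ x H *ᵥ f) y = 0 := by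
      rw [relSum_apply]
      refine Finset.sum_eq_zero fun t ht => hL₃ t fun h => hy2 ?_
      exact (Finset.mem_filter.1 ht).2.1.trans h
    simp only [h0, if_neg hy2, zero_add]
    have h1 := sum_cocovers_covers (f := f) (y := y) fun z hz => by
      have := (hsupp z hz).1; omega
    have h2 : (Module.finrank K y : ℤ) = D + 1 := by omega
    rw [h2, ← sub_eq_iff_eq_add'] at h1
    rw [← h1, sub_add_eq_add_sub]
    congr 1
    -- Among the hyperplanes of `y` through which a path can go, `H ⊓ y` accounts for the term with
    -- `R₃ L₃`, and those not contained in `H` for the terms within the layer `k = 1`.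
    have hmem : H ⊓ y ∈ cocovers ⊥ y := mem_cocovers.2 ⟨bot_le, inf_le_right, hdim⟩
    rw [← Finset.add_sum_erase _ _ hmem, relSum_apply, hL₃a _ inf_le_left]
    congr 1
    · rw [covers, Finset.sum_filter, Finset.sum_filter]
      refine Finset.sum_congr rfl fun z _ => ?_
      by_cases hz : f z = 0
      · rw [hz, ite_self, ite_self]
      obtain ⟨hz1, hz2⟩ := hsupp z hz
      have hzdim := finrank_inf_hyperplane hH hz2
      refine if_congr ⟨fun ⟨a1, _, a3⟩ => ⟨hz2, ?_⟩, fun ⟨_, a2⟩ => ⟨?_, le_top, ?_⟩⟩ rfl rfl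
      · exact Submodule.eq_of_le_of_finrank_eq (le_inf inf_le_left a1) (by omega)
      · rw [a2]; exact inf_le_right
      · rw [a2]; exact hzdim.symm
    · refine Finset.sum_congr ?_ fun t ht => ?_
      · ext t
        rw [Finset.mem_erase, mem_cocovers, Finset.mem_filter]
        constructor
        · rintro ⟨a0, -, a1, a2⟩
          refine ⟨Finset.mem_univ _, a1, ?_, a2.symm⟩
          have htH : ¬ t ≤ H := fun h => a0
            (Submodule.eq_of_le_of_finrank_eq (le_inf h a1) (by omega))
          have := finrank_inf_hyperplane hH htH
          omega
        · rintro ⟨-, a1, a2, a3⟩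
          refine ⟨fun h => ?_, bot_le, a1, a3.symm⟩
          rw [h, ← inf_assoc, inf_idem] at a2
          omega
      · rw [relSum_apply]
        obtain ⟨a0, a1, a2⟩ := (Finset.mem_filter.1 ht).2
        have htH : ¬ t ≤ H := fun h => by rw [inf_eq_right.2 h] at a1; omega
        have htdim := finrank_inf_hyperplane hH htH
        rw [covers, Finset.sum_filter, Finset.sum_filter]
        refine Finset.sum_congr rfl fun z _ => ?_
        by_cases hz : f z = 0
        · rw [hz, ite_self, ite_self]
        obtain ⟨hz1, hz2⟩ := hsupp z hz
        have hzdim := finrank_inf_hyperplane hH hz2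
        refine if_congr ⟨fun ⟨a1, _, a3⟩ => ⟨a1, ?_, a3⟩, fun ⟨a1, _, a3⟩ => ⟨a1, le_top, a3⟩⟩
          rfl rfl
        omega
  · have h0 : f y = 0 := by by_contra h; exact (hsupp y h).2 hy2
    have h1 : relSum (fun y z => layerRel H z y) (relSum (layerRel H) f) y = 0 := by
      rw [relSum_apply]
      refine Finset.sum_eq_zero fun t ht => ?_
      rw [relSum_apply]
      refine Finset.sum_eq_zero fun z hz => ?_
      by_contra h
      obtain ⟨a1, a2, a3⟩ := (Finset.mem_filter.1 hz).2
      have htH : t ≤ H := (Finset.mem_filter.1 ht).2.1.trans hy2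
      obtain ⟨hz1, hz2⟩ := hsupp z h
      have := finrank_inf_hyperplane hH hz2
      rw [inf_eq_right.2 htH] at a2
      omega
    simp only [h0, h1, if_pos hy2, mul_zero, sub_zero, add_zero]
    have key : relSum (layerRel H) (L₃ x H *ᵥ f) y =
        ∑ z : Subsp K D, ∑ t with layerRel H y t ∧ ¬ z ≤ H ∧ t = H ⊓ z, f z := by
      rw [relSum_apply]
      refine (Finset.sum_congr rfl fun t ht => hL₃a t ?_).trans
        (Finset.sum_comm' fun t z => by simp [and_assoc])
      obtain ⟨a1, a2, a3⟩ := (Finset.mem_filter.1 ht).2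
      rw [inf_eq_right.2 hy2] at a2
      exact inf_eq_right.1 (Submodule.eq_of_le_of_finrank_eq inf_le_right (by omega))
    rw [key, Finset.sum_filter]
    refine Finset.sum_congr rfl fun z _ => ?_
    by_cases hz : f z = 0
    · rw [hz, ite_self, Finset.sum_const_zero]
    obtain ⟨hz1, hz2⟩ := hsupp z hz
    have hzdim := finrank_inf_hyperplane hH hz2
    split_ifs with h
    · rw [adjRel] at h
      change Module.finrank K y + _ = 2 * Module.finrank K ↥(y ⊓ z) + 2 at h
      have hyz : y ≤ z := inf_eq_left.1
        (Submodule.eq_of_le_of_finrank_eq inf_le_left (by omega))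
      have : (Finset.univ.filter fun t => layerRel H y t ∧ ¬ z ≤ H ∧ t = H ⊓ z) = {H ⊓ z} := by
        ext t
        rw [Finset.mem_filter, Finset.mem_singleton]
        constructor
        · exact fun h => h.2.2.2
        · rintro rfl
          refine ⟨Finset.mem_univ _, ⟨le_inf hy2 hyz, ?_, by omega⟩, hz2, rfl⟩
          rw [← inf_assoc, inf_idem, inf_eq_right.2 hy2]; omega
      rw [this, Finset.sum_singleton]
    · symm
      refine Finset.sum_eq_zero fun t ht => absurd ?_ h
      obtain ⟨-, ⟨a1, -, -⟩, -, rfl⟩ := Finset.mem_filter.1 ht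
      rw [adjRel]
      rw [inf_eq_left.2 (a1.trans inf_le_right)]
      omega

end TwistedGrassmann

/-! ### The tridiagonal action on the vectors `wBar` -/

namespace TwistedGrassmann

universe u

variable {K : Type u} [Field K] [Fintype K] {D : ℕ}

section Coefficients

/-- The eigenvalue of `R₁ L₁` on a standard basis vector of `H`. -/
noncomputable def coeffL₁ (q : ℂ) (D : ℕ) (ν ρ i j : ℤ) : ℂ :=
  q ^ (ν + j) * gauss q (D - 1 - ν - ρ - i + 1) * gauss q (i - ν)

noncomputable def coeffL₂ (q : ℂ) (D : ℕ) (ν μ ρ j : ℤ) : ℂ :=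
  q ^ (D - 1 - ν + μ - ρ) * gauss q (D + 1 - μ + ρ - j + 1) * gauss q (j - μ)

/-- The coefficients of the adjacency matrix on the vectors `wBar`. -/
noncomputable def wBarUp (q : ℂ) (D : ℕ) (ν ρ j : ℤ) : ℂ :=
  q ^ (2 * ν + 2 * j + 2 - D) * gauss q (j - ν - ρ) * gauss q (D - 1 - ν - j)

noncomputable def wBarDown (q : ℂ) (D : ℕ) (ν μ ρ j : ℤ) : ℂ :=
  q ^ (D - ν + μ - ρ) * gauss q (D + 2 - μ + ρ - j) * gauss q (j - μ)

noncomputable def wBarDiag (q : ℂ) (D : ℕ) (ν μ ρ j : ℤ) : ℂ :=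
  q * coeffL₁ q D ν ρ (D - j) j + q ^ (ν - D + j + 1) * coeffL₂ q D ν μ ρ j + q ^ D -
    gauss q (D + 1) - q ^ D * gauss q (j - ν - ρ)

variable {q : ℂ} (D : ℕ) (ν μ ρ j : ℤ)

/-- For the off-diagonal terms, the unprimed identities compare coefficients of vectors with `k = 1`
and the primed ones of vectors with `k = 0`. That one scalar serves both layers is what makes the
combination `wBar` work. -/
theorem wBarUp_eq (hq : q ≠ 0) (hq1 : 1 - q ≠ 0) :
    coeffL₁ q D ν ρ (D - j) j * q ^ (ν - (D - j - 1) + 1) -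
      q ^ D * gauss q (j - ν - ρ) * q ^ (ν - (D - j - 1)) = wBarUp q D ν ρ j := by
  rw [coeffL₁, wBarUp, ← zpow_natCast q D]
  have e1 : (D : ℤ) - 1 - ν - ρ - (D - j) + 1 = j - ν - ρ := by ring
  have e2 : q ^ (ν + j) * q ^ (ν - (D - j - 1) + 1) = q ^ (2 * ν + 2 * j + 2 - D) := by
    rw [← zpow_add₀ hq]; congr 1; ring
  have e3 : q ^ (D : ℤ) * q ^ (ν - (D - j - 1)) =
      q ^ (2 * ν + 2 * j + 2 - D) * q ^ (D - 1 - ν - j) := by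
    rw [← zpow_add₀ hq, ← zpow_add₀ hq]; congr 1; ring
  have e4 : gauss q (D - j - ν) - q ^ (D - 1 - ν - j) = gauss q (D - 1 - ν - j) := by
    rw [← gauss_succ_sub hq hq1]
    have : (D : ℤ) - 1 - ν - j + 1 = D - j - ν := by ring
    rw [this]; ring
  rw [e1, ← e4]
  linear_combination gauss q (j - ν - ρ) * gauss q (D - j - ν) * e2 - gauss q (j - ν - ρ) * e3

theorem wBarDown_eq (hq : q ≠ 0) : coeffL₂ q D ν μ ρ j * q = wBarDown q D ν μ ρ j := by
  rw [coeffL₂, wBarDown]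
  have e1 : q ^ ((D : ℤ) - 1 - ν + μ - ρ) * q = q ^ (D - ν + μ - ρ) := by
    rw [← zpow_add_one₀ hq]; congr 1; ring
  have e2 : (D : ℤ) + 1 - μ + ρ - j + 1 = D + 2 - μ + ρ - j := by ring
  rw [← e1, e2]; ring

theorem wBarUp_eq' (hq : q ≠ 0) :
    q ^ D * gauss q (j - ν - ρ) * (coeffL₁ q D ν ρ (D - j - 1) j * q ^ (ν - (D - j - 1 - 1))) =
      wBarUp q D ν ρ j * (q ^ D * gauss q (j + 1 - ν - ρ)) := by
  rw [coeffL₁, wBarUp]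
  have e1 : (D : ℤ) - 1 - ν - ρ - (D - j - 1) + 1 = j + 1 - ν - ρ := by ring
  have e2 : q ^ (ν + j) * q ^ (ν - (D - j - 1 - 1)) = q ^ (2 * ν + 2 * j + 2 - D) := by
    rw [← zpow_add₀ hq]; congr 1; ring
  have e3 : (D : ℤ) - j - 1 - ν = D - 1 - ν - j := by ring
  rw [e1, e3, ← e2]; ring

/-- `wBarDiag` is read off from the layer `k = 1`; this is the check on the layer `k = 0`.
Everything is reduced to `[j - ν - ρ]` and `[D - j - 1 - ν]` by means of `[n + 1] = [n] + q ^ n`. -/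
theorem wBarDiag_eq' (hq : q ≠ 0) (hq1 : 1 - q ≠ 0) :
    q ^ D * coeffL₁ q D ν ρ (D - j) j - q ^ D * gauss q (j - ν - ρ) *
      (coeffL₁ q D ν ρ (D - j - 1) j + coeffL₂ q D ν μ ρ j * q ^ (ν - (D - j - 1)) -
        gauss q (D - 1)) = -(wBarDiag q D ν μ ρ j * (q ^ D * gauss q (j - ν - ρ))) := by
  have e0 : ν - ((D : ℤ) - j - 1) = ν - D + j + 1 := by ring
  have e1 : (D : ℤ) - 1 - ν - ρ - (D - j) + 1 = j - ν - ρ := by ring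
  have e2 : (D : ℤ) - 1 - ν - ρ - (D - j - 1) + 1 = j - ν - ρ + 1 := by ring
  have e3 : gauss q (D - j - ν) = gauss q (D - j - 1 - ν) + q ^ (D - j - 1 - ν) := by
    rw [← gauss_succ_sub hq hq1]
    have : (D : ℤ) - j - 1 - ν + 1 = D - j - ν := by ring
    rw [this]; ring
  have e4 : gauss q (j - ν - ρ + 1) = gauss q (j - ν - ρ) + q ^ (j - ν - ρ) := by
    rw [← gauss_succ_sub hq hq1]; ring
  have e5 : gauss q (D + 1) = gauss q (D - 1) + q ^ ((D : ℤ) - 1) + q ^ (D : ℤ) := by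
    rw [← gauss_succ_sub hq hq1, ← gauss_succ_sub hq hq1]
    have : (D : ℤ) - 1 + 1 = D := by ring
    rw [this]; ring
  have e6 : q ^ (ν + j) * q ^ ((D : ℤ) - j - 1 - ν) = q ^ ((D : ℤ) - 1) := by
    rw [← zpow_add₀ hq]; congr 1; ring
  have e7 : q ^ (D : ℤ) = q ^ ((D : ℤ) - 1) * q := by
    rw [← zpow_add_one₀ hq]; congr 1; ring
  have e8 : (1 - q) * gauss q (j - ν - ρ) = 1 - q ^ (j - ν - ρ) := by
    rw [gauss]; field_simp
  rw [wBarDiag, coeffL₁, coeffL₁, e0, e1, e2, e3, e4, e5, ← zpow_natCast q D]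
  linear_combination (q ^ (D : ℤ) * gauss q (j - ν - ρ)) *
    ((1 + q * gauss q (j - ν - ρ)) * e6 - gauss q (j - ν - ρ) * e7 -
      q ^ (ν + j) * gauss q (D - j - 1 - ν) * e8)

theorem wBarDown_eq' (hq : q ≠ 0) (hq1 : 1 - q ≠ 0) :
    q ^ D * coeffL₂ q D ν μ ρ j - q ^ D * gauss q (j - ν - ρ) * coeffL₂ q D ν μ ρ j =
      -(wBarDown q D ν μ ρ j * (q ^ D * gauss q (j - 1 - ν - ρ))) := by
  have e1 : gauss q (j - ν - ρ) = 1 + q * gauss q (j - 1 - ν - ρ) := by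
    have h := gauss_sub_gauss hq (j - ν - ρ) 1
    rw [show gauss q 1 = 1 by rw [gauss, zpow_one, div_self hq1], zpow_one] at h
    have : j - 1 - ν - ρ = j - ν - ρ - 1 := by ring
    rw [this]; linear_combination h
  rw [← wBarDown_eq D ν μ ρ j hq, e1]; ring

end Coefficients

section Action

variable {H : Subsp K D} {x : Subsp K D} {W : Submodule (algH x H) (Subsp K D → ℂ)} {ν μ ρ : ℤ}
  {w : ℤ → ℤ → ℤ → (Subsp K D → ℂ)} {i j k : ℤ}

/-- The formulas of a standard basis apply only inside the index range. A lowering step leaves the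
range only at the lower boundary, and there its coefficient contains `[0]`. -/
theorem raise_lower_standard (hB : IsStandardBasis x H W ν μ ρ w)
    (h : (i, j, k) ∈ indexRange D ν μ ρ) :
    R₁ x H *ᵥ (L₁ x H *ᵥ w i j k + L₂ x H *ᵥ w i j k) +
      R₂ x H *ᵥ (L₁ x H *ᵥ w i j k + L₂ x H *ᵥ w i j k) =
    ((Fintype.card K : ℂ) ^ k * coeffL₁ (Fintype.card K) D ν ρ i j +
        (Fintype.card K : ℂ) ^ (ν - i + k) * coeffL₂ (Fintype.card K) D ν μ ρ j) • w i j k +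
      (coeffL₁ (Fintype.card K) D ν ρ i j * (Fintype.card K : ℂ) ^ (ν - (i - 1) + k)) •
        w (i - 1) (j + 1) k +
      (coeffL₂ (Fintype.card K) D ν μ ρ j * (Fintype.card K : ℂ) ^ k) • w (i + 1) (j - 1) k := by
  have g0 : gauss (Fintype.card K : ℂ) 0 = 0 := (gauss_eq_zero_iff K 0).2 rfl
  obtain ⟨h1, h2, h3, h4, h5, h6⟩ := h
  simp only at h1 h2 h3 h4 h5 h6
  have hL₁ : L₁ x H *ᵥ w i j k = coeffL₁ (Fintype.card K) D ν ρ i j • w (i - 1) j k :=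
    hB.L₁_mul i j k ⟨h1, h2, h3, h4, h5, h6⟩
  have hL₂ : L₂ x H *ᵥ w i j k = coeffL₂ (Fintype.card K) D ν μ ρ j • w i (j - 1) k :=
    hB.L₂_mul i j k ⟨h1, h2, h3, h4, h5, h6⟩
  have e1 : R₁ x H *ᵥ (L₁ x H *ᵥ w i j k) =
      ((Fintype.card K : ℂ) ^ k * coeffL₁ (Fintype.card K) D ν ρ i j) • w i j k := by
    rw [hL₁, Matrix.mulVec_smul]
    rcases eq_or_lt_of_le h1 with rfl | hlt
    · rw [coeffL₁, sub_self, g0, mul_zero, zero_smul, mul_zero, zero_smul]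
    · rw [hB.R₁_mul _ _ _ ⟨by simp only; omega, by simp only; omega, h3, h4, h5, h6⟩, smul_smul,
        sub_add_cancel, mul_comm]
  have e2 : R₂ x H *ᵥ (L₁ x H *ᵥ w i j k) =
      (coeffL₁ (Fintype.card K) D ν ρ i j * (Fintype.card K : ℂ) ^ (ν - (i - 1) + k)) •
        w (i - 1) (j + 1) k := by
    rw [hL₁, Matrix.mulVec_smul]
    rcases eq_or_lt_of_le h1 with rfl | hlt
    · rw [coeffL₁, sub_self, g0, mul_zero, zero_smul, zero_mul, zero_smul]
    · rw [hB.R₂_mul _ _ _ ⟨by simp only; omega, by simp only; omega, h3, h4, h5, h6⟩, smul_smul]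
  have e3 : R₁ x H *ᵥ (L₂ x H *ᵥ w i j k) =
      (coeffL₂ (Fintype.card K) D ν μ ρ j * (Fintype.card K : ℂ) ^ k) • w (i + 1) (j - 1) k := by
    rw [hL₂, Matrix.mulVec_smul]
    rcases eq_or_lt_of_le h3 with rfl | hlt
    · rw [coeffL₂, sub_self, g0, mul_zero, zero_smul, zero_mul, zero_smul]
    · rw [hB.R₁_mul _ _ _ ⟨h1, h2, by simp only; omega, by simp only; omega, h5, h6⟩, smul_smul]
  have e4 : R₂ x H *ᵥ (L₂ x H *ᵥ w i j k) =
      ((Fintype.card K : ℂ) ^ (ν - i + k) * coeffL₂ (Fintype.card K) D ν μ ρ j) • w i j k := by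
    rw [hL₂, Matrix.mulVec_smul]
    rcases eq_or_lt_of_le h3 with rfl | hlt
    · rw [coeffL₂, sub_self, g0, mul_zero, zero_smul, mul_zero, zero_smul]
    · rw [hB.R₂_mul _ _ _ ⟨h1, h2, by simp only; omega, by simp only; omega, h5, h6⟩, smul_smul,
        sub_add_cancel, mul_comm]
  rw [Matrix.mulVec_add, Matrix.mulVec_add, e1, e2, e3, e4, add_smul]
  abel

/-- The adjacency matrix acts tridiagonally on the vectors `wBar`. -/
theorem adj_mulVec_wBar (hxH : x ≤ H) (hH : Module.finrank K H = 2 * D)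
    (hB : IsStandardBasis x H W ν μ ρ w) (h1 : max (ν + ρ + 1) μ ≤ j)
    (h2 : j ≤ min (D - ν - 1) (D - μ + ρ + 1)) :
    adj H *ᵥ wBar H w ν ρ j =
      wBarUp (Fintype.card K) D ν ρ j • wBar H w ν ρ (j + 1) +
      wBarDiag (Fintype.card K) D ν μ ρ j • wBar H w ν ρ j +
      wBarDown (Fintype.card K) D ν μ ρ j • wBar H w ν ρ (j - 1) := by
  have hq := q_ne_zero K
  have hq1 := one_sub_q_ne_zero K
  -- The bounds on `j` are those for which the indices of both components of `wBar` lie in the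
  -- range.
  have hP : ∀ k, 0 ≤ k → k ≤ 1 → (D - j, j, k) ∈ indexRange D ν μ ρ := fun k h3 h4 =>
    ⟨by simp only; omega, by simp only; omega, by simp only; omega, by simp only; omega, h3, h4⟩
  have hQ : ∀ k, 0 ≤ k → k ≤ 1 → (D - j - 1, j, k) ∈ indexRange D ν μ ρ := fun k h3 h4 =>
    ⟨by simp only; omega, by simp only; omega, by simp only; omega, by simp only; omega, h3, h4⟩
  set q : ℂ := (Fintype.card K : ℂ) with hqdef
  have hL₃ : L₃ x H *ᵥ w (D - j) j 1 = q ^ D • w (D - j) j 0 := by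
    rw [hB.L₃_mul _ _ _ (hP 1 (by omega) le_rfl), sub_self, ← zpow_natCast]
    congr 2; ring
  have hL₁ : L₁ x H *ᵥ w (D - j) j 0 = coeffL₁ q D ν ρ (D - j) j • w (D - j - 1) j 0 :=
    hB.L₁_mul _ _ _ (hP 0 le_rfl (by omega))
  have hL₂ : L₂ x H *ᵥ w (D - j) j 0 = coeffL₂ q D ν μ ρ j • w (D - j) (j - 1) 0 :=
    hB.L₂_mul _ _ _ (hP 0 le_rfl (by omega))
  have hR₃ : R₃ x H *ᵥ w (D - j) j 0 = w (D - j) j 1 :=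
    hB.R₃_mul _ _ _ (hP 0 le_rfl (by omega))
  have hR₁ : R₁ x H *ᵥ w (D - j - 1) j 0 = w (D - j) j 0 := by
    rw [hB.R₁_mul _ _ _ (hQ 0 le_rfl (by omega)), zpow_zero, one_smul, sub_add_cancel]
  have hR₂ : R₂ x H *ᵥ w (D - j - 1) j 0 = q ^ (ν - (D - j - 1)) • w (D - j - 1) (j + 1) 0 := by
    rw [hB.R₂_mul _ _ _ (hQ 0 le_rfl (by omega)), add_zero]
  have hR₃' : R₃ x H *ᵥ w (D - j - 1) (j + 1) 0 = w (D - j - 1) (j + 1) 1 := by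
    by_cases h : (D - j - 1, j + 1, (0 : ℤ)) ∈ indexRange D ν μ ρ
    · exact hB.R₃_mul _ _ _ h
    · rw [hB.zero_outside _ _ _ h, Matrix.mulVec_zero, hB.zero_outside]
      rintro ⟨a1, a2, a3, a4, a5, a6⟩
      exact h ⟨a1, a2, a3, a4, le_rfl, by simp⟩
  have hRLP := raise_lower_standard hB (hP 1 (by omega) le_rfl)
  have hRLQ := raise_lower_standard hB (hQ 0 le_rfl (by omega))
  rw [← hqdef, zpow_one] at hRLP
  rw [← hqdef, zpow_zero, one_mul, mul_one, add_zero, add_zero, sub_add_cancel] at hRLQ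
  have hup := wBarUp_eq D ν ρ j hq hq1
  have hup' := wBarUp_eq' D ν ρ j hq
  have hdown := wBarDown_eq D ν μ ρ j hq
  have hdown' := wBarDown_eq' D ν μ ρ j hq hq1
  have hdiag' := wBarDiag_eq' D ν μ ρ j hq hq1
  have hdiag : wBarDiag q D ν μ ρ j = q * coeffL₁ q D ν ρ (D - j) j +
      q ^ (ν - (D - j) + 1) * coeffL₂ q D ν μ ρ j + q ^ D -
      gauss q (D + 1) - q ^ D * gauss q (j - ν - ρ) := by
    rw [wBarDiag, show ν - ((D : ℤ) - j) + 1 = ν - D + j + 1 by ring]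
  have hsplit : wBar H w ν ρ j = (fun v => w (D - j) j 1 v.1) -
      (q ^ D * gauss q (j - ν - ρ)) • fun v => w (D - j - 1) j 0 v.1 := rfl
  ext y
  have h3 := adj_mulVec_sup hxH hH (hB.cell (D - j) j 1) (by ring) y
  have h4 := adj_mulVec_sub hxH hH (hB.cell (D - j - 1) j 0) (by ring) y
  rw [hL₃, Matrix.mulVec_smul, Matrix.mulVec_smul, Matrix.mulVec_smul, hL₁, hL₂, hR₃, hRLP] at h3
  rw [hRLQ, hR₁, hR₂, Matrix.mulVec_add, Matrix.mulVec_smul, hR₃, hR₃'] at h4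
  rw [hsplit, Matrix.mulVec_sub, Matrix.mulVec_smul, Pi.sub_apply, Pi.smul_apply, h3, h4]
  have i1 : (D : ℤ) - (j - 1) = D - j + 1 := by ring
  have i2 : (D : ℤ) - (j + 1) = D - j - 1 := by ring
  simp only [Pi.add_apply, Pi.sub_apply, Pi.smul_apply, smul_eq_mul, wBar, i1, i2, add_sub_cancel_right,
    ← hqdef]
  -- Each summand settles the coefficient of one standard basis vector: the upper and lower
  -- neighbours in both layers and the two diagonal ones.
  linear_combination hup * w (D - j - 1) (j + 1) 1 y.1 + hdown * w (D - j + 1) (j - 1) 1 y.1 -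
    hup' * w (D - j - 1 - 1) (j + 1) 0 y.1 + hdown' * w (D - j) (j - 1) 0 y.1 +
    hdiag' * w (D - j - 1) j 0 y.1 - hdiag * w (D - j) j 1 y.1

end Action
end TwistedGrassmann

/-! ### Distances from the base vertex -/

namespace TwistedGrassmann

/-- A function that changes by at most one along edges and decreases along some edge at every
vertex other than `x` is the distance from `x`. -/
theorem dist_eq_of_lipschitz {V : Type*} (G : SimpleGraph V) (x : V) (f : V → ℕ)
    (h0 : ∀ z, f z = 0 ↔ z = x) (hadj : ∀ v w, G.Adj v w → f w ≤ f v + 1)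
    (hdesc : ∀ z, f z ≠ 0 → ∃ w, G.Adj w z ∧ f w + 1 = f z) (z : V) : G.dist x z = f z := by
  have hw : ∀ n z, f z = n → ∃ p : G.Walk x z, p.length = n := by
    intro n
    induction n with
    | zero =>
      intro z hz
      obtain rfl := (h0 z).1 hz
      exact ⟨.nil, rfl⟩
    | succ n ih =>
      intro z hz
      obtain ⟨w, hwz, hw⟩ := hdesc z (by omega)
      obtain ⟨p, hp⟩ := ih w (by omega)
      exact ⟨p.concat hwz, by rw [SimpleGraph.Walk.length_concat, hp]⟩
  have hle : ∀ {y z : V} (p : G.Walk y z), f z ≤ f y + p.length := by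
    intro y z p
    induction p with
    | nil => simp
    | cons h p ih =>
      have := hadj _ _ h
      rw [SimpleGraph.Walk.length_cons]
      omega
  obtain ⟨p, hp⟩ := hw _ z rfl
  obtain ⟨p', hp'⟩ := p.reachable.exists_walk_length_eq_dist
  have h1 := hle p'
  rw [(h0 x).2 rfl, zero_add, hp'] at h1
  exact le_antisymm (hp ▸ SimpleGraph.dist_le p) h1

universe u

variable {K : Type u} [Field K] [Fintype K] {D : ℕ} {H : Subsp K D}

theorem exists_finrank_between {y z : Subsp K D} (h : y ≤ z) {n : ℕ}
    (h1 : Module.finrank K y ≤ n) (h2 : n ≤ Module.finrank K z) :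
    ∃ t : Subsp K D, y ≤ t ∧ t ≤ z ∧ Module.finrank K t = n := by
  induction n, h1 using Nat.le_induction with
  | base => exact ⟨y, le_rfl, h, rfl⟩
  | succ n hn ih =>
    obtain ⟨t, ht1, ht2, ht3⟩ := ih (by omega)
    have hlt : t < z := lt_of_le_of_ne ht2 fun h => by rw [h] at ht3; omega
    obtain ⟨v, hvz, hvt⟩ := SetLike.exists_of_lt hlt
    refine ⟨t ⊔ K ∙ v, ht1.trans le_sup_left, sup_le ht2 (by simpa using hvz), ?_⟩
    rw [finrank_sup_span_singleton_of_notMem hvt, ht3]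

/-- The distance from `x` in the graph. -/
noncomputable def depth (x : Vertex H) (y : Vertex H) : ℕ :=
  (D - 1 + Module.finrank K y.1) / 2 - Module.finrank K ↥(x.1 ⊓ y.1)

variable {x : Vertex H}

theorem finrank_base (hx : x.1 ≤ H) : Module.finrank K x.1 + 1 = D := by
  obtain ⟨x, ⟨h1, h2⟩ | ⟨h1, h2⟩⟩ := x
  · exact absurd hx h2
  · exact h1

theorem depth_of_le (hx : x.1 ≤ H) {y : Vertex H} (hy : y.1 ≤ H) :
    depth x y + Module.finrank K ↥(x.1 ⊓ y.1) + 1 = D ∧ Module.finrank K y.1 + 1 = D := by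
  have h1 := finrank_base hx
  have h2 := finrank_base hy
  have h3 := Submodule.finrank_mono (inf_le_left : x.1 ⊓ y.1 ≤ x.1)
  rw [depth]; omega

theorem depth_of_not_le (hx : x.1 ≤ H) {y : Vertex H} (hy : ¬ y.1 ≤ H) :
    depth x y + Module.finrank K ↥(x.1 ⊓ y.1) = D ∧ Module.finrank K y.1 = D + 1 := by
  have h1 := finrank_base hx
  have h2 : Module.finrank K y.1 = D + 1 := by
    obtain ⟨y, ⟨h1, h2⟩ | ⟨h1, h2⟩⟩ := y
    · exact h1
    · exact absurd h2 hy
  have h3 := Submodule.finrank_mono (inf_le_left : x.1 ⊓ y.1 ≤ x.1)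
  rw [depth]; omega

/-- `x ⊓ v` and `v ⊓ w` both lie in `v`, so their intersection, which is contained in `x ⊓ w`, is
bounded below in dimension. If `v` is not in `H` but `w` is, one more dimension is needed; it is
gained because both lie in `H ⊓ v`. -/
theorem depth_adj (hx : x.1 ≤ H) (hH : Module.finrank K H = 2 * D) (v w : Vertex H)
    (h : (graph H).Adj v w) : depth x w ≤ depth x v + 1 := by
  have h : Module.finrank K v.1 + Module.finrank K w.1 =
    2 * Module.finrank K ↥(v.1 ⊓ w.1) + 2 := h
  have e1 := Submodule.finrank_sup_add_finrank_inf_eq (x.1 ⊓ v.1) (v.1 ⊓ w.1)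
  have e2 := Submodule.finrank_mono (sup_le (inf_le_right : x.1 ⊓ v.1 ≤ v.1)
    (inf_le_left : v.1 ⊓ w.1 ≤ v.1))
  have e3 := Submodule.finrank_mono (le_inf (inf_le_left.trans inf_le_left)
    (inf_le_right.trans inf_le_right) : x.1 ⊓ v.1 ⊓ (v.1 ⊓ w.1) ≤ x.1 ⊓ w.1)
  by_cases hv : v.1 ≤ H <;> by_cases hw : w.1 ≤ H
  · have := depth_of_le hx hv
    have := depth_of_le hx hw
    omega
  · have := depth_of_le hx hv
    have := depth_of_not_le hx hw
    omega
  · have := depth_of_not_le hx hv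
    have := depth_of_le hx hw
    have e4 := Submodule.finrank_mono (sup_le (le_inf (inf_le_left.trans hx) inf_le_right :
      x.1 ⊓ v.1 ≤ H ⊓ v.1) (le_inf (inf_le_right.trans hw) inf_le_left : v.1 ⊓ w.1 ≤ H ⊓ v.1))
    have e5 := finrank_inf_hyperplane hH hv
    omega
  · have := depth_of_not_le hx hv
    have := depth_of_not_le hx hw
    omega

/-- A neighbour one step closer to `x`: if `z ≤ H`, take a hyperplane of `z` containing `x ⊓ z` and
add a vector of `x` outside `z`; otherwise take a subspace of dimension `D - 1` between `x ⊓ z` and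
`H ⊓ z`. -/
theorem dist_eq_depth (hx : x.1 ≤ H) (hH : Module.finrank K H = 2 * D) (z : Vertex H) :
    (graph H).dist x z = depth x z := by
  have hxD := finrank_base hx
  refine dist_eq_of_lipschitz _ x (depth x) (fun z => ⟨fun h => ?_, ?_⟩) (depth_adj hx hH)
    (fun z hz => ?_) z
  · by_cases hzH : z.1 ≤ H
    · obtain ⟨h1, h2⟩ := depth_of_le hx hzH
      have e1 : x.1 ⊓ z.1 = x.1 := Submodule.eq_of_le_of_finrank_eq inf_le_left (by omega)
      exact Subtype.ext
        (Submodule.eq_of_le_of_finrank_eq (inf_eq_left.1 e1) (by omega)).symm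
    · obtain ⟨h1, h2⟩ := depth_of_not_le hx hzH
      have := Submodule.finrank_mono (inf_le_left : x.1 ⊓ z.1 ≤ x.1)
      omega
  · rintro rfl
    have := (depth_of_le hx hx).1
    rw [inf_idem] at this
    omega
  · by_cases hzH : z.1 ≤ H
    · obtain ⟨h1, h2⟩ := depth_of_le hx hzH
      have hlt : x.1 ⊓ z.1 < x.1 := lt_of_le_of_ne inf_le_left fun h => by
        rw [h] at h1; omega
      obtain ⟨v, hvx, hv⟩ := SetLike.exists_of_lt hlt
      have hvz : v ∉ z.1 := fun h => hv ⟨hvx, h⟩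
      obtain ⟨t, ht1, ht2, ht3⟩ := exists_finrank_between (inf_le_right : x.1 ⊓ z.1 ≤ z.1)
        (n := D - 2) (by omega) (by omega)
      have htH : t ⊔ K ∙ v ≤ H := sup_le (ht2.trans hzH) (by simpa using hx hvx)
      have hdim := finrank_sup_span_singleton_of_notMem (a := t) (v := v) fun h => hvz (ht2 h)
      have hD : 1 ≤ depth x z := by omega
      have hD2 : 2 ≤ D := by omega
      let w : Vertex H := ⟨t ⊔ K ∙ v, Or.inr ⟨by omega, htH⟩⟩
      have e1 : w.1 ⊓ z.1 = t := by
        refine (Submodule.eq_of_le_of_finrank_le (le_inf le_sup_left ht2) ?_).symm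
        have : w.1 ⊓ z.1 < w.1 := lt_of_le_of_ne inf_le_left fun h => hvz (by
          have h' : v ∈ w.1 := Submodule.mem_sup_right (Submodule.mem_span_singleton_self v)
          rw [← h] at h'; exact h'.2)
        have h5 := Submodule.finrank_lt_finrank_of_lt this
        have h6 : Module.finrank K w.1 = Module.finrank K t + 1 := hdim
        exact Nat.lt_succ_iff.1 (lt_of_lt_of_eq h5 h6)
      have hadj : (graph H).Adj w z := by
        change Module.finrank K ↥(t ⊔ K ∙ v) + Module.finrank K z.1 =
          2 * Module.finrank K ↥(w.1 ⊓ z.1) + 2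
        rw [e1]; omega
      refine ⟨w, hadj, ?_⟩
      have h3 := depth_adj hx hH w z hadj
      have h4 := (depth_of_le hx (y := w) htH).1
      have h5 : x.1 ⊓ z.1 ⊔ K ∙ v ≤ x.1 ⊓ w.1 := sup_le
        (le_inf inf_le_left (ht1.trans le_sup_left))
        (le_inf (by simpa using hvx) le_sup_right)
      have h6 := Submodule.finrank_mono h5
      rw [finrank_sup_span_singleton_of_notMem hv] at h6
      omega
    · obtain ⟨h1, h2⟩ := depth_of_not_le hx hzH
      have hdim := finrank_inf_hyperplane hH hzH
      have hle := Submodule.finrank_mono (inf_le_left : x.1 ⊓ z.1 ≤ x.1)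
      obtain ⟨t, ht1, ht2, ht3⟩ := exists_finrank_between
        (le_inf (inf_le_left.trans hx) inf_le_right : x.1 ⊓ z.1 ≤ H ⊓ z.1)
        (n := D - 1) (by omega) (by omega)
      have htH : t ≤ H := ht2.trans inf_le_left
      let w : Vertex H := ⟨t, Or.inr ⟨by omega, htH⟩⟩
      have hadj : (graph H).Adj w z := by
        change Module.finrank K t + Module.finrank K z.1 =
          2 * Module.finrank K ↥(t ⊓ z.1) + 2
        rw [inf_eq_left.2 (ht2.trans inf_le_right)]; omega
      refine ⟨w, hadj, ?_⟩
      have h3 := depth_adj hx hH w z hadj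
      have h4 := (depth_of_le hx (y := w) htH).1
      have h5 : x.1 ⊓ z.1 ≤ x.1 ⊓ w.1 := le_inf inf_le_left ht1
      have h6 := Submodule.finrank_mono h5
      omega

theorem distIdem_mulVec_apply (x : Vertex H) (i : ℕ) (g : Vertex H → ℂ) (y : Vertex H) :
    (distIdem x i *ᵥ g) y = if (graph H).dist x y = i then g y else 0 := by
  classical
  rw [distIdem, Matrix.mulVec_diagonal, Set.indicator_apply]
  simp only [Set.mem_ofPred_eq]
  split_ifs <;> simp

/-- The two cells `(D - j - 1, j, 0)` and `(D - j, j, 1)` that enter `wBar` lie at the same distance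
`j`, which is why the two terms can be combined. -/
theorem depth_of_mem_cell_sub (hx : x.1 ≤ H) {i j : ℤ} (hij : i + j = D - 1) {y : Vertex H}
    (hy : y.1 ∈ cell x.1 H i j 0) : (depth x y : ℤ) = j := by
  have := depth_of_le hx (vertex_of_sub hij hy).2
  have := hy.1
  omega

theorem depth_of_mem_cell_sup (hx : x.1 ≤ H) {i j : ℤ} (hij : i + j = D) {y : Vertex H}
    (hy : y.1 ∈ cell x.1 H i j 1) : (depth x y : ℤ) = j := by
  have := depth_of_not_le hx (vertex_of_sup hij hy).2
  have := hy.1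
  omega

/-- The vectors `wBar` are supported at constant distance from `x`. -/
theorem wBar_apply_eq_zero (hx : x.1 ≤ H) (hH : Module.finrank K H = 2 * D)
    {w : ℤ → ℤ → ℤ → (Subsp K D → ℂ)} (hw : ∀ i j k, w i j k ∈ cellSpace x.1 H i j k)
    (ν ρ j : ℤ) {y : Vertex H} (hy : ((graph H).dist x y : ℤ) ≠ j) : wBar H w ν ρ j y = 0 := by
  rw [dist_eq_depth hx hH] at hy
  rw [wBar, hw _ _ _ y.1 fun h => hy (depth_of_mem_cell_sup hx (by ring) h),
    hw _ _ _ y.1 fun h => hy (depth_of_mem_cell_sub hx (by ring) h)]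
  ring

theorem distIdem_mulVec_of_support {g : Vertex H → ℂ} {j : ℕ}
    (hg : ∀ y, (graph H).dist x y ≠ j → g y = 0) (i : ℕ) :
    distIdem x i *ᵥ g = if i = j then g else 0 := by
  ext y
  rw [distIdem_mulVec_apply]
  by_cases hy : (graph H).dist x y = j
  · rw [hy]
    by_cases hij : i = j
    · rw [if_pos hij.symm, if_pos hij]
    · rw [if_neg (Ne.symm hij), if_neg hij]; rfl
  · rw [hg y hy, ite_self]
    split_ifs
    · exact (hg y hy).symm
    · rfl

end TwistedGrassmann

/-! ### Thin modules given by a chain of vectors -/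

namespace TwistedGrassmann

universe u

variable {K : Type u} [Field K] [Fintype K] {D : ℕ} {H : Subsp K D} {x : Vertex H}

theorem terwilliger_eq (x : Vertex H) : terwilliger x =
    Algebra.adjoin ℂ ({adj H} ∪ Set.range (distIdem x)) := rfl

theorem adj_mem_terwilliger (x : Vertex H) : adj H ∈ terwilliger x :=
  Algebra.subset_adjoin (Or.inl rfl)

theorem distIdem_mem_terwilliger (x : Vertex H) (i : ℕ) : distIdem x i ∈ terwilliger x :=
  Algebra.subset_adjoin (Or.inr ⟨i, rfl⟩)

/-- The vectors `v 0, …, v d` form a basis of the module `W`, `v i` is supported at distance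
`ε + i` from `x`, and the adjacency matrix acts by the matrix `B` with respect to them. -/
structure IsChain (W : Submodule (terwilliger x) (Vertex H → ℂ)) (ε d : ℕ)
    (B : Matrix (Fin (d + 1)) (Fin (d + 1)) ℂ) (v : Fin (d + 1) → Vertex H → ℂ) : Prop where
  ne_zero : ∀ i, v i ≠ 0
  support : ∀ (i : Fin (d + 1)) y, (graph H).dist x y ≠ ε + i → v i y = 0
  adj_mul : ∀ j, adj H *ᵥ v j = ∑ i, B i j • v i
  span_eq : Submodule.span ℂ (Set.range v) = W.restrictScalars ℂ

namespace IsChain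

variable {W W' : Submodule (terwilliger x) (Vertex H → ℂ)} {ε d : ℕ}
  {B : Matrix (Fin (d + 1)) (Fin (d + 1)) ℂ} {v v' : Fin (d + 1) → Vertex H → ℂ}

theorem mem (h : IsChain W ε d B v) (i : Fin (d + 1)) : v i ∈ W := by
  change v i ∈ W.restrictScalars ℂ
  rw [← h.span_eq]
  exact Submodule.subset_span ⟨i, rfl⟩

theorem distIdem_mul (h : IsChain W ε d B v) (k : ℕ) (i : Fin (d + 1)) :
    distIdem x k *ᵥ v i = if k = ε + i then v i else 0 :=
  distIdem_mulVec_of_support (h.support i) k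

/-- The chain vectors lie at distinct distances, so the diagonal matrices extract coordinates.
Linear independence, thinness and simplicity all rest on this. -/
theorem distIdem_mul_combination (h : IsChain W ε d B v) (a : Fin (d + 1) → ℂ)
    (i : Fin (d + 1)) :
    distIdem x (ε + i) *ᵥ (Fintype.linearCombination ℂ v a) = a i • v i := by
  rw [Fintype.linearCombination_apply, Matrix.mulVec_sum, Finset.sum_eq_single i]
  · rw [Matrix.mulVec_smul, h.distIdem_mul, if_pos rfl]
  · intro j _ hj
    rw [Matrix.mulVec_smul, h.distIdem_mul, if_neg, smul_zero]
    intro e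
    exact hj (Fin.ext (by omega))
  · simp

theorem linearIndependent (h : IsChain W ε d B v) : LinearIndependent ℂ v := by
  rw [Fintype.linearIndependent_iff]
  intro a ha i
  have := h.distIdem_mul_combination a i
  rw [Fintype.linearCombination_apply, ha, Matrix.mulVec_zero] at this
  exact (smul_eq_zero.1 this.symm).resolve_right (h.ne_zero i)

theorem exists_combination (h : IsChain W ε d B v) {w : Vertex H → ℂ} (hw : w ∈ W) :
    ∃ a, Fintype.linearCombination ℂ v a = w := by
  have hw : w ∈ W.restrictScalars ℂ := hw
  rw [← h.span_eq, ← Fintype.range_linearCombination] at hw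
  exact hw

theorem combination_mem (h : IsChain W ε d B v) (a : Fin (d + 1) → ℂ) :
    Fintype.linearCombination ℂ v a ∈ W := by
  change _ ∈ W.restrictScalars ℂ
  rw [← h.span_eq, ← Fintype.range_linearCombination]
  exact ⟨a, rfl⟩

theorem combination_injective (h : IsChain W ε d B v) :
    Function.Injective (Fintype.linearCombination ℂ v) :=
  fun a b hab => funext fun i => by
    have h1 := h.distIdem_mul_combination a i
    rw [hab, h.distIdem_mul_combination] at h1
    exact (smul_left_injective ℂ (h.ne_zero i) h1).symm

theorem support_eq (h : IsChain W ε d B v) :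
    TwistedGrassmann.support W = Set.Icc ε (ε + d) := by
  ext k
  constructor
  · rintro ⟨w, hw, hk⟩
    obtain ⟨a, rfl⟩ := h.exists_combination hw
    by_contra hn
    apply hk
    rw [Fintype.linearCombination_apply, Matrix.mulVec_sum]
    refine Finset.sum_eq_zero fun i _ => ?_
    rw [Matrix.mulVec_smul, h.distIdem_mul, if_neg, smul_zero]
    rintro rfl
    exact hn ⟨by omega, by omega⟩
  · rintro ⟨h1, h2⟩
    refine ⟨v ⟨k - ε, by omega⟩, h.mem _, ?_⟩
    rw [h.distIdem_mul, if_pos (by simp; omega)]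
    exact h.ne_zero _

theorem endpoint_eq (h : IsChain W ε d B v) : endpoint W = ε := by
  rw [endpoint, h.support_eq, csInf_Icc (by omega)]

theorem diameter_eq (h : IsChain W ε d B v) : diameter W = d := by
  rw [diameter, h.support_eq, Set.ncard_eq_toFinset_card', Set.toFinset_Icc, Nat.card_Icc]
  omega

theorem component_eq (h : IsChain W ε d B v) (i : Fin (d + 1)) :
    component W (ε + i) = ℂ ∙ v i := by
  refine le_antisymm ?_ ?_
  · rintro _ ⟨w, hw, rfl⟩
    obtain ⟨a, rfl⟩ := h.exists_combination hw
    rw [Matrix.toLin'_apply, h.distIdem_mul_combination]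
    exact Submodule.smul_mem _ _ (Submodule.mem_span_singleton_self _)
  · rw [Submodule.span_singleton_le_iff_mem]
    exact ⟨v i, h.mem i, by rw [Matrix.toLin'_apply, h.distIdem_mul, if_pos rfl]⟩

theorem isThin (h : IsChain W ε d B v) : IsThin W := by
  intro k
  by_cases hk : k ∈ Set.Icc ε (ε + d)
  · have := h.component_eq ⟨k - ε, by have := hk.1; have := hk.2; omega⟩
    have e : ε + (k - ε) = k := by have := hk.1; omega
    simp only [e] at this
    rw [this]
    exact (finrank_span_le_card _).trans (by simp)
  · have : component W k = ⊥ := by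
      rw [← h.support_eq] at hk
      rw [eq_bot_iff]
      rintro _ ⟨w, hw, rfl⟩
      by_contra h0
      exact hk ⟨w, hw, h0⟩
    rw [this, finrank_bot]
    exact Nat.zero_le _

/-- The basis of the module. -/
noncomputable def basis (h : IsChain W ε d B v) :
    Module.Basis (Fin (d + 1)) ℂ (W.restrictScalars ℂ) :=
  (Module.Basis.span h.linearIndependent).map (LinearEquiv.ofEq _ _ h.span_eq)

theorem basis_apply (h : IsChain W ε d B v) (i : Fin (d + 1)) :
    (h.basis i : Vertex H → ℂ) = v i := by
  rw [basis, Module.Basis.map_apply, LinearEquiv.coe_ofEq_apply, Module.Basis.span_apply]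

theorem finrank_eq (h : IsChain W ε d B v) :
    Module.finrank ℂ (W.restrictScalars ℂ) = d + 1 := by
  rw [Module.finrank_eq_card_basis h.basis, Fintype.card_fin]

theorem distIdem_mul_adj (h : IsChain W ε d B v) (i j : Fin (d + 1)) :
    distIdem x (ε + i) *ᵥ (adj H *ᵥ v j) = B i j • v i := by
  rw [h.adj_mul, ← Fintype.linearCombination_apply, h.distIdem_mul_combination]

/-- A nonzero submodule contains some chain vector. The adjacency matrix followed by a diagonal
matrix moves it to either neighbour with a nonzero coefficient, so all chain vectors are reached. -/
theorem isSimpleModule (h : IsChain W ε d B v)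
    (hB : ∀ i j : Fin (d + 1), (i : ℕ) + 1 = j ∨ (j : ℕ) + 1 = i → B i j ≠ 0) :
    IsSimpleModule (terwilliger x) W := by
  rw [isSimpleModule_iff_isAtom]
  refine ⟨fun h0 => h.ne_zero 0 ?_, fun U hU => ?_⟩
  · have := h.mem 0
    rw [h0] at this
    exact this
  by_contra hne
  obtain ⟨u, hu, hu0⟩ := Submodule.exists_mem_ne_zero_of_ne_bot hne
  obtain ⟨a, rfl⟩ := h.exists_combination (hU.le hu)
  obtain ⟨i, hi⟩ : ∃ i, a i ≠ 0 := by
    by_contra hn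
    push Not at hn
    exact hu0 (by rw [show a = 0 from funext hn, map_zero])
  have hcancel : ∀ (c : ℂ) (j : Fin (d + 1)), c ≠ 0 → c • v j ∈ U → v j ∈ U := by
    intro c j hc hj
    have := complex_smul_mem c⁻¹ hj
    rwa [smul_smul, inv_mul_cancel₀ hc, one_smul] at this
  have hvi : v i ∈ U := hcancel _ _ hi (by
    rw [← h.distIdem_mul_combination]
    exact mulVec_mem_of_mem (distIdem_mem_terwilliger x _) hu)
  have hstep : ∀ j k : Fin (d + 1), (j : ℕ) + 1 = k ∨ (k : ℕ) + 1 = j → v j ∈ U → v k ∈ U := by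
    intro j k hjk hj
    refine hcancel _ _ (hB k j hjk.symm) ?_
    rw [← h.distIdem_mul_adj]
    exact mulVec_mem_of_mem (distIdem_mem_terwilliger x _)
      (mulVec_mem_of_mem (adj_mem_terwilliger x) hj)
  have hup : ∀ n : ℕ, ∀ k : Fin (d + 1), (k : ℕ) = i + n → v k ∈ U := by
    intro n
    induction n with
    | zero => intro k hk; obtain rfl : k = i := Fin.ext hk; exact hvi
    | succ n ih =>
      intro k hk
      exact hstep ⟨i + n, by omega⟩ k (Or.inl (by simp; omega)) (ih ⟨i + n, by omega⟩ rfl)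
  have hdown : ∀ n : ℕ, ∀ k : Fin (d + 1), (k : ℕ) + n = i → v k ∈ U := by
    intro n
    induction n with
    | zero => intro k hk; obtain rfl : k = i := Fin.ext hk; exact hvi
    | succ n ih =>
      intro k hk
      exact hstep ⟨k + 1, by omega⟩ k (Or.inr rfl) (ih ⟨k + 1, by omega⟩ (by simp; omega))
  refine hU.not_ge fun w hw => ?_
  obtain ⟨a, rfl⟩ := h.exists_combination hw
  rw [Fintype.linearCombination_apply]
  refine Submodule.sum_mem _ fun k _ => complex_smul_mem _ ?_
  rcases le_total (i : ℕ) k with hik | hik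
  · exact hup (k - i) k (by omega)
  · exact hdown (i - k) k (by omega)

/-- Two chains with the same parameters give the same matrix for every element of the algebra. -/
theorem exists_matrix (h : IsChain W ε d B v) (h' : IsChain W' ε d B v')
    {M : Matrix (Vertex H) (Vertex H) ℂ} (hM : M ∈ terwilliger x) :
    ∃ N : (Fin (d + 1) → ℂ) →ₗ[ℂ] (Fin (d + 1) → ℂ),
      (∀ a, M *ᵥ Fintype.linearCombination ℂ v a = Fintype.linearCombination ℂ v (N a)) ∧
      ∀ a, M *ᵥ Fintype.linearCombination ℂ v' a = Fintype.linearCombination ℂ v' (N a) := by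
  rw [terwilliger_eq] at hM
  induction hM using Algebra.adjoin_induction with
  | mem M hM =>
    rcases hM with rfl | ⟨k, rfl⟩
    · have key : ∀ (w : Fin (d + 1) → Vertex H → ℂ), (∀ j, adj H *ᵥ w j = ∑ i, B i j • w i) →
          ∀ a, adj H *ᵥ Fintype.linearCombination ℂ w a =
            Fintype.linearCombination ℂ w (B *ᵥ a) := by
        intro w hw a
        simp only [Fintype.linearCombination_apply, Matrix.mulVec_sum, Matrix.mulVec_smul, hw,
          Finset.smul_sum, smul_smul, Matrix.mulVec, dotProduct, Finset.sum_smul]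
        rw [Finset.sum_comm]
        exact Finset.sum_congr rfl fun i _ => Finset.sum_congr rfl fun j _ => by rw [mul_comm]
      exact ⟨B.mulVecLin, key v h.adj_mul, key v' h'.adj_mul⟩
    · have key : ∀ (w : Fin (d + 1) → Vertex H → ℂ),
          (∀ i, distIdem x k *ᵥ w i = if k = ε + i then w i else 0) →
          ∀ a, distIdem x k *ᵥ Fintype.linearCombination ℂ w a =
            Fintype.linearCombination ℂ w
              (Matrix.diagonal (fun i : Fin (d + 1) => if k = ε + i then (1 : ℂ) else 0) *ᵥ a) := by
        intro w hw a
        simp only [Fintype.linearCombination_apply, Matrix.mulVec_sum, Matrix.mulVec_smul, hw,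
          Matrix.mulVec_diagonal]
        refine Finset.sum_congr rfl fun i _ => ?_
        split_ifs <;> simp
      exact ⟨Matrix.mulVecLin _, key v (h.distIdem_mul k), key v' (h'.distIdem_mul k)⟩
  | algebraMap c =>
    refine ⟨c • LinearMap.id, fun a => ?_, fun a => ?_⟩ <;>
    rw [Algebra.algebraMap_eq_smul_one, Matrix.smul_mulVec, Matrix.one_mulVec,
      LinearMap.smul_apply, map_smul, LinearMap.id_apply]
  | add M M' _ _ h1 h2 =>
    obtain ⟨N, hN, hN'⟩ := h1
    obtain ⟨P, hP, hP'⟩ := h2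
    refine ⟨N + P, fun a => ?_, fun a => ?_⟩ <;> rw [Matrix.add_mulVec, LinearMap.add_apply, map_add]
    · rw [hN, hP]
    · rw [hN', hP']
  | mul M M' _ _ h1 h2 =>
    obtain ⟨N, hN, hN'⟩ := h1
    obtain ⟨P, hP, hP'⟩ := h2
    refine ⟨N ∘ₗ P, fun a => ?_, fun a => ?_⟩ <;> rw [← Matrix.mulVec_mulVec]
    · rw [hP, hN]; rfl
    · rw [hP', hN']; rfl

/-- The linear map matching the two bases is a module map, because every element of the algebra has
the same matrix with respect to both. -/
theorem nonempty_linearEquiv (h : IsChain W ε d B v) (h' : IsChain W' ε d B v') :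
    Nonempty (W ≃ₗ[terwilliger x] W') := by
  let e : (W.restrictScalars ℂ) ≃ₗ[ℂ] (W'.restrictScalars ℂ) :=
    h.basis.equiv h'.basis (Equiv.refl _)
  have he : ∀ (a : Fin (d + 1) → ℂ) (w : W.restrictScalars ℂ),
      w.1 = Fintype.linearCombination ℂ v a →
        (e w).1 = Fintype.linearCombination ℂ v' a := by
    intro a w hw
    have : w = ∑ i, a i • h.basis i := Subtype.ext (by
      rw [hw, Fintype.linearCombination_apply, AddSubmonoidClass.coe_finsetSum]
      simp [h.basis_apply])
    rw [this, map_sum, AddSubmonoidClass.coe_finsetSum, Fintype.linearCombination_apply]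
    refine Finset.sum_congr rfl fun i _ => ?_
    rw [map_smul, Submodule.coe_smul, Module.Basis.equiv_apply, Equiv.refl_apply, h'.basis_apply]
  refine ⟨⟨⟨⟨fun w => e w, fun a b => e.map_add a b⟩, ?_⟩, fun w => e.symm w, fun w => ?_,
    fun w => ?_⟩⟩
  · rintro ⟨M, hM⟩ ⟨w, hw⟩
    obtain ⟨a, rfl⟩ := h.exists_combination hw
    obtain ⟨N, hN, hN'⟩ := h.exists_matrix h' hM
    refine Subtype.ext ?_
    refine (he (N a) _ (hN a)).trans ?_
    rw [← hN', ← he a ⟨_, hw⟩ rfl]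
    rfl
  · exact e.symm_apply_apply w
  · exact e.apply_symm_apply w

/-- The support condition is transported in the form `E*_{ε+i} v_i = v_i`, which is an identity in
the algebra action. Any simple module isomorphic to a known one thus inherits its chain. -/
theorem of_linearEquiv (h : IsChain W ε d B v) (φ : W ≃ₗ[terwilliger x] W') :
    IsChain W' ε d B fun i => φ ⟨v i, h.mem i⟩ where
  ne_zero i h0 := h.ne_zero i (congrArg Subtype.val (φ.map_eq_zero_iff.1 (Subtype.ext h0)))
  support i y hy := by
    have h1 := map_mulVec φ (distIdem_mem_terwilliger x (ε + i)) ⟨v i, h.mem i⟩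
    have h2 : (⟨distIdem x (ε + i) *ᵥ v i, mulVec_mem_of_mem (distIdem_mem_terwilliger x _)
        (h.mem i)⟩ : W) = ⟨v i, h.mem i⟩ :=
      Subtype.ext ((h.distIdem_mul _ i).trans (if_pos rfl))
    rw [h2] at h1
    rw [h1, distIdem_mulVec_apply, if_neg hy]
  adj_mul j := by
    rw [← map_mulVec φ (adj_mem_terwilliger x) ⟨v j, h.mem j⟩]
    have h2 : (⟨adj H *ᵥ v j, mulVec_mem_of_mem (adj_mem_terwilliger x) (h.mem j)⟩ : W) =
        ∑ i, B i j • ⟨v i, h.mem i⟩ :=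
      Subtype.ext ((h.adj_mul j).trans (by rw [AddSubmonoidClass.coe_finsetSum]; rfl))
    rw [h2, map_sum, AddSubmonoidClass.coe_finsetSum]
    refine Finset.sum_congr rfl fun i _ => ?_
    have := φ.map_smul (algebraMap ℂ (terwilliger x) (B i j)) ⟨v i, h.mem i⟩
    rw [algebraMap_smul, algebraMap_smul] at this
    rw [this]; rfl
  span_eq := by
    refine le_antisymm (Submodule.span_le.2 ?_) fun w hw => ?_
    · rintro _ ⟨i, rfl⟩
      exact (φ ⟨v i, h.mem i⟩).2
    · obtain ⟨a, ha⟩ := h.exists_combination (φ.symm ⟨w, hw⟩).2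
      have h1 : φ.symm ⟨w, hw⟩ = ∑ i, algebraMap ℂ (terwilliger x) (a i) • ⟨v i, h.mem i⟩ :=
        Subtype.ext (by
          rw [← ha, Fintype.linearCombination_apply, AddSubmonoidClass.coe_finsetSum]
          exact Finset.sum_congr rfl fun i _ => by rw [algebraMap_smul]; rfl)
      have h2 : w = ∑ i, a i • (φ ⟨v i, h.mem i⟩ : Vertex H → ℂ) := by
        have := congrArg φ h1
        rw [LinearEquiv.apply_symm_apply, map_sum] at this
        have := congrArg Subtype.val this
        rw [AddSubmonoidClass.coe_finsetSum] at this
        refine this.trans (Finset.sum_congr rfl fun i _ => ?_)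
        rw [map_smul, algebraMap_smul]; rfl
      rw [h2]
      exact Submodule.sum_mem _ fun i _ =>
        Submodule.smul_mem _ _ (Submodule.subset_span ⟨i, rfl⟩)

end IsChain

end TwistedGrassmann

/-! ### Eigenvalues and the dual endpoint -/

namespace TwistedGrassmann

universe u

section Eigenvalues

variable (K : Type u) [Field K] [Fintype K] (D : ℕ)

theorem theta_eq_ofReal (i : ℤ) : theta (Fintype.card K) D i =
    (((Fintype.card K : ℝ) * ((1 - (Fintype.card K : ℝ) ^ (D : ℤ)) / (1 - (Fintype.card K : ℝ))) *
      ((1 - (Fintype.card K : ℝ) ^ ((D : ℤ) + 1)) / (1 - (Fintype.card K : ℝ))) -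
      ((1 - (Fintype.card K : ℝ) ^ i) / (1 - (Fintype.card K : ℝ))) *
      ((1 - (Fintype.card K : ℝ) ^ (2 * D - i + 2)) / (1 - (Fintype.card K : ℝ))) : ℝ) : ℂ) := by
  rw [theta, gauss, gauss, gauss, gauss]
  push_cast
  rfl

theorem conj_theta (i : ℤ) :
    (starRingEnd ℂ) (theta (Fintype.card K) D i) = theta (Fintype.card K) D i := by
  rw [theta_eq_ofReal, Complex.conj_ofReal]

/-- The difference of the two eigenvalues is `(q ^ (i - j) - 1) (q ^ (2D + 2 - i) - q ^ j) / (1 - q)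
^ 2`, and the two hypotheses make the two factors positive. -/
theorem theta_re_lt {i j : ℤ} (h : j < i) (h' : i + j < 2 * D + 2) :
    (theta (Fintype.card K) D i).re < (theta (Fintype.card K) D j).re := by
  rw [theta_eq_ofReal, theta_eq_ofReal, Complex.ofReal_re, Complex.ofReal_re]
  have h1 := one_lt_card_field K
  generalize (Fintype.card K : ℝ) = q at *
  have h0 : q ≠ 0 := by positivity
  have e1 : 1 < q ^ (i - j) := one_lt_zpow₀ h1 (by omega)
  have e2 : q ^ j < q ^ (2 * D + 2 - i) := zpow_lt_zpow_right₀ h1 (by omega)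
  have e3 : q ^ i = q ^ (i - j) * q ^ j := by rw [← zpow_add₀ h0]; congr 1; ring
  have e4 : q ^ (2 * D - j + 2) = q ^ (i - j) * q ^ (2 * D + 2 - i) := by
    rw [← zpow_add₀ h0]; congr 1; ring
  have e5 : q ^ (2 * D - i + 2) = q ^ (2 * D + 2 - i) := by congr 1; ring
  rw [e3, e4, e5, div_mul_div_comm, div_mul_div_comm]
  apply sub_lt_sub_left
  apply div_lt_div_of_pos_right _ (by nlinarith)
  nlinarith [mul_pos (sub_pos.2 e1) (sub_pos.2 e2)]

end Eigenvalues

variable {K : Type u} [Field K] [Fintype K] {D : ℕ} {H : Subsp K D} {x : Vertex H}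

theorem adj_isHermitian (H : Subsp K D) : (adj H).IsHermitian := by
  classical
  ext i j
  rw [adj, Matrix.conjTranspose_apply, SimpleGraph.adjMatrix_apply, SimpleGraph.adjMatrix_apply,
    (graph H).adj_comm]
  split_ifs <;> simp

theorem primIdem_mulVec (i : ℕ) (w : Vertex H → ℂ) : primIdem H i *ᵥ w = WithLp.ofLp
    ((Module.End.eigenspace (Matrix.toEuclideanLin (adj H))
      (theta (Fintype.card K) D i)).starProjection (WithLp.toLp 2 w)) := by
  have := Matrix.ofLp_toEuclideanCLM (primIdem H i) (WithLp.toLp 2 w)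
  rw [← WithLp.ofLp_toLp 2 w, ← this, primIdem]
  congr 2
  exact (Matrix.toEuclideanCLM (n := Vertex H) (𝕜 := ℂ)).apply_symm_apply _

/-- `E_i W ≠ 0` if and only if `W` contains an eigenvector with eigenvalue `θ_i`. -/
theorem actsNonzero_primIdem_iff {W : Submodule (terwilliger x) (Vertex H → ℂ)} {i : ℕ} :
    ActsNonzero (primIdem H i) (W : Set (Vertex H → ℂ)) ↔
      ∃ w ∈ W, w ≠ 0 ∧ adj H *ᵥ w = theta (Fintype.card K) D i • w := by
  set θ := theta (Fintype.card K) D i with hθ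
  constructor
  · rintro ⟨w, hw, hne⟩
    by_contra! hn
    apply hne
    -- Without an eigenvector in `W`, the map `A - θ` is injective, hence onto, on `W`. Its image is
    -- orthogonal to the eigenspace because `A` is Hermitian and `θ` is real.
    let f : (W.restrictScalars ℂ) →ₗ[ℂ] (W.restrictScalars ℂ) :=
      ((adj H).mulVecLin - θ • LinearMap.id).restrict fun u hu => by
        have h1 : adj H *ᵥ u ∈ W := mulVec_mem_of_mem (adj_mem_terwilliger x) hu
        exact (W.restrictScalars ℂ).sub_mem h1 ((W.restrictScalars ℂ).smul_mem _ hu)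
    have hf : Function.Injective f := by
      rw [injective_iff_map_eq_zero]
      rintro ⟨u, hu⟩ h0
      by_contra hu0
      refine hn u hu (fun h => hu0 (Subtype.ext h)) ?_
      exact sub_eq_zero.1 (congrArg Subtype.val h0)
    obtain ⟨⟨u, hu⟩, h⟩ := LinearMap.surjective_of_injective hf ⟨w, hw⟩
    have h : adj H *ᵥ u - θ • u = w := congrArg Subtype.val h
    rw [primIdem_mulVec]
    have : (Module.End.eigenspace (Matrix.toEuclideanLin (adj H)) θ).starProjection
        (WithLp.toLp 2 w) = 0 := by
      rw [Submodule.starProjection_apply_eq_zero_iff, Submodule.mem_orthogonal]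
      intro e he
      have he : Matrix.toEuclideanLin (adj H) e = θ • e := Module.End.mem_eigenspace_iff.1 he
      have hs := (Matrix.isHermitian_iff_isSymmetric.1 (adj_isHermitian H)) e (WithLp.toLp 2 u)
      have hw' : WithLp.toLp 2 w =
          Matrix.toEuclideanLin (adj H) (WithLp.toLp 2 u) - θ • WithLp.toLp 2 u := by
        rw [← h]; rfl
      rw [hw', inner_sub_right, inner_smul_right, ← hs, he, inner_smul_left, hθ, conj_theta,
        sub_self]
    rw [this]; rfl
  · rintro ⟨w, hw, h0, he⟩
    refine ⟨w, hw, ?_⟩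
    rw [primIdem_mulVec, Submodule.starProjection_eq_self_iff.2]
    · exact h0
    · rw [Module.End.mem_eigenspace_iff, Matrix.toEuclideanLin_apply, WithLp.ofLp_toLp, he]
      rfl

/-- The real eigenvalues of a matrix whose off-diagonal entries are non-negative and whose row
sums are all equal do not exceed the row sum. -/
theorem re_le_of_rowSum {n : Type*} [Fintype n] [DecidableEq n] {B : Matrix n n ℂ} {t μ : ℂ}
    (hB : ∀ i j, i ≠ j → ∃ b : ℝ, 0 ≤ b ∧ B i j = b) (hrow : ∀ i, ∑ j, B i j = t)
    {a : n → ℂ} (ha : a ≠ 0) (hμ : B *ᵥ a = μ • a) : μ.re ≤ t.re := by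
  have hev : Module.End.HasEigenvalue (Matrix.toLin' B) μ :=
    Module.End.hasEigenvalue_of_hasEigenvector
      ⟨Module.End.mem_eigenspace_iff.2 (by rw [Matrix.toLin'_apply, hμ]), ha⟩
  -- Gershgorin's theorem: the radius of the disc around `B k k` is the off-diagonal row sum, so the
  -- rightmost point of the disc has real part `t.re`.
  obtain ⟨k, hk⟩ := eigenvalue_mem_ball hev
  rw [Metric.mem_closedBall, Complex.dist_eq] at hk
  have h1 : ∑ j ∈ Finset.univ.erase k, ‖B k j‖ = t.re - (B k k).re := by
    rw [← hrow k, ← Finset.add_sum_erase _ _ (Finset.mem_univ k), Complex.add_re,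
      add_sub_cancel_left, Complex.re_sum]
    refine Finset.sum_congr rfl fun j hj => ?_
    obtain ⟨b, hb, he⟩ := hB k j (Finset.ne_of_mem_erase hj).symm
    rw [he, Complex.norm_real, Complex.ofReal_re, Real.norm_of_nonneg hb]
  have h2 := (Complex.re_le_norm (μ - B k k)).trans hk
  rw [h1, Complex.sub_re] at h2
  linarith

/-- The combination with all coordinates `1` is an eigenvector for the common row sum. A smaller
index would belong to a larger eigenvalue, which `re_le_of_rowSum` excludes. -/
theorem IsChain.dualEndpoint_eq {W : Submodule (terwilliger x) (Vertex H → ℂ)} {ε d e : ℕ}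
    {B : Matrix (Fin (d + 1)) (Fin (d + 1)) ℂ} {v : Fin (d + 1) → Vertex H → ℂ}
    (h : IsChain W ε d B v) (he : e ≤ D) (hB : ∀ i j, i ≠ j → ∃ b : ℝ, 0 ≤ b ∧ B i j = b)
    (hrow : ∀ i, ∑ j, B i j = theta (Fintype.card K) D e) : dualEndpoint W = e := by
  have hmul : ∀ a, adj H *ᵥ Fintype.linearCombination ℂ v a =
      Fintype.linearCombination ℂ v (B *ᵥ a) := by
    intro a
    simp only [Fintype.linearCombination_apply, Matrix.mulVec_sum, Matrix.mulVec_smul, h.adj_mul,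
      Finset.smul_sum, smul_smul, Matrix.mulVec, dotProduct, Finset.sum_smul]
    rw [Finset.sum_comm]
    exact Finset.sum_congr rfl fun i _ => Finset.sum_congr rfl fun j _ => by rw [mul_comm]
  have hmem : e ∈ dualSupport W := by
    refine ⟨he, actsNonzero_primIdem_iff.2
      ⟨Fintype.linearCombination ℂ v 1, h.combination_mem _, fun h0 => ?_, ?_⟩⟩
    · have := congrFun (h.combination_injective (h0.trans (map_zero _).symm)) 0
      exact one_ne_zero this
    · rw [hmul, ← map_smul]
      congr 1
      ext i
      simp [Matrix.mulVec, dotProduct, hrow]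
  refine le_antisymm (Nat.sInf_le hmem) (le_csInf ⟨e, hmem⟩ ?_)
  rintro j ⟨hj, hne⟩
  obtain ⟨w, hw, h0, hw'⟩ := actsNonzero_primIdem_iff.1 hne
  obtain ⟨a, rfl⟩ := h.exists_combination hw
  rw [hmul, ← map_smul] at hw'
  have ha : a ≠ 0 := by rintro rfl; exact h0 (map_zero _)
  have := re_le_of_rowSum hB hrow ha (h.combination_injective hw')
  by_contra! hlt
  exact absurd (theta_re_lt K D (i := e) (j := j) (by omega) (by omega)) (not_lt.2 this)

/-! ### Tridiagonal sums -/

theorem sum_tridiagonal {M : Type*} [AddCommMonoid M] {d : ℕ} (P Q R : ℕ → M)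
    (j : Fin (d + 1)) :
    ∑ i : Fin (d + 1), (if i = j then P i else if (j : ℕ) = i + 1 then Q i
      else if (i : ℕ) = j + 1 then R i else 0) =
    P j + (if 1 ≤ (j : ℕ) then Q (j - 1) else 0) + if (j : ℕ) + 1 ≤ d then R (j + 1) else 0 := by
  have h : ∀ i : Fin (d + 1), (if i = j then P i else if (j : ℕ) = i + 1 then Q i
      else if (i : ℕ) = j + 1 then R i else 0) =
      (if i = j then P i else 0) + (if (j : ℕ) = i + 1 then Q i else 0) +
        (if (i : ℕ) = j + 1 then R i else 0) := by
    intro i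
    by_cases h1 : i = j
    · subst h1; simp
    · by_cases h2 : (j : ℕ) = i + 1
      · rw [if_neg h1, if_pos h2, if_neg h1, if_pos h2, if_neg (by omega)]; simp
      · simp [h1, h2]
  rw [Finset.sum_congr rfl fun i _ => h i, Finset.sum_add_distrib, Finset.sum_add_distrib]
  congr 2
  · simp
  · split_ifs with h1
    · rw [Finset.sum_eq_single ⟨j - 1, by omega⟩]
      · rw [if_pos (by simp; omega)]
      · intro i _ hi
        rw [if_neg]
        intro e
        exact hi (Fin.ext (by simp; omega))
      · simp
    · exact Finset.sum_eq_zero fun i _ => if_neg (by omega)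
  · split_ifs with h1
    · rw [Finset.sum_eq_single ⟨j + 1, by omega⟩]
      · simp
      · intro i _ hi
        rw [if_neg]
        intro e
        exact hi (Fin.ext (by simp; omega))
      · simp
    · exact Finset.sum_eq_zero fun i _ => if_neg (by omega)

theorem coeffB_self (q : ℂ) (d : ℕ) (h r : ℂ) : coeffB q d h r d = 0 := by
  rw [coeffB, sub_self, zpow_zero]; ring

theorem coeffC_zero (q : ℂ) (d : ℕ) (h r s : ℂ) : coeffC q d h r s 0 = 0 := by
  rw [coeffC, pow_zero]; ring

/-- The diagonal entry is chosen for this; at the two ends the missing neighbours do no harm because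
`b_d = 0` and `c_0 = 0`. -/
theorem sum_dualHahn_row (q : ℂ) (d : ℕ) (h r s lam : ℂ) (i : Fin (d + 1)) :
    ∑ j, dualHahn q d h r s lam i j = lam := by
  have := sum_tridiagonal (fun _ => lam - coeffB q d h r i - coeffC q d h r s i)
    (fun _ => coeffC q d h r s i) (fun _ => coeffB q d h r i) i
  have h2 : ∀ j : Fin (d + 1), dualHahn q d h r s lam i j =
      if j = i then lam - coeffB q d h r i - coeffC q d h r s i
      else if (i : ℕ) = j + 1 then coeffC q d h r s i
      else if (j : ℕ) = i + 1 then coeffB q d h r i else 0 := by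
    intro j
    rw [dualHahn, Matrix.of_apply]
    by_cases h1 : i = j
    · rw [if_pos h1, if_pos h1.symm]
    · rw [if_neg h1, if_neg (Ne.symm h1)]
      split_ifs <;> first | rfl | omega
  rw [Finset.sum_congr rfl fun j _ => h2 j, this]
  have hB : (if (i : ℕ) + 1 ≤ d then coeffB q d h r i else 0) = coeffB q d h r i := by
    split_ifs with hi
    · rfl
    · rw [show (i : ℕ) = d by omega, coeffB_self]
  have hC : (if 1 ≤ (i : ℕ) then coeffC q d h r s i else 0) = coeffC q d h r s i := by
    split_ifs with hi
    · rfl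
    · rw [show (i : ℕ) = 0 by omega, coeffC_zero]
  rw [hB, hC]; ring

end TwistedGrassmann

namespace TwistedGrassmann

/-! ### The parameters of the dual `q`-Hahn matrix -/

section Coefficients

variable {q : ℂ} (D d : ℕ) (e a : ℤ) (i : ℕ)

theorem coeffB_eq (hq : q ≠ 0) : coeffB q d (q ^ (2 * D + 2 - e) / (1 - q) ^ 2) (q ^ a) i =
    q ^ (2 * D + 2 - e) / (1 - q) ^ 2 * (1 - q ^ ((i : ℤ) - d)) * (1 - q ^ (a + i + 1)) := by
  rw [coeffB, ← zpow_natCast q (i + 1), ← zpow_add₀ hq]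
  congr 3
  push_cast
  ring

theorem coeffC_eq (hq : q ≠ 0) :
    coeffC q d (q ^ (2 * D + 2 - e) / (1 - q) ^ 2) (q ^ a) (q ^ (2 * e - 2 * D - 3)) i =
    q ^ (2 * D + 2 - e) / (1 - q) ^ 2 * q ^ (2 * e - 2 * D - 2) * (1 - q ^ (i : ℤ)) *
      (1 - q ^ (a + i - d + 2 * D + 2 - 2 * e)) := by
  have e1 : a + ((i : ℤ) - d - 1) - (2 * e - 2 * D - 3) = a + i - d + 2 * D + 2 - 2 * e := by ring
  have e2 : 2 * e - 2 * (D : ℤ) - 3 + 1 = 2 * e - 2 * D - 2 := by ring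
  rw [coeffC, ← zpow_add₀ hq, ← zpow_sub₀ hq, zpow_natCast, mul_assoc _ _ q, ← zpow_add_one₀ hq,
    e1, e2]

end Coefficients

section Real

variable (K : Type*) [Field K] [Fintype K] {D d : ℕ} {e a : ℤ}

/-- Here `a` is the exponent of `r`. The two values `e - D - 2` and `e - D - 1` that occur satisfy
the bounds of this lemma and of `coeffC_pos`, so both off-diagonals are positive. This serves the
Gershgorin bound as well as irreducibility. -/
theorem coeffB_pos (h1 : a ≤ e - D - 1) (h2 : e + d ≤ D) {i : ℕ} (hi : i < d) :
    ∃ b : ℝ, 0 < b ∧ coeffB (Fintype.card K) d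
      ((Fintype.card K : ℂ) ^ (2 * D + 2 - e) / (1 - Fintype.card K) ^ 2)
      ((Fintype.card K : ℂ) ^ a) i = b := by
  have hq := one_lt_card_field K
  refine ⟨(Fintype.card K : ℝ) ^ (2 * D + 2 - e) / (1 - (Fintype.card K : ℝ)) ^ 2 *
    (1 - (Fintype.card K : ℝ) ^ ((i : ℤ) - d)) * (1 - (Fintype.card K : ℝ) ^ (a + i + 1)), ?_, ?_⟩
  · have e1 := zpow_lt_one_of_neg₀ hq (show (i : ℤ) - d < 0 by omega)
    have e2 := zpow_lt_one_of_neg₀ hq (show a + i + 1 < 0 by omega)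
    have e3 : 0 < (1 - (Fintype.card K : ℝ)) ^ 2 := by nlinarith
    have e4 : 0 < (Fintype.card K : ℝ) ^ (2 * D + 2 - e) := zpow_pos (by linarith) _
    exact mul_pos (mul_pos (div_pos e4 e3) (by linarith)) (by linarith)
  · rw [coeffB_eq D d e a i (q_ne_zero K)]
    push_cast
    rfl

theorem coeffC_pos (h1 : e - D - 2 ≤ a) (h2 : e + d ≤ D) {i : ℕ} (hi : 0 < i) :
    ∃ b : ℝ, 0 < b ∧ coeffC (Fintype.card K) d
      ((Fintype.card K : ℂ) ^ (2 * D + 2 - e) / (1 - Fintype.card K) ^ 2)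
      ((Fintype.card K : ℂ) ^ a) ((Fintype.card K : ℂ) ^ (2 * e - 2 * D - 3)) i = b := by
  have hq := one_lt_card_field K
  refine ⟨(Fintype.card K : ℝ) ^ (2 * D + 2 - e) / (1 - (Fintype.card K : ℝ)) ^ 2 *
    (Fintype.card K : ℝ) ^ (2 * e - 2 * D - 2) *
    (((Fintype.card K : ℝ) ^ (i : ℤ) - 1) *
      ((Fintype.card K : ℝ) ^ (a + i - d + 2 * D + 2 - 2 * e) - 1)), ?_, ?_⟩
  · have e1 := one_lt_zpow₀ hq (show 0 < (i : ℤ) by omega)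
    have e2 := one_lt_zpow₀ hq (show 0 < a + i - d + 2 * D + 2 - 2 * e by omega)
    have e3 : 0 < (1 - (Fintype.card K : ℝ)) ^ 2 := by nlinarith
    have e4 : 0 < (Fintype.card K : ℝ) ^ (2 * D + 2 - e) := zpow_pos (by linarith) _
    have e5 : 0 < (Fintype.card K : ℝ) ^ (2 * e - 2 * D - 2) := zpow_pos (by linarith) _
    exact mul_pos (mul_pos (div_pos e4 e3) e5) (mul_pos (by linarith) (by linarith))
  · rw [coeffC_eq D d e a i (q_ne_zero K)]
    push_cast
    ring

theorem admissible_zpow (h1 : e - D - 2 ≤ a) (h1' : a ≤ e - D - 1) (h2 : e + d ≤ D) :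
    Admissible (Fintype.card K) d
      ((Fintype.card K : ℂ) ^ (2 * D + 2 - e) / (1 - Fintype.card K) ^ 2)
      ((Fintype.card K : ℂ) ^ a) ((Fintype.card K : ℂ) ^ (2 * e - 2 * D - 3)) := by
  have hq := q_ne_zero K
  refine ⟨div_ne_zero (zpow_ne_zero _ hq) (pow_ne_zero _ (one_sub_q_ne_zero K)),
    zpow_ne_zero _ hq, zpow_ne_zero _ hq, fun i hi hid => ⟨?_, ?_⟩, fun i hi hid => ?_⟩
  · rw [← zpow_natCast, ← zpow_add₀ hq, Ne, q_zpow_eq_one_iff]; omega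
  · rw [← zpow_natCast, ← zpow_add₀ hq, ← zpow_sub₀ hq, Ne, q_zpow_eq_one_iff]; omega
  · rw [← zpow_natCast, ← zpow_add₀ hq, Ne, q_zpow_eq_one_iff]; omega

theorem dualHahn_nonneg (h1 : e - D - 2 ≤ a) (h1' : a ≤ e - D - 1) (h2 : e + d ≤ D) (t : ℂ)
    (i j : Fin (d + 1)) (hij : i ≠ j) : ∃ b : ℝ, 0 ≤ b ∧ dualHahn (Fintype.card K) d
      ((Fintype.card K : ℂ) ^ (2 * D + 2 - e) / (1 - Fintype.card K) ^ 2)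
      ((Fintype.card K : ℂ) ^ a) ((Fintype.card K : ℂ) ^ (2 * e - 2 * D - 3)) t i j = b := by
  rw [dualHahn, Matrix.of_apply, if_neg hij]
  split_ifs with h3 h4
  · obtain ⟨b, hb, h⟩ := coeffB_pos K h1' h2 (i := i) (by omega)
    exact ⟨b, hb.le, h⟩
  · obtain ⟨b, hb, h⟩ := coeffC_pos K h1 h2 (i := i) (by omega)
    exact ⟨b, hb.le, h⟩
  · exact ⟨0, le_rfl, by simp⟩

theorem dualHahn_ne_zero (h1 : e - D - 2 ≤ a) (h1' : a ≤ e - D - 1) (h2 : e + d ≤ D) (t : ℂ)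
    (i j : Fin (d + 1)) (hij : (i : ℕ) + 1 = j ∨ (j : ℕ) + 1 = i) :
    dualHahn (Fintype.card K) d
      ((Fintype.card K : ℂ) ^ (2 * D + 2 - e) / (1 - Fintype.card K) ^ 2)
      ((Fintype.card K : ℂ) ^ a) ((Fintype.card K : ℂ) ^ (2 * e - 2 * D - 3)) t i j ≠ 0 := by
  rw [dualHahn, Matrix.of_apply, if_neg (by rintro rfl; omega)]
  split_ifs with h3 h4
  · obtain ⟨b, hb, h⟩ := coeffB_pos K h1' h2 (i := i) (by omega)
    rw [h]; exact_mod_cast hb.ne'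
  · obtain ⟨b, hb, h⟩ := coeffC_pos K h1 h2 (i := i) (by omega)
    rw [h]; exact_mod_cast hb.ne'
  · omega

end Real

section Identities

variable {q : ℂ} {D d : ℕ} {ν μ ρ e a ε : ℤ} {i : ℕ}

/-- Rescaling the basis changes only the ratio of opposite off-diagonal entries, so it is enough to
match their products and the diagonal. The name `left` stands for the case `ε = ν + ρ + 1`, `right`
for `ε = μ`. -/
theorem wBarUp_mul_wBarDown_left (hq : q ≠ 0) (hε : ε = ν + ρ + 1)
    (hd : (d : ℤ) = D - 2 * ν - ρ - 2) (he : e = ν + μ + 1) (ha : a = e - D - 2) :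
    wBarUp q D ν ρ (ε + i) * wBarDown q D ν μ ρ (ε + i + 1) =
      coeffB q d (q ^ (2 * D + 2 - e) / (1 - q) ^ 2) (q ^ a) i *
      coeffC q d (q ^ (2 * D + 2 - e) / (1 - q) ^ 2) (q ^ a) (q ^ (2 * e - 2 * D - 3)) (i + 1) := by
  rw [coeffB_eq D d e a i hq, coeffC_eq D d e a (i + 1) hq, wBarUp, wBarDown, ha, hd, he, hε]
  simp only [gauss]
  push_cast
  generalize (i : ℤ) = i
  generalize (D : ℤ) = D
  simp only [zpow_add₀ hq, zpow_sub₀ hq, two_mul, zpow_one, zpow_ofNat]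
  field_simp
  ring

theorem wBarUp_mul_wBarDown_right (hq : q ≠ 0) (hε : ε = μ)
    (hd : (d : ℤ) = D - 2 * μ + ρ + 1) (he : e = ν + μ + 1) (ha : a = e - D - 1) :
    wBarUp q D ν ρ (ε + i) * wBarDown q D ν μ ρ (ε + i + 1) =
      coeffB q d (q ^ (2 * D + 2 - e) / (1 - q) ^ 2) (q ^ a) i *
      coeffC q d (q ^ (2 * D + 2 - e) / (1 - q) ^ 2) (q ^ a) (q ^ (2 * e - 2 * D - 3)) (i + 1) := by
  rw [coeffB_eq D d e a i hq, coeffC_eq D d e a (i + 1) hq, wBarUp, wBarDown, ha, hd, he, hε]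
  simp only [gauss]
  push_cast
  generalize (i : ℤ) = i
  generalize (D : ℤ) = D
  simp only [zpow_add₀ hq, zpow_sub₀ hq, two_mul, zpow_one, zpow_ofNat]
  field_simp
  ring

theorem wBarDiag_left (hq : q ≠ 0) (hq1 : 1 - q ≠ 0) (hε : ε = ν + ρ + 1)
    (hd : (d : ℤ) = D - 2 * ν - ρ - 2) (he : e = ν + μ + 1) (ha : a = e - D - 2) :
    wBarDiag q D ν μ ρ (ε + i) = theta q D e -
      coeffB q d (q ^ (2 * D + 2 - e) / (1 - q) ^ 2) (q ^ a) i -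
      coeffC q d (q ^ (2 * D + 2 - e) / (1 - q) ^ 2) (q ^ a) (q ^ (2 * e - 2 * D - 3)) i := by
  rw [coeffB_eq D d e a i hq, coeffC_eq D d e a i hq, wBarDiag, coeffL₁, coeffL₂, theta, ha, hd,
    he, hε, ← zpow_natCast q D]
  simp only [gauss]
  generalize (i : ℤ) = i
  generalize (D : ℤ) = D
  simp only [zpow_add₀ hq, zpow_sub₀ hq, two_mul, zpow_one, zpow_ofNat]
  field_simp
  ring

theorem wBarDiag_right (hq : q ≠ 0) (hq1 : 1 - q ≠ 0) (hε : ε = μ)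
    (hd : (d : ℤ) = D - 2 * μ + ρ + 1) (he : e = ν + μ + 1) (ha : a = e - D - 1) :
    wBarDiag q D ν μ ρ (ε + i) = theta q D e -
      coeffB q d (q ^ (2 * D + 2 - e) / (1 - q) ^ 2) (q ^ a) i -
      coeffC q d (q ^ (2 * D + 2 - e) / (1 - q) ^ 2) (q ^ a) (q ^ (2 * e - 2 * D - 3)) i := by
  rw [coeffB_eq D d e a i hq, coeffC_eq D d e a i hq, wBarDiag, coeffL₁, coeffL₂, theta, ha, hd,
    he, hε, ← zpow_natCast q D]
  simp only [gauss]
  generalize (i : ℤ) = i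
  generalize (D : ℤ) = D
  simp only [zpow_add₀ hq, zpow_sub₀ hq, two_mul, zpow_one, zpow_ofNat]
  field_simp
  ring

end Identities

end TwistedGrassmann

/-! ### Complementary modules as chains -/

namespace TwistedGrassmann

universe u

variable {K : Type u} [Field K] [Fintype K] {D : ℕ} {H : Subsp K D} {x : Vertex H}
  {W : Submodule (algH x.1 H) (Subsp K D → ℂ)} {ν μ ρ : ℤ} {w : ℤ → ℤ → ℤ → (Subsp K D → ℂ)}

theorem distIdem_mulVec_wBar (hx : x.1 ≤ H) (hH : Module.finrank K H = 2 * D)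
    (hw : ∀ i j k, w i j k ∈ cellSpace x.1 H i j k) (ν ρ j : ℤ) (k : ℕ) :
    distIdem x k *ᵥ wBar H w ν ρ j = if (k : ℤ) = j then wBar H w ν ρ j else 0 := by
  ext y
  rw [distIdem_mulVec_apply]
  by_cases hy : ((graph H).dist x y : ℤ) = j
  · by_cases hk : (k : ℤ) = j
    · rw [if_pos (by omega), if_pos hk]
    · rw [if_neg (by omega), if_neg hk]; rfl
  · have h0 := wBar_apply_eq_zero hx hH hw ν ρ j hy
    rw [h0, ite_self]
    split_ifs
    · exact h0.symm
    · rfl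

/-- If the first component of `wBar` is nonzero, then so is `wBar`. -/
theorem wBar_ne_zero {x H : Subsp K D} (hw : ∀ i j k, w i j k ∈ cellSpace x H i j k) {ν ρ j : ℤ}
    (h : w (D - j) j 1 ≠ 0) : wBar H w ν ρ j ≠ 0 := by
  obtain ⟨y, hy⟩ := Function.ne_iff.1 h
  have hc : y ∈ cell x H (D - j) j 1 := by_contra fun hn => hy (hw _ _ _ y hn)
  have hv := vertex_of_sup (by ring) hc
  intro h0
  have h1 := congrFun h0 (⟨y, Or.inl hv⟩ : Vertex H)
  have h2 : w (D - j - 1) j 0 y = 0 := hw _ _ _ y fun hn => by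
    have := hn.1.symm.trans hc.1; omega
  have h3 : w (D - j) j 1 y - (Fintype.card K : ℂ) ^ D * gauss (Fintype.card K) (j - ν - ρ) *
    w (D - j - 1) j 0 y = 0 := h1
  rw [h2, mul_zero, sub_zero] at h3
  exact hy h3

theorem IsStandardBasis.wBar_ne_zero {x : Subsp K D} {W : Submodule (algH x H) (Subsp K D → ℂ)}
    (hB : IsStandardBasis x H W ν μ ρ w) {j : ℤ}
    (h1 : max (ν + ρ + 1) μ ≤ j) (h2 : j ≤ min (D - ν - 1) (D - μ + ρ + 1)) :
    wBar H w ν ρ j ≠ 0 :=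
  TwistedGrassmann.wBar_ne_zero hB.cell
    (hB.ne_zero ⟨by dsimp only; omega, by dsimp only; omega, by dsimp only; omega,
      by dsimp only; omega, zero_le_one, le_rfl⟩)

/-- At the upper end either the coefficient contains `[D - 1 - ν - j] = [0]`, or `j + 1` is beyond
the range of the standard basis and the vector itself is zero. -/
theorem IsStandardBasis.wBarUp_smul {x : Subsp K D} {W : Submodule (algH x H) (Subsp K D → ℂ)}
    (hB : IsStandardBasis x H W ν μ ρ w) {j : ℤ}
    (h2 : j ≤ min (D - ν - 1) (D - μ + ρ + 1)) (h3 : ¬ j + 1 ≤ min (D - ν - 1) (D - μ + ρ + 1)) :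
    wBarUp (Fintype.card K) D ν ρ j • wBar H w ν ρ (j + 1) = 0 := by
  by_cases h : j = D - ν - 1
  · rw [wBarUp, (gauss_eq_zero_iff K (D - 1 - ν - j)).2 (by omega), mul_zero, zero_smul]
  · have e1 := hB.zero_outside (D - (j + 1)) (j + 1) 1 fun h' => by
      have h4 : j + 1 ≤ D + 1 - μ + ρ := h'.2.2.2.1
      omega
    have e2 := hB.zero_outside (D - (j + 1) - 1) (j + 1) 0 fun h' => by
      have h4 : j + 1 ≤ D + 1 - μ + ρ := h'.2.2.2.1
      omega
    have : wBar H w ν ρ (j + 1) = 0 := by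
      ext y; simp [wBar, e1, e2]
    rw [this, smul_zero]

/-- At the lower end either the coefficient contains `[j - μ] = [0]`, or `j = ν + ρ + 1`. In the
latter case the next `wBar` has its first term out of range and its second term multiplied by `[0]`.
-/
theorem IsStandardBasis.wBarDown_smul {x : Subsp K D} {W : Submodule (algH x H) (Subsp K D → ℂ)}
    (hB : IsStandardBasis x H W ν μ ρ w) {j : ℤ}
    (h2 : max (ν + ρ + 1) μ ≤ j) (h3 : ¬ max (ν + ρ + 1) μ ≤ j - 1) :
    wBarDown (Fintype.card K) D ν μ ρ j • wBar H w ν ρ (j - 1) = 0 := by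
  by_cases h : j = μ
  · rw [wBarDown, (gauss_eq_zero_iff K (j - μ)).2 (by omega), mul_zero, zero_smul]
  · have e1 := hB.zero_outside (D - (j - 1)) (j - 1) 1 fun h' => by
      have h4 : D - (j - 1) ≤ D - 1 - ν - ρ := h'.2.1
      omega
    have : wBar H w ν ρ (j - 1) = 0 := by
      ext y
      simp [wBar, e1, (gauss_eq_zero_iff K (j - 1 - ν - ρ)).2 (by omega)]
    rw [this, smul_zero]

theorem modW₂_stable (hx : x.1 ≤ H) (hH : Module.finrank K H = 2 * D)
    (hB : IsStandardBasis x.1 H W ν μ ρ w) :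
    ∀ M ∈ ({adj H} ∪ Set.range (distIdem x) : Set (Matrix (Vertex H) (Vertex H) ℂ)),
      ∀ u ∈ modW₂ H w ν μ ρ, M *ᵥ u ∈ modW₂ H w ν μ ρ := by
  intro M hM u hu
  have key : modW₂ H w ν μ ρ ≤ (modW₂ H w ν μ ρ).comap M.mulVecLin := by
    refine Submodule.span_le.2 ?_
    rintro _ ⟨j, h1, h2, rfl⟩
    have hmem : ∀ j, max (ν + ρ + 1) μ ≤ j → j ≤ min (D - ν - 1) (D - μ + ρ + 1) →
        wBar H w ν ρ j ∈ modW₂ H w ν μ ρ := fun j h1 h2 =>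
      Submodule.subset_span ⟨j, h1, h2, rfl⟩
    change M *ᵥ wBar H w ν ρ j ∈ modW₂ H w ν μ ρ
    rcases hM with rfl | ⟨k, rfl⟩
    · rw [adj_mulVec_wBar hx hH hB h1 h2]
      refine add_mem (add_mem ?_ (Submodule.smul_mem _ _ (hmem j h1 h2))) ?_
      · by_cases h3 : j + 1 ≤ min (D - ν - 1) (D - μ + ρ + 1)
        · exact Submodule.smul_mem _ _ (hmem _ (by omega) h3)
        · rw [hB.wBarUp_smul h2 h3]; exact Submodule.zero_mem _
      · by_cases h3 : max (ν + ρ + 1) μ ≤ j - 1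
        · exact Submodule.smul_mem _ _ (hmem _ h3 (by omega))
        · rw [hB.wBarDown_smul h1 h3]; exact Submodule.zero_mem _
    · rw [distIdem_mulVec_wBar hx hH hB.cell]
      split_ifs
      · exact hmem j h1 h2
      · exact Submodule.zero_mem _
  exact key hu

/-- The space `modW₂` as a module for the Terwilliger algebra. -/
noncomputable def complementary (hx : x.1 ≤ H) (hH : Module.finrank K H = 2 * D)
    (hB : IsStandardBasis x.1 H W ν μ ρ w) : Submodule (terwilliger x) (Vertex H → ℂ) :=
  submoduleOfStable (terwilliger_eq x) (modW₂ H w ν μ ρ) (modW₂_stable hx hH hB)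

/-- `ε`, `ε'`, `d` are the endpoint, the dual endpoint and the diameter of the complementary
module of a module with endpoint `(ν, μ, 0)` and index `ρ`, and `q ^ a` is its parameter `r`. -/
def ChainParams (D : ℕ) (ν μ ρ : ℤ) (ε e d : ℕ) (a : ℤ) : Prop :=
  (e : ℤ) = ν + μ + 1 ∧
    ((ε : ℤ) = ν + ρ + 1 ∧ (d : ℤ) = D - 2 * ν - ρ - 2 ∧ a = e - D - 2 ∧ μ ≤ ν + ρ + 1 ∨
      (ε : ℤ) = μ ∧ (d : ℤ) = D - 2 * μ + ρ + 1 ∧ a = e - D - 1 ∧ ν + ρ + 1 < μ)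

/-- The matrix of the adjacency matrix on a complementary module. -/
noncomputable def chainMatrix (q : ℂ) (D e d : ℕ) (a : ℤ) : Matrix (Fin (d + 1)) (Fin (d + 1)) ℂ :=
  dualHahn q d (q ^ (2 * D + 2 - e : ℤ) / (1 - q) ^ 2) (q ^ a) (q ^ (2 * e - 2 * D - 3 : ℤ))
    (theta q D e)

/-- The scaling factors of the basis of a complementary module. -/
noncomputable def chainScale (q : ℂ) (D : ℕ) (ν ρ : ℤ) (ε e d : ℕ) (a : ℤ) (i : ℕ) : ℂ :=
  ∏ l ∈ Finset.range i, wBarUp q D ν ρ (ε + l) /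
    coeffC q d (q ^ (2 * D + 2 - e : ℤ) / (1 - q) ^ 2) (q ^ a) (q ^ (2 * e - 2 * D - 3 : ℤ)) (l + 1)

theorem chainScale_succ (q : ℂ) (D : ℕ) (ν ρ : ℤ) (ε e d : ℕ) (a : ℤ) (i : ℕ) :
    chainScale q D ν ρ ε e d a (i + 1) = chainScale q D ν ρ ε e d a i * (wBarUp q D ν ρ (ε + i) /
      coeffC q d (q ^ (2 * D + 2 - e : ℤ) / (1 - q) ^ 2) (q ^ a) (q ^ (2 * e - 2 * D - 3 : ℤ))
        (i + 1)) :=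
  Finset.prod_range_succ _ _

variable {ε e d : ℕ} {a : ℤ}

theorem ChainParams.bounds (hP : ChainParams D ν μ ρ ε e d a) :
    (e : ℤ) - D - 2 ≤ a ∧ a ≤ e - D - 1 ∧ (e : ℤ) + d ≤ D ∧ max (ν + ρ + 1) μ = ε ∧
      min (D - ν - 1) (D - μ + ρ + 1) = ε + d := by
  obtain ⟨h1, ⟨h2, h3, h4, h5⟩ | ⟨h2, h3, h4, h5⟩⟩ := hP <;>
  refine ⟨by omega, by omega, by omega, by omega, by omega⟩

theorem ChainParams.up_mul_down (hP : ChainParams D ν μ ρ ε e d a) (i : ℕ) :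
    wBarUp (Fintype.card K) D ν ρ (ε + i) * wBarDown (Fintype.card K) D ν μ ρ (ε + i + 1) =
      coeffB (Fintype.card K) d ((Fintype.card K : ℂ) ^ (2 * D + 2 - e : ℤ) /
        (1 - (Fintype.card K : ℂ)) ^ 2) ((Fintype.card K : ℂ) ^ a) i *
      coeffC (Fintype.card K) d ((Fintype.card K : ℂ) ^ (2 * D + 2 - e : ℤ) /
        (1 - (Fintype.card K : ℂ)) ^ 2) ((Fintype.card K : ℂ) ^ a)
          ((Fintype.card K : ℂ) ^ (2 * e - 2 * D - 3 : ℤ)) (i + 1) := by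
  obtain ⟨h1, ⟨h2, h3, h4, h5⟩ | ⟨h2, h3, h4, h5⟩⟩ := hP
  · exact wBarUp_mul_wBarDown_left (q_ne_zero K) h2 h3 h1 h4
  · exact wBarUp_mul_wBarDown_right (q_ne_zero K) h2 h3 h1 h4

theorem ChainParams.diag (hP : ChainParams D ν μ ρ ε e d a) (i : ℕ) :
    wBarDiag (Fintype.card K) D ν μ ρ (ε + i) = theta (Fintype.card K) D e -
      coeffB (Fintype.card K) d ((Fintype.card K : ℂ) ^ (2 * D + 2 - e : ℤ) /
        (1 - (Fintype.card K : ℂ)) ^ 2) ((Fintype.card K : ℂ) ^ a) i -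
      coeffC (Fintype.card K) d ((Fintype.card K : ℂ) ^ (2 * D + 2 - e : ℤ) /
        (1 - (Fintype.card K : ℂ)) ^ 2) ((Fintype.card K : ℂ) ^ a)
          ((Fintype.card K : ℂ) ^ (2 * e - 2 * D - 3 : ℤ)) i := by
  obtain ⟨h1, ⟨h2, h3, h4, h5⟩ | ⟨h2, h3, h4, h5⟩⟩ := hP
  · exact wBarDiag_left (q_ne_zero K) (one_sub_q_ne_zero K) h2 h3 h1 h4
  · exact wBarDiag_right (q_ne_zero K) (one_sub_q_ne_zero K) h2 h3 h1 h4

variable (K) in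
theorem ChainParams.coeffC_ne_zero (hP : ChainParams D ν μ ρ ε e d a) (i : ℕ) :
    coeffC (Fintype.card K) d ((Fintype.card K : ℂ) ^ (2 * D + 2 - e : ℤ) /
        (1 - (Fintype.card K : ℂ)) ^ 2) ((Fintype.card K : ℂ) ^ a)
          ((Fintype.card K : ℂ) ^ (2 * e - 2 * D - 3 : ℤ)) (i + 1) ≠ 0 := by
  obtain ⟨h1, h2, h3, -, -⟩ := hP.bounds
  obtain ⟨b, hb, h⟩ := coeffC_pos K h1 h3 (i := i + 1) (by omega)
  rw [h]; exact_mod_cast hb.ne'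

variable (K) in
-- `wBarUp` cannot vanish inside the chain, because its product with `wBarDown` is `b_l c_{l+1} ≠
-- 0`.
theorem ChainParams.scale_ne_zero (hP : ChainParams D ν μ ρ ε e d a) {i : ℕ} (hi : i ≤ d) :
    chainScale (Fintype.card K) D ν ρ ε e d a i ≠ 0 := by
  refine Finset.prod_ne_zero_iff.2 fun l hl => div_ne_zero ?_ (hP.coeffC_ne_zero K l)
  rw [Finset.mem_range] at hl
  obtain ⟨h1, h2, h3, h4, h5⟩ := hP.bounds
  obtain ⟨b, hb, hbe⟩ := coeffB_pos K h2 h3 (i := l) (by omega)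
  intro h0
  have h := hP.up_mul_down (K := K) l
  rw [h0, zero_mul, hbe] at h
  rcases mul_eq_zero.1 h.symm with h | h
  · exact hb.ne' (by exact_mod_cast h)
  · exact hP.coeffC_ne_zero K l h

theorem isChain_complementary (hx : x.1 ≤ H) (hH : Module.finrank K H = 2 * D)
    (hB : IsStandardBasis x.1 H W ν μ ρ w) (hP : ChainParams D ν μ ρ ε e d a) :
    IsChain (complementary hx hH hB) ε d (chainMatrix (Fintype.card K) D e d a)
      fun i => chainScale (Fintype.card K) D ν ρ ε e d a i • wBar H w ν ρ (ε + i) := by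
  obtain ⟨-, -, -, hlo, hhi⟩ := hP.bounds
  refine ⟨fun i => ?_, fun i y hy => ?_, fun j => ?_, ?_⟩
  · exact smul_ne_zero (hP.scale_ne_zero K (by omega)) (hB.wBar_ne_zero (by omega) (by omega))
  · rw [Pi.smul_apply, wBar_apply_eq_zero hx hH hB.cell _ _ _ (by omega), smul_zero]
  · let P : ℕ → Vertex H → ℂ := fun i => wBarDiag (Fintype.card K) D ν μ ρ (ε + i) •
      chainScale (Fintype.card K) D ν ρ ε e d a i • wBar H w ν ρ (ε + i)
    let Q : ℕ → Vertex H → ℂ := fun i => coeffB (Fintype.card K) d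
      ((Fintype.card K : ℂ) ^ (2 * D + 2 - e : ℤ) / (1 - (Fintype.card K : ℂ)) ^ 2)
      ((Fintype.card K : ℂ) ^ a) i •
        chainScale (Fintype.card K) D ν ρ ε e d a i • wBar H w ν ρ (ε + i)
    let R : ℕ → Vertex H → ℂ := fun i => coeffC (Fintype.card K) d
      ((Fintype.card K : ℂ) ^ (2 * D + 2 - e : ℤ) / (1 - (Fintype.card K : ℂ)) ^ 2)
      ((Fintype.card K : ℂ) ^ a) ((Fintype.card K : ℂ) ^ (2 * e - 2 * D - 3 : ℤ)) i •
        chainScale (Fintype.card K) D ν ρ ε e d a i • wBar H w ν ρ (ε + i)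
    have hsum : ∀ i : Fin (d + 1), chainMatrix (Fintype.card K) D e d a i j •
        chainScale (Fintype.card K) D ν ρ ε e d a i • wBar H w ν ρ (ε + i) =
        if i = j then P i else if (j : ℕ) = i + 1 then Q i
        else if (i : ℕ) = j + 1 then R i else 0 := by
      intro i
      rw [chainMatrix, dualHahn, Matrix.of_apply, ite_smul, ite_smul, ite_smul, zero_smul,
        ← hP.diag]
    refine Eq.trans ?_ ((Finset.sum_congr rfl fun i _ => hsum i).trans
      (sum_tridiagonal (d := d) P Q R j)).symm
    dsimp only [P, Q, R]
    rw [Matrix.mulVec_smul, adj_mulVec_wBar hx hH hB (by omega) (by omega), smul_add, smul_add]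
    refine (add_rotate _ _ _).trans
      (congrArg₂ (· + ·) (congrArg₂ (· + ·) (smul_comm _ _ _) ?_) ?_)
    · split_ifs with hj
      · obtain ⟨i, hi⟩ : ∃ i : ℕ, (j : ℕ) = i + 1 := ⟨j - 1, by omega⟩
        rw [hi, Nat.add_sub_cancel, chainScale_succ, smul_smul,
          smul_smul]
        have e1 : (ε : ℤ) + ((i + 1 : ℕ) : ℤ) - 1 = ε + i := by push_cast; ring
        have e2 : (ε : ℤ) + ((i + 1 : ℕ) : ℤ) = ε + i + 1 := by push_cast; ring
        rw [e1, e2]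
        congr 1
        -- One factor of the scale is `wBarUp / c_{i+1}`, so the entry above the diagonal becomes
        -- `wBarUp * wBarDown / c_{i+1} = b_i`; the entry below it becomes `c_{i+1}`.
        have h := hP.up_mul_down (K := K) i
        have hc := hP.coeffC_ne_zero K i
        rw [mul_assoc, div_mul_eq_mul_div, h, mul_div_cancel_right₀ _ hc]
        exact mul_comm _ _
      · have := hB.wBarDown_smul (j := ε + (j : ℕ)) (by omega) (by omega)
        rw [this, smul_zero]
    · split_ifs with hj
      · rw [chainScale_succ, smul_smul, smul_smul]
        have e2 : (ε : ℤ) + (((j : ℕ) + 1 : ℕ) : ℤ) = ε + (j : ℕ) + 1 := by push_cast; ring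
        rw [e2]
        congr 1
        have hc := hP.coeffC_ne_zero K j
        rw [mul_left_comm, mul_div_cancel₀ _ hc]
      · have := hB.wBarUp_smul (j := ε + (j : ℕ)) (by omega) (by omega)
        rw [this, smul_zero]
  · have : (complementary hx hH hB).restrictScalars ℂ = modW₂ H w ν μ ρ :=
      restrictScalars_submoduleOfStable
    rw [this]
    refine le_antisymm (Submodule.span_le.2 ?_) (Submodule.span_le.2 ?_)
    · rintro _ ⟨i, rfl⟩
      exact Submodule.smul_mem _ _ (Submodule.subset_span ⟨_, by omega, by omega, rfl⟩)
    · rintro _ ⟨j, h1, h2, rfl⟩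
      have hj : j = ε + ((j - ε).toNat : ℤ) := by omega
      have hd : (j - ε).toNat < d + 1 := by omega
      have h3 := Submodule.smul_mem (Submodule.span ℂ (Set.range fun i : Fin (d + 1) =>
        chainScale (Fintype.card K) D ν ρ ε e d a i • wBar H w ν ρ (ε + i)))
          (chainScale (Fintype.card K) D ν ρ ε e d a (j - ε).toNat)⁻¹
          (Submodule.subset_span ⟨⟨(j - ε).toNat, hd⟩, rfl⟩)
      dsimp only at h3
      rwa [smul_smul, inv_mul_cancel₀ (hP.scale_ne_zero K (by omega)), one_smul, ← hj] at h3

end TwistedGrassmann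

namespace TwistedGrassmann

/-! ### Isotypic components of sums of simple modules -/

section Isotypic

variable {R M ι : Type*} [Ring R] [AddCommGroup M] [Module R M]

/-- A simple submodule of a sum of simple submodules is isomorphic to one of them. -/
theorem exists_linearEquiv_of_le_iSup {S : ι → Submodule R M} (hS : ∀ i, IsSimpleModule R (S i))
    {N : Submodule R M} (hN : IsSimpleModule R N) (h : N ≤ ⨆ i, S i) :
    ∃ i, Nonempty (N ≃ₗ[R] S i) := by
  have : ∀ m : Set.range S, IsSimpleModule R m := by
    rintro ⟨_, i, rfl⟩; exact hS i
  obtain ⟨_, ⟨i, rfl⟩, he⟩ := N.linearEquiv_of_le_sSup (Set.range S) (by rwa [sSup_range])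
  exact ⟨i, he⟩

/-- The isotypic component of a sum of simple modules is the sum of those of the given type. -/
theorem map_subtype_isotypicComponent {S : ι → Submodule R M} (hS : ∀ i, IsSimpleModule R (S i))
    {V : Submodule R M} (hV : V = ⨆ i, S i) (W : Submodule R M) (hW : IsSimpleModule R W) :
    (isotypicComponent R V W).map V.subtype = ⨆ i : {i // Nonempty (S i ≃ₗ[R] W)}, S i := by
  set A := ⨆ i : {i // Nonempty (S i ≃ₗ[R] W)}, S i with hA
  set B := ⨆ i : {i // ¬ Nonempty (S i ≃ₗ[R] W)}, S i with hB
  have hAB : V ≤ A ⊔ B := by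
    rw [hV]
    refine iSup_le fun i => ?_
    by_cases hi : Nonempty (S i ≃ₗ[R] W)
    · exact (le_iSup (fun i : {i // Nonempty (S i ≃ₗ[R] W)} => S i) ⟨i, hi⟩).trans le_sup_left
    · exact (le_iSup (fun i : {i // ¬ Nonempty (S i ≃ₗ[R] W)} => S i) ⟨i, hi⟩).trans le_sup_right
  have hAN : A ≤ isotypicComponent R M W := iSup_le fun i => le_sSup i.2
  -- A simple submodule of the intersection would be of type `W` and also isomorphic to a summand
  -- that is not. The modular law then cuts `A ⊔ B` down to `A`.
  have hNB : isotypicComponent R M W ⊓ B = ⊥ := by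
    have := IsSemisimpleModule.of_injective _
      (Submodule.inclusion_injective (inf_le_left : isotypicComponent R M W ⊓ B ≤ _))
    refine (IsSemisimpleModule.eq_bot_or_exists_simple_le _).resolve_right ?_
    rintro ⟨N, hle, hN⟩
    have h1 := isIsotypicOfType_submodule_iff.1 (IsIsotypicOfType.isotypicComponent R M W) N
      (hle.trans inf_le_left)
    obtain ⟨i, h2⟩ := exists_linearEquiv_of_le_iSup (fun i => hS i.1) hN (hle.trans inf_le_right)
    exact i.2 ⟨h2.some.symm.trans h1.some⟩
  refine le_antisymm ?_ ?_
  · have h1 : (isotypicComponent R V W).map V.subtype ≤ isotypicComponent R M W :=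
      Submodule.map_le_iff_le_comap.2 (LinearMap.le_comap_isotypicComponent W V.subtype)
    have h2 : (isotypicComponent R V W).map V.subtype ≤ V := Submodule.map_subtype_le _ _
    calc _ ≤ (A ⊔ B) ⊓ isotypicComponent R M W := le_inf (h2.trans hAB) h1
      _ = A ⊔ B ⊓ isotypicComponent R M W := (sup_inf_assoc_of_le B hAN)
      _ ≤ A := by rw [inf_comm, hNB, sup_bot_eq]
  · refine iSup_le fun i => ?_
    have hle : S i ≤ V := by rw [hV]; exact le_iSup S i
    have e : (S i).submoduleOf V ≃ₗ[R] S i := Submodule.submoduleOfEquivOfLe hle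
    have h1 : (S i).submoduleOf V ≤ isotypicComponent R V W :=
      le_sSup ⟨e.trans i.2.some⟩
    intro u hu
    exact ⟨⟨u, hle hu⟩, h1 hu, rfl⟩

/-- An isotypic module of finite length is a power of `W`, and the exponent is found by comparing
dimensions. -/
theorem nonempty_isotypicComponent_linearEquiv {k : Type*} [Field k] [Algebra k R] [Module k M]
    [IsScalarTower k R M] [Module.Finite k M] {S : ι → Submodule R M}
    (hS : ∀ i, IsSimpleModule R (S i)) {V W : Submodule R M} (hV : V = ⨆ i, S i)
    (hW : IsSimpleModule R W) {m : ℕ}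
    (h : Module.finrank k ((⨆ i : {i // Nonempty (S i ≃ₗ[R] W)}, S i).restrictScalars k)
      = m * Module.finrank k (W.restrictScalars k)) :
    Nonempty (isotypicComponent R V W ≃ₗ[R] (Fin m → W)) := by
  haveI : IsNoetherian R M := isNoetherian_of_tower k inferInstance
  obtain ⟨n, ⟨e⟩⟩ := (IsIsotypicOfType.isotypicComponent R V W).linearEquiv_fun
  have e1 := ((isotypicComponent R V W).equivMapOfInjective V.subtype
    V.subtype_injective).symm.trans e
  rw [map_subtype_isotypicComponent hS hV W hW] at e1
  have h1 : Module.finrank k ((⨆ i : {i // Nonempty (S i ≃ₗ[R] W)},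
      S i).restrictScalars k) = n * Module.finrank k (W.restrictScalars k) := by
    haveI : Module.Finite k W := inferInstanceAs (Module.Finite k (W.restrictScalars k))
    have := (e1.restrictScalars k).finrank_eq
    rw [Module.finrank_pi_fintype, Finset.sum_const, Finset.card_univ, Fintype.card_fin,
      smul_eq_mul] at this
    exact this
  have hpos : 0 < Module.finrank k (W.restrictScalars k) := by
    have := IsSimpleModule.nontrivial R W
    have : Nontrivial (W.restrictScalars k) := this
    exact Module.finrank_pos
  rw [h] at h1
  obtain rfl : m = n := Nat.eq_of_mul_eq_mul_right hpos h1
  exact ⟨e⟩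

/-- Sums of simple modules of different types are disjoint. -/
theorem disjoint_iSup_of_not_linearEquiv {κ : Type*} {S : ι → Submodule R M}
    (hS : ∀ i, IsSimpleModule R (S i)) {S' : κ → Submodule R M}
    (hS' : ∀ i, IsSimpleModule R (S' i)) (h : ∀ i j, IsEmpty (S i ≃ₗ[R] S' j)) :
    Disjoint (⨆ i, S i) (⨆ i, S' i) := by
  have h1 : IsSemisimpleModule R ↥(⨆ i ∈ (Set.univ : Set ι), S i) :=
    isSemisimpleModule_biSup_of_isSemisimpleModule_submodule fun i _ => by
      have := hS i; infer_instance
  rw [iSup_univ] at h1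
  have := IsSemisimpleModule.of_injective _
    (Submodule.inclusion_injective (inf_le_left : (⨆ i, S i) ⊓ (⨆ i, S' i) ≤ _))
  rw [disjoint_iff]
  refine (IsSemisimpleModule.eq_bot_or_exists_simple_le _).resolve_right ?_
  rintro ⟨N, hNle, hN⟩
  obtain ⟨i, ⟨φ⟩⟩ := exists_linearEquiv_of_le_iSup hS hN (hNle.trans inf_le_left)
  obtain ⟨j, ⟨φ'⟩⟩ := exists_linearEquiv_of_le_iSup hS' hN (hNle.trans inf_le_right)
  exact (h i j).false (φ.symm.trans φ')

end Isotypic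

end TwistedGrassmann

/-! ### From known chains to all simple submodules of their sum -/

namespace TwistedGrassmann

universe u

variable {K : Type u} [Field K] [Fintype K] {D : ℕ} {H : Subsp K D} {x : Vertex H}

section Chain

variable {W W' : Submodule (terwilliger x) (Vertex H → ℂ)} {ε e d : ℕ} {a : ℤ}
  {v : Fin (d + 1) → Vertex H → ℂ}

theorem IsChain.isSimpleModule_of_chainMatrix
    (h : IsChain W ε d (chainMatrix (Fintype.card K) D e d a) v) (h1 : (e : ℤ) - D - 2 ≤ a)
    (h2 : a ≤ e - D - 1) (h3 : (e : ℤ) + d ≤ D) : IsSimpleModule (terwilliger x) W :=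
  h.isSimpleModule fun i j hij => dualHahn_ne_zero K h1 h2 h3 _ i j hij

theorem IsChain.params_eq (h : IsChain W ε d (chainMatrix (Fintype.card K) D e d a) v)
    (h1 : (e : ℤ) - D - 2 ≤ a) (h2 : a ≤ e - D - 1) (h3 : (e : ℤ) + d ≤ D) :
    dualEndpoint W = e ∧ params W = ((ε : ℤ), (e : ℤ), (d : ℤ)) := by
  have he : dualEndpoint W = e := h.dualEndpoint_eq (by omega)
    (fun i j hij => dualHahn_nonneg K h1 h2 h3 _ i j hij)
    (fun i => sum_dualHahn_row _ _ _ _ _ _ i)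
  exact ⟨he, by rw [params, h.endpoint_eq, h.diameter_eq, he]⟩

theorem IsChain.isDualHahn (h : IsChain W ε d (chainMatrix (Fintype.card K) D e d a) v)
    (h1 : (e : ℤ) - D - 2 ≤ a) (h2 : a ≤ e - D - 1) (h3 : (e : ℤ) + d ≤ D) :
    IsDualHahn W (Fintype.card K) ((Fintype.card K : ℂ) ^ a) := by
  obtain rfl : dualEndpoint W = e := (h.params_eq h1 h2 h3).1
  obtain rfl : diameter W = d := h.diameter_eq
  obtain rfl : endpoint W = ε := h.endpoint_eq
  refine ⟨h.isThin, admissible_zpow K h1 h2 h3, h.basis, fun i => ?_, fun j => ?_⟩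
  · rw [h.basis_apply, h.component_eq]
    exact Submodule.mem_span_singleton_self _
  · simp only [h.basis_apply]
    exact h.adj_mul j

end Chain

/-- The description of the simple submodules of a sum of simple submodules whose adjacency
matrices are known, provided that the dimension of the sum of the summands with given parameters
is known. -/
theorem isDescribedBy_of_chains {ι : Type*} {S : ι → Submodule (terwilliger x) (Vertex H → ℂ)}
    {V : Submodule (terwilliger x) (Vertex H → ℂ)} (hV : V = ⨆ i, S i) (ε e d : ι → ℕ) {t : ℤ}
    (ht : -D - 2 ≤ t) (ht' : t ≤ -D - 1) (hed : ∀ i, (e i : ℤ) + d i ≤ D)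
    (hS : ∀ i, ∃ v, IsChain (S i) (ε i) (d i)
      (chainMatrix (Fintype.card K) D (e i) (d i) (e i + t)) v)
    {Ω : Set (ℤ × ℤ × ℤ)} (hΩ : (Set.range fun i => ((ε i : ℤ), (e i : ℤ), (d i : ℤ))) = Ω)
    {ratio : ℤ × ℤ × ℤ → ℂ}
    (hm : ∀ i, ∃ m : ℕ,
      (∀ ι' : Set ι, (∀ j, j ∈ ι' ↔ ε j = ε i ∧ e j = e i ∧ d j = d i) →
        Module.finrank ℂ ((⨆ j : ι', S j).restrictScalars ℂ) = m * (d i + 1)) ∧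
      (m : ℂ) / (qFac (Fintype.card K) (D - 1) * qFac (Fintype.card K) (D + 1)) =
        ratio (ε i, e i, d i)) :
    IsDescribedBy V Ω (fun ε' => (Fintype.card K : ℂ) ^ (ε' + t)) ratio := by
  have hSs : ∀ i, IsSimpleModule (terwilliger x) (S i) := fun i => by
    obtain ⟨v, hv⟩ := hS i
    exact hv.isSimpleModule_of_chainMatrix (by omega) (by omega) (hed i)
  have hchain : ∀ W : Submodule (terwilliger x) (Vertex H → ℂ), ∀ i,
      Nonempty (W ≃ₗ[terwilliger x] S i) →
      ∃ v, IsChain W (ε i) (d i) (chainMatrix (Fintype.card K) D (e i) (d i) (e i + t)) v := by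
    rintro W i ⟨φ⟩
    obtain ⟨v, hv⟩ := hS i
    exact ⟨_, hv.of_linearEquiv φ.symm⟩
  have hex : ∀ W ≤ V, IsSimpleModule (terwilliger x) W →
      ∃ i, Nonempty (W ≃ₗ[terwilliger x] S i) := fun W hW hWs =>
    exists_linearEquiv_of_le_iSup hSs hWs (hW.trans hV.le)
  have hparams : ∀ W : Submodule (terwilliger x) (Vertex H → ℂ), ∀ i,
      Nonempty (W ≃ₗ[terwilliger x] S i) →
      dualEndpoint W = e i ∧ params W = ((ε i : ℤ), (e i : ℤ), (d i : ℤ)) := by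
    intro W i h
    obtain ⟨v, hv⟩ := hchain W i h
    exact hv.params_eq (by omega) (by omega) (hed i)
  -- The parameters are invariants of the isomorphism class. Conversely, for the fixed offset `t`
  -- equal parameters mean equal matrices, hence isomorphic chains.
  have hiso : ∀ W : Submodule (terwilliger x) (Vertex H → ℂ), ∀ i j,
      Nonempty (W ≃ₗ[terwilliger x] S i) →
        (Nonempty (S j ≃ₗ[terwilliger x] W) ↔ ε j = ε i ∧ e j = e i ∧ d j = d i) := by
    intro W i j hi
    constructor
    · rintro ⟨φ⟩
      have h1 := (hparams W i hi).2
      rw [(hparams W j ⟨φ.symm⟩).2] at h1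
      simpa using h1
    · rintro ⟨h1, h2, h3⟩
      obtain ⟨v, hv⟩ := hchain W i hi
      rw [← h1, ← h2] at hv
      generalize d i = d' at *
      subst h3
      obtain ⟨v', hv'⟩ := hS j
      exact hv'.nonempty_linearEquiv hv
  refine ⟨?_, fun W hW hWs => ?_, fun W hW W' hW' hWs hWs' => ?_, fun W hW hWs => ?_⟩
  · rw [← hΩ]
    ext p
    constructor
    · rintro ⟨W, hW, hWs, rfl⟩
      obtain ⟨i, hi⟩ := hex W hW hWs
      exact ⟨i, (hparams W i hi).2.symm⟩
    · rintro ⟨i, rfl⟩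
      exact ⟨S i, by rw [hV]; exact le_iSup S i, hSs i, (hparams (S i) i ⟨.refl _ _⟩).2⟩
  · obtain ⟨i, hi⟩ := hex W hW hWs
    obtain ⟨v, hv⟩ := hchain W i hi
    rw [(hparams W i hi).1]
    exact hv.isDualHahn (by omega) (by omega) (hed i)
  · obtain ⟨i, hi⟩ := hex W hW hWs
    obtain ⟨j, hj⟩ := hex W' hW' hWs'
    have h1 := (hiso W i j hi)
    rw [(hparams W i hi).2, (hparams W' j hj).2]
    constructor
    · rintro ⟨φ⟩
      obtain ⟨h2, h3, h4⟩ := h1.1 ⟨(φ.trans hj.some).symm⟩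
      rw [h2, h3, h4]
    · intro h
      obtain ⟨φ⟩ := h1.2 (by simp at h; omega)
      exact ⟨(hj.some.trans φ).symm⟩
  · obtain ⟨i, hi⟩ := hex W hW hWs
    obtain ⟨m, hm1, hm2⟩ := hm i
    refine ⟨m, ?_, by rw [(hparams W i hi).2]; exact hm2⟩
    obtain ⟨v, hv⟩ := hchain W i hi
    refine nonempty_isotypicComponent_linearEquiv (k := ℂ) hSs hV hWs ?_
    rw [hv.finrank_eq]
    exact hm1 {j | Nonempty (S j ≃ₗ[terwilliger x] W)} fun j => hiso W i j hi

end TwistedGrassmann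

/-! ### Sums of complementary modules over all lowest vectors -/

namespace TwistedGrassmann

universe u

variable {K : Type u} [Field K] [Fintype K] {D : ℕ} {H : Subsp K D} {x : Vertex H}
  {F : FlagDecomposition x.1 H} {c : ℤ → ℤ → ℤ → Prop}

/-- The map sending a lowest vector to one of the vectors `wBar` of the module generated by it. -/
noncomputable def wBarLin (x H : Subsp K D) (ν μ ρ j : ℤ) :
    (Subsp K D → ℂ) →ₗ[ℂ] (Vertex H → ℂ) where
  toFun f := wBar H (fun i j k => stdVec x H ν μ i j k f) ν ρ j
  map_add' f g := by ext y; simp only [wBar, map_add, Pi.add_apply]; ring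
  map_smul' a f := by
    ext y
    simp only [wBar, map_smul, Pi.smul_apply, smul_eq_mul, RingHom.id_apply]
    ring

/-- The lowest vectors of the simple modules with `τ = 0` that satisfy the condition `c` and have
a nonzero complementary module. -/
structure LowestVector (F : FlagDecomposition x.1 H) (c : ℤ → ℤ → ℤ → Prop) where
  (ν μ ρ : ℤ)
  vec : Subsp K D → ℂ
  mem : vec ∈ F.lowestSpace ν μ ρ
  ne_zero : vec ≠ 0
  prop : c ν μ ρ
  lt : ρ < D - 2 * ν - 1

/-- The complementary module generated by a lowest vector. -/
noncomputable def LowestVector.module (hx : x.1 ≤ H) (hH : Module.finrank K H = 2 * D)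
    (p : LowestVector F c) : Submodule (terwilliger x) (Vertex H → ℂ) :=
  complementary hx hH (isStandardBasis_stdVec hx hH p.mem p.ne_zero)

theorem LowestVector.restrictScalars_module (hx : x.1 ≤ H) (hH : Module.finrank K H = 2 * D)
    (p : LowestVector F c) : (p.module hx hH).restrictScalars ℂ =
      modW₂ H (fun i j k => stdVec x.1 H p.ν p.μ i j k p.vec) p.ν p.μ p.ρ := by
  ext u; rfl

theorem modW₂_le_sumW₂ {W : Submodule (algH x.1 H) (Subsp K D → ℂ)} {ν μ ρ : ℤ}
    {w : ℤ → ℤ → ℤ → (Subsp K D → ℂ)} (h1 : IsSimpleModule (algH x.1 H) W)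
    (h2 : HasEndpoint x.1 H W ν μ 0 ρ) (hB : IsStandardBasis x.1 H W ν μ ρ w) (hc : c ν μ ρ) :
    modW₂ H w ν μ ρ ≤ sumW₂ x c :=
  le_sSup ⟨W, ν, μ, ρ, w, h1, h2, hB, hc, rfl⟩

theorem sumW₂_stable (hx : x.1 ≤ H) (hH : Module.finrank K H = 2 * D)
    (c : ℤ → ℤ → ℤ → Prop) :
    ∀ M ∈ ({adj H} ∪ Set.range (distIdem x) : Set (Matrix (Vertex H) (Vertex H) ℂ)),
      ∀ u ∈ sumW₂ x c, M *ᵥ u ∈ sumW₂ x c := by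
  intro M hM u hu
  have key : sumW₂ x c ≤ (sumW₂ x c).comap M.mulVecLin := by
    refine sSup_le ?_
    rintro U ⟨W, ν, μ, ρ, w, h1, h2, hB, h4, rfl⟩ v hv
    exact modW₂_le_sumW₂ h1 h2 hB h4 (modW₂_stable hx hH hB M hM v hv)
  exact key hu

/-- The sum of the complementary modules subject to the condition `c`. -/
noncomputable def sumModule (hx : x.1 ≤ H) (hH : Module.finrank K H = 2 * D)
    (c : ℤ → ℤ → ℤ → Prop) : Submodule (terwilliger x) (Vertex H → ℂ) :=
  submoduleOfStable (terwilliger_eq x) (sumW₂ x c) (sumW₂_stable hx hH c)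

theorem restrictScalars_sumModule (hx : x.1 ≤ H) (hH : Module.finrank K H = 2 * D) :
    (sumModule hx hH c).restrictScalars ℂ = sumW₂ x c :=
  restrictScalars_submoduleOfStable

theorem IsStandardBasis.mem_indexRange_of_isSimpleModule
    {W : Submodule (algH x.1 H) (Subsp K D → ℂ)} {ν μ ρ : ℤ} {w : ℤ → ℤ → ℤ → (Subsp K D → ℂ)}
    (hB : IsStandardBasis x.1 H W ν μ ρ w) (hW : IsSimpleModule (algH x.1 H) W) :
    (ν, μ, 0) ∈ indexRange D ν μ ρ :=
  hB.eq_zero_or_range (isSimpleModule_iff_isAtom.1 hW).1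

/-- Every standard basis is the one generated by its vector `w ν μ 0`. The modules with `ρ ≥ D - 2ν
- 1` may be left out, since the index range of their `wBar` is empty. -/
theorem sumModule_eq_iSup (F : FlagDecomposition x.1 H) (hx : x.1 ≤ H)
    (hH : Module.finrank K H = 2 * D) (c : ℤ → ℤ → ℤ → Prop) :
    sumModule hx hH c = ⨆ p : LowestVector F c, p.module hx hH := by
  have hxD := finrank_base hx
  refine le_antisymm ?_ (iSup_le fun p => ?_)
  · have : sumW₂ x c ≤ (⨆ p : LowestVector F c, p.module hx hH).restrictScalars ℂ := by
      refine sSup_le ?_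
      rintro U ⟨W, ν, μ, ρ, w, h1, h2, hB, h4, rfl⟩
      have h0 := hB.mem_indexRange_of_isSimpleModule h1
      obtain ⟨h5, h6⟩ := hB.eq_stdVec F h0
      by_cases hlt : ρ < D - 2 * ν - 1
      · let p : LowestVector F c := ⟨ν, μ, ρ, w ν μ 0, h5, hB.ne_zero h0, h4, hlt⟩
        have h7 : modW₂ H w ν μ ρ = (p.module hx hH).restrictScalars ℂ := by
          rw [p.restrictScalars_module]
          have : w = fun i j k => stdVec x.1 H ν μ i j k (w ν μ 0) := by
            funext i j k; exact h6 i j k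
          exact congrArg (fun w => modW₂ H w ν μ ρ) this
        rw [h7]
        exact le_iSup (fun p : LowestVector F c => p.module hx hH) p
      · refine Submodule.span_le.2 ?_
        rintro _ ⟨j, h7, h8, rfl⟩
        omega
    exact this
  · intro u hu
    have h1 : u ∈ (p.module hx hH).restrictScalars ℂ := hu
    rw [p.restrictScalars_module] at h1
    exact modW₂_le_sumW₂ (stdModule_isSimpleModule hx hH p.mem p.ne_zero)
      (stdModule_hasEndpoint hx hxD hH p.mem p.ne_zero)
      (isStandardBasis_stdVec hx hH p.mem p.ne_zero) p.prop h1

/-- All lowest vectors of one type are treated together: the sum of their modules is the image of `d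
+ 1` copies of the space of lowest vectors under a map built from `wBar`. The map is injective
because the matrix of distance `ε + i` recovers the `i`-th term. -/
theorem finrank_iSup_module (hx : x.1 ≤ H) (hH : Module.finrank K H = 2 * D) {ν μ ρ : ℤ}
    {ε e d : ℕ} {a : ℤ} (hP : ChainParams D ν μ ρ ε e d a) (hc : c ν μ ρ)
    (hlt : ρ < D - 2 * ν - 1) {s : Set (LowestVector F c)}
    (hs : ∀ p, p ∈ s ↔ p.ν = ν ∧ p.μ = μ ∧ p.ρ = ρ) :
    Module.finrank ℂ ((⨆ p : s, p.1.module hx hH).restrictScalars ℂ) =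
      Module.finrank ℂ (F.lowestSpace ν μ ρ) * (d + 1) := by
  obtain ⟨-, -, -, hlo, hhi⟩ := hP.bounds
  have hcell : ∀ f : F.lowestSpace ν μ ρ, ∀ i j k,
      stdVec x.1 H ν μ i j k f ∈ cellSpace x.1 H i j k := fun f i j k =>
    stdVec_mem_cellSpace (F := F) (FlagDecomposition.mem_lowestSpace.1 f.2).1 i j k
  let Φ : (Fin (d + 1) → F.lowestSpace ν μ ρ) →ₗ[ℂ] (Vertex H → ℂ) :=
    ∑ i : Fin (d + 1), wBarLin x.1 H ν μ ρ (ε + (i : ℕ)) ∘ₗ (F.lowestSpace ν μ ρ).subtype ∘ₗ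
      LinearMap.proj i
  have hΦ : ∀ g, Φ g = ∑ i : Fin (d + 1), wBarLin x.1 H ν μ ρ (ε + (i : ℕ)) (g i) := by
    intro g
    simp [Φ, LinearMap.sum_apply]
  have hproj : ∀ g (i : Fin (d + 1)), distIdem x (ε + i) *ᵥ Φ g =
      wBarLin x.1 H ν μ ρ (ε + (i : ℕ)) (g i) := by
    intro g i
    rw [hΦ, Matrix.mulVec_sum, Finset.sum_eq_single i]
    · exact (distIdem_mulVec_wBar hx hH (hcell (g i)) ν ρ _ _).trans (if_pos (by push_cast; rfl))
    · intro j _ hj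
      refine (distIdem_mulVec_wBar hx hH (hcell (g j)) ν ρ _ _).trans (if_neg ?_)
      intro h
      exact hj (Fin.ext (by omega))
    · simp
  have hinj : Function.Injective Φ := by
    rw [injective_iff_map_eq_zero]
    intro g hg
    funext i
    by_contra hne
    have h1 := hproj g i
    rw [hg, Matrix.mulVec_zero] at h1
    have h2 : ((g i : F.lowestSpace ν μ ρ) : Subsp K D → ℂ) ≠ 0 := fun h => hne (Subtype.ext h)
    exact (isStandardBasis_stdVec hx hH (g i).2 h2).wBar_ne_zero (by omega) (by omega) h1.symm
  have hrange : (⨆ p : s, p.1.module hx hH).restrictScalars ℂ = LinearMap.range Φ := by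
    refine le_antisymm ?_ ?_
    · rw [Submodule.restrictScalars_iSup]
      refine iSup_le ?_
      rintro ⟨p, hp⟩
      obtain ⟨rfl, rfl, rfl⟩ := (hs p).1 hp
      rw [p.restrictScalars_module]
      refine Submodule.span_le.2 ?_
      rintro _ ⟨j, h1, h2, rfl⟩
      have hj : (ε : ℤ) + ((j - ε).toNat : ℤ) = j := by omega
      refine ⟨Pi.single ⟨(j - ε).toNat, by omega⟩ ⟨p.vec, p.mem⟩, ?_⟩
      rw [hΦ, Finset.sum_eq_single ⟨(j - ε).toNat, by omega⟩]
      · rw [Pi.single_eq_same, hj]; rfl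
      · intro i _ hi
        rw [Pi.single_eq_of_ne hi]
        exact map_zero _
      · simp
    · rintro _ ⟨g, rfl⟩
      rw [hΦ]
      refine Submodule.sum_mem _ fun i _ => ?_
      by_cases h0 : ((g i : F.lowestSpace ν μ ρ) : Subsp K D → ℂ) = 0
      · rw [h0, map_zero]; exact Submodule.zero_mem _
      · let p : LowestVector F c := ⟨ν, μ, ρ, g i, (g i).2, h0, hc, hlt⟩
        have hp : p ∈ s := (hs p).2 ⟨rfl, rfl, rfl⟩
        refine le_iSup (fun p : s => p.1.module hx hH) ⟨p, hp⟩ ?_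
        change _ ∈ (p.module hx hH).restrictScalars ℂ
        rw [p.restrictScalars_module]
        exact Submodule.subset_span ⟨ε + (i : ℕ),
          show max (ν + ρ + 1) μ ≤ (ε : ℤ) + (i : ℕ) by omega,
          show (ε : ℤ) + (i : ℕ) ≤ min (D - ν - 1) (D - μ + ρ + 1) by omega, rfl⟩
  rw [hrange, LinearMap.finrank_range_of_inj hinj, Module.finrank_pi_fintype, Finset.sum_const,
    Finset.card_univ, Fintype.card_fin, smul_eq_mul, mul_comm]

end TwistedGrassmann

/-! ### Parameters and multiplicities -/

namespace TwistedGrassmann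

universe u

/-- The conditions under which lowest vectors exist. -/
def LowestBounds (D : ℕ) (ν μ ρ : ℤ) : Prop :=
  0 ≤ ν ∧ 0 ≤ ρ ∧ ρ ≤ μ ∧ 2 * ν + ρ + 1 ≤ D ∧ 2 * μ ≤ D + 1 + ρ

section Lowest

variable {K : Type u} [Field K] [Fintype K] {D : ℕ} {x H : Subsp K D} {F : FlagDecomposition x H}
  {ν μ ρ : ℤ}

/-- The upper bounds are the lengths of the strings. The bound `ρ ≤ μ` holds because a summand of
rank `ρ` has no functions on cells with second coordinate below `ρ`. -/
theorem lowestBounds_of_mem (hxH : x ≤ H) (hx : Module.finrank K x + 1 = D)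
    (hH : Module.finrank K H = 2 * D) {f : Subsp K D → ℂ} (hf : f ∈ F.lowestSpace ν μ ρ)
    (h0 : f ≠ 0) : LowestBounds D ν μ ρ := by
  obtain ⟨h1, -, -⟩ := FlagDecomposition.mem_lowestSpace.1 hf
  obtain ⟨hc, hp⟩ := F.mem_rankSpace.1 h1
  have h2 := (cell_bounds_of_ne_zero hxH hx hH hc h0).1.1
  have h3 : (ν, μ, 0) ∈ indexRange D ν μ ρ := mem_indexRange_of_lowestSpace hf h0
  obtain ⟨h4, h5, h6, h7, -, -⟩ := h3
  dsimp only at h4 h5 h6 h7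
  obtain ⟨s, hs⟩ : ∃ s, F.proj s f ≠ 0 := by
    by_contra! hn
    exact h0 (F.ext_proj (suppIn_of_mem_cellSpace hc) (fun _ _ => rfl) fun s => by
      rw [hn s, map_zero])
  have h8 : (F.rk s : ℤ) = ρ := by_contra fun h => hs (hp s h)
  have h9 : ¬ μ < F.rk s := fun h =>
    hs (F.eq_zero_of_lt s _ (F.proj_mem s f) ν μ (F.proj_mem_cellSpace hc s) h)
  exact ⟨h2, by omega, by omega, by omega, by omega⟩

theorem finrank_lowestSpace_div (hb : LowestBounds D ν μ ρ) :
    (Module.finrank ℂ (F.lowestSpace ν μ ρ) : ℂ) /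
        (qFac (Fintype.card K) (D - 1) * qFac (Fintype.card K) (D + 1)) =
      (-1) ^ ρ * (Fintype.card K : ℂ) ^ (binomTwo ρ + ν + μ - ρ) *
        (1 - (Fintype.card K : ℂ) ^ (D - ρ - 2 * ν)) *
        (1 - (Fintype.card K : ℂ) ^ (D + 2 + ρ - 2 * μ)) /
      (qFac (Fintype.card K) ρ * qFac (Fintype.card K) ν * qFac (Fintype.card K) (D - ρ - ν) *
        qFac (Fintype.card K) (μ - ρ) * qFac (Fintype.card K) (D + 2 - μ)) := by
  obtain ⟨h1, h2, h3, h4, h5⟩ := hb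
  obtain ⟨b, hb⟩ := Int.eq_ofNat_of_zero_le (sub_nonneg.2 h3)
  lift ν to ℕ using h1
  lift ρ to ℕ using h2
  obtain rfl : μ = ρ + b := by omega
  rw [F.finrank_lowestSpace (by omega) (by omega), mul_div_cancel_left₀ _
    (mul_ne_zero (qFac_ne_zero K _) (qFac_ne_zero K _)), zpow_natCast]
  have e1 : binomTwo (ρ : ℤ) + ν + (ρ + b) - ρ = ((ρ.choose 2 + ν + b : ℕ) : ℤ) := by
    rw [binomTwo, Int.toNat_natCast]; push_cast; ring
  have e2 : (D : ℤ) + 2 + ρ - 2 * (ρ + b) = D + 2 - ρ - 2 * b := by ring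
  have e3 : (ρ : ℤ) + b - ρ = b := by ring
  have e4 : (D : ℤ) + 2 - (ρ + b) = D + 2 - ρ - b := by ring
  rw [e1, e2, e3, e4, zpow_natCast]

/-- Within the bounds the exponents `D - ρ - 2ν` and `D + 2 + ρ - 2μ` are positive, so no factor of
the dimension formula vanishes. Hence every admissible triple does occur. -/
theorem lowestSpace_exists_ne_zero (F : FlagDecomposition x H) (hb : LowestBounds D ν μ ρ) :
    ∃ f ∈ F.lowestSpace ν μ ρ, f ≠ 0 := by
  have hq := q_ne_zero K
  refine Submodule.exists_mem_ne_zero_of_ne_bot fun h => ?_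
  have h1 := finrank_lowestSpace_div (F := F) hb
  rw [h, finrank_bot, Nat.cast_zero, zero_div] at h1
  obtain ⟨h2, h3, h4, h5, h6⟩ := hb
  refine div_ne_zero (mul_ne_zero (mul_ne_zero (mul_ne_zero (zpow_ne_zero _ (by norm_num))
    (zpow_ne_zero _ hq)) ?_) ?_) (mul_ne_zero (mul_ne_zero (mul_ne_zero (mul_ne_zero ?_ ?_) ?_)
      ?_) ?_) h1.symm
  · rw [sub_ne_zero, ne_comm, Ne, q_zpow_eq_one_iff]; omega
  · rw [sub_ne_zero, ne_comm, Ne, q_zpow_eq_one_iff]; omega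
  all_goals exact qFac_ne_zero K _

end Lowest

section Ratio

variable (q : ℂ) {D : ℕ} {ν μ ρ : ℤ} {ε e d : ℕ} {a : ℤ}

theorem neg_one_zpow_congr {m n k : ℤ} (h : m = n + 2 * k) : (-1 : ℂ) ^ m = (-1) ^ n := by
  rw [h, zpow_add₀ (by norm_num), zpow_mul]
  norm_num

/-- Here `ρ = 2ε + d - D`, `ν = D - 1 - ε - d` and `μ - ρ = ε* - ε`, so the factors agree one by
one. The signs agree because `D - d = ρ + 2 (ν + 1)`. -/
theorem ratio₂₀_eq (he : (e : ℤ) = ν + μ + 1) (hε : (ε : ℤ) = ν + ρ + 1)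
    (hd : (d : ℤ) = D - 2 * ν - ρ - 2) : ratio₂₀ q D (ε, e, d) =
      (-1) ^ ρ * q ^ (binomTwo ρ + ν + μ - ρ) * (1 - q ^ (D - ρ - 2 * ν)) *
        (1 - q ^ (D + 2 + ρ - 2 * μ)) /
      (qFac q ρ * qFac q ν * qFac q (D - ρ - ν) * qFac q (μ - ρ) * qFac q (D + 2 - μ)) := by
  rw [ratio₂₀]
  have e0 : 2 * (ε : ℤ) - D + d = ρ := by omega
  have e1 : 2 * (D : ℤ) - 2 * e - d + 2 = D + 2 + ρ - 2 * μ := by omega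
  have e2 : (d : ℤ) + 2 = D - ρ - 2 * ν := by omega
  have e3 : (D : ℤ) - 2 * ε + e - d - 1 + binomTwo ρ = binomTwo ρ + ν + μ - ρ := by omega
  have e4 : (D : ℤ) - ε + 1 = D - ρ - ν := by omega
  have e5 : 2 * (D : ℤ) - ε - e - d + 2 = D + 2 - μ := by omega
  have e6 : (D : ℤ) - ε - d - 1 = ν := by omega
  have e7 : (e : ℤ) - ε = μ - ρ := by omega
  rw [e0, e1, e2, e3, e4, e5, e6, e7, neg_one_zpow_congr (n := ρ) (k := ν + 1) (by omega)]
  congr 1 <;> ring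

/-- Here `ρ = 2ε + d - D - 1`, `ν = ε* - ε - 1` and `μ = ε`. The two factors `1 - q ^ _` trade
places compared with `ratio₂₀_eq`, and `D - d + 1 = ρ + 2 (μ - ρ)`. -/
theorem ratio₂₁_eq (he : (e : ℤ) = ν + μ + 1) (hε : (ε : ℤ) = μ)
    (hd : (d : ℤ) = D - 2 * μ + ρ + 1) : ratio₂₁ q D (ε, e, d) =
      (-1) ^ ρ * q ^ (binomTwo ρ + ν + μ - ρ) * (1 - q ^ (D - ρ - 2 * ν)) *
        (1 - q ^ (D + 2 + ρ - 2 * μ)) /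
      (qFac q ρ * qFac q ν * qFac q (D - ρ - ν) * qFac q (μ - ρ) * qFac q (D + 2 - μ)) := by
  rw [ratio₂₁]
  have e0 : 2 * (ε : ℤ) - D + d - 1 = ρ := by omega
  have e1 : 2 * (D : ℤ) - 2 * e - d + 3 = D - ρ - 2 * ν := by omega
  have e2 : (d : ℤ) + 1 = D + 2 + ρ - 2 * μ := by omega
  have e3 : (D : ℤ) - 2 * ε + e - d + binomTwo ρ = binomTwo ρ + ν + μ - ρ := by omega
  have e4 : (D : ℤ) - ε + 2 = D + 2 - μ := by omega
  have e5 : 2 * (D : ℤ) - ε - e - d + 2 = D - ρ - ν := by omega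
  have e6 : (D : ℤ) - ε - d + 1 = μ - ρ := by omega
  have e7 : (e : ℤ) - ε - 1 = ν := by omega
  rw [e0, e1, e2, e3, e4, e5, e6, e7, neg_one_zpow_congr (n := ρ) (k := μ - ρ) (by omega)]
  congr 1 <;> ring

end Ratio

variable {K : Type u} [Field K] [Fintype K] {D : ℕ} {H : Subsp K D} {x : Vertex H}
  {F : FlagDecomposition x.1 H} {c : ℤ → ℤ → ℤ → Prop}

theorem LowestVector.bounds (hx : x.1 ≤ H) (hH : Module.finrank K H = 2 * D)
    (p : LowestVector F c) : LowestBounds D p.ν p.μ p.ρ :=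
  lowestBounds_of_mem hx (finrank_base hx) hH p.mem p.ne_zero

theorem LowestVector.isChain (hx : x.1 ≤ H) (hH : Module.finrank K H = 2 * D)
    (p : LowestVector F c) {ε e d : ℕ} {a : ℤ} (hP : ChainParams D p.ν p.μ p.ρ ε e d a) :
    ∃ v, IsChain (p.module hx hH) ε d (chainMatrix (Fintype.card K) D e d a) v :=
  ⟨_, isChain_complementary hx hH _ hP⟩

theorem isDescribedBy_sumModule (F : FlagDecomposition x.1 H) (hx : x.1 ≤ H)
    (hH : Module.finrank K H = 2 * D) (ε e d : LowestVector F c → ℕ) {t : ℤ}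
    (ht : -D - 2 ≤ t) (ht' : t ≤ -D - 1)
    (hP : ∀ p, ChainParams D p.ν p.μ p.ρ (ε p) (e p) (d p) (e p + t))
    {Ω : Set (ℤ × ℤ × ℤ)} (hΩ : (Set.range fun p => ((ε p : ℤ), (e p : ℤ), (d p : ℤ))) = Ω)
    {ratio : ℤ × ℤ × ℤ → ℂ}
    (hratio : ∀ p, (Module.finrank ℂ (F.lowestSpace p.ν p.μ p.ρ) : ℂ) /
        (qFac (Fintype.card K) (D - 1) * qFac (Fintype.card K) (D + 1)) =
          ratio (ε p, e p, d p)) :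
    IsDescribedBy (sumModule hx hH c) Ω (fun ε' => (Fintype.card K : ℂ) ^ (ε' + t)) ratio := by
  refine isDescribedBy_of_chains (sumModule_eq_iSup F hx hH c) ε e d ht ht'
    (fun p => (hP p).bounds.2.2.1) (fun p => p.isChain hx hH (hP p)) hΩ fun p =>
      ⟨_, fun s hs => ?_, hratio p⟩
  refine finrank_iSup_module hx hH (hP p) p.prop p.lt fun p' => ?_
  rw [hs]
  -- The offset `t` decides which alternative of `ChainParams` holds, and within one alternative the
  -- three parameters determine `(ν, μ, ρ)`.
  have h1 := hP p
  have h2 := hP p'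
  rw [ChainParams] at h1 h2
  omega

theorem isDescribedBy_left (F : FlagDecomposition x.1 H) (hx : x.1 ≤ H)
    (hH : Module.finrank K H = 2 * D) :
    IsDescribedBy (sumModule hx hH fun ν μ ρ => μ ≤ ν + ρ + 1) (Omega₂₀ D)
      (fun ε' => (Fintype.card K : ℂ) ^ (ε' - D - 2)) (ratio₂₀ (Fintype.card K) D) := by
  have hP : ∀ p : LowestVector F fun ν μ ρ => μ ≤ ν + ρ + 1, ChainParams D p.ν p.μ p.ρ
      (p.ν + p.ρ + 1).toNat (p.ν + p.μ + 1).toNat (D - 2 * p.ν - p.ρ - 2).toNat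
      ((p.ν + p.μ + 1).toNat + (-D - 2)) := by
    intro p
    have hb := p.bounds hx hH
    have h1 := p.prop
    have h2 := p.lt
    rw [LowestBounds] at hb
    rw [ChainParams]
    omega
  have hfun : (fun ε' : ℤ => (Fintype.card K : ℂ) ^ (ε' - D - 2)) =
      fun ε' : ℤ => (Fintype.card K : ℂ) ^ (ε' + (-D - 2 : ℤ)) := by
    funext ε'; congr 1; ring
  rw [hfun]
  refine isDescribedBy_sumModule F hx hH _ _ _ (by omega) (by omega) hP ?_ fun p => ?_
  · ext ⟨ε, e, d⟩
    simp only [Set.mem_range, Prod.mk.injEq, Omega₂₀, Omega, Set.mem_ofPred_eq]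
    constructor
    · rintro ⟨p, h1, h2, h3⟩
      have hb := p.bounds hx hH
      have h4 := p.prop
      have h5 := p.lt
      rw [LowestBounds] at hb
      omega
    · intro h
      -- The triple is the solution of `ε = ν + ρ + 1`, `e = ν + μ + 1`, `d = D - 2ν - ρ - 2`.
      have hb : LowestBounds D (D - 1 - ε - d) (e - D + ε + d) (2 * ε + d - D) := by
        rw [LowestBounds]; omega
      obtain ⟨f, hf, h0⟩ := lowestSpace_exists_ne_zero F hb
      refine ⟨⟨_, _, _, f, hf, h0, ?_, ?_⟩, ?_, ?_, ?_⟩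
      all_goals first | omega | (dsimp only; omega)
  · have h1 := hP p
    have h2 := p.prop
    rw [ChainParams] at h1
    rw [finrank_lowestSpace_div (p.bounds hx hH), ratio₂₀_eq (Fintype.card K : ℂ)] <;> omega

theorem isDescribedBy_right (F : FlagDecomposition x.1 H) (hx : x.1 ≤ H)
    (hH : Module.finrank K H = 2 * D) :
    IsDescribedBy (sumModule hx hH fun ν μ ρ => ν + ρ + 1 < μ) (Omega₂₁ D)
      (fun ε' => (Fintype.card K : ℂ) ^ (ε' - D - 1)) (ratio₂₁ (Fintype.card K) D) := by
  have hP : ∀ p : LowestVector F fun ν μ ρ => ν + ρ + 1 < μ, ChainParams D p.ν p.μ p.ρ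
      p.μ.toNat (p.ν + p.μ + 1).toNat (D - 2 * p.μ + p.ρ + 1).toNat
      ((p.ν + p.μ + 1).toNat + (-D - 1)) := by
    intro p
    have hb := p.bounds hx hH
    have h1 := p.prop
    have h2 := p.lt
    rw [LowestBounds] at hb
    rw [ChainParams]
    omega
  have hfun : (fun ε' : ℤ => (Fintype.card K : ℂ) ^ (ε' - D - 1)) =
      fun ε' : ℤ => (Fintype.card K : ℂ) ^ (ε' + (-D - 1 : ℤ)) := by
    funext ε'; congr 1; ring
  rw [hfun]
  refine isDescribedBy_sumModule F hx hH _ _ _ (by omega) (by omega) hP ?_ fun p => ?_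
  · ext ⟨ε, e, d⟩
    simp only [Set.mem_range, Prod.mk.injEq, Omega₂₁, Omega, Set.mem_ofPred_eq]
    constructor
    · rintro ⟨p, h1, h2, h3⟩
      have hb := p.bounds hx hH
      have h4 := p.prop
      have h5 := p.lt
      rw [LowestBounds] at hb
      omega
    · intro h
      -- The triple is the solution of `ε = μ`, `e = ν + μ + 1`, `d = D - 2μ + ρ + 1`.
      have hb : LowestBounds D (e - ε - 1) ε (d + 2 * ε - D - 1) := by
        rw [LowestBounds]; omega
      obtain ⟨f, hf, h0⟩ := lowestSpace_exists_ne_zero F hb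
      refine ⟨⟨_, _, _, f, hf, h0, ?_, ?_⟩, ?_, ?_, ?_⟩
      all_goals first | omega | (dsimp only; omega)
  · have h1 := hP p
    have h2 := p.prop
    rw [ChainParams] at h1
    rw [finrank_lowestSpace_div (p.bounds hx hH), ratio₂₁_eq (Fintype.card K : ℂ)] <;> omega

end TwistedGrassmann

namespace TwistedGrassmann

universe u

variable {K : Type u} [Field K] [Fintype K] {D : ℕ} {H : Subsp K D} {x : Vertex H}

/-! ### Extension of functions on the vertices by zero -/

/-- The extension by zero of a function on the vertices to all subspaces. -/
noncomputable def extendZero (H : Subsp K D) : (Vertex H → ℂ) →ₗ[ℂ] (Subsp K D → ℂ) :=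
  Function.ExtendByZero.linearMap ℂ fun z : Vertex H => z.1

theorem vertex_val_injective : Function.Injective fun z : Vertex H => z.1 :=
  Subtype.val_injective

theorem extendZero_apply (f : Vertex H → ℂ) (z : Vertex H) : extendZero H f z.1 = f z :=
  vertex_val_injective.extend_apply f 0 z

theorem extendZero_apply' (f : Vertex H → ℂ) {y : Subsp K D} (hy : ¬ ∃ z : Vertex H, z.1 = y) :
    extendZero H f y = 0 :=
  Function.extend_apply' _ _ _ hy

theorem extendZero_injective : Function.Injective (extendZero H) := fun f g h => by
  funext z
  rw [← extendZero_apply f, h, extendZero_apply]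

/-- The two cells involved consist of vertices only, so passing to functions on the vertices loses
nothing and the extension lies in the original module. -/
theorem extendZero_wBar {x : Subsp K D} {w : ℤ → ℤ → ℤ → (Subsp K D → ℂ)}
    (hw : ∀ i j k, w i j k ∈ cellSpace x H i j k) (ν ρ j : ℤ) :
    extendZero H (wBar H w ν ρ j) =
      w (D - j) j 1 - ((Fintype.card K : ℂ) ^ D * gauss (Fintype.card K) (j - ν - ρ)) •
        w (D - j - 1) j 0 := by
  funext y
  by_cases hy : ∃ z : Vertex H, z.1 = y
  · obtain ⟨z, rfl⟩ := hy
    rw [extendZero_apply]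
    rfl
  · rw [extendZero_apply' _ hy]
    have h1 : w (D - j) j 1 y = 0 := hw _ _ _ y fun h =>
      hy ⟨⟨y, Or.inl (vertex_of_sup (by ring) h)⟩, rfl⟩
    have h2 : w (D - j - 1) j 0 y = 0 := hw _ _ _ y fun h =>
      hy ⟨⟨y, Or.inr (vertex_of_sub (by ring) h)⟩, rfl⟩
    simp [h1, h2]

theorem IsStandardBasis.extendZero_mem {x : Subsp K D} {W : Submodule (algH x H) (Subsp K D → ℂ)}
    {ν μ ρ : ℤ} {w : ℤ → ℤ → ℤ → (Subsp K D → ℂ)} (hB : IsStandardBasis x H W ν μ ρ w)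
    {u : Vertex H → ℂ} (hu : u ∈ modW₂ H w ν μ ρ) :
    extendZero H u ∈ W := by
  have : modW₂ H w ν μ ρ ≤ (W.restrictScalars ℂ).comap
      (extendZero H) := by
    refine Submodule.span_le.2 ?_
    rintro _ ⟨j, -, -, rfl⟩
    change extendZero H (wBar H w ν ρ j) ∈ W
    rw [extendZero_wBar hB.cell]
    exact W.sub_mem (hB.mem _ _ _) (complex_smul_mem _ (hB.mem _ _ _))
  exact this hu

/-- The comparison takes place in the larger space: after extension by zero the two sums lie in sums
of simple modules with different endpoints, which are non-isomorphic, so those sums are disjoint. -/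
theorem disjoint_sumModule (hx : x.1 ≤ H) (hH : Module.finrank K H = 2 * D)
    {c c' : ℤ → ℤ → ℤ → Prop} (hcc : ∀ ν μ ρ, c ν μ ρ → ¬ c' ν μ ρ) :
    Disjoint (sumModule hx hH c) (sumModule hx hH c') := by
  have hxD := finrank_base hx
  obtain ⟨F⟩ := nonempty_flagDecomposition hx hxD hH
  have hle : ∀ c, ∀ u ∈ sumModule hx hH c,
      extendZero H u ∈
        ⨆ p : LowestVector F c, stdModule hx hH p.mem := by
    intro c u hu
    have h1 : u ∈ (⨆ p : LowestVector F c, p.module hx hH).restrictScalars ℂ := by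
      rw [← sumModule_eq_iSup F hx hH c]; exact hu
    have h2 : (⨆ p : LowestVector F c, p.module hx hH).restrictScalars ℂ ≤
        ((⨆ p : LowestVector F c, stdModule hx hH p.mem).restrictScalars ℂ).comap
          (extendZero H) := by
      rw [Submodule.restrictScalars_iSup]
      refine iSup_le fun p v hv => ?_
      rw [p.restrictScalars_module] at hv
      exact le_iSup (fun p : LowestVector F c => stdModule hx hH p.mem) p
        ((isStandardBasis_stdVec hx hH p.mem p.ne_zero).extendZero_mem hv)
    exact h2 h1
  have hsimple : ∀ c, ∀ p : LowestVector F c,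
      IsSimpleModule (algH x.1 H) (stdModule hx hH p.mem) := fun c p =>
    stdModule_isSimpleModule hx hH p.mem p.ne_zero
  have hbot : Disjoint (⨆ p : LowestVector F c, stdModule hx hH p.mem)
      (⨆ p : LowestVector F c', stdModule hx hH p.mem) := by
    refine disjoint_iSup_of_not_linearEquiv (hsimple c) (hsimple c') fun p p' => ⟨fun φ => ?_⟩
    have h1 := (stdModule_hasEndpoint hx hxD hH p.mem p.ne_zero).of_linearEquiv φ
    obtain ⟨h2, h3, h4⟩ := h1.unique (stdModule_hasEndpoint hx hxD hH p'.mem p'.ne_zero)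
    have h5 := p.prop
    rw [h2, h3, h4] at h5
    exact hcc _ _ _ h5 p'.prop
  rw [Submodule.disjoint_def] at hbot ⊢
  intro u hu hu'
  exact extendZero_injective ((hbot _ (hle c u hu) (hle c' u hu')).trans (map_zero _).symm)

theorem sumModule_sup (hx : x.1 ≤ H) (hH : Module.finrank K H = 2 * D)
    {c c' c'' : ℤ → ℤ → ℤ → Prop} (hcc : ∀ ν μ ρ, c ν μ ρ ↔ c' ν μ ρ ∨ c'' ν μ ρ) :
    sumModule hx hH c = sumModule hx hH c' ⊔ sumModule hx hH c'' := by
  have key : ∀ {c c' : ℤ → ℤ → ℤ → Prop}, (∀ ν μ ρ, c ν μ ρ → c' ν μ ρ) →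
      sumModule hx hH c ≤ sumModule hx hH c' := by
    intro c c' h u hu
    have : sumW₂ x c ≤ sumW₂ x c' := by
      refine sSup_le ?_
      rintro _ ⟨W, ν, μ, ρ, w, h1, h2, h3, h4, rfl⟩
      exact modW₂_le_sumW₂ h1 h2 h3 (h _ _ _ h4)
    exact this hu
  refine le_antisymm ?_ (sup_le (key fun ν μ ρ h => (hcc _ _ _).2 (Or.inl h))
    (key fun ν μ ρ h => (hcc _ _ _).2 (Or.inr h)))
  intro u hu
  have : sumW₂ x c ≤ (sumModule hx hH c' ⊔ sumModule hx hH c'').restrictScalars ℂ := by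
    refine sSup_le ?_
    rintro _ ⟨W, ν, μ, ρ, w, h1, h2, h3, h4, rfl⟩ v hv
    rcases (hcc _ _ _).1 h4 with h5 | h5
    · exact Submodule.mem_sup_left
        (show v ∈ sumModule hx hH c' from modW₂_le_sumW₂ h1 h2 h3 h5 hv)
    · exact Submodule.mem_sup_right
        (show v ∈ sumModule hx hH c'' from modW₂_le_sumW₂ h1 h2 h3 h5 hv)
  exact this hu

/-! ### Independence of the standard basis -/

/-- The cell `(ν, μ, 0)` meets the module in a line and the vector there generates the whole basis,
so two standard bases differ by one common scalar. -/
theorem IsStandardBasis.modW₂_le {W : Submodule (algH x.1 H) (Subsp K D → ℂ)} {ν μ ρ : ℤ}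
    {w w' : ℤ → ℤ → ℤ → (Subsp K D → ℂ)} (hB : IsStandardBasis x.1 H W ν μ ρ w)
    (hB' : IsStandardBasis x.1 H W ν μ ρ w') (F : FlagDecomposition x.1 H)
    (h0 : (ν, μ, 0) ∈ indexRange D ν μ ρ) : modW₂ H w ν μ ρ ≤ modW₂ H w' ν μ ρ := by
  obtain ⟨c, hc⟩ := hB'.cellIdem_mem_span (hB.mem ν μ 0) ν μ 0
  rw [cellIdem_mulVec_of_mem (hB.cell ν μ 0)] at hc
  have hw : ∀ i j k, w i j k = c • w' i j k := fun i j k => by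
    rw [(hB.eq_stdVec F h0).2, (hB'.eq_stdVec F h0).2, hc, map_smul]
  refine Submodule.span_le.2 ?_
  rintro _ ⟨j, h1, h2, rfl⟩
  have : wBar H w ν ρ j = c • wBar H w' ν ρ j := by
    ext y
    simp only [wBar, hw, Pi.smul_apply, smul_eq_mul]
    ring
  rw [this]
  exact Submodule.smul_mem _ _ (Submodule.subset_span ⟨j, h1, h2, rfl⟩)

theorem exists_chainParams {ν μ ρ : ℤ} (hb : LowestBounds D ν μ ρ) (hlt : ρ < D - 2 * ν - 1) :
    ∃ (ε e d : ℕ) (a : ℤ), ChainParams D ν μ ρ ε e d a := by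
  rw [LowestBounds] at hb
  by_cases h : μ ≤ ν + ρ + 1
  · refine ⟨(ν + ρ + 1).toNat, (ν + μ + 1).toNat, (D - 2 * ν - ρ - 2).toNat,
      (ν + μ + 1).toNat - D - 2, ?_⟩
    rw [ChainParams]; omega
  · refine ⟨μ.toNat, (ν + μ + 1).toNat, (D - 2 * μ + ρ + 1).toNat,
      (ν + μ + 1).toNat - D - 1, ?_⟩
    rw [ChainParams]; omega

end TwistedGrassmann

/-! ### The theorem -/

theorem mainTheorem2 {K : Type*} [Field K] [Fintype K] (D : ℕ) (hD : 2 ≤ D)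
    (H : Subsp K D) (hH : Module.finrank K ↥H = 2 * D) (x : Vertex H) (hx : x.1 ≤ H) :
    (∀ (Wt : Submodule (algH x.1 H) (Subsp K D → ℂ)) (ν μ ρ : ℤ),
      IsSimpleModule (algH x.1 H) Wt → HasEndpoint x.1 H Wt ν μ 0 ρ →
        ∃ W₂ : Submodule (terwilliger x) (Vertex H → ℂ),
          (∃ w, IsStandardBasis x.1 H Wt ν μ ρ w) ∧
          (∀ w, IsStandardBasis x.1 H Wt ν μ ρ w →
            W₂.restrictScalars ℂ = modW₂ H w ν μ ρ) ∧
          (ρ < D - 2 * ν - 1 → IsSimpleModule (terwilliger x) W₂ ∧ IsThin W₂)) ∧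
    ∃ V₂ V₂₀ V₂₁ : Submodule (terwilliger x) (Vertex H → ℂ),
      V₂.restrictScalars ℂ = sumW₂ x (fun _ _ _ => True) ∧
      V₂₀.restrictScalars ℂ = sumW₂ x (fun ν μ ρ => μ ≤ ν + ρ + 1) ∧
      V₂₁.restrictScalars ℂ = sumW₂ x (fun ν μ ρ => ν + ρ + 1 < μ) ∧
      V₂ = V₂₀ ⊔ V₂₁ ∧ Disjoint V₂₀ V₂₁ ∧
      IsDescribedBy V₂₀ (Omega₂₀ D) (fun ε' => (Fintype.card K : ℂ) ^ (ε' - D - 2))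
        (ratio₂₀ (Fintype.card K) D) ∧
      IsDescribedBy V₂₁ (Omega₂₁ D) (fun ε' => (Fintype.card K : ℂ) ^ (ε' - D - 1))
        (ratio₂₁ (Fintype.card K) D) := by
  have hxD := finrank_base hx
  obtain ⟨F⟩ := nonempty_flagDecomposition hx hxD hH
  refine ⟨fun Wt ν μ ρ hW he => ?_, ?_⟩
  · obtain ⟨f, hf, h0, rfl⟩ := exists_eq_stdModule F hx hxD hH hW he
    have hB := isStandardBasis_stdVec hx hH hf h0
    have hr := hB.mem_indexRange_of_isSimpleModule hW
    refine ⟨complementary hx hH hB, ⟨_, hB⟩, fun w hw => ?_, fun hlt => ?_⟩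
    · have : (complementary hx hH hB).restrictScalars ℂ = modW₂ H _ ν μ ρ :=
        restrictScalars_submoduleOfStable
      rw [this]
      exact le_antisymm (hB.modW₂_le hw F hr) (hw.modW₂_le hB F hr)
    · obtain ⟨ε, e, d, a, hP⟩ := exists_chainParams (lowestBounds_of_mem hx hxD hH hf h0) hlt
      have hc := isChain_complementary hx hH hB hP
      obtain ⟨h1, h2, h3, -, -⟩ := hP.bounds
      exact ⟨hc.isSimpleModule_of_chainMatrix h1 h2 h3, hc.isThin⟩
  · refine ⟨sumModule hx hH fun _ _ _ => True, sumModule hx hH fun ν μ ρ => μ ≤ ν + ρ + 1,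
      sumModule hx hH fun ν μ ρ => ν + ρ + 1 < μ, restrictScalars_sumModule hx hH,
      restrictScalars_sumModule hx hH, restrictScalars_sumModule hx hH,
      sumModule_sup hx hH fun ν μ ρ => ?_, disjoint_sumModule hx hH fun ν μ ρ h => not_lt.2 h,
      isDescribedBy_left F hx hH, isDescribedBy_right F hx hH⟩
    rw [true_iff]
    exact le_or_gt _ _
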